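/- **Setting.** Let $\mathcal X,\mathcal Y$ be finite-dimensional Euclidean spaces, let $\xi$ be a noise variable with law $P$, and let $f(x,y)=\mathbb E[\hat f(x,y,\xi)]$ and $g(x,y)=\mathbb E[\hat g(x,y,\xi)]$, where $f$ and $\hat f(\cdot,\xi)$ are differentiable and $g$ and $\hat g(\cdot,\xi)$ are twice differentiable in $(x,y)$, with measurable derivatives. Write $\partial_{xy}g(x,y)$ for the operator $\mathcal Y\to\mathcal X$ transpose to the Jacobian of $x\mapsto\partial_y g(x,y)$. For a batch $D$, $\hat f(x,y,D)$ and $\hat g(x,y,D)$ denote averages over $D$. Assume, with positive constants $\mu_g\le L_g$, $L_f,B,L_g',M_g$ and $\tilde\sigma_f,\tilde\sigma_g,\tilde\sigma_{xy},\tilde\sigma_{yy}\ge0$: 1. $g(x,\cdot)$ is $L_g$-smooth and $\mu_g$-strongly convex for every $x$; 2. $\nabla f$ is $L_f$-Lipschitz and $\|\partial_yf\|\le B$; 3. $\partial_{xy}g$ and $\partial_{yy}g$ are $M_g$-Lipschitz in $(x,y)$, and $\|\partial_yg(x,y)-\partial_yg(x',y)\|\le L_g'\|x-x'\|$; 4.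 for every batch $D$ of i.i.d. samples, $\nabla\hat f(x,y,D)$ and $\partial_y\hat g(x,y,D)$ are unbiased estimators of $\nabla f(x,y)$ and $\partial_yg(x,y)$ with variances at most $\tilde\sigma_f^2/|D|$ and $\tilde\sigma_g^2/|D|$; 5. $F_1=\partial_{xy}\hat g(x,y,D)-\partial_{xy}g(x,y)$ and $F_2=\partial_{yy}\hat g(x,y,D)-\partial_{yy}g(x,y)$ have mean zero, $\|\mathbb E[F_1^\top F_1]\|_{op}\le\tilde\sigma_{xy}^2/|D|$ and $\|\mathbb E[F_2^\top F_2]\|_{op}\le\tilde\sigma_{yy}^2/|D|$. Let $y^*(x)=\arg\min_yg(x,y)$, $\mathcal L(x)=f(x,y^*(x))$, $\mathcal L^*=\inf\mathcal L$, and let $z^*(x,y)$ minimize $z\mapsto\frac12z^\top\partial_{yy}g(x,y)z+z^\top\partial_yf(x,y)$. Put $\kappa_g=L_g/\mu_g$, $L_y=L_g'/\mu_g$, $L_z=M_gB/\mu_g^2+L_f/\mu_g$, $L_\psi=\max(L_f+M_gB/\mu_g+L_g'L_z,\,L_g')$ and $$L=\Big(L_f+\frac{L_g'M_gB}{\mu_g^2}+\frac{L_g'L_f+M_gB}{\mu_g}\Big)\Big(1+\frac{L_g'}{\mu_g}\Big).$$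 The batches have sizes $|D_f|,|D_g|,|D_{xy}|,|D_{yy}|\ge1$ with $|D_{yy}|\ge\tilde\sigma_{yy}^2/(\mu_gL_g)$. Write $\sigma_f^2=\tilde\sigma_f^2/|D_f|$, and similarly $\sigma_g^2$, $\sigma_{xy}^2$, $\sigma_{yy}^2$. The deterministic setting is the one where all four $\tilde\sigma$ vanish. **Algorithm.** Let $\alpha=1/L_g$, $\beta=1/(2L_g)$, $\gamma=1/L$. Start from square-integrable $(x_0,y_{-1},z_{-1})$ independent of the samples. At iteration $k\ge0$, $y_k$ is the result of $T$ steps $y\leftarrow y-\alpha\,\partial_y\hat g(x_k,y,D_g)$ from $y_{k-1}$; then $(u_k,v_k)=\nabla\hat f(x_k,y_k,D_f)$; $z_k$ is the result of $N$ steps $z\leftarrow z-\beta(\partial_{yy}\hat g(x_k,y_k,D_{yy})z+v_k)$ from $z_{k-1}$; finally $x_{k+1}=x_k-\gamma\big(u_k+\partial_{xy}\hat g(x_k,y_k,D_{xy})z_k\big)$. A new independent batch is drawn each time. **Energies.** The strongly convex case is $\mu>0$, where $\mathcal L(x)-\mathcal L(x')\le\nabla\mathcal L(x)^\top(x-x')-\frac\mu2\|x-x'\|^2$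 for all $x,x'$, with minimizer $x^*$; the non-convex case is $\mu<0$, where $\mathcal L$ is only assumed bounded below. Let $u=1$ ($u=0$ is also allowed in the deterministic setting). If $\mu>0$, choose $\eta_0\in[\mu,L]$ and let $\delta_k=\gamma\eta_k$, $\eta_{k+1}=\eta_k+\delta_{k+1}(\mu-\eta_k)$, $\underline\eta=\mu$; if $\mu<0$, let $\eta_k=\underline\eta=L$ and $\delta_k=1$. Let $\kappa_{\mathcal L}=L/\underline\eta$ (so $\kappa_{\mathcal L}=L/\mu$ for $\mu>0$ and $\kappa_{\mathcal L}=1$ for $\mu<0$). Define $$E_k^x=\begin{cases}\frac{\delta_k}{2\gamma}\mathbb E\|x_k-x^*\|^2+(1-u)\mathbb E[\mathcal L(x_k)-\mathcal L^*],&\mu>0,\\ \frac{\delta_k}{2\gamma L^2}\mathbb E\|\nabla\mathcal L(x_k)\|^2,&\mu<0,\end{cases}$$ $E_k^y=\mathbb E\|y_{k-1}-y^*(x_k)\|^2$, $E_k^z=\mathbb E\|z_{k-1}-z^*(x_k,y_k)\|^2$ and $E_k^{tot}=E_k^x+aE_k^y+bE_k^z$ with $a=\delta_0(1-\alpha\mu_g)^{T/2}$,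 $b=\delta_0(1-\frac12\beta\mu_g)^{N/2}$. Let $\hat x_0=x_0$ and $\hat x_k=u(1-\delta_k)\hat x_{k-1}+(1-u(1-\delta_k))x_k$. **Constants.** Let $\zeta_0=2L^2\eta_0/\mu^2$ if $\mu>0$ and $u=1$, and $\zeta_0=2L$ otherwise; let $\sigma_x^2=2\sigma_{xy}^2+2L_g'^2\mu_g^{-2}\sigma_{yy}^2$, $$w_x^2=\Big(1+\frac{2L_g'}{\mu_g}+\frac{6(\sigma_{xy}^2+L_g'^2)}{\mu_g^2}\Big)\sigma_f^2+\frac{2(\sigma_{xy}^2+L_g'^2)B^2}{L_g\mu_g^3}\sigma_{yy}^2+\frac{2B^2}{\mu_g^2}\sigma_{xy}^2,$$ $$\mathcal W^2=\Big(\kappa_{\mathcal L}\tfrac{1-u}2\mathbf 1_{\mu>0}+3\Big)w_x^2+\frac{60\,\kappa_{\mathcal L}L_\psi^2}{\mu_gL_g}\sigma_g^2,$$ $$C=\max\Big\{1+2\log\big(6+\tfrac{24L_\psi^2}{\eta_0}\big),\;2\log\big(1+\tfrac{4L_y^2}{L^2}\max(\eta_0,8\zeta_0)\big),\;0,\;-2\log\tfrac{5L_\psi^2}{\eta_0},\;-2\log\tfrac{L}{4L_y^2}\Big\},$$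 $$C'=\max\Big\{1+2\log\big(4+\tfrac{12(2L_\psi^2+\sigma_x^2)}{\eta_0}\big),\;2\log\big(1+\tfrac{2L_z^2}{L_y^2}(1+16L_y^2)\big),\;0,\;-2\log\tfrac{L_\psi^2}{4L_z^2\eta_0},\;-2\log\tfrac{\gamma(\sigma_{xy}^2+L_g'^2)\underline\eta}{\eta_0}\Big\},$$ $$T_{\min}=\Big\lfloor\frac{C}{\alpha\mu_g}\Big\rfloor+1,\qquad N_{\min}=\Big\lfloor\frac{2(C+C')}{\beta\mu_g}\Big\rfloor+1 .$$ **Theorem.** Let $T\ge T_{\min}$ and $N\ge N_{\min}$. Then all expectations above are finite, and: (i) if $\mu>0$, for all $k\ge0$, $$\mathbb E[\mathcal L(\hat x_k)-\mathcal L^*]+E_k^{tot}\le\Big(1-\frac1{2\kappa_{\mathcal L}}\Big)^k\big(E_0^{tot}+\mathbb E[\mathcal L(x_0)-\mathcal L^*]\big)+\frac{2\mathcal W^2}L;$$ (ii) if $\mu<0$, for all $k\ge1$, $$\frac1k\sum_{t=1}^kE_t^{tot}\le\frac2k\big(\mathbb E[\mathcal L(x_0)-\mathcal L^*]+E_0^y+E_0^z\big)+\frac{2\mathcal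 W^2}L.$$ Moreover $\mathcal W^2=0$ in the deterministic setting and $\mathcal W^2>0$ otherwise, and there is a constant $c$ depending only on $L_g,L_f,B,L_g',M_g,\tilde\sigma_{xy}$ such that $$\mathcal W^2\le c\Big(\kappa_{\mathcal L}\kappa_g^5\frac{\tilde\sigma_g^2}{|D_g|}+\kappa_g^3\frac{\tilde\sigma_{yy}^2}{|D_{yy}|}+\kappa_g^2\frac{\tilde\sigma_{xy}^2}{|D_{xy}|}+\kappa_g^2\frac{\tilde\sigma_f^2}{|D_f|}\Big)$$ and $T_{\min},N_{\min}\le c\,\kappa_g(1+\log\kappa_g+\log\kappa_{\mathcal L})$. -/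

import Mathlib

open MeasureTheory ProbabilityTheory

noncomputable section

namespace AmIGO

/-! ### Partial derivatives, minimizers, mini-batches -/

section Calculus

variable {X Y : Type*}
  [NormedAddCommGroup X] [InnerProductSpace ℝ X] [CompleteSpace X]
  [NormedAddCommGroup Y] [InnerProductSpace ℝ Y] [CompleteSpace Y]

/-- The partial gradient `∂ₓ h (x, y)`. -/
def gradX (h : X → Y → ℝ) (x : X) (y : Y) : X := gradient (fun x' => h x' y) x

/-- The partial gradient `∂_y h (x, y)`. -/
def gradY (h : X → Y → ℝ) (x : X) (y : Y) : Y := gradient (fun y' => h x y') y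

/-- The partial Hessian `∂_yy h (x, y)`, an operator on `Y`. -/
def hessYY (h : X → Y → ℝ) (x : X) (y : Y) : Y →L[ℝ] Y :=
  fderiv ℝ (fun y' => gradY h x y') y

/-- The mixed derivative `∂_xy h (x, y)`, as the operator `Y → X` (a `dim X × dim Y` matrix)
that occurs in the hypergradient `∂ₓ f + ∂_xy g z`: the transpose of the Jacobian of
`x ↦ ∂_y h (x, y)`. -/
def hessXY (h : X → Y → ℝ) (x : X) (y : Y) : Y →L[ℝ] X :=
  ContinuousLinearMap.adjoint (fderiv ℝ (fun x' => gradY h x' y) x)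

/-- The Euclidean norm of the pair `(a, b)`. -/
def pairNorm (a : X) (b : Y) : ℝ := √(‖a‖ ^ 2 + ‖b‖ ^ 2)

/-- A global minimizer of `φ` (an arbitrary point if there is none). -/
def argmin (φ : Y → ℝ) : Y := Classical.epsilon (fun y => ∀ y', φ y ≤ φ y')

/-- The inner solution `y*(x)`. -/
def yStar (g : X → Y → ℝ) (x : X) : Y := argmin (g x)

/-- The quadratic `Q(x, y, z) = ½ zᵀ ∂_yy g(x, y) z + zᵀ ∂_y f(x, y)`. -/
def quad (f g : X → Y → ℝ) (x : X) (y z : Y) : ℝ :=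
  (1 / 2) * inner ℝ z (hessYY g x y z) + inner ℝ z (gradY f x y)

/-- The minimizer `z*(x, y)` of `Q(x, y, ·)`. -/
def zStar (f g : X → Y → ℝ) (x : X) (y : Y) : Y := argmin (quad f g x y)

/-- The outer objective `ℒ(x) = f(x, y*(x))`. -/
def outer (f g : X → Y → ℝ) (x : X) : ℝ := f x (yStar g x)

/-- The optimal value `ℒ* = inf ℒ` (the minimum, when it is attained). -/
def outerStar (f g : X → Y → ℝ) : ℝ := ⨅ x, outer f g x

/-- A minimizer `x*` of `ℒ`. -/
def xStar (f g : X → Y → ℝ) : X := argmin (outer f g)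

/-- The average over a batch `D` of the random function `h`. -/
def batch {Ξ : Type*} {n : ℕ} (h : X → Y → Ξ → ℝ) (D : Fin n → Ξ) (x : X) (y : Y) : ℝ :=
  (n : ℝ)⁻¹ * ∑ i, h x y (D i)

end Calculus

/-! ### Numerical parameters -/

/-- The constants of the assumptions, the noise levels `σ̃`, the batch sizes, the convexity
parameter `μ` of `ℒ`, the initial value `η₀` and the switch `u`. -/
structure Params where
  /-- smoothness of `g` in `y` -/
  Lg : ℝ
  /-- strong convexity of `g` in `y` -/
  μg : ℝ
  /-- Lipschitz constant of `∇f` -/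
  Lf : ℝ
  /-- bound on `∂_y f` -/
  B : ℝ
  /-- Lipschitz constant of `∂_y g` in `x` -/
  Lg' : ℝ
  /-- Lipschitz constant of `∂_xy g` and `∂_yy g` -/
  Mg : ℝ
  /-- noise level of `∇f̂` -/
  σf : ℝ
  /-- noise level of `∂_y ĝ` -/
  σg : ℝ
  /-- noise level of `∂_xy ĝ` -/
  σxy : ℝ
  /-- noise level of `∂_yy ĝ` -/
  σyy : ℝ
  /-- size of the batches for `∇f̂` -/
  nf : ℕ
  /-- size of the batches for `∂_y ĝ` -/
  ng : ℕ
  /-- size of the batches for `∂_xy ĝ` -/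
  nxy : ℕ
  /-- size of the batches for `∂_yy ĝ` -/
  nyy : ℕ
  /-- (weak) convexity parameter of `ℒ`; only its sign matters when it is negative -/
  μ : ℝ
  /-- initial value of `η`, used when `μ > 0` -/
  η₀ : ℝ
  /-- `0` or `1` -/
  u : ℝ

namespace Params

variable (p : Params)

/-- Condition number of the inner problem. -/
def κg : ℝ := p.Lg / p.μg

/-- Lipschitz constant of `y*`. -/
def Ly : ℝ := p.Lg' / p.μg

/-- Lipschitz constant of `z*`. -/
def Lz : ℝ := p.Mg * p.B / p.μg ^ 2 + p.Lf / p.μg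

/-- Constant controlling the bias of the gradient estimate. -/
def Lψ : ℝ := max (p.Lf + p.Mg * p.B / p.μg + p.Lg' * p.Lz) p.Lg'

/-- Smoothness constant of `ℒ`. -/
def L : ℝ :=
  (p.Lf + p.Lg' * p.Mg * p.B / p.μg ^ 2 + (p.Lg' * p.Lf + p.Mg * p.B) / p.μg)
    * (1 + p.Lg' / p.μg)

/-- Variances of batch estimates. -/
def varf : ℝ := p.σf ^ 2 / p.nf
/-- Variances of batch estimates. -/
def varg : ℝ := p.σg ^ 2 / p.ng
/-- Variances of batch estimates. -/
def varxy : ℝ := p.σxy ^ 2 / p.nxy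
/-- Variances of batch estimates. -/
def varyy : ℝ := p.σyy ^ 2 / p.nyy

/-- Step size of the inner gradient descent. -/
def α : ℝ := 1 / p.Lg
/-- Step size of the linear solver. -/
def β : ℝ := 1 / (2 * p.Lg)
/-- Outer step size. -/
def γ : ℝ := 1 / p.L

/-- The sequence `η`. For `μ > 0` this is the solution of the implicit recursion
`η (k+1) = η k + δ (k+1) * (μ - η k)` with `δ (k+1) = γ * η (k+1)`;
for `μ < 0` it is constantly `L`. -/
def η : ℕ → ℝ
  | 0 => if 0 < p.μ then p.η₀ else p.L
  | k + 1 => if 0 < p.μ then η k / (1 + p.γ * (η k - p.μ)) else p.L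

/-- `δ k = γ * η k`. -/
def δ (k : ℕ) : ℝ := p.γ * p.η k

/-- The limiting value of `η`: `μ` in the strongly convex case, `L` otherwise. -/
def ηmin : ℝ := if 0 < p.μ then p.μ else p.L

/-- `κ_ℒ = L / μ` in the strongly convex case, and `1` otherwise; it is `1 / inf δ`. -/
def κL : ℝ := p.L / p.ηmin

/-- All noise levels vanish. -/
def Deterministic : Prop := p.σf = 0 ∧ p.σg = 0 ∧ p.σxy = 0 ∧ p.σyy = 0

/-- Variance constant of the gradient estimate. -/
def wx2 : ℝ :=
  (1 + 2 * p.Lg' / p.μg + 6 * (p.varxy + p.Lg' ^ 2) / p.μg ^ 2) * p.varf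
    + 2 * (p.varxy + p.Lg' ^ 2) * p.B ^ 2 / (p.Lg * p.μg ^ 3) * p.varyy
    + 2 * p.B ^ 2 / p.μg ^ 2 * p.varxy

/-- Multiplicative variance constant of the gradient estimate. -/
def σx2 : ℝ := 2 * p.varxy + 2 * p.Lg' ^ 2 / p.μg ^ 2 * p.varyy

/-- The effective variance `𝒲²`. -/
def W2 : ℝ :=
  ((if 0 < p.μ then p.κL * ((1 - p.u) / 2) else 0) + 3) * p.wx2
    + 60 * p.κL * p.Lψ ^ 2 / (p.μg * p.Lg) * p.varg

/-- `ζ₀`: `‖∇ℒ‖²` is bounded by a multiple of it in terms of the outer energy. -/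
def ζ₀ : ℝ :=
  if 0 < p.μ ∧ p.u = 1 then 2 * p.L ^ 2 * p.η 0 / p.ηmin ^ 2 else 2 * p.L

/-- Logarithmic factor in the number of inner iterations. -/
def C : ℝ :=
  max (1 + 2 * Real.log (6 + 24 * p.Lψ ^ 2 / p.η 0))
    (max (2 * Real.log (1 + 4 * p.Ly ^ 2 / p.L ^ 2 * max (p.η 0) (8 * p.ζ₀)))
      (max 0
        (max (-2 * Real.log (5 * p.Lψ ^ 2 / p.η 0)) (-2 * Real.log (p.L / (4 * p.Ly ^ 2))))))

/-- Additional logarithmic factor in the number of iterations of the linear solver. -/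
def C' : ℝ :=
  max (1 + 2 * Real.log (4 + 12 * (2 * p.Lψ ^ 2 + p.σx2) / p.η 0))
    (max (2 * Real.log (1 + 2 * p.Lz ^ 2 / p.Ly ^ 2 * (1 + 16 * p.Ly ^ 2)))
      (max 0
        (max (-2 * Real.log (p.Lψ ^ 2 / (4 * p.Lz ^ 2 * p.η 0)))
          (-2 * Real.log (p.γ * (p.varxy + p.Lg' ^ 2) * (p.ηmin / p.η 0))))))

/-- The number of inner gradient steps. -/
def Tmin : ℕ := ⌊p.C / (p.α * p.μg)⌋₊ + 1

/-- The number of steps of the linear solver. -/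
def Nmin : ℕ := ⌊2 * (p.C + p.C') / (p.β * p.μg)⌋₊ + 1

/-- The weight `a = δ₀ (1 - α μ_g)^{T/2}`. -/
def a (T : ℕ) : ℝ := p.δ 0 * √((1 - p.α * p.μg) ^ T)

/-- The weight `b = δ₀ (1 - β μ_g / 2)^{N/2}`. -/
def b (N : ℕ) : ℝ := p.δ 0 * √((1 - p.β * p.μg / 2) ^ N)

/-- Positivity of the constants, admissible batch sizes, and the ranges of `μ`, `η₀`, `u`. -/
structure Admissible : Prop where
  μg_pos : 0 < p.μg
  μg_le : p.μg ≤ p.Lg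
  Lf_pos : 0 < p.Lf
  B_pos : 0 < p.B
  Lg'_pos : 0 < p.Lg'
  Mg_pos : 0 < p.Mg
  σf_nonneg : 0 ≤ p.σf
  σg_nonneg : 0 ≤ p.σg
  σxy_nonneg : 0 ≤ p.σxy
  σyy_nonneg : 0 ≤ p.σyy
  nf_pos : 1 ≤ p.nf
  ng_pos : 1 ≤ p.ng
  nxy_pos : 1 ≤ p.nxy
  nyy_large : max 1 (p.σyy ^ 2 / (p.μg * p.Lg)) ≤ p.nyy
  μ_ne : p.μ ≠ 0
  η₀_ge : 0 < p.μ → p.μ ≤ p.η₀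
  η₀_le : 0 < p.μ → p.η₀ ≤ p.L
  u_eq : p.u = 1 ∨ (p.u = 0 ∧ p.Deterministic)

end Params

/-! ### Assumptions on the problem and on the noise -/

section Assumptions

variable {X Y : Type*}
  [NormedAddCommGroup X] [InnerProductSpace ℝ X] [CompleteSpace X]
  [NormedAddCommGroup Y] [InnerProductSpace ℝ Y] [CompleteSpace Y]

/-- Assumptions on `f` and `g`: `f` is differentiable, `g` twice differentiable, the inner
problems are smooth and strongly convex, and the derivatives are Lipschitz. -/
structure RegularProblem (p : Params) (f g : X → Y → ℝ) : Prop where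
  f_diff : Differentiable ℝ (fun q : X × Y => f q.1 q.2)
  g_diff : Differentiable ℝ (fun q : X × Y => g q.1 q.2)
  g_diff2 : Differentiable ℝ (fderiv ℝ (fun q : X × Y => g q.1 q.2))
  g_smooth : ∀ x y y', ‖gradY g x y - gradY g x y'‖ ≤ p.Lg * ‖y - y'‖
  g_strong : ∀ x, StrongConvexOn Set.univ p.μg (g x)
  f_lip : ∀ x x' y y', pairNorm (gradX f x y - gradX f x' y') (gradY f x y - gradY f x' y')
    ≤ p.Lf * pairNorm (x - x') (y - y')
  f_bound : ∀ x y, ‖gradY f x y‖ ≤ p.B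
  g_xy_lip : ∀ x x' y y', ‖hessXY g x y - hessXY g x' y'‖ ≤ p.Mg * pairNorm (x - x') (y - y')
  g_yy_lip : ∀ x x' y y', ‖hessYY g x y - hessYY g x' y'‖ ≤ p.Mg * pairNorm (x - x') (y - y')
  g_y_lip : ∀ x x' y, ‖gradY g x y - gradY g x' y‖ ≤ p.Lg' * ‖x - x'‖

variable [MeasurableSpace X] [MeasurableSpace Y] {Ξ : Type*} [MeasurableSpace Ξ]

/-- `f` and `g` are the expectations of the random functions `f̂` and `ĝ`, which are
differentiable (resp. twice differentiable) with measurable derivatives. -/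
structure StochasticModel (f g : X → Y → ℝ) (fhat ghat : X → Y → Ξ → ℝ)
    (P : Measure Ξ) : Prop where
  f_int : ∀ x y, Integrable (fhat x y) P
  f_eq : ∀ x y, f x y = ∫ ξ, fhat x y ξ ∂P
  g_int : ∀ x y, Integrable (ghat x y) P
  g_eq : ∀ x y, g x y = ∫ ξ, ghat x y ξ ∂P
  fhat_diff : ∀ ξ, Differentiable ℝ (fun q : X × Y => fhat q.1 q.2 ξ)
  ghat_diff : ∀ ξ, Differentiable ℝ (fun q : X × Y => ghat q.1 q.2 ξ)
  ghat_diff2 : ∀ ξ, Differentiable ℝ (fderiv ℝ (fun q : X × Y => ghat q.1 q.2 ξ))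
  meas_fx : Measurable (fun q : X × Y × Ξ => gradX (fun x y => fhat x y q.2.2) q.1 q.2.1)
  meas_fy : Measurable (fun q : X × Y × Ξ => gradY (fun x y => fhat x y q.2.2) q.1 q.2.1)
  meas_gy : Measurable (fun q : X × Y × Ξ => gradY (fun x y => ghat x y q.2.2) q.1 q.2.1)
  meas_gxy : Measurable (fun q : X × Y × Ξ => hessXY (fun x y => ghat x y q.2.2) q.1 q.2.1)
  meas_gyy : Measurable (fun q : X × Y × Ξ => hessYY (fun x y => ghat x y q.2.2) q.1 q.2.1)

/-- Unbiased gradients of bounded variance, for every batch of `n ≥ 1` i.i.d. samples. -/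
structure GradientNoise (p : Params) (f g : X → Y → ℝ) (fhat ghat : X → Y → Ξ → ℝ)
    (P : Measure Ξ) : Prop where
  fx_int : ∀ (n : ℕ), 1 ≤ n → ∀ x y,
    Integrable (fun D => gradX (batch fhat D) x y) (Measure.pi fun _ : Fin n => P)
  fx_mean : ∀ (n : ℕ), 1 ≤ n → ∀ x y,
    ∫ D, gradX (batch fhat D) x y ∂(Measure.pi fun _ : Fin n => P) = gradX f x y
  fy_int : ∀ (n : ℕ), 1 ≤ n → ∀ x y,
    Integrable (fun D => gradY (batch fhat D) x y) (Measure.pi fun _ : Fin n => P)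
  fy_mean : ∀ (n : ℕ), 1 ≤ n → ∀ x y,
    ∫ D, gradY (batch fhat D) x y ∂(Measure.pi fun _ : Fin n => P) = gradY f x y
  f_var_int : ∀ (n : ℕ), 1 ≤ n → ∀ x y,
    Integrable (fun D => pairNorm (gradX (batch fhat D) x y - gradX f x y)
      (gradY (batch fhat D) x y - gradY f x y) ^ 2) (Measure.pi fun _ : Fin n => P)
  f_var : ∀ (n : ℕ), 1 ≤ n → ∀ x y,
    ∫ D, pairNorm (gradX (batch fhat D) x y - gradX f x y)
      (gradY (batch fhat D) x y - gradY f x y) ^ 2 ∂(Measure.pi fun _ : Fin n => P)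
      ≤ p.σf ^ 2 / n
  gy_int : ∀ (n : ℕ), 1 ≤ n → ∀ x y,
    Integrable (fun D => gradY (batch ghat D) x y) (Measure.pi fun _ : Fin n => P)
  gy_mean : ∀ (n : ℕ), 1 ≤ n → ∀ x y,
    ∫ D, gradY (batch ghat D) x y ∂(Measure.pi fun _ : Fin n => P) = gradY g x y
  gy_var_int : ∀ (n : ℕ), 1 ≤ n → ∀ x y,
    Integrable (fun D => ‖gradY (batch ghat D) x y - gradY g x y‖ ^ 2)
      (Measure.pi fun _ : Fin n => P)
  gy_var : ∀ (n : ℕ), 1 ≤ n → ∀ x y,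
    ∫ D, ‖gradY (batch ghat D) x y - gradY g x y‖ ^ 2 ∂(Measure.pi fun _ : Fin n => P)
      ≤ p.σg ^ 2 / n

/-- The error `F₁ = ∂_xy ĝ - ∂_xy g` on a batch. -/
def F₁ (g : X → Y → ℝ) (ghat : X → Y → Ξ → ℝ) (x : X) (y : Y) {n : ℕ} (D : Fin n → Ξ) :
    Y →L[ℝ] X :=
  hessXY (batch ghat D) x y - hessXY g x y

/-- The error `F₂ = ∂_yy ĝ - ∂_yy g` on a batch. -/
def F₂ (g : X → Y → ℝ) (ghat : X → Y → Ξ → ℝ) (x : X) (y : Y) {n : ℕ} (D : Fin n → Ξ) :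
    Y →L[ℝ] Y :=
  hessYY (batch ghat D) x y - hessYY g x y

/-- Centred second derivatives with bounded second moment `‖E[FᵀF]‖`, for every batch of
`n ≥ 1` i.i.d. samples. -/
structure HessianNoise (p : Params) (g : X → Y → ℝ) (ghat : X → Y → Ξ → ℝ)
    (P : Measure Ξ) : Prop where
  xy_int : ∀ (n : ℕ), 1 ≤ n → ∀ x y,
    Integrable (fun D => F₁ g ghat x y D) (Measure.pi fun _ : Fin n => P)
  xy_mean : ∀ (n : ℕ), 1 ≤ n → ∀ x y,
    ∫ D, F₁ g ghat x y D ∂(Measure.pi fun _ : Fin n => P) = 0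
  xy_sq_int : ∀ (n : ℕ), 1 ≤ n → ∀ x y,
    Integrable (fun D => ContinuousLinearMap.adjoint (F₁ g ghat x y D) ∘L F₁ g ghat x y D)
      (Measure.pi fun _ : Fin n => P)
  xy_var : ∀ (n : ℕ), 1 ≤ n → ∀ x y,
    ‖∫ D, ContinuousLinearMap.adjoint (F₁ g ghat x y D) ∘L F₁ g ghat x y D
      ∂(Measure.pi fun _ : Fin n => P)‖ ≤ p.σxy ^ 2 / n
  yy_int : ∀ (n : ℕ), 1 ≤ n → ∀ x y,
    Integrable (fun D => F₂ g ghat x y D) (Measure.pi fun _ : Fin n => P)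
  yy_mean : ∀ (n : ℕ), 1 ≤ n → ∀ x y,
    ∫ D, F₂ g ghat x y D ∂(Measure.pi fun _ : Fin n => P) = 0
  yy_sq_int : ∀ (n : ℕ), 1 ≤ n → ∀ x y,
    Integrable (fun D => ContinuousLinearMap.adjoint (F₂ g ghat x y D) ∘L F₂ g ghat x y D)
      (Measure.pi fun _ : Fin n => P)
  yy_var : ∀ (n : ℕ), 1 ≤ n → ∀ x y,
    ‖∫ D, ContinuousLinearMap.adjoint (F₂ g ghat x y D) ∘L F₂ g ghat x y D
      ∂(Measure.pi fun _ : Fin n => P)‖ ≤ p.σyy ^ 2 / n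

end Assumptions

/-! ### The algorithm -/

/-- Labels of the noise samples drawn by the algorithm: outer iteration `k`, inner iteration
`t` where there is one, and position `i` inside the batch. -/
inductive SampleIdx where
  | g (k t i : ℕ)
  | gyy (k t i : ℕ)
  | f (k i : ℕ)
  | gxy (k i : ℕ)

section Algorithm

variable {X Y : Type*}
  [NormedAddCommGroup X] [InnerProductSpace ℝ X] [CompleteSpace X]
  [NormedAddCommGroup Y] [InnerProductSpace ℝ Y] [CompleteSpace Y] {Ξ : Type*}

/-- Stochastic gradient descent on `g(x, ·)`: the `t`-th iterate from `y`, where `D s` is the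
batch of the step from `s` to `s + 1`. -/
def innerY (ghat : X → Y → Ξ → ℝ) (α : ℝ) (x : X) {n : ℕ} (D : ℕ → Fin n → Ξ) (y : Y) : ℕ → Y
  | 0 => y
  | t + 1 => innerY ghat α x D y t
      - α • gradY (batch ghat (D t)) x (innerY ghat α x D y t)

/-- Stochastic gradient descent on `Q(x, y, ·)`: the `t`-th iterate from `z`. -/
def innerZ (ghat : X → Y → Ξ → ℝ) (β : ℝ) (x : X) (y v : Y) {n : ℕ} (D : ℕ → Fin n → Ξ)
    (z : Y) : ℕ → Y
  | 0 => z
  | t + 1 => innerZ ghat β x y v D z t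
      - β • (hessYY (batch ghat (D t)) x y (innerZ ghat β x y v D z t) + v)

variable (p : Params) (T N : ℕ) (fhat ghat : X → Y → Ξ → ℝ)

/-- One outer iteration: from `(x k, y (k-1), z (k-1))` to `(x (k+1), y k, z k)`, given the
noise samples `s`. -/
def step (s : SampleIdx → Ξ) (k : ℕ) (q : X × Y × Y) : X × Y × Y :=
  let x := q.1
  let y := innerY ghat p.α x (fun t (i : Fin p.ng) => s (.g k t i)) q.2.1 T
  let Df : Fin p.nf → Ξ := fun i => s (.f k i)
  let Dxy : Fin p.nxy → Ξ := fun i => s (.gxy k i)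
  let z := innerZ ghat p.β x y (gradY (batch fhat Df) x y)
    (fun t (i : Fin p.nyy) => s (.gyy k t i)) q.2.2 N
  let ψ := gradX (batch fhat Df) x y + hessXY (batch ghat Dxy) x y z
  (x - p.γ • ψ, y, z)

/-- The triple `(x k, y (k-1), z (k-1))`, started from `q₀ = (x 0, y (-1), z (-1))`. -/
def run (q₀ : X × Y × Y) (s : SampleIdx → Ξ) : ℕ → X × Y × Y
  | 0 => q₀
  | k + 1 => step p T N fhat ghat s k (run q₀ s k)

variable {Ω : Type*} (q₀ : Ω → X × Y × Y) (ξ : SampleIdx → Ω → Ξ)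

/-- The outer iterate `x k`. -/
def xIter (k : ℕ) (ω : Ω) : X := (run p T N fhat ghat (q₀ ω) (fun i => ξ i ω) k).1

/-- The warm start `y (k-1)` of the inner descent at iteration `k`. -/
def yInit (k : ℕ) (ω : Ω) : Y := (run p T N fhat ghat (q₀ ω) (fun i => ξ i ω) k).2.1

/-- The warm start `z (k-1)` of the linear solver at iteration `k`. -/
def zInit (k : ℕ) (ω : Ω) : Y := (run p T N fhat ghat (q₀ ω) (fun i => ξ i ω) k).2.2

/-- The output `y k` of the inner descent at iteration `k`. -/
def yIter (k : ℕ) (ω : Ω) : Y := yInit p T N fhat ghat q₀ ξ (k + 1) ω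

/-- The averaged iterates. -/
def xHat : ℕ → Ω → X
  | 0, ω => xIter p T N fhat ghat q₀ ξ 0 ω
  | k + 1, ω => (p.u * (1 - p.δ (k + 1))) • xHat k ω
      + (1 - p.u * (1 - p.δ (k + 1))) • xIter p T N fhat ghat q₀ ξ (k + 1) ω

variable [MeasurableSpace Ω] (Pr : Measure Ω) (f g : X → Y → ℝ)

/-- The expected suboptimality `E[ℒ(V) - ℒ*]` of a random point `V`. -/
def gap (V : Ω → X) : ℝ := ∫ ω, (outer f g (V ω) - outerStar f g) ∂Pr

/-- The outer energy `E_k^x`. -/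
def Ex (k : ℕ) : ℝ :=
  if 0 < p.μ then
    p.δ k / (2 * p.γ) * ∫ ω, ‖xIter p T N fhat ghat q₀ ξ k ω - xStar f g‖ ^ 2 ∂Pr
      + (1 - p.u) * gap Pr f g (xIter p T N fhat ghat q₀ ξ k)
  else
    p.δ k / (2 * p.γ * p.L ^ 2) *
      ∫ ω, ‖gradient (outer f g) (xIter p T N fhat ghat q₀ ξ k ω)‖ ^ 2 ∂Pr

/-- The warm-start error `E_k^y`. -/
def Ey (k : ℕ) : ℝ :=
  ∫ ω, ‖yInit p T N fhat ghat q₀ ξ k ω - yStar g (xIter p T N fhat ghat q₀ ξ k ω)‖ ^ 2 ∂Pr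

/-- The warm-start error `E_k^z`. -/
def Ez (k : ℕ) : ℝ :=
  ∫ ω, ‖zInit p T N fhat ghat q₀ ξ k ω
    - zStar f g (xIter p T N fhat ghat q₀ ξ k ω) (yIter p T N fhat ghat q₀ ξ k ω)‖ ^ 2 ∂Pr

/-- The aggregate energy `E_k^tot = E_k^x + a E_k^y + b E_k^z`. -/
def Etot (k : ℕ) : ℝ :=
  Ex p T N fhat ghat q₀ ξ Pr f g k + p.a T * Ey p T N fhat ghat q₀ ξ Pr g k
    + p.b N * Ez p T N fhat ghat q₀ ξ Pr f g k

/-- All the random variables whose expectations enter the energies at time `k` are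
integrable. -/
structure FiniteEnergy (k : ℕ) : Prop where
  dist : Integrable (fun ω => ‖xIter p T N fhat ghat q₀ ξ k ω - xStar f g‖ ^ 2) Pr
  value : Integrable (fun ω => outer f g (xIter p T N fhat ghat q₀ ξ k ω)) Pr
  value_hat : Integrable (fun ω => outer f g (xHat p T N fhat ghat q₀ ξ k ω)) Pr
  grad : Integrable
    (fun ω => ‖gradient (outer f g) (xIter p T N fhat ghat q₀ ξ k ω)‖ ^ 2) Pr
  err_y : Integrable (fun ω => ‖yInit p T N fhat ghat q₀ ξ k ω
    - yStar g (xIter p T N fhat ghat q₀ ξ k ω)‖ ^ 2) Pr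
  err_z : Integrable (fun ω => ‖zInit p T N fhat ghat q₀ ξ k ω
    - zStar f g (xIter p T N fhat ghat q₀ ξ k ω) (yIter p T N fhat ghat q₀ ξ k ω)‖ ^ 2) Pr

end Algorithm

end AmIGO

end

set_option linter.unusedSectionVars false

namespace AmIGO

/-! ### Smooth and strongly convex functions on a Hilbert space -/

section GenericCalculus

variable {E : Type*} [NormedAddCommGroup E] [InnerProductSpace ℝ E] [CompleteSpace E]

/-! The method is an inexact gradient descent on ℒ, and the proof follows three coupled quantities:
the outer energy and the squared errors of the two warm starts.

Implicit differentiation of ∂_y g(x, y*(x)) = 0 identifies ∇ℒ(x) with the field ∂ₓf + ∂_xy g z* at y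
= y*(x) (`hasGradientAt_outer`). This field, y* and z* are Lipschitz, so ℒ is L-smooth.
Conditionally on the state (x_k, y_k, z_{k-1}) the gradient estimate is a mean plus a centred noise.
The mean is what the exact linear solver would produce: the Hessian noise is fresh, centred and
multiplies an iterate independent of it, and the mean iterates are affine in the batch gradient. The
bias therefore contains no variance of the solver. It is controlled by the error of y_k and by a
geometrically small multiple of the error of z_{k-1} (`sq_norm_psiMean_sub_gradient_le`). The
variance is a fixed floor plus another small multiple of that error (`isNoise_psiHat`, `psiVar_le`).
The step β and the size of the Hessian batch keep the solver contracting in mean square despite its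
multiplicative noise.

An outer step lowers ℒ by γ/2 ‖∇ℒ‖², up to bias and variance (`outer_step_le`). With strong
convexity, the recursion of η turns this into a contraction of η‖x - x*‖²/2 together with a bound on
δ times the gap (`outer_step_strongly_convex`). The warm-start errors contract during the inner
loops, and then grow because their targets move with x (`Ey_succ_le`, `Ez_succ_le`). The
displacement of x is in turn bounded by variance, bias and ‖∇ℒ‖².

The weights of the energy are what closes this loop. With l² = (1 - α μ_g)^T, the squared error of y
contracts by l⁴ and carries the weight δ₀ l. This weight is small, so the drift of the target costs
little compared with the outer decrease; it is large compared with l⁴, so half of the weighted error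
pays for its own recursion and for the bias. The weight of z works in the same way.
`weighted_errors_le` is this bookkeeping, and `C` and `C'` collect the logarithms of the smallness
conditions that it needs.

The result is a contraction by 1 - δ/2 plus noise (`energy_step_of_pos`), or a telescoping decrease
(`energy_step_of_neg`). For the orders of magnitude, 1/μ_g = κ_g/L_g exhibits the powers of κ_g in
𝒲², and every argument of a logarithm in `C` and `C'`, or its inverse, is polynomial in κ_g κ_ℒ. -/

lemma hasDerivAt_comp_line {h : E → ℝ} {G x v : E} {t : ℝ}
    (hG : HasGradientAt h G (x + t • v)) :
    HasDerivAt (fun s : ℝ => h (x + s • v)) (inner ℝ G v) t := by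
  have h1 : HasDerivAt (fun s : ℝ => x + s • v) v t := by
    simpa using ((hasDerivAt_id t).smul_const v).const_add x
  exact ((hasGradientAt_iff_hasFDerivAt.mp hG).comp_hasDerivAt t h1).congr_deriv
    (InnerProductSpace.toDual_apply_apply ..)

/-- The descent lemma for functions with Lipschitz gradient. -/
lemma le_quadratic_of_lipschitz_gradient {h : E → ℝ} {G : E → E} {L : ℝ}
    (hG : ∀ x, HasGradientAt h (G x) x) (hL : ∀ x y, ‖G x - G y‖ ≤ L * ‖x - y‖) (x y : E) :
    h y ≤ h x + inner ℝ (G x) (y - x) + L / 2 * ‖y - x‖ ^ 2 := by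
  set v := y - x with hv
  -- Along the segment, the difference between h and its quadratic model has derivative ⟨G(x + tv) -
  -- G(x), v⟩ - L t ‖v‖², which is nonpositive for t in (0, 1) by Cauchy-Schwarz and the Lipschitz
  -- bound.
  have hd : ∀ t : ℝ, HasDerivAt
      (fun t : ℝ => h (x + t • v) - t * inner ℝ (G x) v - L / 2 * t ^ 2 * ‖v‖ ^ 2)
      (inner ℝ (G (x + t • v)) v - inner ℝ (G x) v - L * t * ‖v‖ ^ 2) t := by
    intro t
    have h1 := hasDerivAt_comp_line (t := t) (hG (x + t • v))
    have h2 := (hasDerivAt_id t).mul_const (inner ℝ (G x) v)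
    have h3 := (((hasDerivAt_id t).pow 2).const_mul (L / 2)).mul_const (‖v‖ ^ 2)
    refine ((h1.sub h2).sub h3).congr_deriv ?_
    simp only [id]
    push_cast
    ring
  have hanti : AntitoneOn
      (fun t : ℝ => h (x + t • v) - t * inner ℝ (G x) v - L / 2 * t ^ 2 * ‖v‖ ^ 2)
      (Set.Icc 0 1) := by
    apply antitoneOn_of_deriv_nonpos (convex_Icc 0 1)
    · exact fun t _ => (hd t).continuousAt.continuousWithinAt
    · exact fun t _ => (hd t).differentiableAt.differentiableWithinAt
    · intro t ht
      rw [interior_Icc] at ht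
      rw [(hd t).deriv, ← inner_sub_left]
      have h1 := real_inner_le_norm (G (x + t • v) - G x) v
      have h2 := hL (x + t • v) x
      rw [add_sub_cancel_left, norm_smul, Real.norm_of_nonneg ht.1.le] at h2
      nlinarith [norm_nonneg v]
  have := hanti (Set.left_mem_Icc.mpr zero_le_one) (Set.right_mem_Icc.mpr zero_le_one) zero_le_one
  simp only [one_smul, zero_smul, add_zero, hv] at this
  simp only [add_sub_cancel] at this
  rw [← hv] at this
  linarith

/-- The gradient step of length 1/L lowers h by at least ‖G x‖²/(2L), and the new value cannot be
below m. -/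
lemma sq_norm_gradient_le {h : E → ℝ} {G : E → E} {L m : ℝ} (hL0 : 0 < L)
    (hG : ∀ x, HasGradientAt h (G x) x) (hL : ∀ x y, ‖G x - G y‖ ≤ L * ‖x - y‖)
    (hm : ∀ x, m ≤ h x) (x : E) : ‖G x‖ ^ 2 ≤ 2 * L * (h x - m) := by
  have h1 := le_quadratic_of_lipschitz_gradient hG hL x (x - (1 / L) • G x)
  have h2 := hm (x - (1 / L) • G x)
  rw [sub_sub_cancel_left, inner_neg_right, norm_neg, norm_smul, inner_smul_right,
    real_inner_self_eq_norm_sq, Real.norm_of_nonneg (by positivity)] at h1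
  have h3 : (1 / (2 * L)) * ‖G x‖ ^ 2 ≤ h x - m := by
    have : -(1 / L * ‖G x‖ ^ 2) + L / 2 * (1 / L * ‖G x‖) ^ 2 = -(1 / (2 * L)) * ‖G x‖ ^ 2 := by
      field_simp
      ring
    linarith
  rw [div_mul_eq_mul_div, one_mul, div_le_iff₀ (by positivity)] at h3
  linarith

/-- First-order lower bound for a strongly convex function. -/
lemma _root_.StrongConvexOn.add_inner_le {h : E → ℝ} {m : ℝ} {G x : E}
    (hs : StrongConvexOn Set.univ m h) (hG : HasGradientAt h G x) (y : E) :
    h x + inner ℝ G (y - x) + m / 2 * ‖y - x‖ ^ 2 ≤ h y := by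
  have hd : HasDerivAt (fun s : ℝ => h (x + s • (y - x))) (inner ℝ G (y - x)) 0 :=
    hasDerivAt_comp_line (by simpa using hG)
  have hlim := hd.tendsto_slope_zero_right
  -- Strong convexity between x and y bounds the difference quotient at t by this expression; the
  -- claim is the limit t → 0⁺.
  have hlim2 : Filter.Tendsto (fun t : ℝ => h y - h x - (1 - t) * (m / 2 * ‖y - x‖ ^ 2))
      (nhdsWithin 0 (Set.Ioi 0)) (nhds (h y - h x - (1 - 0) * (m / 2 * ‖y - x‖ ^ 2))) := by
    apply tendsto_nhdsWithin_of_tendsto_nhds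
    apply Continuous.tendsto (by fun_prop)
  have hle := le_of_tendsto_of_tendsto hlim hlim2 (by
    filter_upwards [Ioo_mem_nhdsGT (zero_lt_one' ℝ)] with t ht
    have h1 := hs.2 (Set.mem_univ x) (Set.mem_univ y) (sub_nonneg.mpr ht.2.le) ht.1.le
      (by ring : (1 - t) + t = 1)
    have h2 : (1 - t) • x + t • y = x + t • (y - x) := by module
    rw [h2] at h1
    simp only [smul_eq_mul, zero_add, zero_smul, add_zero] at h1 ⊢
    rw [norm_sub_rev x y] at h1
    rw [inv_mul_le_iff₀ ht.1]
    nlinarith)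
  linarith

end GenericCalculus

section Operators

variable {E : Type*} [NormedAddCommGroup E] [InnerProductSpace ℝ E]

/-- Polarization: 4⟨Mv, w⟩ is the difference of the quadratic form at v + w and at v - w, and the
second value is nonnegative. The bound is then tested on w parallel to Mv. -/
lemma opNorm_le_of_symmetric_of_bounds {M : E →L[ℝ] E} {c : ℝ}
    (hs : ∀ v w, inner ℝ (M v) w = inner ℝ v (M w)) (h0 : ∀ v, 0 ≤ inner ℝ (M v) v)
    (hc : ∀ v, inner ℝ (M v) v ≤ c * ‖v‖ ^ 2) (hc0 : 0 ≤ c) : ‖M‖ ≤ c := by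
  have key : ∀ v w : E, inner ℝ (M v) w ≤ c / 4 * ‖v + w‖ ^ 2 := by
    intro v w
    have h1 := hc (v + w)
    have h2 := h0 (v - w)
    simp only [map_add, map_sub, inner_add_left, inner_add_right, inner_sub_left,
      inner_sub_right] at h1 h2
    have h3 : inner ℝ (M w) v = inner ℝ (M v) w := by rw [hs w v, real_inner_comm]
    linarith
  refine ContinuousLinearMap.opNorm_le_bound _ hc0 fun v => ?_
  by_cases hMv : M v = 0
  · rw [hMv, norm_zero]; positivity
  by_cases hv : v = 0
  · simp [hv]
  have hMp : 0 < ‖M v‖ := norm_pos_iff.mpr hMv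
  have hvp : 0 < ‖v‖ := norm_pos_iff.mpr hv
  -- Scaling Mv to the length of v balances the two vectors, so that ‖v + w‖ ≤ 2‖v‖ and the factor
  -- c/4 becomes c.
  have h1 := key v ((‖v‖ / ‖M v‖) • M v)
  rw [inner_smul_right, real_inner_self_eq_norm_sq] at h1
  have h2 : ‖v + (‖v‖ / ‖M v‖) • M v‖ ≤ 2 * ‖v‖ := by
    refine (norm_add_le _ _).trans ?_
    rw [norm_smul, Real.norm_of_nonneg (by positivity), div_mul_cancel₀ _ hMp.ne']
    linarith
  have h3 : ‖v + (‖v‖ / ‖M v‖) • M v‖ ^ 2 ≤ (2 * ‖v‖) ^ 2 := by gcongr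
  have h4 : ‖v‖ / ‖M v‖ * ‖M v‖ ^ 2 = ‖v‖ * ‖M v‖ := by field_simp
  rw [h4] at h1
  have h5 : ‖v‖ * ‖M v‖ ≤ ‖v‖ * (c * ‖v‖) := by nlinarith
  exact le_of_mul_le_mul_left h5 hvp

/-- The quadratic minorant makes h coercive, and coercive continuous functions attain their minimum
in finite dimension. This gives both y*(x) and, in the strongly convex case, x*. -/
lemma exists_forall_le_of_quadratic_lower_bound [FiniteDimensional ℝ E] {h : E → ℝ}
    (hc : Continuous h) {m c : ℝ} (hm : 0 < m) {G x : E}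
    (hlow : ∀ y, c + inner ℝ G (y - x) + m / 2 * ‖y - x‖ ^ 2 ≤ h y) :
    ∃ y, ∀ y', h y ≤ h y' := by
  have : ProperSpace E := FiniteDimensional.proper ℝ E
  apply hc.exists_forall_le
  have h1 : Filter.Tendsto (fun y : E => ‖y - x‖) (Filter.cocompact E) Filter.atTop :=
    tendsto_dist_right_cocompact_atTop x |>.congr (fun y => by rw [dist_eq_norm])
  have h2 : Filter.Tendsto (fun s : ℝ => c + s * (m / 2 * s - ‖G‖)) Filter.atTop Filter.atTop := by
    apply Filter.tendsto_atTop_add_const_left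
    apply Filter.Tendsto.atTop_mul_atTop₀ Filter.tendsto_id
    apply Filter.tendsto_atTop_add_const_right
    exact Filter.tendsto_id.const_mul_atTop (by positivity)
  refine Filter.tendsto_atTop_mono (fun y => ?_) (h2.comp h1)
  have h3 := abs_real_inner_le_norm G (y - x)
  have h4 := neg_abs_le (inner ℝ G (y - x))
  have h5 := hlow y
  simp only [Function.comp]
  nlinarith

end Operators

end AmIGO

namespace AmIGO

/-! ### Partial gradients and Hessians in terms of the joint derivative -/

section PairNorm

variable {X Y : Type*} [NormedAddCommGroup X] [InnerProductSpace ℝ X] [CompleteSpace X]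
  [NormedAddCommGroup Y] [InnerProductSpace ℝ Y] [CompleteSpace Y]

lemma pairNorm_nonneg (a : X) (b : Y) : 0 ≤ pairNorm a b := Real.sqrt_nonneg _

lemma pairNorm_sq (a : X) (b : Y) : pairNorm a b ^ 2 = ‖a‖ ^ 2 + ‖b‖ ^ 2 :=
  Real.sq_sqrt (by positivity)

lemma norm_fst_le_pairNorm (a : X) (b : Y) : ‖a‖ ≤ pairNorm a b :=
  Real.le_sqrt_of_sq_le (by nlinarith [sq_nonneg ‖b‖])

lemma norm_snd_le_pairNorm (a : X) (b : Y) : ‖b‖ ≤ pairNorm a b :=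
  Real.le_sqrt_of_sq_le (by nlinarith [sq_nonneg ‖a‖])

lemma pairNorm_le_add (a : X) (b : Y) : pairNorm a b ≤ ‖a‖ + ‖b‖ :=
  Real.sqrt_le_iff.mpr ⟨by positivity, by nlinarith [norm_nonneg a, norm_nonneg b]⟩

lemma pairNorm_zero_left (b : Y) : pairNorm (0 : X) b = ‖b‖ := by
  simp [pairNorm]

end PairNorm

section PartialDerivatives

variable {X Y : Type*} [NormedAddCommGroup X] [InnerProductSpace ℝ X] [CompleteSpace X]
  [NormedAddCommGroup Y] [InnerProductSpace ℝ Y] [CompleteSpace Y]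

/-- The Riesz isomorphism of a real Hilbert space, as a linear map. -/
noncomputable def rieszRep (Y : Type*) [NormedAddCommGroup Y] [InnerProductSpace ℝ Y]
    [CompleteSpace Y] : (Y →L[ℝ] ℝ) →L[ℝ] Y :=
  LinearMap.mkContinuous
    { toFun := fun φ => (InnerProductSpace.toDual ℝ Y).symm φ
      map_add' := fun a b => map_add _ a b
      map_smul' := fun c a => by simp } 1
    (fun φ => by
      simp only [LinearMap.coe_mk, AddHom.coe_mk]
      rw [LinearIsometryEquiv.norm_map, one_mul])

lemma rieszRep_apply (φ : Y →L[ℝ] ℝ) :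
    rieszRep Y φ = (InnerProductSpace.toDual ℝ Y).symm φ := rfl

lemma inner_rieszRep (φ : Y →L[ℝ] ℝ) (v : Y) : inner ℝ (rieszRep Y φ) v = φ v := by
  rw [rieszRep_apply, InnerProductSpace.toDual_symm_apply]

variable {h : X → Y → ℝ}

lemma hasFDerivAt_partial_fst {F : Type*} [NormedAddCommGroup F] [NormedSpace ℝ F]
    {H : X × Y → F} (hd : Differentiable ℝ H) (x : X) (y : Y) :
    HasFDerivAt (fun x' => H (x', y))
      ((fderiv ℝ H (x, y)).comp (ContinuousLinearMap.inl ℝ X Y)) x :=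
  (hd (x, y)).hasFDerivAt.comp x (hasFDerivAt_prodMk_left x y)

lemma hasFDerivAt_partial_snd {F : Type*} [NormedAddCommGroup F] [NormedSpace ℝ F]
    {H : X × Y → F} (hd : Differentiable ℝ H) (x : X) (y : Y) :
    HasFDerivAt (fun y' => H (x, y'))
      ((fderiv ℝ H (x, y)).comp (ContinuousLinearMap.inr ℝ X Y)) y :=
  (hd (x, y)).hasFDerivAt.comp y (hasFDerivAt_prodMk_right x y)

lemma gradX_eq_rieszRep (hd : Differentiable ℝ (fun q : X × Y => h q.1 q.2)) (x : X) (y : Y) :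
    gradX h x y = rieszRep X ((fderiv ℝ (fun q : X × Y => h q.1 q.2) (x, y)).comp
      (ContinuousLinearMap.inl ℝ X Y)) := by
  rw [gradX, gradient, (hasFDerivAt_partial_fst hd x y).fderiv, rieszRep_apply]

lemma gradY_eq_rieszRep (hd : Differentiable ℝ (fun q : X × Y => h q.1 q.2)) (x : X) (y : Y) :
    gradY h x y = rieszRep Y ((fderiv ℝ (fun q : X × Y => h q.1 q.2) (x, y)).comp
      (ContinuousLinearMap.inr ℝ X Y)) := by
  rw [gradY, gradient, (hasFDerivAt_partial_snd hd x y).fderiv, rieszRep_apply]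

lemma hasGradientAt_gradY (hd : Differentiable ℝ (fun q : X × Y => h q.1 q.2)) (x : X) (y : Y) :
    HasGradientAt (h x) (gradY h x y) y :=
  (hasFDerivAt_partial_snd hd x y).differentiableAt.hasGradientAt

lemma fderiv_uncurry_apply (hd : Differentiable ℝ (fun q : X × Y => h q.1 q.2)) (x : X) (y : Y)
    (v : X) (w : Y) : fderiv ℝ (fun q : X × Y => h q.1 q.2) (x, y) (v, w)
      = inner ℝ (gradX h x y) v + inner ℝ (gradY h x y) w := by
  rw [gradX_eq_rieszRep hd, gradY_eq_rieszRep hd, inner_rieszRep, inner_rieszRep]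
  simp [← map_add]

/-- The partial gradient is a fixed continuous linear map applied to the joint derivative, which is
differentiable by `hd2`. -/
lemma differentiable_gradY (hd : Differentiable ℝ (fun q : X × Y => h q.1 q.2))
    (hd2 : Differentiable ℝ (fderiv ℝ (fun q : X × Y => h q.1 q.2))) :
    Differentiable ℝ (fun q : X × Y => gradY h q.1 q.2) := by
  have : (fun q : X × Y => gradY h q.1 q.2) = fun q => rieszRep Y
      ((fderiv ℝ (fun q : X × Y => h q.1 q.2) q).comp (ContinuousLinearMap.inr ℝ X Y)) := by
    ext1 q
    exact gradY_eq_rieszRep hd q.1 q.2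
  rw [this]
  exact (rieszRep Y).differentiable.comp (hd2.clm_comp (differentiable_const _))

lemma differentiable_gradY_fst (hd : Differentiable ℝ (fun q : X × Y => h q.1 q.2))
    (hd2 : Differentiable ℝ (fderiv ℝ (fun q : X × Y => h q.1 q.2))) (y : Y) :
    Differentiable ℝ (fun x => gradY h x y) :=
  (differentiable_gradY hd hd2).comp (differentiable_id.prodMk (differentiable_const y))

lemma differentiable_gradY_snd (hd : Differentiable ℝ (fun q : X × Y => h q.1 q.2))
    (hd2 : Differentiable ℝ (fderiv ℝ (fun q : X × Y => h q.1 q.2))) (x : X) :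
    Differentiable ℝ (fun y => gradY h x y) :=
  (differentiable_gradY hd hd2).comp ((differentiable_const x).prodMk differentiable_id)

lemma hasFDerivAt_gradY (hd : Differentiable ℝ (fun q : X × Y => h q.1 q.2))
    (hd2 : Differentiable ℝ (fderiv ℝ (fun q : X × Y => h q.1 q.2))) (x : X) (y : Y) :
    HasFDerivAt (fun q : X × Y => gradY h q.1 q.2)
      ((ContinuousLinearMap.adjoint (hessXY h x y)).coprod (hessYY h x y)) (x, y) := by
  have hD := (differentiable_gradY hd hd2 (x, y)).hasFDerivAt
  convert hD using 1
  have h1 := hasFDerivAt_partial_fst (differentiable_gradY hd hd2) x y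
  have h2 := hasFDerivAt_partial_snd (differentiable_gradY hd hd2) x y
  rw [hessXY, hessYY, h1.fderiv, h2.fderiv, ContinuousLinearMap.adjoint_adjoint]
  ext v <;> simp

/-- Symmetry of the second derivative of h at (x, y), evaluated on the vectors (0, v) and (0, w).
Twice differentiability is enough for it. -/
lemma inner_hessYY_comm (hd : Differentiable ℝ (fun q : X × Y => h q.1 q.2))
    (hd2 : Differentiable ℝ (fderiv ℝ (fun q : X × Y => h q.1 q.2))) (x : X) (y v w : Y) :
    inner ℝ (hessYY h x y v) w = inner ℝ v (hessYY h x y w) := by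
  set H := fun q : X × Y => h q.1 q.2 with hH
  have hsymm := second_derivative_symmetric (fun q => (hd q).hasFDerivAt) (hd2 (x, y)).hasFDerivAt
    ((0 : X), v) ((0 : X), w)
  have key : ∀ a b : Y, inner ℝ (hessYY h x y a) b
      = fderiv ℝ (fderiv ℝ H) (x, y) (0, a) (0, b) := by
    intro a b
    have e : (fun y' => gradY h x y') = fun y' => rieszRep Y
        ((fderiv ℝ H (x, y')).comp (ContinuousLinearMap.inr ℝ X Y)) := by
      ext1 y'; exact gradY_eq_rieszRep hd x y'
    have d1 := hasFDerivAt_partial_snd (F := X × Y →L[ℝ] ℝ) (H := fderiv ℝ H) hd2 x y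
    have d2 := (rieszRep Y).hasFDerivAt.comp y
      (d1.clm_comp (hasFDerivAt_const (ContinuousLinearMap.inr ℝ X Y) y))
    rw [hessYY, e]
    have d3 := d2.fderiv
    simp only [Function.comp_def] at d3
    rw [d3, ContinuousLinearMap.comp_apply, inner_rieszRep]
    simp
  rw [key v w, hsymm, ← key w v, real_inner_comm]

end PartialDerivatives

/-! ### Derivatives of batch averages -/

section Batch

variable {X Y : Type*} [NormedAddCommGroup X] [InnerProductSpace ℝ X] [CompleteSpace X]
  [NormedAddCommGroup Y] [InnerProductSpace ℝ Y] [CompleteSpace Y] {Ξ : Type*}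
  {h : X → Y → Ξ → ℝ} {n : ℕ}

lemma fderiv_batch_uncurry (hd : ∀ ξ, Differentiable ℝ (fun q : X × Y => h q.1 q.2 ξ))
    (D : Fin n → Ξ) (q : X × Y) :
    HasFDerivAt (fun q : X × Y => batch h D q.1 q.2)
      ((n : ℝ)⁻¹ • ∑ i, fderiv ℝ (fun q : X × Y => h q.1 q.2 (D i)) q) q := by
  have h1 : HasFDerivAt (fun q : X × Y => ∑ i, h q.1 q.2 (D i))
      (∑ i, fderiv ℝ (fun q : X × Y => h q.1 q.2 (D i)) q) q :=
    HasFDerivAt.fun_sum fun i _ => (hd (D i) q).hasFDerivAt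
  exact h1.const_mul _

lemma differentiable_batch (hd : ∀ ξ, Differentiable ℝ (fun q : X × Y => h q.1 q.2 ξ))
    (D : Fin n → Ξ) : Differentiable ℝ (fun q : X × Y => batch h D q.1 q.2) :=
  fun q => (fderiv_batch_uncurry hd D q).differentiableAt

/-- This and the next three identities reduce batches to single samples, for which the measurability
of the derivatives is assumed. -/
lemma gradX_batch (hd : ∀ ξ, Differentiable ℝ (fun q : X × Y => h q.1 q.2 ξ))
    (D : Fin n → Ξ) (x : X) (y : Y) :
    gradX (batch h D) x y = (n : ℝ)⁻¹ • ∑ i, gradX (fun x y => h x y (D i)) x y := by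
  rw [gradX_eq_rieszRep (differentiable_batch hd D), (fderiv_batch_uncurry hd D (x, y)).fderiv]
  simp_rw [fun i => gradX_eq_rieszRep (h := fun x y => h x y (D i)) (hd (D i)) x y]
  rw [← map_sum, ← map_smul]
  congr 1
  ext v
  simp

lemma gradY_batch (hd : ∀ ξ, Differentiable ℝ (fun q : X × Y => h q.1 q.2 ξ))
    (D : Fin n → Ξ) (x : X) (y : Y) :
    gradY (batch h D) x y = (n : ℝ)⁻¹ • ∑ i, gradY (fun x y => h x y (D i)) x y := by
  rw [gradY_eq_rieszRep (differentiable_batch hd D), (fderiv_batch_uncurry hd D (x, y)).fderiv]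
  simp_rw [fun i => gradY_eq_rieszRep (h := fun x y => h x y (D i)) (hd (D i)) x y]
  rw [← map_sum, ← map_smul]
  congr 1
  ext v
  simp

lemma hessYY_batch (hd : ∀ ξ, Differentiable ℝ (fun q : X × Y => h q.1 q.2 ξ))
    (hd2 : ∀ ξ, Differentiable ℝ (fderiv ℝ (fun q : X × Y => h q.1 q.2 ξ)))
    (D : Fin n → Ξ) (x : X) (y : Y) :
    hessYY (batch h D) x y = (n : ℝ)⁻¹ • ∑ i, hessYY (fun x y => h x y (D i)) x y := by
  have e : (fun y' => gradY (batch h D) x y')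
      = fun y' => (n : ℝ)⁻¹ • ∑ i, gradY (fun x y => h x y (D i)) x y' := by
    ext1 y'; exact gradY_batch hd D x y'
  have h1 : HasFDerivAt (fun y' => ∑ i, gradY (fun x y => h x y (D i)) x y')
      (∑ i, hessYY (fun x y => h x y (D i)) x y) y :=
    HasFDerivAt.fun_sum fun i _ =>
      (differentiable_gradY_snd (hd (D i)) (hd2 (D i)) x y).hasFDerivAt
  rw [hessYY, e]
  exact (h1.const_smul (n : ℝ)⁻¹).fderiv

lemma hessXY_batch (hd : ∀ ξ, Differentiable ℝ (fun q : X × Y => h q.1 q.2 ξ))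
    (hd2 : ∀ ξ, Differentiable ℝ (fderiv ℝ (fun q : X × Y => h q.1 q.2 ξ)))
    (D : Fin n → Ξ) (x : X) (y : Y) :
    hessXY (batch h D) x y = (n : ℝ)⁻¹ • ∑ i, hessXY (fun x y => h x y (D i)) x y := by
  have e : (fun x' => gradY (batch h D) x' y)
      = fun x' => (n : ℝ)⁻¹ • ∑ i, gradY (fun x y => h x y (D i)) x' y := by
    ext1 x'; exact gradY_batch hd D x' y
  have h1 : HasFDerivAt (fun x' => ∑ i, gradY (fun x y => h x y (D i)) x' y)
      (∑ i, fderiv ℝ (fun x' => gradY (fun x y => h x y (D i)) x' y) x) x :=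
    HasFDerivAt.fun_sum fun i _ =>
      (differentiable_gradY_fst (hd (D i)) (hd2 (D i)) y x).hasFDerivAt
  have h2 : fderiv ℝ (fun x' => (n : ℝ)⁻¹ • ∑ i, gradY (fun x y => h x y (D i)) x' y) x = _ :=
    (h1.const_smul (n : ℝ)⁻¹).fderiv
  rw [hessXY, e, h2]
  simp [hessXY, map_sum]

end Batch

end AmIGO

namespace AmIGO

namespace Params.Admissible

variable {p : Params} (hp : p.Admissible)
include hp

lemma Lg_pos : 0 < p.Lg := hp.μg_pos.trans_le hp.μg_le

lemma L_pos : 0 < p.L := by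
  have := hp.μg_pos; have := hp.Lf_pos; have := hp.B_pos; have := hp.Lg'_pos; have := hp.Mg_pos
  unfold Params.L
  positivity

lemma γ_pos : 0 < p.γ := by
  have := hp.L_pos
  unfold Params.γ
  positivity

lemma Ly_pos : 0 < p.Ly := div_pos hp.Lg'_pos hp.μg_pos

lemma Lz_pos : 0 < p.Lz := by
  have := hp.μg_pos; have := hp.Lf_pos; have := hp.B_pos; have := hp.Mg_pos
  unfold Params.Lz
  positivity

lemma Lψ_pos : 0 < p.Lψ := hp.Lg'_pos.trans_le (le_max_right _ _)

end Params.Admissible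

/-- The hypergradient field `∂ₓ f (x, y) + ∂_xy g (x, y) z*(x, y)`. -/
noncomputable def hyperGrad {X Y : Type*} [NormedAddCommGroup X] [InnerProductSpace ℝ X]
    [CompleteSpace X] [NormedAddCommGroup Y] [InnerProductSpace ℝ Y] [CompleteSpace Y]
    (f g : X → Y → ℝ) (x : X) (y : Y) : X :=
  gradX f x y + hessXY g x y (zStar f g x y)

/-! ### Regularity of y*, z* and ℒ -/

section Regularity

variable {X Y : Type*} [NormedAddCommGroup X] [InnerProductSpace ℝ X] [CompleteSpace X]
  [NormedAddCommGroup Y] [InnerProductSpace ℝ Y] [CompleteSpace Y] [FiniteDimensional ℝ Y]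

/-- The product carries the maximum norm while the hypotheses use the Euclidean norm of pairs;
squeezing avoids comparing the two. -/
lemma continuous_of_norm_sub_le_pairNorm {F : Type*} [NormedAddCommGroup F] {φ : X → Y → F} {c : ℝ}
    (hφ : ∀ x x' y y', ‖φ x y - φ x' y'‖ ≤ c * pairNorm (x - x') (y - y')) :
    Continuous (fun q : X × Y => φ q.1 q.2) := by
  rw [continuous_iff_continuousAt]
  intro q
  rw [ContinuousAt, tendsto_iff_norm_sub_tendsto_zero]
  have h1 : Filter.Tendsto (fun q' : X × Y => c * pairNorm (q'.1 - q.1) (q'.2 - q.2)) (nhds q)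
      (nhds 0) := by
    have : Continuous (fun q' : X × Y => c * pairNorm (q'.1 - q.1) (q'.2 - q.2)) := by
      unfold pairNorm
      fun_prop
    simpa [pairNorm] using this.tendsto q
  exact squeeze_zero (fun _ => norm_nonneg _) (fun q' => hφ q'.1 q.1 q'.2 q.2) h1

variable {p : Params} {f g : X → Y → ℝ} (hp : p.Admissible) (hr : RegularProblem p f g)
include hp hr

/-- Sum of the first-order strong convexity bounds at y and at y'. -/
lemma gradY_strongly_monotone (x : X) (y y' : Y) :
    p.μg * ‖y - y'‖ ^ 2 ≤ inner ℝ (gradY g x y - gradY g x y') (y - y') := by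
  have h1 := (hr.g_strong x).add_inner_le (hasGradientAt_gradY hr.g_diff x y) y'
  have h2 := (hr.g_strong x).add_inner_le (hasGradientAt_gradY hr.g_diff x y') y
  rw [← neg_sub y y', norm_neg, inner_neg_right] at h1
  rw [inner_sub_left]
  linarith

lemma hasFDerivAt_hessYY (x : X) (y : Y) :
    HasFDerivAt (fun y' => gradY g x y') (hessYY g x y) y :=
  (differentiable_gradY_snd hr.g_diff hr.g_diff2 x y).hasFDerivAt

/-- Strong monotonicity between y and y + tv, divided by t², in the limit t → 0⁺. -/
lemma le_inner_hessYY (x : X) (y v : Y) : p.μg * ‖v‖ ^ 2 ≤ inner ℝ (hessYY g x y v) v := by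
  have hd : HasDerivAt (fun t : ℝ => inner ℝ (gradY g x (y + t • v)) v)
      (inner ℝ (hessYY g x y v) v) 0 := by
    have h1 : HasDerivAt (fun s : ℝ => y + s • v) v 0 := by
      simpa using ((hasDerivAt_id (0 : ℝ)).smul_const v).const_add y
    have h2 : HasFDerivAt (fun y' => gradY g x y') (hessYY g x y) (y + (0 : ℝ) • v) := by
      simpa using hasFDerivAt_hessYY hp hr x y
    have h3 := h2.comp_hasDerivAt (0 : ℝ) h1
    have h4 := h3.inner ℝ (hasDerivAt_const (0 : ℝ) v)
    simpa using! h4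
  have hlim := hd.tendsto_slope_zero_right
  refine ge_of_tendsto hlim ?_
  filter_upwards [self_mem_nhdsWithin] with t ht
  have ht : 0 < t := ht
  have h1 := gradY_strongly_monotone hp hr x (y + t • v) y
  rw [add_sub_cancel_left, inner_smul_right, norm_smul, Real.norm_of_nonneg ht.le,
    inner_sub_left] at h1
  simp only [zero_add, zero_smul, add_zero, smul_eq_mul]
  rw [le_inv_mul_iff₀ ht]
  refine le_of_mul_le_mul_left ?_ ht
  linarith

lemma norm_hessYY_le (x : X) (y : Y) : ‖hessYY g x y‖ ≤ p.Lg :=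
  norm_fderiv_le_of_lip' ℝ hp.Lg_pos.le (Filter.Eventually.of_forall fun y' => hr.g_smooth x y' y)

lemma inner_hessYY_le (x : X) (y v : Y) : inner ℝ (hessYY g x y v) v ≤ p.Lg * ‖v‖ ^ 2 := by
  have h1 := real_inner_le_norm (hessYY g x y v) v
  have h2 := (hessYY g x y).le_of_opNorm_le (norm_hessYY_le hp hr x y) v
  nlinarith [norm_nonneg v]

lemma norm_hessXY_le (x : X) (y : Y) : ‖hessXY g x y‖ ≤ p.Lg' := by
  rw [hessXY, LinearIsometryEquiv.norm_map]
  exact norm_fderiv_le_of_lip' ℝ hp.Lg'_pos.le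
    (Filter.Eventually.of_forall fun x' => hr.g_y_lip x' x y)

lemma norm_le_norm_hessYY_apply (x : X) (y v : Y) : p.μg * ‖v‖ ≤ ‖hessYY g x y v‖ := by
  have h1 := real_inner_le_norm (hessYY g x y v) v
  have h2 := le_inner_hessYY hp hr x y v
  rcases eq_or_lt_of_le (norm_nonneg v) with h | h
  · rw [← h]; simp
  · refine le_of_mul_le_mul_right ?_ h
    linarith

lemma hessYY_surjective (x : X) (y : Y) : Function.Surjective (hessYY g x y) := by
  apply (LinearMap.injective_iff_surjective (f := (hessYY g x y : Y →ₗ[ℝ] Y))).mp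
  refine (injective_iff_map_eq_zero _).mpr fun v hv => ?_
  have h1 := norm_le_norm_hessYY_apply hp hr x y v
  have h2 : hessYY g x y v = 0 := hv
  rw [h2, norm_zero] at h1
  have := hp.μg_pos
  exact norm_le_zero_iff.mp (by nlinarith)

/-- The Hessian has its spectrum in [μ_g, L_g], so the spectrum of this symmetric operator lies in
[0, 1 - cμ_g]. The condition cL_g ≤ 1 is what keeps it nonnegative. -/
lemma norm_one_sub_smul_hessYY_le {c : ℝ} (hc0 : 0 ≤ c) (hc : c * p.Lg ≤ 1) (x : X) (y : Y) :
    ‖ContinuousLinearMap.id ℝ Y - c • hessYY g x y‖ ≤ 1 - c * p.μg := by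
  apply opNorm_le_of_symmetric_of_bounds
  · intro v w
    simp only [sub_apply, ContinuousLinearMap.id_apply,
      smul_apply, inner_sub_left, inner_sub_right, inner_smul_left,
      inner_smul_right, inner_hessYY_comm hr.g_diff hr.g_diff2 x y v w]
    simp
  · intro v
    simp only [sub_apply, ContinuousLinearMap.id_apply,
      smul_apply, inner_sub_left, inner_smul_left,
      real_inner_self_eq_norm_sq]
    have h1 := mul_le_mul_of_nonneg_left (inner_hessYY_le hp hr x y v) hc0
    simp only [conj_trivial]
    nlinarith [sq_nonneg ‖v‖]
  · intro v
    simp only [sub_apply, ContinuousLinearMap.id_apply,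
      smul_apply, inner_sub_left, inner_smul_left,
      real_inner_self_eq_norm_sq]
    have h1 := mul_le_mul_of_nonneg_left (le_inner_hessYY hp hr x y v) hc0
    simp only [conj_trivial]
    nlinarith [sq_nonneg ‖v‖]
  · have := hp.μg_le
    nlinarith

/-- The derivative of the gradient step is I - α∂_yy g, and the mean value inequality transfers its
norm to the step. -/
lemma norm_gradY_step_sub_le (x : X) (y y' : Y) :
    ‖(y - p.α • gradY g x y) - (y' - p.α • gradY g x y')‖ ≤ (1 - p.α * p.μg) * ‖y - y'‖ := by
  have hd : ∀ y, HasFDerivAt (fun y => y - p.α • gradY g x y)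
      (ContinuousLinearMap.id ℝ Y - p.α • hessYY g x y) y := fun y =>
    (hasFDerivAt_id y).sub ((hasFDerivAt_hessYY hp hr x y).const_smul p.α)
  refine Convex.norm_image_sub_le_of_norm_fderiv_le (𝕜 := ℝ) (s := Set.univ)
    (f := fun y => y - p.α • gradY g x y)
    (fun y _ => (hd y).differentiableAt) (fun y _ => ?_) convex_univ (Set.mem_univ _)
    (Set.mem_univ _)
  rw [(hd y).fderiv]
  have := hp.Lg_pos
  apply norm_one_sub_smul_hessYY_le hp hr
  · unfold Params.α; positivity
  · unfold Params.α; rw [one_div, inv_mul_cancel₀ this.ne']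

lemma yStar_le (x : X) (y : Y) : g x (yStar g x) ≤ g x y := by
  have hc : Continuous (g x) :=
    continuous_iff_continuousAt.mpr fun y => (hasGradientAt_gradY hr.g_diff x y).differentiableAt.continuousAt
  exact Classical.epsilon_spec (exists_forall_le_of_quadratic_lower_bound hc hp.μg_pos fun y =>
    (hr.g_strong x).add_inner_le (hasGradientAt_gradY hr.g_diff x 0) y) y

lemma gradY_yStar (x : X) : gradY g x (yStar g x) = 0 := by
  have h1 : IsLocalMin (g x) (yStar g x) := Filter.Eventually.of_forall (yStar_le hp hr x)
  rw [gradY, gradient, h1.fderiv_eq_zero, map_zero]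

/-- Strong monotonicity of ∂_y g(x, ·) between the two minimizers. The gradient at y*(x') with
parameter x is only the effect of replacing x' by x, because it vanishes with parameter x'. -/
lemma norm_yStar_sub_le (x x' : X) : ‖yStar g x - yStar g x'‖ ≤ p.Ly * ‖x - x'‖ := by
  have h1 := gradY_strongly_monotone hp hr x (yStar g x) (yStar g x')
  have h2 : gradY g x (yStar g x) = gradY g x' (yStar g x') := by
    rw [gradY_yStar hp hr, gradY_yStar hp hr]
  have h3 := real_inner_le_norm (gradY g x (yStar g x) - gradY g x (yStar g x'))
    (yStar g x - yStar g x')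
  have h4 := hr.g_y_lip x' x (yStar g x')
  rw [← h2, norm_sub_rev x' x] at h4
  have hμ := hp.μg_pos
  rw [Params.Ly, div_mul_eq_mul_div, le_div_iff₀ hμ]
  rcases eq_or_lt_of_le (norm_nonneg (yStar g x - yStar g x')) with h | h
  · rw [← h]
    have := hp.Lg'_pos
    simp only [zero_mul]
    positivity
  · refine le_of_mul_le_mul_right ?_ h
    nlinarith

/-- The optimality condition of the linear system. -/
lemma hessYY_zStar (x : X) (y : Y) : hessYY g x y (zStar f g x y) = - gradY f x y := by
  obtain ⟨z, hz⟩ := hessYY_surjective hp hr x y (-gradY f x y)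
  -- Completing the square at a solution z of the linear system, which exists by surjectivity of the
  -- Hessian.
  have hexp : ∀ w, quad f g x y w = quad f g x y z + (1 / 2) * inner ℝ (hessYY g x y (w - z)) (w - z) := by
    intro w
    have hb : gradY f x y = - hessYY g x y z := by rw [hz, neg_neg]
    have hs := inner_hessYY_comm hr.g_diff hr.g_diff2 x y
    simp only [quad, hb, map_sub, inner_sub_left, inner_sub_right, inner_neg_right]
    rw [hs w w, hs w z, hs z w, hs z z]
    have h1 : inner ℝ z (hessYY g x y w) = inner ℝ w (hessYY g x y z) := by
      rw [← hs, real_inner_comm]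
    rw [h1]
    ring
  have hmin : ∀ w, quad f g x y z ≤ quad f g x y w := by
    intro w
    rw [hexp w]
    have h1 := le_inner_hessYY hp hr x y (w - z)
    have h2 : 0 ≤ p.μg * ‖w - z‖ ^ 2 := by have := hp.μg_pos; positivity
    linarith
  -- `zStar` is a choice among minimizers, hence known only through its minimality once a minimizer
  -- exists; strong convexity of the quadratic then forces it to be z.
  have h1 : ∀ w, quad f g x y (zStar f g x y) ≤ quad f g x y w :=
    Classical.epsilon_spec (p := fun z => ∀ w, quad f g x y z ≤ quad f g x y w) ⟨z, hmin⟩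
  have h2 := h1 z
  rw [hexp (zStar f g x y)] at h2
  have h3 := le_inner_hessYY hp hr x y (zStar f g x y - z)
  have h4 : p.μg * ‖zStar f g x y - z‖ ^ 2 ≤ 0 := by linarith
  have h5 : ‖zStar f g x y - z‖ ^ 2 ≤ 0 := by
    have := hp.μg_pos
    by_contra hcon
    push Not at hcon
    nlinarith
  have h6 : zStar f g x y = z := by
    rw [← sub_eq_zero, ← norm_eq_zero]
    exact pow_eq_zero_iff (two_ne_zero) |>.mp (le_antisymm h5 (sq_nonneg _))
  rw [h6, hz]

lemma norm_zStar_le (x : X) (y : Y) : ‖zStar f g x y‖ ≤ p.B / p.μg := by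
  have h1 := norm_le_norm_hessYY_apply hp hr x y (zStar f g x y)
  rw [hessYY_zStar hp hr, norm_neg] at h1
  rw [le_div_iff₀ hp.μg_pos]
  linarith [hr.f_bound x y]

/-- Subtracting the two linear systems gives H(z - z') = -(b - b') - (H - H')z', where H and b are
the Hessian and ∂_y f. The right-hand side is bounded because z' is at most B/μ_g, and H is
coercive. -/
lemma norm_zStar_sub_le (x x' : X) (y y' : Y) :
    ‖zStar f g x y - zStar f g x' y'‖ ≤ p.Lz * pairNorm (x - x') (y - y') := by
  have h1 := norm_le_norm_hessYY_apply hp hr x y (zStar f g x y - zStar f g x' y')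
  have h2 : hessYY g x y (zStar f g x y - zStar f g x' y')
      = -(gradY f x y - gradY f x' y') - (hessYY g x y - hessYY g x' y') (zStar f g x' y') := by
    rw [map_sub, hessYY_zStar hp hr, sub_apply, hessYY_zStar hp hr]
    abel
  have h3 : ‖hessYY g x y (zStar f g x y - zStar f g x' y')‖
      ≤ p.Lf * pairNorm (x - x') (y - y') + p.Mg * pairNorm (x - x') (y - y') * (p.B / p.μg) := by
    rw [h2]
    refine (norm_sub_le _ _).trans ?_
    rw [norm_neg]
    refine add_le_add ((norm_snd_le_pairNorm _ _).trans (hr.f_lip x x' y y')) ?_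
    refine ((hessYY g x y - hessYY g x' y').le_of_opNorm_le (hr.g_yy_lip x x' y y') _).trans ?_
    exact mul_le_mul_of_nonneg_left (norm_zStar_le hp hr x' y')
      (mul_nonneg hp.Mg_pos.le (pairNorm_nonneg _ _))
  have hμ := hp.μg_pos
  have h4 : p.Lz * pairNorm (x - x') (y - y') = (p.Lf * pairNorm (x - x') (y - y')
      + p.Mg * pairNorm (x - x') (y - y') * (p.B / p.μg)) / p.μg := by
    unfold Params.Lz
    field_simp
    ring
  rw [h4, le_div_iff₀ hμ]
  linarith

/-- Product rule for increments: the increment of ∂_xy g acts on the bounded vector z*, and the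
bounded operator ∂_xy g acts on the increment of z*. -/
lemma norm_hyperGrad_sub_le (x x' : X) (y y' : Y) :
    ‖hyperGrad f g x y - hyperGrad f g x' y'‖
      ≤ (p.Lf + p.Mg * p.B / p.μg + p.Lg' * p.Lz) * pairNorm (x - x') (y - y') := by
  have h1 : hyperGrad f g x y - hyperGrad f g x' y' = (gradX f x y - gradX f x' y')
      + ((hessXY g x y - hessXY g x' y') (zStar f g x' y')
        + hessXY g x y (zStar f g x y - zStar f g x' y')) := by
    simp only [hyperGrad, map_sub, sub_apply]
    abel
  have h2 := (norm_fst_le_pairNorm _ _).trans (hr.f_lip x x' y y')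
  have h3 := (hessXY g x y - hessXY g x' y').le_of_opNorm_le (hr.g_xy_lip x x' y y')
    (zStar f g x' y')
  have h4 := (hessXY g x y).le_of_opNorm_le (norm_hessXY_le hp hr x y)
    (zStar f g x y - zStar f g x' y')
  have h5 := mul_le_mul_of_nonneg_left (norm_zStar_le hp hr x' y')
    (mul_nonneg hp.Mg_pos.le (pairNorm_nonneg (x - x') (y - y')))
  have h6 := mul_le_mul_of_nonneg_left (norm_zStar_sub_le hp hr x x' y y') hp.Lg'_pos.le
  rw [h1]
  rw [← add_assoc]
  refine (norm_add₃_le ..).trans ?_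
  have h7 : p.Mg * pairNorm (x - x') (y - y') * (p.B / p.μg)
      = p.Mg * p.B / p.μg * pairNorm (x - x') (y - y') := by ring
  rw [h7] at h5
  linarith

lemma continuous_yStar : Continuous (yStar g) :=
  (LipschitzWith.of_dist_le_mul (K := ⟨p.Ly, hp.Ly_pos.le⟩) fun x x' => by
    rw [dist_eq_norm, dist_eq_norm]; exact norm_yStar_sub_le hp hr x x').continuous

/-- Implicit differentiation. Along the curve (x', y*(x')) the gradient ∂_y g vanishes identically,
so its first-order expansion there is a linear equation for the increment of y*, solved by inverting
the Hessian. -/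
lemma hasFDerivAt_yStar (x : X) : ∃ D : X →L[ℝ] Y, HasFDerivAt (yStar g) D x ∧
    ∀ v, hessYY g x (yStar g x) (D v)
      = - ContinuousLinearMap.adjoint (hessXY g x (yStar g x)) v := by
  set A := hessYY g x (yStar g x) with hA
  set J := ContinuousLinearMap.adjoint (hessXY g x (yStar g x)) with hJ
  have hinj : Function.Injective A :=
    (LinearMap.injective_iff_surjective (f := (A : Y →ₗ[ℝ] Y))).mpr (hessYY_surjective hp hr x _)
  let e : Y ≃L[ℝ] Y := (LinearEquiv.ofInjectiveEndo (A : Y →ₗ[ℝ] Y) hinj).toContinuousLinearEquiv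
  have he : ∀ v, e v = A v := fun v => rfl
  have he' : ∀ v, A (e.symm v) = v := fun v => by rw [← he, e.apply_symm_apply]
  refine ⟨-((e.symm : Y →L[ℝ] Y).comp J), ?_, fun v => by simp [he']⟩
  have h1 := (hasFDerivAt_gradY hr.g_diff hr.g_diff2 x (yStar g x)).isLittleO
  have ht : Filter.Tendsto (fun x' => (x', yStar g x')) (nhds x) (nhds (x, yStar g x)) :=
    (continuous_id.prodMk (continuous_yStar hp hr)).tendsto x
  have h2 := h1.comp_tendsto ht
  -- The Lipschitz bound of y* makes a remainder that is small with respect to the pair small with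
  -- respect to x' - x.
  have hO : (fun x' => (x', yStar g x') - (x, yStar g x)) =O[nhds x] fun x' => x' - x := by
    apply Asymptotics.IsBigO.of_bound (max 1 p.Ly)
    refine Filter.Eventually.of_forall fun x' => ?_
    rw [Prod.mk_sub_mk, Prod.norm_def, max_le_iff]
    constructor
    · exact le_mul_of_one_le_left (norm_nonneg _) (le_max_left _ _)
    · exact (norm_yStar_sub_le hp hr x' x).trans
        (mul_le_mul_of_nonneg_right (le_max_right _ _) (norm_nonneg _))
  have h3 := h2.trans_isBigO hO
  rw [hasFDerivAt_iff_isLittleO]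
  -- The remainder of y* is the negative inverse Hessian applied to the Taylor remainder of ∂_y g.
  have h4 : (fun x' => yStar g x' - yStar g x - (-((e.symm : Y →L[ℝ] Y).comp J)) (x' - x))
      = fun x' => (-(e.symm : Y →L[ℝ] Y)) (((fun q : X × Y => gradY g q.1 q.2 - gradY g x (yStar g x)
        - (J.coprod A) (q - (x, yStar g x))) ∘ fun x' => (x', yStar g x')) x') := by
    ext1 x'
    apply e.injective
    simp only [Function.comp, gradY_yStar hp hr, he]
    simp [he', map_sub]
    abel
  rw [h4]
  exact ((-(e.symm : Y →L[ℝ] Y)).isBigO_comp _ _).trans_isLittleO h3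

/-- Adjoint method. The chain rule produces ⟨∂_y f, Dv⟩ with D the derivative of y*. Since ∂_y f =
-H z* and HD = -J, with J the Jacobian of ∂_y g in x, symmetry of H turns this into ⟨z*, Jv⟩, that
is ⟨∂_xy g z*, v⟩. -/
lemma hasGradientAt_outer (x : X) :
    HasGradientAt (outer f g) (hyperGrad f g x (yStar g x)) x := by
  obtain ⟨D, hD, hDA⟩ := hasFDerivAt_yStar hp hr x
  have h1 : HasFDerivAt (fun x' => (x', yStar g x')) ((ContinuousLinearMap.id ℝ X).prod D) x :=
    (hasFDerivAt_id x).prodMk hD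
  have h2 := HasFDerivAt.comp x (f := fun x' => (x', yStar g x'))
    (g := fun q : X × Y => f q.1 q.2) (hr.f_diff (x, yStar g x)).hasFDerivAt h1
  rw [hasGradientAt_iff_hasFDerivAt]
  convert! h2 using 1
  ext v
  rw [ContinuousLinearMap.comp_apply, ContinuousLinearMap.prod_apply, ContinuousLinearMap.id_apply,
    fderiv_uncurry_apply hr.f_diff, InnerProductSpace.toDual_apply_apply, hyperGrad, inner_add_left]
  congr 1
  have h3 : gradY f x (yStar g x) = - hessYY g x (yStar g x) (zStar f g x (yStar g x)) := by
    rw [hessYY_zStar hp hr, neg_neg]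
  rw [h3, inner_neg_left, inner_hessYY_comm hr.g_diff hr.g_diff2, hDA, inner_neg_right, neg_neg,
    ContinuousLinearMap.adjoint_inner_right]

lemma gradient_outer (x : X) : gradient (outer f g) x = hyperGrad f g x (yStar g x) :=
  (hasGradientAt_outer hp hr x).gradient

lemma hasGradientAt_outer_gradient (x : X) :
    HasGradientAt (outer f g) (gradient (outer f g) x) x := by
  rw [gradient_outer hp hr]; exact hasGradientAt_outer hp hr x

lemma norm_gradient_outer_sub_le (x x' : X) :
    ‖gradient (outer f g) x - gradient (outer f g) x'‖ ≤ p.L * ‖x - x'‖ := by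
  rw [gradient_outer hp hr, gradient_outer hp hr]
  refine (norm_hyperGrad_sub_le hp hr _ _ _ _).trans ?_
  -- Bounding the pair by the sum of the norms is what gives L its factor 1 + L_g'/μ_g.
  have h1 : pairNorm (x - x') (yStar g x - yStar g x') ≤ (1 + p.Ly) * ‖x - x'‖ := by
    have := pairNorm_le_add (x - x') (yStar g x - yStar g x')
    have := norm_yStar_sub_le hp hr x x'
    linarith
  have h0 : 0 ≤ p.Lf + p.Mg * p.B / p.μg + p.Lg' * p.Lz := by
    have := hp.μg_pos; have := hp.Lf_pos; have := hp.B_pos; have := hp.Lg'_pos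
    have := hp.Mg_pos; have := hp.Lz_pos
    positivity
  refine (mul_le_mul_of_nonneg_left h1 h0).trans_eq ?_
  have hμ := hp.μg_pos
  unfold Params.L Params.Lz Params.Ly
  field_simp
  ring

/-- The part of the bias that is due to stopping the inner descent early: only y differs from y*(x).
-/
lemma norm_hyperGrad_sub_gradient_outer_le (x : X) (y : Y) :
    ‖hyperGrad f g x y - gradient (outer f g) x‖ ≤ p.Lψ * ‖y - yStar g x‖ := by
  rw [gradient_outer hp hr]
  refine (norm_hyperGrad_sub_le hp hr _ _ _ _).trans ?_
  rw [sub_self, pairNorm_zero_left]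
  exact mul_le_mul_of_nonneg_right (le_max_left _ _) (norm_nonneg _)

end Regularity

end AmIGO

namespace AmIGO

/-! ### Independence of disjoint groups of samples -/

section Independence

variable {Ω Q Ξ ι : Type*} [mΩ : MeasurableSpace Ω] [MeasurableSpace Q] [MeasurableSpace Ξ]
  {μ : Measure Ω}

/-- The σ-algebra generated by the starting point (index `none`) or by one sample. -/
@[reducible] def sampleAlgebra (q₀ : Ω → Q) (ξ : ι → Ω → Ξ) : Option ι → MeasurableSpace Ω
  | none => MeasurableSpace.comap q₀ inferInstance
  | some i => MeasurableSpace.comap (ξ i) inferInstance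

/-- The σ-algebra generated by the starting point and the samples with labels in `S`. -/
@[reducible] def observed (q₀ : Ω → Q) (ξ : ι → Ω → Ξ) (S : Set (Option ι)) : MeasurableSpace Ω :=
  ⨆ i ∈ S, sampleAlgebra q₀ ξ i

variable {q₀ : Ω → Q} {ξ : ι → Ω → Ξ}

lemma sampleAlgebra_le (hq : Measurable q₀) (hξ : ∀ i, Measurable (ξ i)) (i : Option ι) :
    sampleAlgebra q₀ ξ i ≤ mΩ := by
  cases i with
  | none => exact hq.comap_le
  | some i => exact (hξ i).comap_le

lemma observed_le (hq : Measurable q₀) (hξ : ∀ i, Measurable (ξ i)) (S : Set (Option ι)) :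
    observed q₀ ξ S ≤ mΩ :=
  iSup₂_le fun i _ => sampleAlgebra_le hq hξ i

lemma observed_mono {S S' : Set (Option ι)} (h : S ⊆ S') : observed q₀ ξ S ≤ observed q₀ ξ S' :=
  biSup_mono h

lemma measurable_start_observed {S : Set (Option ι)} (h : none ∈ S) :
    Measurable[observed q₀ ξ S] q₀ := by
  have h1 : sampleAlgebra q₀ ξ none ≤ observed q₀ ξ S := le_biSup (sampleAlgebra q₀ ξ) h
  exact (comap_measurable q₀).mono h1 le_rfl

lemma measurable_sample_observed {S : Set (Option ι)} {i : ι} (h : some i ∈ S) :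
    Measurable[observed q₀ ξ S] (ξ i) := by
  have h1 : sampleAlgebra q₀ ξ (some i) ≤ observed q₀ ξ S := le_biSup (sampleAlgebra q₀ ξ) h
  exact (comap_measurable (ξ i)).mono h1 le_rfl

lemma measurable_batch_observed {κ : Type*} {S : Set (Option ι)} {e : κ → ι}
    (h : ∀ i, some (e i) ∈ S) : Measurable[observed q₀ ξ S] (fun ω i => ξ (e i) ω) :=
  @measurable_pi_lambda _ _ _ (observed q₀ ξ S) _ _ fun i => measurable_sample_observed (h i)

/-- The starting point is adjoined to the samples as one more member of the family. The product
formula splits off its event first, by independence from the whole sample, and then factorizes the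
remaining ones. -/
lemma iIndep_sampleAlgebra [IsProbabilityMeasure μ]
    (hind : iIndepFun ξ μ) (hqξ : IndepFun q₀ (fun ω i => ξ i ω) μ) :
    iIndep (sampleAlgebra q₀ ξ) μ := by
  classical
  rw [iIndep_iff]
  intro s F hF
  have hind' := (iIndep_iff _ _).mp hind
  have hsome : ∀ t : Finset ι, (∀ j ∈ t, some j ∈ s) →
      μ (⋂ j ∈ t, F (some j)) = ∏ j ∈ t, μ (F (some j)) := fun t ht =>
    hind' t (f := fun j => F (some j)) fun j hj => hF (some j) (ht j hj)
  set t := Finset.eraseNone s with ht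
  have hmem : ∀ j, j ∈ t ↔ some j ∈ s := fun j => Finset.mem_eraseNone
  -- Independence from the starting point is assumed for the sample as a whole, so the intersection
  -- of the single events has to be an event of the whole sample.
  have hmeas : MeasurableSet[MeasurableSpace.comap (fun ω i => ξ i ω) inferInstance]
      (⋂ j ∈ t, F (some j)) := by
    refine Finset.measurableSet_biInter _ fun j hj => ?_
    obtain ⟨B, hB, hBF⟩ := hF (some j) ((hmem j).mp hj)
    rw [← hBF]
    exact ⟨(fun x => x j) ⁻¹' B, measurable_pi_apply j hB, rfl⟩
  by_cases hn : none ∈ s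
  · have hs : s = insert none (t.map Function.Embedding.some) := by
      ext i
      cases i <;> simp [hn, hmem]
    have hnot : none ∉ t.map (Function.Embedding.some (α := ι)) := by simp
    have hinter : (⋂ i ∈ s, F i) = F none ∩ ⋂ j ∈ t, F (some j) := by
      rw [hs, Finset.set_biInter_insert]
      congr 1
      ext ω
      simp
    rw [hinter, hs, Finset.prod_insert hnot, Finset.prod_map]
    have := (Indep_iff _ _ _).mp hqξ (F none) _ (hF none hn) hmeas
    rw [this, hsome t fun j hj => (hmem j).mp hj]
    rfl
  · have hs : s = t.map Function.Embedding.some := by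
      ext i
      cases i <;> simp [hn, hmem]
    have hinter : (⋂ i ∈ s, F i) = ⋂ j ∈ t, F (some j) := by
      rw [hs]
      ext ω
      simp
    rw [hinter, hs, Finset.prod_map, hsome t fun j hj => (hmem j).mp hj]
    rfl

/-- The form in which independence is used below: it is enough to exhibit disjoint sets of labels on
which the two variables depend. -/
lemma indepFun_of_observed [IsProbabilityMeasure μ] {α β : Type*} [MeasurableSpace α]
    [MeasurableSpace β] (hq : Measurable q₀) (hξ : ∀ i, Measurable (ξ i))
    (hind : iIndepFun ξ μ) (hqξ : IndepFun q₀ (fun ω i => ξ i ω) μ) {S S' : Set (Option ι)}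
    (hS : Disjoint S S') {U : Ω → α} {V : Ω → β} (hU : Measurable[observed q₀ ξ S] U)
    (hV : Measurable[observed q₀ ξ S'] V) : IndepFun U V μ := by
  have h1 : Indep (observed q₀ ξ S) (observed q₀ ξ S') μ :=
    indep_iSup_of_disjoint (sampleAlgebra_le hq hξ) (iIndep_sampleAlgebra hind hqξ) hS
  exact indep_of_indep_of_le_left (indep_of_indep_of_le_right h1 hV.comap_le) hU.comap_le

variable {α β : Type*} [MeasurableSpace α] [MeasurableSpace β]

/-- Averaging first over the second of two independent variables. -/
lemma integral_comp_indep_eq [IsProbabilityMeasure μ] {F : Type*} [NormedAddCommGroup F]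
    [NormedSpace ℝ F] {U : Ω → α} {V : Ω → β} (hU : Measurable U) (hV : Measurable V)
    (hUV : IndepFun U V μ) {φ : α × β → F} (hφ : StronglyMeasurable φ)
    (hint : Integrable (fun ω => φ (U ω, V ω)) μ) :
    ∫ ω, φ (U ω, V ω) ∂μ = ∫ ω, (∫ ω', φ (U ω, V ω') ∂μ) ∂μ := by
  have hmap := hUV.map_prod_eq_prod_map_map hU.aemeasurable hV.aemeasurable
  have := Measure.isProbabilityMeasure_map (μ := μ) hU.aemeasurable
  have := Measure.isProbabilityMeasure_map (μ := μ) hV.aemeasurable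
  have h1 : ∫ ω, φ (U ω, V ω) ∂μ = ∫ q, φ q ∂((μ.map U).prod (μ.map V)) := by
    rw [← hmap, integral_map (hU.prodMk hV).aemeasurable hφ.aestronglyMeasurable]
  have h2 : Integrable φ ((μ.map U).prod (μ.map V)) := by
    rw [← hmap, integrable_map_measure hφ.aestronglyMeasurable (hU.prodMk hV).aemeasurable]
    exact hint
  rw [h1, integral_prod _ h2, integral_map hU.aemeasurable]
  · refine integral_congr_ae (Filter.Eventually.of_forall fun ω => ?_)
    exact integral_map hV.aemeasurable (hφ.comp_measurable measurable_prodMk_left).aestronglyMeasurable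
  · exact hφ.integral_prod_right'.aestronglyMeasurable

/-- Conditional bounds of nonnegative functions integrate. -/
lemma integral_comp_indep_le [IsProbabilityMeasure μ] {U : Ω → α} {V : Ω → β}
    (hU : Measurable U) (hV : Measurable V)
    (hUV : IndepFun U V μ) {φ : α × β → ℝ} (hφ : Measurable φ) (h0 : ∀ a, 0 ≤ φ a) {H : α → ℝ}
    (hi : ∀ a, Integrable (fun ω => φ (a, V ω)) μ) (hH : ∀ a, ∫ ω, φ (a, V ω) ∂μ ≤ H a)
    (hHi : Integrable (fun ω => H (U ω)) μ) :
    Integrable (fun ω => φ (U ω, V ω)) μ ∧ ∫ ω, φ (U ω, V ω) ∂μ ≤ ∫ ω, H (U ω) ∂μ := by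
  have hmap := hUV.map_prod_eq_prod_map_map hU.aemeasurable hV.aemeasurable
  have := Measure.isProbabilityMeasure_map (μ := μ) hU.aemeasurable
  have := Measure.isProbabilityMeasure_map (μ := μ) hV.aemeasurable
  have hmapV : ∀ a, ∫ y, φ (a, y) ∂(μ.map V) = ∫ ω', φ (a, V ω') ∂μ := fun a =>
    integral_map hV.aemeasurable (hφ.comp measurable_prodMk_left).aestronglyMeasurable
  have hnn : ∀ a, 0 ≤ ∫ ω', φ (a, V ω') ∂μ := fun a => integral_nonneg fun ω' => h0 _
  have hsm : StronglyMeasurable fun a => ∫ y, φ (a, y) ∂(μ.map V) :=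
    hφ.stronglyMeasurable.integral_prod_right'
  have hdom : Integrable (fun ω => ∫ ω', φ (U ω, V ω') ∂μ) μ := by
    refine hHi.mono' ?_ (Filter.Eventually.of_forall fun ω => ?_)
    · simp_rw [← hmapV]
      exact (hsm.comp_measurable hU).aestronglyMeasurable
    · rw [Real.norm_of_nonneg (hnn _)]
      exact hH _
  -- Tonelli's criterion: for nonnegative φ it is enough that the sections are integrable and that
  -- their integrals are, and the latter are dominated by H.
  have hint : Integrable (fun ω => φ (U ω, V ω)) μ := by
    rw [← Function.comp_def φ, ← integrable_map_measure hφ.aestronglyMeasurable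
      (hU.prodMk hV).aemeasurable, hmap, integrable_prod_iff hφ.aestronglyMeasurable]
    constructor
    · refine Filter.Eventually.of_forall fun a => ?_
      exact (integrable_map_measure (hφ.comp measurable_prodMk_left).aestronglyMeasurable
        hV.aemeasurable).mpr (hi a)
    · simp_rw [Real.norm_of_nonneg (h0 _)]
      refine (integrable_map_measure hsm.aestronglyMeasurable hU.aemeasurable).mpr ?_
      simpa only [Function.comp_def, hmapV] using hdom
  refine ⟨hint, ?_⟩
  rw [integral_comp_indep_eq hU hV hUV hφ.stronglyMeasurable hint]
  exact integral_mono hdom hHi fun ω => hH _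

/-- The noise assumptions are stated under the product law, whereas the algorithm runs on Ω.
Distinct labels are needed for a batch to have the product law. -/
lemma map_batch [IsProbabilityMeasure μ] {P : Measure Ξ} {n : ℕ} {e : Fin n → ι}
    (he : Function.Injective e) (hξ : ∀ i, Measurable (ξ i)) (hind : iIndepFun ξ μ)
    (hlaw : ∀ i, μ.map (ξ i) = P) :
    μ.map (fun ω (i : Fin n) => ξ (e i) ω) = Measure.pi fun _ => P := by
  have h1 : iIndepFun (fun i => ξ (e i)) μ := hind.precomp he
  rw [iIndepFun_iff_map_fun_eq_pi_map (fun i => (hξ (e i)).aemeasurable)] at h1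
  rw [h1]
  simp_rw [hlaw]

end Independence

section Moments

variable {Ω : Type*} [MeasurableSpace Ω] {μ : Measure Ω} [IsProbabilityMeasure μ]
  {F : Type*} [NormedAddCommGroup F] [InnerProductSpace ℝ F] [CompleteSpace F]

lemma _root_.MeasureTheory.Integrable.of_sq_norm {V : Ω → F} (hm : AEStronglyMeasurable V μ)
    (h2 : Integrable (fun ω => ‖V ω‖ ^ 2) μ) : Integrable V μ :=
  ((memLp_two_iff_integrable_sq_norm hm).mpr h2).integrable one_le_two

/-- Bias-variance decomposition. -/
lemma integral_sq_norm_add {V : Ω → F} (w : F) (hV : Integrable V μ)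
    (h2 : Integrable (fun ω => ‖V ω‖ ^ 2) μ) :
    Integrable (fun ω => ‖w + V ω‖ ^ 2) μ ∧
    ∫ ω, ‖w + V ω‖ ^ 2 ∂μ = ‖w‖ ^ 2 + 2 * inner ℝ w (∫ ω, V ω ∂μ) + ∫ ω, ‖V ω‖ ^ 2 ∂μ := by
  have hi : Integrable (fun ω => 2 * inner ℝ w (V ω)) μ := (hV.const_inner w).const_mul 2
  have e : (fun ω => ‖w + V ω‖ ^ 2) = fun ω => (‖w‖ ^ 2 + 2 * inner ℝ w (V ω)) + ‖V ω‖ ^ 2 := by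
    ext1 ω
    exact norm_add_sq_real w (V ω)
  rw [e]
  have hc : Integrable (fun ω => ‖w‖ ^ 2 + 2 * inner ℝ w (V ω)) μ := (integrable_const _).add hi
  refine ⟨hc.add h2, ?_⟩
  rw [integral_add hc h2, integral_add (integrable_const _) hi,
    integral_const_mul, integral_inner hV]
  simp

end Moments

end AmIGO

namespace AmIGO

/-! ### Measurability of the updates -/

section Measurability

variable {X Y Ξ Ω : Type*}
  [NormedAddCommGroup X] [InnerProductSpace ℝ X] [CompleteSpace X] [FiniteDimensional ℝ X]
  [MeasurableSpace X] [BorelSpace X]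
  [NormedAddCommGroup Y] [InnerProductSpace ℝ Y] [CompleteSpace Y] [FiniteDimensional ℝ Y]
  [MeasurableSpace Y] [BorelSpace Y]
  [MeasurableSpace Ξ] {mΩ : MeasurableSpace Ω}
  {f g : X → Y → ℝ} {fhat ghat : X → Y → Ξ → ℝ} {P : Measure Ξ}
  (hm : StochasticModel f g fhat ghat P) {n : ℕ} {x : Ω → X} {y z v : Ω → Y}
  {D : Ω → Fin n → Ξ}
include hm

/-- The σ-algebra of Ω is an implicit variable in this section, so that the lemmas also apply to the
σ-algebras generated by parts of the sample. -/
lemma StochasticModel.measurable_gradX_batch (hx : Measurable x) (hy : Measurable y)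
    (hD : ∀ i, Measurable fun ω => D ω i) :
    Measurable fun ω => gradX (batch fhat (D ω)) (x ω) (y ω) := by
  simp_rw [gradX_batch hm.fhat_diff]
  refine Measurable.const_smul (Finset.measurable_sum _ fun i _ => ?_) _
  exact hm.meas_fx.comp (hx.prodMk (hy.prodMk (hD i)))

lemma StochasticModel.measurable_gradY_batch_f (hx : Measurable x) (hy : Measurable y)
    (hD : ∀ i, Measurable fun ω => D ω i) :
    Measurable fun ω => gradY (batch fhat (D ω)) (x ω) (y ω) := by
  simp_rw [gradY_batch hm.fhat_diff]
  refine Measurable.const_smul (Finset.measurable_sum _ fun i _ => ?_) _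
  exact hm.meas_fy.comp (hx.prodMk (hy.prodMk (hD i)))

lemma StochasticModel.measurable_gradY_batch_g (hx : Measurable x) (hy : Measurable y)
    (hD : ∀ i, Measurable fun ω => D ω i) :
    Measurable fun ω => gradY (batch ghat (D ω)) (x ω) (y ω) := by
  simp_rw [gradY_batch hm.ghat_diff]
  refine Measurable.const_smul (Finset.measurable_sum _ fun i _ => ?_) _
  exact hm.meas_gy.comp (hx.prodMk (hy.prodMk (hD i)))

lemma StochasticModel.measurable_hessYY_batch_apply (hx : Measurable x) (hy : Measurable y)
    (hz : Measurable z) (hD : ∀ i, Measurable fun ω => D ω i) :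
    Measurable fun ω => hessYY (batch ghat (D ω)) (x ω) (y ω) (z ω) := by
  simp_rw [hessYY_batch hm.ghat_diff hm.ghat_diff2, smul_apply, sum_apply]
  refine Measurable.const_smul (Finset.measurable_sum _ fun i _ => ?_) _
  have h1 := hm.meas_gyy.comp (hx.prodMk (hy.prodMk (hD i)))
  have hc : Continuous fun q : (Y →L[ℝ] Y) × Y => q.1 q.2 := isBoundedBilinearMap_apply.continuous
  exact hc.measurable.comp (h1.prodMk hz)

lemma StochasticModel.measurable_hessXY_batch_apply (hx : Measurable x) (hy : Measurable y)
    (hz : Measurable z) (hD : ∀ i, Measurable fun ω => D ω i) :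
    Measurable fun ω => hessXY (batch ghat (D ω)) (x ω) (y ω) (z ω) := by
  simp_rw [hessXY_batch hm.ghat_diff hm.ghat_diff2, smul_apply, sum_apply]
  refine Measurable.const_smul (Finset.measurable_sum _ fun i _ => ?_) _
  have h1 := hm.meas_gxy.comp (hx.prodMk (hy.prodMk (hD i)))
  have hc : Continuous fun q : (Y →L[ℝ] X) × Y => q.1 q.2 := isBoundedBilinearMap_apply.continuous
  exact hc.measurable.comp (h1.prodMk hz)

lemma StochasticModel.measurable_innerY {D : Ω → ℕ → Fin n → Ξ} (α : ℝ) (hx : Measurable x)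
    (hy : Measurable y) (t : ℕ) (hD : ∀ s < t, ∀ i, Measurable fun ω => D ω s i) :
    Measurable fun ω => innerY ghat α (x ω) (D ω) (y ω) t := by
  induction t with
  | zero => exact hy
  | succ t ih =>
    have ih := ih fun s hs => hD s (hs.trans t.lt_succ_self)
    exact ih.sub ((hm.measurable_gradY_batch_g hx ih (hD t t.lt_succ_self)).const_smul α)

lemma StochasticModel.measurable_innerZ {D : Ω → ℕ → Fin n → Ξ} (β : ℝ) (hx : Measurable x)
    (hy : Measurable y) (hv : Measurable v) (hz : Measurable z) (t : ℕ)
    (hD : ∀ s < t, ∀ i, Measurable fun ω => D ω s i) :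
    Measurable fun ω => innerZ ghat β (x ω) (y ω) (v ω) (D ω) (z ω) t := by
  induction t with
  | zero => exact hz
  | succ t ih =>
    have ih := ih fun s hs => hD s (hs.trans t.lt_succ_self)
    exact ih.sub (((hm.measurable_hessYY_batch_apply hx hy ih (hD t t.lt_succ_self)).add
      hv).const_smul β)

end Measurability

/-! ### Moments of the batch noise on the probability space -/

section Transfer

variable {Ω α : Type*} [MeasurableSpace Ω] [MeasurableSpace α] {μ : Measure Ω} {ν : Measure α}
  {V : Ω → α}

lemma integrable_comp_of_map_eq {F : Type*} [NormedAddCommGroup F] (hV : Measurable V)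
    (hmap : μ.map V = ν) {φ : α → F} (hφ : Integrable φ ν) : Integrable (fun ω => φ (V ω)) μ := by
  subst hmap
  exact (integrable_map_measure hφ.aestronglyMeasurable hV.aemeasurable).mp hφ

lemma integral_comp_of_map_eq {F : Type*} [NormedAddCommGroup F] [NormedSpace ℝ F]
    (hV : Measurable V) (hmap : μ.map V = ν) {φ : α → F} (hφ : Integrable φ ν) :
    ∫ ω, φ (V ω) ∂μ = ∫ a, φ a ∂ν := by
  subst hmap
  exact (integral_map hV.aemeasurable hφ.aestronglyMeasurable).symm

variable {E G : Type*} [NormedAddCommGroup E] [InnerProductSpace ℝ E] [CompleteSpace E]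
  [NormedAddCommGroup G] [InnerProductSpace ℝ G] [CompleteSpace G] {A : α → E →L[ℝ] G}

lemma inner_adjoint_comp_self_apply (B : E →L[ℝ] G) (z : E) :
    inner ℝ z ((ContinuousLinearMap.adjoint B ∘L B) z) = ‖B z‖ ^ 2 := by
  rw [ContinuousLinearMap.comp_apply, ContinuousLinearMap.adjoint_inner_right,
    real_inner_self_eq_norm_sq]

lemma integrable_sq_norm_apply
    (hA : Integrable (fun a => ContinuousLinearMap.adjoint (A a) ∘L A a) ν) (z : E) :
    Integrable (fun a => ‖A a z‖ ^ 2) ν := by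
  simp_rw [← inner_adjoint_comp_self_apply]
  exact (hA.apply_continuousLinearMap z).const_inner z

/-- E‖Az‖² = ⟨z, E[AᵀA] z⟩. A bound on the operator norm of the second moment is thus a variance
bound proportional to ‖z‖²: the noise is multiplicative. -/
lemma integral_sq_norm_apply_le {s : ℝ}
    (hA : Integrable (fun a => ContinuousLinearMap.adjoint (A a) ∘L A a) ν)
    (hs : ‖∫ a, ContinuousLinearMap.adjoint (A a) ∘L A a ∂ν‖ ≤ s) (z : E) :
    ∫ a, ‖A a z‖ ^ 2 ∂ν ≤ s * ‖z‖ ^ 2 := by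
  simp_rw [← inner_adjoint_comp_self_apply]
  rw [integral_inner (hA.apply_continuousLinearMap z), ← ContinuousLinearMap.integral_apply hA]
  refine (real_inner_le_norm _ _).trans ?_
  have := ContinuousLinearMap.le_of_opNorm_le _ hs z
  nlinarith [norm_nonneg z]

end Transfer

/-- The noise samples are i.i.d. with law `P`, and independent of the starting point. -/
structure IsSampling {Ω Q Ξ : Type*} [MeasurableSpace Ω] [MeasurableSpace Q] [MeasurableSpace Ξ]
    (μ : Measure Ω) (P : Measure Ξ) (q₀ : Ω → Q) (ξ : SampleIdx → Ω → Ξ) : Prop where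
  meas : ∀ i, Measurable (ξ i)
  law : ∀ i, μ.map (ξ i) = P
  indep : iIndepFun ξ μ
  meas_start : Measurable q₀
  indep_start : IndepFun q₀ (fun ω i => ξ i ω) μ

namespace IsSampling

variable {Ω Q Ξ : Type*} [MeasurableSpace Ω] [MeasurableSpace Q] [MeasurableSpace Ξ]
  {μ : Measure Ω} [IsProbabilityMeasure μ] {P : Measure Ξ} {q₀ : Ω → Q} {ξ : SampleIdx → Ω → Ξ}
  (hs : IsSampling μ P q₀ ξ)
include hs

lemma indepFun {α β : Type*} [MeasurableSpace α] [MeasurableSpace β]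
    {S S' : Set (Option SampleIdx)} (hS : Disjoint S S') {U : Ω → α} {V : Ω → β}
    (hU : Measurable[observed q₀ ξ S] U) (hV : Measurable[observed q₀ ξ S'] V) :
    IndepFun U V μ :=
  indepFun_of_observed hs.meas_start hs.meas hs.indep hs.indep_start hS hU hV

lemma map_batch {n : ℕ} {e : Fin n → SampleIdx} (he : Function.Injective e) :
    μ.map (fun ω i => ξ (e i) ω) = Measure.pi fun _ => P :=
  AmIGO.map_batch he hs.meas hs.indep hs.law

lemma map_batch_g (k t n : ℕ) :
    μ.map (fun ω (i : Fin n) => ξ (.g k t i) ω) = Measure.pi fun _ => P :=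
  hs.map_batch fun i j h => by simpa [Fin.val_inj] using h

lemma map_batch_gyy (k t n : ℕ) :
    μ.map (fun ω (i : Fin n) => ξ (.gyy k t i) ω) = Measure.pi fun _ => P :=
  hs.map_batch fun i j h => by simpa [Fin.val_inj] using h

lemma map_batch_f (k n : ℕ) :
    μ.map (fun ω (i : Fin n) => ξ (.f k i) ω) = Measure.pi fun _ => P :=
  hs.map_batch fun i j h => by simpa [Fin.val_inj] using h

lemma map_batch_gxy (k n : ℕ) :
    μ.map (fun ω (i : Fin n) => ξ (.gxy k i) ω) = Measure.pi fun _ => P :=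
  hs.map_batch fun i j h => by simpa [Fin.val_inj] using h

lemma measurable_of_observed {α : Type*} [MeasurableSpace α] {S : Set (Option SampleIdx)}
    {U : Ω → α} (hU : Measurable[observed q₀ ξ S] U) : Measurable U :=
  hU.mono (observed_le hs.meas_start hs.meas S) le_rfl

end IsSampling

section BatchNoise

variable {X Y Ξ Ω : Type*}
  [NormedAddCommGroup X] [InnerProductSpace ℝ X] [CompleteSpace X] [FiniteDimensional ℝ X]
  [MeasurableSpace X] [BorelSpace X]
  [NormedAddCommGroup Y] [InnerProductSpace ℝ Y] [CompleteSpace Y] [FiniteDimensional ℝ Y]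
  [MeasurableSpace Y] [BorelSpace Y]
  [MeasurableSpace Ξ] [MeasurableSpace Ω] {μ : Measure Ω} [IsProbabilityMeasure μ]
  {p : Params} {f g : X → Y → ℝ} {fhat ghat : X → Y → Ξ → ℝ} {P : Measure Ξ}
  [IsProbabilityMeasure P] {n : ℕ} {V : Ω → Fin n → Ξ}

/-- A centred square-integrable random vector with second moment at most `s`. -/
structure IsNoise {F : Type*} [NormedAddCommGroup F] [NormedSpace ℝ F]
    (μ : Measure Ω) (W : Ω → F) (s : ℝ) : Prop where
  integrable : Integrable W μ
  mean : ∫ ω, W ω ∂μ = 0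
  integrable_sq : Integrable (fun ω => ‖W ω‖ ^ 2) μ
  sq_le : ∫ ω, ‖W ω‖ ^ 2 ∂μ ≤ s

lemma GradientNoise.isNoise_gy (hn : GradientNoise p f g fhat ghat P) (h1 : 1 ≤ n)
    (hV : Measurable V) (hmap : μ.map V = Measure.pi fun _ => P) (x : X) (y : Y) :
    IsNoise μ (fun ω => gradY (batch ghat (V ω)) x y - gradY g x y) (p.σg ^ 2 / n) := by
  have hi := hn.gy_int n h1 x y
  refine ⟨(integrable_comp_of_map_eq hV hmap hi).sub (integrable_const _), ?_,
    integrable_comp_of_map_eq hV hmap (hn.gy_var_int n h1 x y), ?_⟩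
  · rw [integral_sub (integrable_comp_of_map_eq hV hmap hi) (integrable_const _),
      integral_comp_of_map_eq hV hmap hi, hn.gy_mean n h1]
    simp
  · rw [integral_comp_of_map_eq hV hmap (hn.gy_var_int n h1 x y)]
    exact hn.gy_var n h1 x y

lemma GradientNoise.fx_integrable_and_mean (hn : GradientNoise p f g fhat ghat P) (h1 : 1 ≤ n)
    (hV : Measurable V) (hmap : μ.map V = Measure.pi fun _ => P) (x : X) (y : Y) :
    Integrable (fun ω => gradX (batch fhat (V ω)) x y - gradX f x y) μ ∧
      ∫ ω, (gradX (batch fhat (V ω)) x y - gradX f x y) ∂μ = 0 := by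
  have hi := hn.fx_int n h1 x y
  refine ⟨(integrable_comp_of_map_eq hV hmap hi).sub (integrable_const _), ?_⟩
  rw [integral_sub (integrable_comp_of_map_eq hV hmap hi) (integrable_const _),
      integral_comp_of_map_eq hV hmap hi, hn.fx_mean n h1]
  simp

lemma GradientNoise.fy_integrable_and_mean (hn : GradientNoise p f g fhat ghat P) (h1 : 1 ≤ n)
    (hV : Measurable V) (hmap : μ.map V = Measure.pi fun _ => P) (x : X) (y : Y) :
    Integrable (fun ω => gradY (batch fhat (V ω)) x y - gradY f x y) μ ∧
      ∫ ω, (gradY (batch fhat (V ω)) x y - gradY f x y) ∂μ = 0 := by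
  have hi := hn.fy_int n h1 x y
  refine ⟨(integrable_comp_of_map_eq hV hmap hi).sub (integrable_const _), ?_⟩
  rw [integral_sub (integrable_comp_of_map_eq hV hmap hi) (integrable_const _),
      integral_comp_of_map_eq hV hmap hi, hn.fy_mean n h1]
  simp

lemma GradientNoise.pair_sq_le (hn : GradientNoise p f g fhat ghat P) (h1 : 1 ≤ n)
    (hV : Measurable V) (hmap : μ.map V = Measure.pi fun _ => P) (x : X) (y : Y) :
    Integrable (fun ω => ‖gradX (batch fhat (V ω)) x y - gradX f x y‖ ^ 2
      + ‖gradY (batch fhat (V ω)) x y - gradY f x y‖ ^ 2) μ ∧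
    ∫ ω, (‖gradX (batch fhat (V ω)) x y - gradX f x y‖ ^ 2
      + ‖gradY (batch fhat (V ω)) x y - gradY f x y‖ ^ 2) ∂μ ≤ p.σf ^ 2 / n := by
  simp_rw [← pairNorm_sq]
  refine ⟨integrable_comp_of_map_eq hV hmap (hn.f_var_int n h1 x y), ?_⟩
  rw [integral_comp_of_map_eq hV hmap (hn.f_var_int n h1 x y)]
  exact hn.f_var n h1 x y

lemma HessianNoise.isNoise_xy (hn : HessianNoise p g ghat P) (h1 : 1 ≤ n)
    (hV : Measurable V) (hmap : μ.map V = Measure.pi fun _ => P) (x : X) (y z : Y) :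
    IsNoise μ (fun ω => F₁ g ghat x y (V ω) z) (p.σxy ^ 2 / n * ‖z‖ ^ 2) := by
  have hi := hn.xy_int n h1 x y
  have hsq := integrable_sq_norm_apply (hn.xy_sq_int n h1 x y) z
  refine ⟨integrable_comp_of_map_eq hV hmap (hi.apply_continuousLinearMap z), ?_,
    integrable_comp_of_map_eq hV hmap hsq, ?_⟩
  · rw [integral_comp_of_map_eq hV hmap (hi.apply_continuousLinearMap z),
      ← ContinuousLinearMap.integral_apply hi, hn.xy_mean n h1]
    rfl
  · rw [integral_comp_of_map_eq hV hmap hsq]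
    exact integral_sq_norm_apply_le (hn.xy_sq_int n h1 x y) (hn.xy_var n h1 x y) z

lemma HessianNoise.isNoise_yy (hn : HessianNoise p g ghat P) (h1 : 1 ≤ n)
    (hV : Measurable V) (hmap : μ.map V = Measure.pi fun _ => P) (x : X) (y z : Y) :
    IsNoise μ (fun ω => F₂ g ghat x y (V ω) z) (p.σyy ^ 2 / n * ‖z‖ ^ 2) := by
  have hi := hn.yy_int n h1 x y
  have hsq := integrable_sq_norm_apply (hn.yy_sq_int n h1 x y) z
  refine ⟨integrable_comp_of_map_eq hV hmap (hi.apply_continuousLinearMap z), ?_,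
    integrable_comp_of_map_eq hV hmap hsq, ?_⟩
  · rw [integral_comp_of_map_eq hV hmap (hi.apply_continuousLinearMap z),
      ← ContinuousLinearMap.integral_apply hi, hn.yy_mean n h1]
    rfl
  · rw [integral_comp_of_map_eq hV hmap hsq]
    exact integral_sq_norm_apply_le (hn.yy_sq_int n h1 x y) (hn.yy_var n h1 x y) z

end BatchNoise

end AmIGO

namespace AmIGO

namespace Params.Admissible

variable {p : Params} (hp : p.Admissible)
include hp

lemma α_mul_μg : p.α * p.μg = p.μg / p.Lg := by unfold Params.α; ring

lemma β_mul_μg : p.β * p.μg = p.μg / (2 * p.Lg) := by unfold Params.β; ring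

lemma varf_nonneg : 0 ≤ p.varf := by unfold Params.varf; positivity
lemma varg_nonneg : 0 ≤ p.varg := by unfold Params.varg; positivity
lemma varxy_nonneg : 0 ≤ p.varxy := by unfold Params.varxy; positivity
lemma varyy_nonneg : 0 ≤ p.varyy := by unfold Params.varyy; positivity

lemma μg_div_Lg_le : p.μg / p.Lg ≤ 1 := (div_le_one hp.Lg_pos).mpr hp.μg_le

lemma nyy_pos : 1 ≤ p.nyy := by
  have := (le_max_left _ _).trans hp.nyy_large
  exact_mod_cast this

/-- The only use of the lower bound on |D_yy|; it makes the multiplicative noise of the solver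
harmless. -/
lemma varyy_le : p.varyy ≤ p.μg * p.Lg := by
  have h1 := (le_max_right _ _).trans hp.nyy_large
  have h2 : (0 : ℝ) < p.nyy := by exact_mod_cast hp.nyy_pos
  have h3 := mul_pos hp.μg_pos hp.Lg_pos
  unfold Params.varyy
  rw [div_le_iff₀ h3] at h1
  rw [div_le_iff₀ h2]
  linarith

end Params.Admissible

/-! ### Error of the inner descent -/

section InnerDescent

variable {X Y Ξ Ω Q : Type*}
  [NormedAddCommGroup X] [InnerProductSpace ℝ X] [CompleteSpace X] [FiniteDimensional ℝ X]
  [MeasurableSpace X] [BorelSpace X]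
  [NormedAddCommGroup Y] [InnerProductSpace ℝ Y] [CompleteSpace Y] [FiniteDimensional ℝ Y]
  [MeasurableSpace Y] [BorelSpace Y]
  [MeasurableSpace Ξ] [MeasurableSpace Ω] [MeasurableSpace Q]
  {μ : Measure Ω} [IsProbabilityMeasure μ]
  {p : Params} {f g : X → Y → ℝ} {fhat ghat : X → Y → Ξ → ℝ} {P : Measure Ξ}
  [IsProbabilityMeasure P] {q₀ : Ω → Q} {ξ : SampleIdx → Ω → Ξ}

/-- Error of the stochastic gradient descent on `g x` from a deterministic point. -/
lemma integral_sq_norm_innerY_sub_le (hp : p.Admissible) (hr : RegularProblem p f g)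
    (hm : StochasticModel f g fhat ghat P) (hn : GradientNoise p f g fhat ghat P)
    (hs : IsSampling μ P q₀ ξ) (k T : ℕ) (x : X) (y : Y) :
    Integrable (fun ω => ‖innerY ghat p.α x (fun t (i : Fin p.ng) => ξ (.g k t i) ω) y T
      - yStar g x‖ ^ 2) μ ∧
    ∫ ω, ‖innerY ghat p.α x (fun t (i : Fin p.ng) => ξ (.g k t i) ω) y T - yStar g x‖ ^ 2 ∂μ
      ≤ ((1 - p.α * p.μg) ^ T) ^ 2 * ‖y - yStar g x‖ ^ 2 + p.varg / (p.μg * p.Lg) := by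
  have hμ := hp.μg_pos
  have hL := hp.Lg_pos
  have hv := hp.varg_nonneg
  induction T with
  | zero =>
    simp only [innerY]
    refine ⟨integrable_const _, ?_⟩
    simp
    positivity
  | succ T ih =>
    have hU : Measurable[observed q₀ ξ {o | ∃ s i, s < T ∧ o = some (SampleIdx.g k s i)}]
        (fun ω => innerY ghat p.α x (fun t (i : Fin p.ng) => ξ (.g k t i) ω) y T) :=
      hm.measurable_innerY p.α measurable_const measurable_const T fun s hs i =>
        measurable_sample_observed ⟨s, i, hs, rfl⟩
    have hV : Measurable[observed q₀ ξ {o | ∃ i, o = some (SampleIdx.g k T i)}]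
        (fun ω (i : Fin p.ng) => ξ (.g k T i) ω) :=
      measurable_batch_observed fun i => ⟨i, rfl⟩
    have hd : Disjoint {o | ∃ s i, s < T ∧ o = some (SampleIdx.g k s i)}
        {o | ∃ i, o = some (SampleIdx.g k T i)} := by
      rw [Set.disjoint_left]
      rintro _ ⟨s, i, hs, rfl⟩ ⟨j, hj⟩
      simp at hj
      omega
    have hUV := hs.indepFun hd hU hV
    have hU' := hs.measurable_of_observed hU
    have hV' := hs.measurable_of_observed hV
    have hφ : Measurable fun q : Y × (Fin p.ng → Ξ) =>
        ‖q.1 - p.α • gradY (batch ghat q.2) x q.1 - yStar g x‖ ^ 2 :=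
      (((measurable_fst.sub ((hm.measurable_gradY_batch_g measurable_const measurable_fst
        fun i => (measurable_pi_apply i).comp measurable_snd).const_smul p.α)).sub
          measurable_const).norm).pow_const 2
    have hstep : ∀ a : Y, Integrable (fun ω =>
          ‖a - p.α • gradY (batch ghat fun (i : Fin p.ng) => ξ (.g k T i) ω) x a - yStar g x‖ ^ 2) μ ∧
        ∫ ω, ‖a - p.α • gradY (batch ghat fun (i : Fin p.ng) => ξ (.g k T i) ω) x a - yStar g x‖ ^ 2 ∂μ
          ≤ (1 - p.α * p.μg) ^ 2 * ‖a - yStar g x‖ ^ 2 + p.α ^ 2 * p.varg := by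
      intro a
      have hno := hn.isNoise_gy hp.ng_pos hV' (hs.map_batch_g k T p.ng) x a
      have h1 := integral_sq_norm_add (a - p.α • gradY g x a - yStar g x)
        (hno.integrable.smul (-p.α)) (by
          simp_rw [Pi.smul_apply, norm_smul, mul_pow]
          exact hno.integrable_sq.const_mul _)
      simp only [Pi.smul_apply] at h1
      rw [integral_smul, hno.mean] at h1
      -- A noisy step is the exact step plus -α times the centred gradient noise, so its squared
      -- error is the exact one plus a variance.
      have e : ∀ ω, a - p.α • gradY g x a - yStar g x + -p.α •
          (gradY (batch ghat fun (i : Fin p.ng) => ξ (.g k T i) ω) x a - gradY g x a)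
          = a - p.α • gradY (batch ghat fun (i : Fin p.ng) => ξ (.g k T i) ω) x a - yStar g x := by
        intro ω; module
      simp_rw [e] at h1
      refine ⟨h1.1, h1.2.trans_le ?_⟩
      simp_rw [norm_smul, mul_pow]
      rw [integral_const_mul, smul_zero, inner_zero_right, mul_zero, add_zero, norm_neg,
        Real.norm_eq_abs, sq_abs]
      have h2 := norm_gradY_step_sub_le hp hr x a (yStar g x)
      rw [gradY_yStar hp hr, smul_zero, sub_zero] at h2
      have h3 : ‖a - p.α • gradY g x a - yStar g x‖ ^ 2
          ≤ ((1 - p.α * p.μg) * ‖a - yStar g x‖) ^ 2 := by gcongr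
      rw [mul_pow] at h3
      exact add_le_add h3 (mul_le_mul_of_nonneg_left hno.sq_le (sq_nonneg _))
    have key := integral_comp_indep_le hU' hV' hUV hφ (fun _ => by positivity)
      (H := fun a => (1 - p.α * p.μg) ^ 2 * ‖a - yStar g x‖ ^ 2 + p.α ^ 2 * p.varg)
      (fun a => (hstep a).1) (fun a => (hstep a).2)
      ((ih.1.const_mul _).add (integrable_const _))
    refine ⟨key.1, key.2.trans ?_⟩
    rw [integral_add (ih.1.const_mul _) (integrable_const _), integral_const_mul]
    simp only [integral_const, probReal_univ, smul_eq_mul, one_mul]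
    have h1 := mul_le_mul_of_nonneg_left ih.2 (sq_nonneg (1 - p.α * p.μg))
    -- The noise floor n = σ_g²/(μ_g L_g) does not increase under the recursion: with t = μ_g/L_g
    -- the new floor is (1 - t)² n + t n = (1 - t + t²) n.
    have h2 : (1 - p.α * p.μg) ^ 2 * (p.varg / (p.μg * p.Lg)) + p.α ^ 2 * p.varg
        ≤ p.varg / (p.μg * p.Lg) := by
      rw [hp.α_mul_μg]
      have h3 : p.varg / (p.μg * p.Lg) - ((1 - p.μg / p.Lg) ^ 2 * (p.varg / (p.μg * p.Lg))
          + p.α ^ 2 * p.varg) = p.varg / (p.μg * p.Lg) * (p.μg / p.Lg) * (1 - p.μg / p.Lg) := by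
        unfold Params.α
        field_simp
        ring
      have h4 : 0 ≤ p.varg / (p.μg * p.Lg) * (p.μg / p.Lg) * (1 - p.μg / p.Lg) :=
        mul_nonneg (by positivity) (by linarith [hp.μg_div_Lg_le])
      linarith
    have h5 : ((1 - p.α * p.μg) ^ (T + 1)) ^ 2
        = (1 - p.α * p.μg) ^ 2 * ((1 - p.α * p.μg) ^ T) ^ 2 := by ring
    rw [h5]
    refine (add_le_add_left h1 _).trans ?_
    linarith

end InnerDescent

end AmIGO

namespace AmIGO

namespace Params.Admissible

variable {p : Params} (hp : p.Admissible)
include hp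

lemma β_pos : 0 < p.β := by
  have := hp.Lg_pos
  unfold Params.β
  positivity

lemma β_mul_μg_pos : 0 < p.β * p.μg := mul_pos hp.β_pos hp.μg_pos

lemma β_mul_μg_le : p.β * p.μg ≤ 1 / 2 := by
  rw [hp.β_mul_μg, div_le_iff₀ (by linarith [hp.Lg_pos])]
  linarith [hp.μg_le]

lemma β_mul_Lg : p.β * p.Lg = 1 / 2 := by
  have := hp.Lg_pos
  unfold Params.β
  field_simp

lemma β_sq_mul_varyy_le : p.β ^ 2 * p.varyy ≤ p.β * p.μg / 2 := by
  have h1 := mul_le_mul_of_nonneg_left hp.varyy_le (sq_nonneg p.β)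
  have h2 : p.β ^ 2 * (p.μg * p.Lg) = p.β * p.μg / 2 := by
    have := hp.β_mul_Lg
    linear_combination (p.β * p.μg) * this
  linarith

/-- The Hessian noise adds β²σ_yy² to the contraction factor of second moments. With β = 1/(2L_g)
and σ_yy² ≤ μ_g L_g this is at most βμ_g/2, and half of the rate 2βμ_g survives because βμ_g ≤ 1/2.
-/
lemma contraction_sq_add_le : (1 - p.β * p.μg) ^ 2 + p.β ^ 2 * p.varyy ≤ 1 - p.β * p.μg := by
  have h1 := hp.β_sq_mul_varyy_le
  have h2 := hp.β_mul_μg_le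
  have h3 := hp.β_mul_μg_pos
  nlinarith

end Params.Admissible

/-- The mean of the iterates of the linear solver. -/
noncomputable def meanZ {X Y : Type*} [NormedAddCommGroup X] [InnerProductSpace ℝ X]
    [NormedAddCommGroup Y] [InnerProductSpace ℝ Y] [CompleteSpace Y]
    (g : X → Y → ℝ) (β : ℝ) (x : X) (y v z : Y) : ℕ → Y
  | 0 => z
  | t + 1 => meanZ g β x y v z t - β • (hessYY g x y (meanZ g β x y v z t) + v)

/-- Bound of the variance of the iterates of the linear solver. -/
noncomputable def spreadZ {X Y : Type*} [NormedAddCommGroup X] [InnerProductSpace ℝ X]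
    [NormedAddCommGroup Y] [InnerProductSpace ℝ Y] [CompleteSpace Y]
    (p : Params) (g : X → Y → ℝ) (x : X) (y v z : Y) : ℕ → ℝ
  | 0 => 0
  | t + 1 => (1 - p.β * p.μg) * spreadZ p g x y v z t
      + p.β ^ 2 * p.varyy * ‖meanZ g p.β x y v z t‖ ^ 2

/-! ### Mean and variance of the stochastic linear solver -/

section LinearSolver

variable {X Y Ξ Ω Q : Type*}
  [NormedAddCommGroup X] [InnerProductSpace ℝ X] [CompleteSpace X] [FiniteDimensional ℝ X]
  [MeasurableSpace X] [BorelSpace X]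
  [NormedAddCommGroup Y] [InnerProductSpace ℝ Y] [CompleteSpace Y] [FiniteDimensional ℝ Y]
  [MeasurableSpace Y] [BorelSpace Y]
  [MeasurableSpace Ξ] [MeasurableSpace Ω] [MeasurableSpace Q]
  {μ : Measure Ω} [IsProbabilityMeasure μ]
  {p : Params} {f g : X → Y → ℝ} {fhat ghat : X → Y → Ξ → ℝ} {P : Measure Ξ}
  [IsProbabilityMeasure P] {q₀ : Ω → Q} {ξ : SampleIdx → Ω → Ξ}

lemma IsNoise.integral_sq_norm_add_le {F : Type*} [NormedAddCommGroup F] [InnerProductSpace ℝ F]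
    [CompleteSpace F] {W : Ω → F} {s : ℝ} (hW : IsNoise μ W s) (w : F) (c : ℝ) :
    Integrable (fun ω => ‖w + c • W ω‖ ^ 2) μ ∧
      ∫ ω, ‖w + c • W ω‖ ^ 2 ∂μ ≤ ‖w‖ ^ 2 + c ^ 2 * s := by
  have h1 := integral_sq_norm_add w (hW.integrable.smul c) (by
    simp_rw [Pi.smul_apply, norm_smul, mul_pow]
    exact hW.integrable_sq.const_mul _)
  simp only [Pi.smul_apply] at h1
  rw [integral_smul, hW.mean] at h1
  refine ⟨h1.1, h1.2.trans_le ?_⟩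
  simp_rw [norm_smul, mul_pow]
  rw [integral_const_mul, smul_zero, inner_zero_right, mul_zero, add_zero, Real.norm_eq_abs, sq_abs]
  exact add_le_add_right (mul_le_mul_of_nonneg_left hW.sq_le (sq_nonneg _)) _

lemma spreadZ_nonneg (hp : p.Admissible) (x : X) (y v z : Y) (t : ℕ) :
    0 ≤ spreadZ p g x y v z t := by
  induction t with
  | zero => exact le_rfl
  | succ t ih =>
    have h1 := hp.β_mul_μg_le
    have h2 := hp.varyy_nonneg
    exact add_nonneg (mul_nonneg (by linarith) ih) (by positivity)

/-- Moments of the stochastic linear solver with deterministic data. -/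
lemma innerZ_moments (hp : p.Admissible) (hr : RegularProblem p f g)
    (hm : StochasticModel f g fhat ghat P) (hn : HessianNoise p g ghat P)
    (hs : IsSampling μ P q₀ ξ) (k : ℕ) (x : X) (y v z : Y) (N : ℕ) :
    IsNoise μ (fun ω => innerZ ghat p.β x y v (fun t (i : Fin p.nyy) => ξ (.gyy k t i) ω) z N
      - meanZ g p.β x y v z N) (spreadZ p g x y v z N) := by
  induction N with
  | zero =>
    constructor <;> simp [innerZ, meanZ, spreadZ]
  | succ N ih =>
    set Z := fun ω => innerZ ghat p.β x y v (fun t (i : Fin p.nyy) => ξ (.gyy k t i) ω) z N with hZ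
    set m := meanZ g p.β x y v z N with hmean
    have hU : Measurable[observed q₀ ξ {o | ∃ s i, s < N ∧ o = some (SampleIdx.gyy k s i)}] Z :=
      hm.measurable_innerZ p.β measurable_const measurable_const measurable_const
        measurable_const N fun s hs i => measurable_sample_observed ⟨s, i, hs, rfl⟩
    have hV : Measurable[observed q₀ ξ {o | ∃ i, o = some (SampleIdx.gyy k N i)}]
        (fun ω (i : Fin p.nyy) => ξ (.gyy k N i) ω) :=
      measurable_batch_observed fun i => ⟨i, rfl⟩
    have hd : Disjoint {o | ∃ s i, s < N ∧ o = some (SampleIdx.gyy k s i)}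
        {o | ∃ i, o = some (SampleIdx.gyy k N i)} := by
      rw [Set.disjoint_left]
      rintro _ ⟨s, i, hs, rfl⟩ ⟨j, hj⟩
      simp at hj
      omega
    have hUV := hs.indepFun hd hU hV
    have hU' := hs.measurable_of_observed hU
    have hV' := hs.measurable_of_observed hV
    have hψ : Measurable fun q : Y × (Fin p.nyy → Ξ) =>
        q.1 - p.β • (hessYY (batch ghat q.2) x y q.1 + v) - meanZ g p.β x y v z (N + 1) :=
      (measurable_fst.sub (((hm.measurable_hessYY_batch_apply measurable_const measurable_const
        measurable_fst fun i => (measurable_pi_apply i).comp measurable_snd).add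
          measurable_const).const_smul p.β)).sub measurable_const
    have hφ := hψ.norm.pow_const 2
    have hF : ∀ a, IsNoise μ (fun ω => F₂ g ghat x y (fun (i : Fin p.nyy) => ξ (.gyy k N i) ω) a)
        (p.varyy * ‖a‖ ^ 2) := fun a =>
      hn.isNoise_yy hp.nyy_pos hV' (hs.map_batch_gyy k N p.nyy) x y a
    -- The deviation from the mean is contracted, and the fresh noise acts on the iterate a itself,
    -- not on its deviation. This is why ‖m‖² feeds `spreadZ`.
    have e : ∀ a ω, a - p.β • (hessYY (batch ghat fun (i : Fin p.nyy) => ξ (.gyy k N i) ω) x y a + v)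
          - meanZ g p.β x y v z (N + 1)
        = (ContinuousLinearMap.id ℝ Y - p.β • hessYY g x y) (a - m)
          + (-p.β) • F₂ g ghat x y (fun (i : Fin p.nyy) => ξ (.gyy k N i) ω) a := by
      intro a ω
      simp only [meanZ, F₂, ← hmean, sub_apply, smul_apply, ContinuousLinearMap.id_apply, map_sub]
      module
    have hr1 : ‖ContinuousLinearMap.id ℝ Y - p.β • hessYY g x y‖ ≤ 1 - p.β * p.μg :=
      norm_one_sub_smul_hessYY_le hp hr hp.β_pos.le (by linarith [hp.β_mul_Lg]) x y
    have hstep : ∀ a : Y, Integrable (fun ω => ‖a - p.β • (hessYY (batch ghat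
          fun (i : Fin p.nyy) => ξ (.gyy k N i) ω) x y a + v) - meanZ g p.β x y v z (N + 1)‖ ^ 2) μ ∧
        ∫ ω, ‖a - p.β • (hessYY (batch ghat fun (i : Fin p.nyy) => ξ (.gyy k N i) ω) x y a + v)
          - meanZ g p.β x y v z (N + 1)‖ ^ 2 ∂μ
          ≤ (1 - p.β * p.μg) ^ 2 * ‖a - m‖ ^ 2 + p.β ^ 2 * p.varyy * ‖a‖ ^ 2 := by
      intro a
      simp_rw [e a]
      have h1 := (hF a).integral_sq_norm_add_le
        ((ContinuousLinearMap.id ℝ Y - p.β • hessYY g x y) (a - m)) (-p.β)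
      refine ⟨h1.1, h1.2.trans ?_⟩
      have h2 := ContinuousLinearMap.le_of_opNorm_le _ hr1 (a - m)
      have h3 : ‖(ContinuousLinearMap.id ℝ Y - p.β • hessYY g x y) (a - m)‖ ^ 2
          ≤ ((1 - p.β * p.μg) * ‖a - m‖) ^ 2 := by gcongr
      rw [mul_pow] at h3
      linarith
    have hZi : Integrable Z μ := by
      have h1 : Integrable (fun ω => (Z ω - m) + m) μ := ih.integrable.add (integrable_const m)
      simpa using h1
    -- The second moment of the iterate is ‖m‖² plus its variance; the variance part is absorbed by
    -- `contraction_sq_add_le`.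
    have hZ2 : Integrable (fun ω => ‖Z ω‖ ^ 2) μ ∧
        ∫ ω, ‖Z ω‖ ^ 2 ∂μ ≤ ‖m‖ ^ 2 + spreadZ p g x y v z N := by
      have := ih.integral_sq_norm_add_le m 1
      simpa [hZ] using this
    have key := integral_comp_indep_le hU' hV' hUV hφ (fun _ => by positivity)
      (H := fun a => (1 - p.β * p.μg) ^ 2 * ‖a - m‖ ^ 2 + p.β ^ 2 * p.varyy * ‖a‖ ^ 2)
      (fun a => (hstep a).1) (fun a => (hstep a).2)
      ((ih.integrable_sq.const_mul _).add (hZ2.1.const_mul _))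
    have hsq : Integrable (fun ω => ‖Z ω - p.β • (hessYY (batch ghat
        fun (i : Fin p.nyy) => ξ (.gyy k N i) ω) x y (Z ω) + v)
          - meanZ g p.β x y v z (N + 1)‖ ^ 2) μ := key.1
    have hint : Integrable (fun ω => Z ω - p.β • (hessYY (batch ghat
        fun (i : Fin p.nyy) => ξ (.gyy k N i) ω) x y (Z ω) + v) - meanZ g p.β x y v z (N + 1)) μ :=
      Integrable.of_sq_norm (hψ.comp (hU'.prodMk hV')).aestronglyMeasurable hsq
    refine ⟨hint, ?_, hsq, key.2.trans ?_⟩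
    -- The batch of this step is independent of the iterate that it multiplies, so the noise has
    -- zero conditional mean and the mean follows the exact iteration.
    · have h1 := integral_comp_indep_eq hU' hV' hUV hψ.stronglyMeasurable hint
      refine Eq.trans h1 ?_
      have h2 : ∀ a, ∫ ω, (a - p.β • (hessYY (batch ghat
          fun (i : Fin p.nyy) => ξ (.gyy k N i) ω) x y a + v) - meanZ g p.β x y v z (N + 1)) ∂μ
          = (ContinuousLinearMap.id ℝ Y - p.β • hessYY g x y) (a - m) := by
        intro a
        simp_rw [e a]
        have h3 : Integrable (fun ω => -p.β • F₂ g ghat x y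
            (fun (i : Fin p.nyy) => ξ (.gyy k N i) ω) a) μ := (hF a).integrable.smul _
        rw [integral_add (integrable_const _) h3, integral_smul, (hF a).mean]
        simp
      simp_rw [h2]
      rw [ContinuousLinearMap.integral_comp_comm _ ih.integrable, ih.mean, map_zero]
    · rw [integral_add (ih.integrable_sq.const_mul _) (hZ2.1.const_mul _), integral_const_mul,
        integral_const_mul, spreadZ]
      have h1 := mul_le_mul_of_nonneg_left ih.sq_le (sq_nonneg (1 - p.β * p.μg))
      have h2 := mul_le_mul_of_nonneg_left hZ2.2
        (mul_nonneg (sq_nonneg p.β) hp.varyy_nonneg)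
      have h3 := mul_le_mul_of_nonneg_right hp.contraction_sq_add_le
        (spreadZ_nonneg (g := g) hp x y v z N)
      rw [← hmean]
      linarith

end LinearSolver

end AmIGO

namespace AmIGO

/-! ### Dependence of the mean iterates on the starting point and the right-hand side -/

section MeanIteration

variable {X Y : Type*}
  [NormedAddCommGroup X] [InnerProductSpace ℝ X] [CompleteSpace X]
  [NormedAddCommGroup Y] [InnerProductSpace ℝ Y] [CompleteSpace Y] [FiniteDimensional ℝ Y]
  {p : Params} {f g : X → Y → ℝ}

lemma norm_one_sub_β_smul_hessYY_le (hp : p.Admissible) (hr : RegularProblem p f g) (x : X)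
    (y : Y) : ‖ContinuousLinearMap.id ℝ Y - p.β • hessYY g x y‖ ≤ 1 - p.β * p.μg :=
  norm_one_sub_smul_hessYY_le hp hr hp.β_pos.le (by linarith [hp.β_mul_Lg]) x y

/-- z* is the fixed point of the affine map that is iterated, whose linear part is a contraction. -/
lemma norm_meanZ_sub_zStar_le (hp : p.Admissible) (hr : RegularProblem p f g) (x : X) (y z : Y)
    (t : ℕ) : ‖meanZ g p.β x y (gradY f x y) z t - zStar f g x y‖
      ≤ (1 - p.β * p.μg) ^ t * ‖z - zStar f g x y‖ := by
  have h0 : 0 ≤ 1 - p.β * p.μg := by linarith [hp.β_mul_μg_le]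
  induction t with
  | zero => simp [meanZ]
  | succ t ih =>
    have e : meanZ g p.β x y (gradY f x y) z (t + 1) - zStar f g x y
        = (ContinuousLinearMap.id ℝ Y - p.β • hessYY g x y)
          (meanZ g p.β x y (gradY f x y) z t - zStar f g x y) := by
      have h1 : gradY f x y = - hessYY g x y (zStar f g x y) := by
        rw [hessYY_zStar hp hr, neg_neg]
      simp only [meanZ, sub_apply, smul_apply, ContinuousLinearMap.id_apply, map_sub]
      rw [hessYY_zStar hp hr]
      module
    rw [e]
    refine (ContinuousLinearMap.le_of_opNorm_le _ (norm_one_sub_β_smul_hessYY_le hp hr x y)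
      _).trans ?_
    refine (mul_le_mul_of_nonneg_left ih h0).trans_eq ?_
    ring

/-- The mean iterates depend affinely on the right-hand side of the linear system. -/
lemma exists_meanZ_sub_meanZ (hp : p.Admissible) (hr : RegularProblem p f g) (x : X) (y z : Y)
    (t : ℕ) : ∃ K : Y →L[ℝ] Y, ‖K‖ ≤ 1 / p.μg ∧
      ∀ v v', meanZ g p.β x y v z t - meanZ g p.β x y v' z t = K (v - v') := by
  have h0 : 0 ≤ 1 - p.β * p.μg := by linarith [hp.β_mul_μg_le]
  have hμ := hp.μg_pos
  induction t with
  | zero => exact ⟨0, by simp [hμ.le], fun v v' => by simp [meanZ]⟩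
  | succ t ih =>
    obtain ⟨K, hK, hKe⟩ := ih
    refine ⟨(ContinuousLinearMap.id ℝ Y - p.β • hessYY g x y) ∘L K
      - p.β • ContinuousLinearMap.id ℝ Y, ?_, fun v v' => ?_⟩
    · refine (norm_sub_le _ _).trans ?_
      have h1 := (ContinuousLinearMap.opNorm_comp_le
        (ContinuousLinearMap.id ℝ Y - p.β • hessYY g x y) K).trans
        (mul_le_mul (norm_one_sub_β_smul_hessYY_le hp hr x y) hK (norm_nonneg _) h0)
      have h2 : ‖p.β • ContinuousLinearMap.id ℝ Y‖ ≤ p.β * 1 := by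
        rw [norm_smul, Real.norm_of_nonneg hp.β_pos.le]
        exact mul_le_mul_of_nonneg_left ContinuousLinearMap.norm_id_le hp.β_pos.le
      -- The bound 1/μ_g is the fixed point of the recursion of the norms of K.
      have h3 : (1 - p.β * p.μg) * (1 / p.μg) + p.β * 1 = 1 / p.μg := by
        field_simp
        ring
      linarith
    · have h1 := hKe v v'
      have h2 : meanZ g p.β x y v z t = meanZ g p.β x y v' z t + K (v - v') := by rw [← h1]; abel
      simp only [meanZ, sub_apply, smul_apply, ContinuousLinearMap.id_apply,
        ContinuousLinearMap.comp_apply]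
      rw [h2, map_add]
      module

end MeanIteration

/-- Bound of the mean of `spreadZ` over the batch used in the linear system, where `d` bounds the
squared distance from the starting point to the solution. -/
noncomputable def Params.spreadBound (p : Params) (N : ℕ) (d : ℝ) : ℝ :=
  p.varyy / (p.μg * p.Lg) * ((p.B / p.μg) ^ 2 + p.varf / (2 * p.μg ^ 2))
    + 2 * (p.varyy / (p.μg * p.Lg)) * (1 - p.β * p.μg) ^ N * d

/-! ### Moments over the batch that supplies the right-hand side -/

section GradientEstimate

variable {X Y Ξ Ω Q : Type*}
  [NormedAddCommGroup X] [InnerProductSpace ℝ X] [CompleteSpace X] [FiniteDimensional ℝ X]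
  [MeasurableSpace X] [BorelSpace X]
  [NormedAddCommGroup Y] [InnerProductSpace ℝ Y] [CompleteSpace Y] [FiniteDimensional ℝ Y]
  [MeasurableSpace Y] [BorelSpace Y]
  [MeasurableSpace Ξ] [MeasurableSpace Ω] [MeasurableSpace Q]
  {μ : Measure Ω} [IsProbabilityMeasure μ]
  {p : Params} {f g : X → Y → ℝ} {fhat ghat : X → Y → Ξ → ℝ} {P : Measure Ξ}
  [IsProbabilityMeasure P] {q₀ : Ω → Q} {ξ : SampleIdx → Ω → Ξ}

lemma isNoise_apply_gradY_batch
    (hn : GradientNoise p f g fhat ghat P)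
    {V : Ω → Fin p.nf → Ξ} (h1 : 1 ≤ p.nf) (hV : Measurable V)
    (hmap : μ.map V = Measure.pi fun _ => P) (x : X) (y : Y) {K : Y →L[ℝ] Y} {c : ℝ}
    (hK : ‖K‖ ≤ c) :
    IsNoise μ (fun ω => K (gradY (batch fhat (V ω)) x y - gradY f x y)) (c ^ 2 * p.varf) := by
  obtain ⟨hi, hz⟩ := hn.fy_integrable_and_mean h1 hV hmap x y
  obtain ⟨hpi, hps⟩ := hn.pair_sq_le h1 hV hmap x y
  have hb : ∀ ω, ‖K (gradY (batch fhat (V ω)) x y - gradY f x y)‖ ^ 2 ≤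
      c ^ 2 * (‖gradX (batch fhat (V ω)) x y - gradX f x y‖ ^ 2
        + ‖gradY (batch fhat (V ω)) x y - gradY f x y‖ ^ 2) := by
    intro ω
    have h2 := ContinuousLinearMap.le_of_opNorm_le _ hK
      (gradY (batch fhat (V ω)) x y - gradY f x y)
    have h3 : ‖K (gradY (batch fhat (V ω)) x y - gradY f x y)‖ ^ 2
      ≤ (c * ‖gradY (batch fhat (V ω)) x y - gradY f x y‖) ^ 2 := by gcongr
    nlinarith [mul_nonneg (sq_nonneg c) (sq_nonneg ‖gradX (batch fhat (V ω)) x y - gradX f x y‖)]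
  have hKi := K.integrable_comp hi
  have hsq : Integrable (fun ω => ‖K (gradY (batch fhat (V ω)) x y - gradY f x y)‖ ^ 2) μ :=
    (hpi.const_mul (c ^ 2)).mono' (hKi.aestronglyMeasurable.norm.pow 2)
      (Filter.Eventually.of_forall fun ω => by
        rw [Real.norm_of_nonneg (by positivity)]; exact hb ω)
  refine ⟨hKi, ?_, hsq, ?_⟩
  · rw [ContinuousLinearMap.integral_comp_comm _ hi, hz, map_zero]
  · refine (integral_mono hsq (hpi.const_mul _) hb).trans ?_
    rw [integral_const_mul]
    exact mul_le_mul_of_nonneg_left hps (sq_nonneg c)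

lemma isNoise_add_apply_gradY_batch
    (hn : GradientNoise p f g fhat ghat P)
    {V : Ω → Fin p.nf → Ξ} (h1 : 1 ≤ p.nf) (hV : Measurable V)
    (hmap : μ.map V = Measure.pi fun _ => P) (x : X) (y : Y) {K : Y →L[ℝ] X} {c : ℝ}
    (hK : ‖K‖ ≤ c) :
    IsNoise μ (fun ω => (gradX (batch fhat (V ω)) x y - gradX f x y)
      + K (gradY (batch fhat (V ω)) x y - gradY f x y)) ((1 + c + c ^ 2) * p.varf) := by
  have hc : 0 ≤ c := (norm_nonneg _).trans hK
  obtain ⟨hix, hzx⟩ := hn.fx_integrable_and_mean h1 hV hmap x y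
  obtain ⟨hi, hz⟩ := hn.fy_integrable_and_mean h1 hV hmap x y
  obtain ⟨hpi, hps⟩ := hn.pair_sq_le h1 hV hmap x y
  have hb : ∀ ω, ‖(gradX (batch fhat (V ω)) x y - gradX f x y)
        + K (gradY (batch fhat (V ω)) x y - gradY f x y)‖ ^ 2 ≤
      (1 + c + c ^ 2) * (‖gradX (batch fhat (V ω)) x y - gradX f x y‖ ^ 2
        + ‖gradY (batch fhat (V ω)) x y - gradY f x y‖ ^ 2) := by
    intro ω
    have h2 := ContinuousLinearMap.le_of_opNorm_le _ hK
      (gradY (batch fhat (V ω)) x y - gradY f x y)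
    have h3 := (norm_add_le (gradX (batch fhat (V ω)) x y - gradX f x y)
      (K (gradY (batch fhat (V ω)) x y - gradY f x y))).trans (add_le_add_right h2 _)
    set a := ‖gradX (batch fhat (V ω)) x y - gradX f x y‖
    set b := ‖gradY (batch fhat (V ω)) x y - gradY f x y‖
    have h4 : ‖(gradX (batch fhat (V ω)) x y - gradX f x y)
        + K (gradY (batch fhat (V ω)) x y - gradY f x y)‖ ^ 2 ≤ (a + c * b) ^ 2 := by gcongr
    -- (a + cb)² ≤ (1 + c + c²)(a² + b²), from 2ab ≤ a² + b². Only the sum a² + b² has a known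
    -- bound, since the variance assumption concerns the full gradient of f.
    nlinarith [mul_nonneg hc (sq_nonneg (a - b)), sq_nonneg a, sq_nonneg b, sq_nonneg (c * a),
      mul_nonneg hc (sq_nonneg a), mul_nonneg hc (sq_nonneg b)]
  have hKi : Integrable (fun ω => K (gradY (batch fhat (V ω)) x y - gradY f x y)) μ :=
    K.integrable_comp hi
  have hsq : Integrable (fun ω => ‖(gradX (batch fhat (V ω)) x y - gradX f x y)
      + K (gradY (batch fhat (V ω)) x y - gradY f x y)‖ ^ 2) μ :=
    (hpi.const_mul (1 + c + c ^ 2)).mono' ((hix.add hKi).aestronglyMeasurable.norm.pow 2)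
      (Filter.Eventually.of_forall fun ω => by
        rw [Real.norm_of_nonneg (by positivity)]; exact hb ω)
  refine ⟨hix.add hKi, ?_, hsq, ?_⟩
  · rw [integral_add hix hKi, hzx, ContinuousLinearMap.integral_comp_comm _ hi, hz, map_zero,
      add_zero]
  · refine (integral_mono hsq (hpi.const_mul _) hb).trans ?_
    rw [integral_const_mul]
    exact mul_le_mul_of_nonneg_left hps (by positivity)

/-- The mean of the linear iterates over the batch used in the linear system. -/
lemma meanZ_batch_moments (hp : p.Admissible) (hr : RegularProblem p f g)
    (hn : GradientNoise p f g fhat ghat P)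
    {V : Ω → Fin p.nf → Ξ} (hV : Measurable V)
    (hmap : μ.map V = Measure.pi fun _ => P) (x : X) (y z : Y) (t : ℕ) :
    IsNoise μ (fun ω => meanZ g p.β x y (gradY (batch fhat (V ω)) x y) z t
      - meanZ g p.β x y (gradY f x y) z t) (p.varf / p.μg ^ 2) := by
  obtain ⟨K, hK, hKe⟩ := exists_meanZ_sub_meanZ hp hr x y z t
  simp_rw [hKe]
  have := isNoise_apply_gradY_batch hn hp.nf_pos hV hmap x y hK
  convert this using 1
  field_simp

lemma IsNoise.integral_sq_norm_le_of_sub {F : Type*} [NormedAddCommGroup F] [InnerProductSpace ℝ F]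
    [CompleteSpace F] {Z : Ω → F} {m : F} {s : ℝ} (hW : IsNoise μ (fun ω => Z ω - m) s) (w : F) :
    Integrable (fun ω => ‖Z ω - w‖ ^ 2) μ ∧ ∫ ω, ‖Z ω - w‖ ^ 2 ∂μ ≤ ‖m - w‖ ^ 2 + s := by
  have h := hW.integral_sq_norm_add_le (m - w) 1
  have e : ∀ ω, m - w + (1 : ℝ) • (Z ω - m) = Z ω - w := fun ω => by module
  simp_rw [e] at h
  simpa using h

lemma sq_norm_meanZ_le (hp : p.Admissible) (hr : RegularProblem p f g) (x : X) (y z : Y) (t : ℕ) :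
    ‖meanZ g p.β x y (gradY f x y) z t‖ ^ 2
      ≤ 2 * (p.B / p.μg) ^ 2 + 2 * ((1 - p.β * p.μg) ^ t) ^ 2 * ‖z - zStar f g x y‖ ^ 2 := by
  have h1 := norm_meanZ_sub_zStar_le hp hr x y z t
  have h2 := norm_zStar_le hp hr x y
  have h3 := norm_add_le (zStar f g x y)
    (meanZ g p.β x y (gradY f x y) z t - zStar f g x y)
  rw [add_sub_cancel] at h3
  have h4 : ‖meanZ g p.β x y (gradY f x y) z t‖ ^ 2
      ≤ (p.B / p.μg + (1 - p.β * p.μg) ^ t * ‖z - zStar f g x y‖) ^ 2 := by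
    have := h3.trans (add_le_add h2 h1)
    gcongr
  nlinarith [sq_nonneg (p.B / p.μg - (1 - p.β * p.μg) ^ t * ‖z - zStar f g x y‖)]

/-- The averaged variance contracts by r = 1 - βμ_g and is forced by a constant plus a transient of
order r^(2N) d. The forcing decays faster than the recursion, so the transient part of the solution
is of order r^N d, without a factor N. -/
lemma integral_spreadZ_le (hp : p.Admissible) (hr : RegularProblem p f g)
    (hn : GradientNoise p f g fhat ghat P)
    {V : Ω → Fin p.nf → Ξ} (hV : Measurable V)
    (hmap : μ.map V = Measure.pi fun _ => P) (x : X) (y z : Y) (N : ℕ) :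
    Integrable (fun ω => spreadZ p g x y (gradY (batch fhat (V ω)) x y) z N) μ ∧
      ∫ ω, spreadZ p g x y (gradY (batch fhat (V ω)) x y) z N ∂μ
        ≤ p.spreadBound N (‖z - zStar f g x y‖ ^ 2) := by
  have hr0 : 1 / 2 ≤ 1 - p.β * p.μg := by linarith [hp.β_mul_μg_le]
  have hr1 : 1 - p.β * p.μg ≤ 1 := by linarith [hp.β_mul_μg_pos]
  have hμ := hp.μg_pos
  have hL := hp.Lg_pos
  have hvy := hp.varyy_nonneg
  have hβτ : p.β ^ 2 * p.varyy = p.β * p.μg * (p.varyy / (p.μg * p.Lg)) / 2 := by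
    unfold Params.β
    field_simp
  set τ := p.varyy / (p.μg * p.Lg) with hτ
  have hτ0 : 0 ≤ τ := by positivity
  set r := 1 - p.β * p.μg with hrdef
  set d := ‖z - zStar f g x y‖ ^ 2 with hd
  have hd0 : 0 ≤ d := sq_nonneg _
  -- The stronger profile r^N (1 - r^N) vanishes at N = 0, as the variance does, and is preserved by
  -- the induction; the bound r^N alone would not be.
  suffices h : Integrable (fun ω => spreadZ p g x y (gradY (batch fhat (V ω)) x y) z N) μ ∧
      ∫ ω, spreadZ p g x y (gradY (batch fhat (V ω)) x y) z N ∂μ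
        ≤ τ * ((p.B / p.μg) ^ 2 + p.varf / (2 * p.μg ^ 2)) + 2 * τ * d * (r ^ N * (1 - r ^ N)) by
    refine ⟨h.1, h.2.trans ?_⟩
    unfold Params.spreadBound
    have h1 : 0 ≤ r ^ N := pow_nonneg (by linarith) _
    have h2 : 0 ≤ 2 * τ * d * (r ^ N * r ^ N) := by positivity
    rw [← hτ, ← hrdef]
    linarith
  induction N with
  | zero =>
    simp only [spreadZ]
    refine ⟨integrable_const _, ?_⟩
    have := hp.varf_nonneg
    simp
    positivity
  | succ N ih =>
    have h1 := meanZ_batch_moments hp hr hn hV hmap x y z N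
    have h2 := h1.integral_sq_norm_le_of_sub 0
    simp only [sub_zero] at h2
    simp only [spreadZ]
    refine ⟨(ih.1.const_mul _).add (h2.1.const_mul _), ?_⟩
    rw [integral_add (ih.1.const_mul _) (h2.1.const_mul _), integral_const_mul, integral_const_mul,
      hβτ, ← hrdef]
    have h3 := h2.2.trans (add_le_add_left (sq_norm_meanZ_le hp hr x y z N) _)
    rw [← hrdef, ← hd] at h3
    have hb0 := hp.β_mul_μg_pos
    have h4 := mul_le_mul_of_nonneg_left h3 (a := p.β * p.μg * τ / 2) (by positivity)
    have h5 := mul_le_mul_of_nonneg_left ih.2 (a := r) (by linarith)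
    refine (add_le_add h5 h4).trans ?_
    -- The slack of the induction step; it is nonnegative because r ≥ 1/2, which comes from β =
    -- 1/(2L_g).
    have h6 : 0 ≤ τ * d * (r ^ N) ^ 2 * (1 - r) * (2 * r - 1) := by
      have : 0 ≤ 1 - r := by linarith
      have : 0 ≤ 2 * r - 1 := by linarith
      positivity
    have hb : p.β * p.μg = 1 - r := by rw [hrdef]; ring
    rw [hb]
    have h7 : τ * ((p.B / p.μg) ^ 2 + p.varf / (2 * p.μg ^ 2))
          + 2 * τ * d * (r ^ (N + 1) * (1 - r ^ (N + 1)))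
        - (r * (τ * ((p.B / p.μg) ^ 2 + p.varf / (2 * p.μg ^ 2)) + 2 * τ * d * (r ^ N * (1 - r ^ N)))
          + (1 - r) * τ / 2 * (2 * (p.B / p.μg) ^ 2 + 2 * (r ^ N) ^ 2 * d + p.varf / p.μg ^ 2))
        = τ * d * (r ^ N) ^ 2 * (1 - r) * (2 * r - 1) := by
      rw [pow_succ]
      field_simp
      ring
    linarith

end GradientEstimate

end AmIGO

namespace AmIGO

section Samples

variable {Ω Ξ : Type*}

/-- The batches of the inner descent at iteration `k`. -/
abbrev samplesG (p : Params) (ξ : SampleIdx → Ω → Ξ) (k : ℕ) (ω : Ω) : ℕ → Fin p.ng → Ξ :=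
  fun t i => ξ (.g k t i) ω

/-- The batches of the linear solver at iteration `k`. -/
abbrev samplesYY (p : Params) (ξ : SampleIdx → Ω → Ξ) (k : ℕ) (ω : Ω) : ℕ → Fin p.nyy → Ξ :=
  fun t i => ξ (.gyy k t i) ω

/-- The batch of the gradient of `f` at iteration `k`. -/
abbrev samplesF (p : Params) (ξ : SampleIdx → Ω → Ξ) (k : ℕ) (ω : Ω) : Fin p.nf → Ξ :=
  fun i => ξ (.f k i) ω

/-- The batch of the mixed derivative at iteration `k`. -/
abbrev samplesXY (p : Params) (ξ : SampleIdx → Ω → Ξ) (k : ℕ) (ω : Ω) : Fin p.nxy → Ξ :=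
  fun i => ξ (.gxy k i) ω

end Samples

section Updates

variable {X Y Ξ : Type*}
  [NormedAddCommGroup X] [InnerProductSpace ℝ X] [CompleteSpace X]
  [NormedAddCommGroup Y] [InnerProductSpace ℝ Y] [CompleteSpace Y]

/-- The output of the linear solver. -/
noncomputable def zStep (p : Params) (N : ℕ) (fhat ghat : X → Y → Ξ → ℝ) (Df : Fin p.nf → Ξ)
    (Dyy : ℕ → Fin p.nyy → Ξ) (x : X) (y z : Y) : Y :=
  innerZ ghat p.β x y (gradY (batch fhat Df) x y) Dyy z N

/-- The stochastic estimate of the hypergradient. -/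
noncomputable def psiHat (p : Params) (N : ℕ) (fhat ghat : X → Y → Ξ → ℝ) (Df : Fin p.nf → Ξ)
    (Dyy : ℕ → Fin p.nyy → Ξ) (Dxy : Fin p.nxy → Ξ) (x : X) (y z : Y) : X :=
  gradX (batch fhat Df) x y + hessXY (batch ghat Dxy) x y (zStep p N fhat ghat Df Dyy x y z)

/-- The conditional mean of `psiHat`. -/
noncomputable def psiMean (p : Params) (N : ℕ) (f g : X → Y → ℝ) (x : X) (y z : Y) : X :=
  gradX f x y + hessXY g x y (meanZ g p.β x y (gradY f x y) z N)

end Updates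

/-! ### Conditional moments of the solver output and of the gradient estimate -/

section GradientEstimate

variable {X Y Ξ Ω Q : Type*}
  [NormedAddCommGroup X] [InnerProductSpace ℝ X] [CompleteSpace X] [FiniteDimensional ℝ X]
  [MeasurableSpace X] [BorelSpace X]
  [NormedAddCommGroup Y] [InnerProductSpace ℝ Y] [CompleteSpace Y] [FiniteDimensional ℝ Y]
  [MeasurableSpace Y] [BorelSpace Y]
  [MeasurableSpace Ξ] [MeasurableSpace Ω] [MeasurableSpace Q]
  {μ : Measure Ω} [IsProbabilityMeasure μ]
  {p : Params} {f g : X → Y → ℝ} {fhat ghat : X → Y → Ξ → ℝ} {P : Measure Ξ}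
  [IsProbabilityMeasure P] {q₀ : Ω → Q} {ξ : SampleIdx → Ω → Ξ}

lemma IsNoise.clm_apply {E F : Type*} [NormedAddCommGroup E] [InnerProductSpace ℝ E]
    [CompleteSpace E] [NormedAddCommGroup F] [InnerProductSpace ℝ F] [CompleteSpace F]
    {W : Ω → E} {s : ℝ} (hW : IsNoise μ W s) (M : E →L[ℝ] F) {c : ℝ} (hM : ‖M‖ ≤ c) :
    IsNoise μ (fun ω => M (W ω)) (c ^ 2 * s) := by
  have hi := M.integrable_comp hW.integrable
  have hb : ∀ ω, ‖M (W ω)‖ ^ 2 ≤ c ^ 2 * ‖W ω‖ ^ 2 := fun ω => by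
    rw [← mul_pow]
    have := ContinuousLinearMap.le_of_opNorm_le _ hM (W ω)
    gcongr
  have hsq : Integrable (fun ω => ‖M (W ω)‖ ^ 2) μ :=
    (hW.integrable_sq.const_mul (c ^ 2)).mono' (hi.aestronglyMeasurable.norm.pow 2)
      (Filter.Eventually.of_forall fun ω => by
        rw [Real.norm_of_nonneg (by positivity)]; exact hb ω)
  refine ⟨hi, ?_, hsq, ?_⟩
  · rw [ContinuousLinearMap.integral_comp_comm _ hW.integrable, hW.mean, map_zero]
  · refine (integral_mono hsq (hW.integrable_sq.const_mul _) hb).trans ?_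
    rw [integral_const_mul]
    exact mul_le_mul_of_nonneg_left hW.sq_le (sq_nonneg c)

lemma measurable_meanZ_batch (hp : p.Admissible) (hr : RegularProblem p f g)
    (hm : StochasticModel f g fhat ghat P) {n : ℕ} (x : X) (y z : Y) (t : ℕ) :
    Measurable fun a : Fin n → Ξ => meanZ g p.β x y (gradY (batch fhat a) x y) z t := by
  obtain ⟨K, -, hKe⟩ := exists_meanZ_sub_meanZ hp hr x y z t
  have e : (fun a : Fin n → Ξ => meanZ g p.β x y (gradY (batch fhat a) x y) z t)
      = fun a => meanZ g p.β x y 0 z t + K (gradY (batch fhat a) x y) := by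
    ext1 a
    have := hKe (gradY (batch fhat a) x y) 0
    rw [sub_zero] at this
    rw [← this]; abel
  rw [e]
  exact measurable_const.add (K.continuous.measurable.comp (hm.measurable_gradY_batch_f
    measurable_const measurable_const fun i => measurable_pi_apply i))

/-- Moments of affine images of the output of the linear solver. -/
lemma zStep_moments (hp : p.Admissible) (hr : RegularProblem p f g)
    (hm : StochasticModel f g fhat ghat P) (hn : GradientNoise p f g fhat ghat P)
    (hn2 : HessianNoise p g ghat P) (hs : IsSampling μ P q₀ ξ) (k N : ℕ) (x : X) (y z : Y)
    {F : Type*} [NormedAddCommGroup F] [InnerProductSpace ℝ F] [FiniteDimensional ℝ F]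
    [CompleteSpace F] [MeasurableSpace F] [BorelSpace F] {w : (Fin p.nf → Ξ) → F}
    (hw : Measurable w)
    (hw2 : Integrable (fun ω => ‖w (samplesF p ξ k ω)‖ ^ 2) μ) (M : Y →L[ℝ] F) {c : ℝ}
    (hM : ‖M‖ ≤ c) {R : Ω → F}
    (hR : ∀ ω, R ω = w (samplesF p ξ k ω)
      + M (zStep p N fhat ghat (samplesF p ξ k ω) (samplesYY p ξ k ω) x y z
        - meanZ g p.β x y (gradY (batch fhat (samplesF p ξ k ω)) x y) z N)) :
    Integrable R μ ∧ ∫ ω, R ω ∂μ = ∫ ω, w (samplesF p ξ k ω) ∂μ ∧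
      Integrable (fun ω => ‖R ω‖ ^ 2) μ ∧
      ∫ ω, ‖R ω‖ ^ 2 ∂μ ≤ ∫ ω, ‖w (samplesF p ξ k ω)‖ ^ 2 ∂μ
        + c ^ 2 * p.spreadBound N (‖z - zStar f g x y‖ ^ 2) := by
  have hc : 0 ≤ c := (norm_nonneg _).trans hM
  have hU : Measurable[observed q₀ ξ {o | ∃ i, o = some (SampleIdx.f k i)}] (samplesF p ξ k) :=
    measurable_batch_observed fun i => ⟨i, rfl⟩
  have hV : Measurable[observed q₀ ξ {o | ∃ t i, o = some (SampleIdx.gyy k t i)}]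
      (samplesYY p ξ k) :=
    @measurable_pi_lambda _ _ _ (observed q₀ ξ _) _ _ fun t =>
      measurable_batch_observed fun i => ⟨t, i, rfl⟩
  have hd : Disjoint {o | ∃ i, o = some (SampleIdx.f k i)}
      {o | ∃ t i, o = some (SampleIdx.gyy k t i)} := by
    rw [Set.disjoint_left]
    rintro _ ⟨i, rfl⟩ ⟨t, j, hj⟩
    simp at hj
  have hUV := hs.indepFun hd hU hV
  have hU' := hs.measurable_of_observed hU
  have hV' := hs.measurable_of_observed hV
  have hv : Measurable fun a : Fin p.nf → Ξ => gradY (batch fhat a) x y :=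
    hm.measurable_gradY_batch_f measurable_const measurable_const fun i => measurable_pi_apply i
  have hmz := measurable_meanZ_batch (n := p.nf) hp hr hm x y z N
  have hzs : Measurable fun q : (Fin p.nf → Ξ) × (ℕ → Fin p.nyy → Ξ) =>
      zStep p N fhat ghat q.1 q.2 x y z :=
    hm.measurable_innerZ p.β measurable_const measurable_const (hv.comp measurable_fst)
      measurable_const N fun s _ i =>
        (measurable_pi_apply i).comp ((measurable_pi_apply s).comp measurable_snd)
  have hψ : Measurable fun q : (Fin p.nf → Ξ) × (ℕ → Fin p.nyy → Ξ) =>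
      w q.1 + M (zStep p N fhat ghat q.1 q.2 x y z
        - meanZ g p.β x y (gradY (batch fhat q.1) x y) z N) :=
    (hw.comp measurable_fst).add (M.continuous.measurable.comp
      (hzs.sub (hmz.comp measurable_fst)))
  -- For a frozen batch of f, the deviation of the solver from its mean is a centred noise
  -- independent of that batch. The cross term vanishes and the variance `spreadZ` remains to be
  -- averaged over the batch.
  have hnoise : ∀ a : Fin p.nf → Ξ, IsNoise μ (fun ω => M (zStep p N fhat ghat a
      (samplesYY p ξ k ω) x y z - meanZ g p.β x y (gradY (batch fhat a) x y) z N))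
      (c ^ 2 * spreadZ p g x y (gradY (batch fhat a) x y) z N) := fun a =>
    (innerZ_moments hp hr hm hn2 hs k x y (gradY (batch fhat a) x y) z N).clm_apply M hM
  have hstep : ∀ a : Fin p.nf → Ξ, _ := fun a => (hnoise a).integral_sq_norm_add_le (w a) 1
  simp only [one_smul, one_pow, one_mul] at hstep
  obtain ⟨hsi, hsb⟩ := integral_spreadZ_le hp hr hn hU' (hs.map_batch_f k p.nf) x y z N
  have key := integral_comp_indep_le hU' hV' hUV (hψ.norm.pow_const 2) (fun _ => by positivity)
    (H := fun a => ‖w a‖ ^ 2 + c ^ 2 * spreadZ p g x y (gradY (batch fhat a) x y) z N)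
    (fun a => (hstep a).1) (fun a => (hstep a).2) (hw2.add (hsi.const_mul _))
  obtain rfl : R = _ := funext hR
  have hsq : Integrable (fun ω => ‖w (samplesF p ξ k ω)
      + M (zStep p N fhat ghat (samplesF p ξ k ω) (samplesYY p ξ k ω) x y z
        - meanZ g p.β x y (gradY (batch fhat (samplesF p ξ k ω)) x y) z N)‖ ^ 2) μ := key.1
  have hint : Integrable (fun ω => w (samplesF p ξ k ω)
      + M (zStep p N fhat ghat (samplesF p ξ k ω) (samplesYY p ξ k ω) x y z
        - meanZ g p.β x y (gradY (batch fhat (samplesF p ξ k ω)) x y) z N)) μ :=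
    Integrable.of_sq_norm (hψ.comp (hU'.prodMk hV')).aestronglyMeasurable hsq
  refine ⟨hint, ?_, hsq, key.2.trans ?_⟩
  · refine (integral_comp_indep_eq hU' hV' hUV hψ.stronglyMeasurable hint).trans ?_
    refine integral_congr_ae (Filter.Eventually.of_forall fun ω => ?_)
    dsimp only
    rw [integral_add (integrable_const _) (hnoise (samplesF p ξ k ω)).integrable,
      (hnoise (samplesF p ξ k ω)).mean]
    simp
  · rw [integral_add hw2 (hsi.const_mul _), integral_const_mul]
    exact add_le_add_right (mul_le_mul_of_nonneg_left hsb (sq_nonneg c)) _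

/-- Bound of the variance of the gradient estimate, where `d` bounds the squared distance of the
starting point of the linear solver to the solution. -/
noncomputable def Params.psiVar (p : Params) (N : ℕ) (d : ℝ) : ℝ :=
  (1 + p.Lg' / p.μg + (p.Lg' / p.μg) ^ 2) * p.varf + p.Lg' ^ 2 * p.spreadBound N d
    + p.varxy * (2 * (p.B / p.μg) ^ 2 + 2 * ((1 - p.β * p.μg) ^ N) ^ 2 * d
      + p.varf / p.μg ^ 2 + p.spreadBound N d)

/-- Bound of the error of the linear solver. -/
noncomputable def Params.zErr (p : Params) (N : ℕ) (d : ℝ) : ℝ :=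
  ((1 - p.β * p.μg) ^ N) ^ 2 * d + p.varf / p.μg ^ 2 + p.spreadBound N d

/-- The three terms are the exact mean iterate, the fluctuation of the right-hand side amplified by
at most 1/μ_g, and the Hessian noise. The point w is z* for the error and 0 for the second moment.
-/
lemma zStep_sub_moments (hp : p.Admissible) (hr : RegularProblem p f g)
    (hm : StochasticModel f g fhat ghat P) (hn : GradientNoise p f g fhat ghat P)
    (hn2 : HessianNoise p g ghat P) (hs : IsSampling μ P q₀ ξ) (k N : ℕ) (x : X) (y z w : Y) :
    Integrable (fun ω => ‖zStep p N fhat ghat (samplesF p ξ k ω) (samplesYY p ξ k ω) x y z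
      - w‖ ^ 2) μ ∧
    ∫ ω, ‖zStep p N fhat ghat (samplesF p ξ k ω) (samplesYY p ξ k ω) x y z - w‖ ^ 2 ∂μ
      ≤ ‖meanZ g p.β x y (gradY f x y) z N - w‖ ^ 2 + p.varf / p.μg ^ 2
        + p.spreadBound N (‖z - zStar f g x y‖ ^ 2) := by
  have hU : Measurable (samplesF p ξ k) := measurable_pi_lambda _ fun i => hs.meas _
  have hmz := meanZ_batch_moments hp hr hn hU (hs.map_batch_f k p.nf) x y z N
  obtain ⟨h1, h2⟩ := hmz.integral_sq_norm_le_of_sub w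
  have hw : Measurable fun a : Fin p.nf → Ξ =>
      meanZ g p.β x y (gradY (batch fhat a) x y) z N - w :=
    (measurable_meanZ_batch hp hr hm x y z N).sub measurable_const
  have key := zStep_moments hp hr hm hn hn2 hs k N x y z hw h1
    (ContinuousLinearMap.id ℝ Y) ContinuousLinearMap.norm_id_le
    (R := fun ω => zStep p N fhat ghat (samplesF p ξ k ω) (samplesYY p ξ k ω) x y z - w)
    (fun ω => by simp)
  refine ⟨key.2.2.1, key.2.2.2.trans ?_⟩
  linarith

lemma zStep_error (hp : p.Admissible) (hr : RegularProblem p f g)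
    (hm : StochasticModel f g fhat ghat P) (hn : GradientNoise p f g fhat ghat P)
    (hn2 : HessianNoise p g ghat P) (hs : IsSampling μ P q₀ ξ) (k N : ℕ) (x : X) (y z : Y) :
    Integrable (fun ω => ‖zStep p N fhat ghat (samplesF p ξ k ω) (samplesYY p ξ k ω) x y z
      - zStar f g x y‖ ^ 2) μ ∧
    ∫ ω, ‖zStep p N fhat ghat (samplesF p ξ k ω) (samplesYY p ξ k ω) x y z
      - zStar f g x y‖ ^ 2 ∂μ ≤ p.zErr N (‖z - zStar f g x y‖ ^ 2) := by
  obtain ⟨h1, h2⟩ := zStep_sub_moments hp hr hm hn hn2 hs k N x y z (zStar f g x y)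
  refine ⟨h1, h2.trans ?_⟩
  have h3 := norm_meanZ_sub_zStar_le hp hr x y z N
  have h4 : ‖meanZ g p.β x y (gradY f x y) z N - zStar f g x y‖ ^ 2
      ≤ ((1 - p.β * p.μg) ^ N * ‖z - zStar f g x y‖) ^ 2 := by gcongr
  rw [mul_pow] at h4
  unfold Params.zErr
  linarith

/-- The gradient estimate has mean `psiMean` and bounded variance. -/
lemma isNoise_psiHat (hp : p.Admissible) (hr : RegularProblem p f g)
    (hm : StochasticModel f g fhat ghat P) (hn : GradientNoise p f g fhat ghat P)
    (hn2 : HessianNoise p g ghat P) (hs : IsSampling μ P q₀ ξ) (k N : ℕ) (x : X) (y z : Y) :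
    IsNoise μ (fun ω => psiHat p N fhat ghat (samplesF p ξ k ω) (samplesYY p ξ k ω)
      (samplesXY p ξ k ω) x y z - psiMean p N f g x y z)
      (p.psiVar N (‖z - zStar f g x y‖ ^ 2)) := by
  have hDf : Measurable (samplesF p ξ k) := measurable_pi_lambda _ fun i => hs.meas _
  have hmapf := hs.map_batch_f k p.nf
  obtain ⟨K, hK, hKe⟩ := exists_meanZ_sub_meanZ hp hr x y z N
  have hv : Measurable fun a : Fin p.nf → Ξ => gradY (batch fhat a) x y :=
    hm.measurable_gradY_batch_f measurable_const measurable_const fun i => measurable_pi_apply i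
  have hGK : ‖(hessXY g x y) ∘L K‖ ≤ p.Lg' / p.μg := by
    refine (ContinuousLinearMap.opNorm_comp_le _ _).trans ?_
    rw [div_eq_mul_one_div]
    exact mul_le_mul (norm_hessXY_le hp hr x y) hK (norm_nonneg _) hp.Lg'_pos.le
  have hw : Measurable fun a : Fin p.nf → Ξ => (gradX (batch fhat a) x y - gradX f x y)
      + ((hessXY g x y) ∘L K) (gradY (batch fhat a) x y - gradY f x y) :=
    ((hm.measurable_gradX_batch measurable_const measurable_const
      fun i => measurable_pi_apply i).sub measurable_const).add
      (((hessXY g x y) ∘L K).continuous.measurable.comp (hv.sub measurable_const))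
  -- The noise of ∂ₓf and the response of the mean solver to the noise of ∂_y f share one batch and
  -- may be correlated, so they are bounded as one noise.
  have hwn := isNoise_add_apply_gradY_batch (μ := μ) hn hp.nf_pos hDf hmapf x y hGK
  have key := zStep_moments hp hr hm hn hn2 hs k N x y z hw hwn.integrable_sq
    (hessXY g x y) (norm_hessXY_le hp hr x y)
    (R := fun ω => (gradX (batch fhat (samplesF p ξ k ω)) x y - gradX f x y)
      + hessXY g x y (zStep p N fhat ghat (samplesF p ξ k ω) (samplesYY p ξ k ω) x y z
        - meanZ g p.β x y (gradY f x y) z N)) (fun ω => by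
      have h1 := hKe (gradY (batch fhat (samplesF p ξ k ω)) x y) (gradY f x y)
      rw [ContinuousLinearMap.comp_apply, ← h1]
      simp only [map_sub]
      abel)
  obtain ⟨hWi, hWm, hW2, hWs⟩ := key
  rw [hwn.mean] at hWm
  have hWs := hWs.trans (add_le_add_left hwn.sq_le _)
  -- The error of the estimate is W + F₁Z: W gathers the noise of D_f and D_yy, and F₁ is the fresh
  -- error of ∂_xy, which multiplies the solver output Z. Hence the second moment of Z, and not only
  -- its variance, enters below.
  set W := fun ω => (gradX (batch fhat (samplesF p ξ k ω)) x y - gradX f x y)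
      + hessXY g x y (zStep p N fhat ghat (samplesF p ξ k ω) (samplesYY p ξ k ω) x y z
        - meanZ g p.β x y (gradY f x y) z N) with hWdef
  set Z := fun ω => zStep p N fhat ghat (samplesF p ξ k ω) (samplesYY p ξ k ω) x y z with hZdef
  obtain ⟨hZ2, hZs⟩ := zStep_sub_moments hp hr hm hn hn2 hs k N x y z 0
  simp only [sub_zero] at hZ2 hZs
  have hS : Measurable[observed q₀ ξ {o | (∃ i, o = some (SampleIdx.f k i)) ∨
      ∃ t i, o = some (SampleIdx.gyy k t i)}] (fun ω => gradY (batch fhat (samplesF p ξ k ω)) x y) :=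
    hm.measurable_gradY_batch_f measurable_const measurable_const
      fun i => measurable_sample_observed (Or.inl ⟨i, rfl⟩)
  have hZm : Measurable[observed q₀ ξ {o | (∃ i, o = some (SampleIdx.f k i)) ∨
      ∃ t i, o = some (SampleIdx.gyy k t i)}] Z :=
    hm.measurable_innerZ p.β measurable_const measurable_const hS measurable_const N
      fun s _ i => measurable_sample_observed (Or.inr ⟨s, i, rfl⟩)
  have hWmeas : Measurable[observed q₀ ξ {o | (∃ i, o = some (SampleIdx.f k i)) ∨
      ∃ t i, o = some (SampleIdx.gyy k t i)}] W :=
    ((hm.measurable_gradX_batch measurable_const measurable_const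
      fun i => measurable_sample_observed (Or.inl ⟨i, rfl⟩)).sub measurable_const).add
      ((hessXY g x y).continuous.measurable.comp (hZm.sub measurable_const))
  have hU := hWmeas.prodMk hZm
  have hV : Measurable[observed q₀ ξ {o | ∃ i, o = some (SampleIdx.gxy k i)}] (samplesXY p ξ k) :=
    measurable_batch_observed fun i => ⟨i, rfl⟩
  have hd : Disjoint {o | (∃ i, o = some (SampleIdx.f k i)) ∨
      ∃ t i, o = some (SampleIdx.gyy k t i)} {o | ∃ i, o = some (SampleIdx.gxy k i)} := by
    rw [Set.disjoint_left]
    rintro _ (⟨i, rfl⟩ | ⟨t, i, rfl⟩) ⟨j, hj⟩ <;> simp at hj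
  have hUV := hs.indepFun hd hU hV
  have hU' := hs.measurable_of_observed hU
  have hV' := hs.measurable_of_observed hV
  have hψ : Measurable fun q : (X × Y) × (Fin p.nxy → Ξ) => q.1.1 + F₁ g ghat x y q.2 q.1.2 := by
    simp only [F₁, sub_apply]
    exact (measurable_fst.comp measurable_fst).add ((hm.measurable_hessXY_batch_apply
      measurable_const measurable_const (measurable_snd.comp measurable_fst)
      fun i => (measurable_pi_apply i).comp measurable_snd).sub
        ((hessXY g x y).continuous.measurable.comp (measurable_snd.comp measurable_fst)))
  have hF : ∀ a, IsNoise μ (fun ω => F₁ g ghat x y (samplesXY p ξ k ω) a)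
      (p.varxy * ‖a‖ ^ 2) := fun a =>
    hn2.isNoise_xy hp.nxy_pos hV' (hs.map_batch_gxy k p.nxy) x y a
  have hstep : ∀ a : X × Y, _ := fun a => (hF a.2).integral_sq_norm_add_le a.1 1
  simp only [one_smul, one_pow, one_mul] at hstep
  have kk := integral_comp_indep_le hU' hV' hUV (hψ.norm.pow_const 2) (fun _ => by positivity)
    (H := fun a => ‖a.1‖ ^ 2 + p.varxy * ‖a.2‖ ^ 2)
    (fun a => (hstep a).1) (fun a => (hstep a).2) (hW2.add (hZ2.const_mul _))
  have hsq : Integrable (fun ω => ‖W ω + F₁ g ghat x y (samplesXY p ξ k ω) (Z ω)‖ ^ 2) μ := kk.1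
  have hint : Integrable (fun ω => W ω + F₁ g ghat x y (samplesXY p ξ k ω) (Z ω)) μ :=
    Integrable.of_sq_norm (hψ.comp (hU'.prodMk hV')).aestronglyMeasurable hsq
  have e : (fun ω => psiHat p N fhat ghat (samplesF p ξ k ω) (samplesYY p ξ k ω)
      (samplesXY p ξ k ω) x y z - psiMean p N f g x y z)
      = fun ω => W ω + F₁ g ghat x y (samplesXY p ξ k ω) (Z ω) := by
    ext1 ω
    simp only [psiHat, psiMean, hWdef, hZdef, F₁, sub_apply, map_sub]
    abel
  rw [e]
  refine ⟨hint, ?_, hsq, kk.2.trans ?_⟩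
  · refine (integral_comp_indep_eq hU' hV' hUV hψ.stronglyMeasurable hint).trans ?_
    rw [← hWm]
    refine integral_congr_ae (Filter.Eventually.of_forall fun ω => ?_)
    dsimp only
    rw [integral_add (integrable_const _) (hF (Z ω)).integrable, (hF (Z ω)).mean,
      integral_const, probReal_univ, one_smul, add_zero]
  · rw [integral_add hW2 (hZ2.const_mul _), integral_const_mul]
    have h1 := hZs.trans (add_le_add_left (add_le_add_left (sq_norm_meanZ_le hp hr x y z N) _) _)
    have h2 := mul_le_mul_of_nonneg_left h1 hp.varxy_nonneg
    unfold Params.psiVar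
    linarith

end GradientEstimate

end AmIGO

namespace AmIGO

/-! ### Bias of the gradient estimate, and square integrability -/

section RegularityMeasurability

variable {X Y : Type*}
  [NormedAddCommGroup X] [InnerProductSpace ℝ X] [CompleteSpace X] [FiniteDimensional ℝ X]
  [MeasurableSpace X] [BorelSpace X]
  [NormedAddCommGroup Y] [InnerProductSpace ℝ Y] [CompleteSpace Y] [FiniteDimensional ℝ Y]
  [MeasurableSpace Y] [BorelSpace Y]
  {p : Params} {f g : X → Y → ℝ} (hp : p.Admissible) (hr : RegularProblem p f g)
include hp hr

lemma continuous_zStar : Continuous fun q : X × Y => zStar f g q.1 q.2 :=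
  continuous_of_norm_sub_le_pairNorm fun x x' y y' => norm_zStar_sub_le hp hr x x' y y'

lemma continuous_hyperGrad : Continuous fun q : X × Y => hyperGrad f g q.1 q.2 :=
  continuous_of_norm_sub_le_pairNorm fun x x' y y' => norm_hyperGrad_sub_le hp hr x x' y y'

lemma continuous_gradient_outer : Continuous fun x => gradient (outer f g) x := by
  simp_rw [gradient_outer hp hr]
  exact (continuous_hyperGrad hp hr).comp (continuous_id.prodMk (continuous_yStar hp hr))

lemma continuous_outer : Continuous (outer f g) :=
  continuous_iff_continuousAt.mpr fun x =>
    (hasGradientAt_outer hp hr x).differentiableAt.continuousAt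

lemma continuous_meanZ (t : ℕ) :
    Continuous fun q : X × Y × Y => meanZ g p.β q.1 q.2.1 (gradY f q.1 q.2.1) q.2.2 t := by
  have hA : Continuous fun q : X × Y => hessYY g q.1 q.2 :=
    continuous_of_norm_sub_le_pairNorm hr.g_yy_lip
  have hb : Continuous fun q : X × Y => gradY f q.1 q.2 :=
    continuous_of_norm_sub_le_pairNorm fun x x' y y' =>
      (norm_snd_le_pairNorm _ _).trans (hr.f_lip x x' y y')
  have hfst : Continuous fun q : X × Y × Y => (q.1, q.2.1) := by fun_prop
  induction t with
  | zero => exact continuous_snd.comp continuous_snd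
  | succ t ih =>
    simp only [meanZ]
    exact ih.sub ((((hA.comp hfst).clm_apply ih).add (hb.comp hfst)).const_smul p.β)

lemma continuous_psiMean (N : ℕ) :
    Continuous fun q : X × Y × Y => psiMean p N f g q.1 q.2.1 q.2.2 := by
  have hG : Continuous fun q : X × Y => hessXY g q.1 q.2 :=
    continuous_of_norm_sub_le_pairNorm hr.g_xy_lip
  have hb : Continuous fun q : X × Y => gradX f q.1 q.2 :=
    continuous_of_norm_sub_le_pairNorm fun x x' y y' =>
      (norm_fst_le_pairNorm _ _).trans (hr.f_lip x x' y y')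
  have hfst : Continuous fun q : X × Y × Y => (q.1, q.2.1) := by fun_prop
  exact (hb.comp hfst).add ((hG.comp hfst).clm_apply (continuous_meanZ hp hr N))

lemma norm_psiMean_sub_hyperGrad_le (N : ℕ) (x : X) (y z : Y) :
    ‖psiMean p N f g x y z - hyperGrad f g x y‖
      ≤ p.Lg' * ((1 - p.β * p.μg) ^ N * ‖z - zStar f g x y‖) := by
  have e : psiMean p N f g x y z - hyperGrad f g x y
      = hessXY g x y (meanZ g p.β x y (gradY f x y) z N - zStar f g x y) := by
    simp only [psiMean, hyperGrad, map_sub]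
    abel
  rw [e]
  exact (ContinuousLinearMap.le_of_opNorm_le _ (norm_hessXY_le hp hr x y) _).trans
    (mul_le_mul_of_nonneg_left (norm_meanZ_sub_zStar_le hp hr x y z N) hp.Lg'_pos.le)

/-- The bias of the gradient estimate. -/
lemma sq_norm_psiMean_sub_gradient_le (N : ℕ) (x : X) (y z : Y) :
    ‖psiMean p N f g x y z - gradient (outer f g) x‖ ^ 2
      ≤ 2 * p.Lψ ^ 2 * ‖y - yStar g x‖ ^ 2
        + 2 * p.Lψ ^ 2 * ((1 - p.β * p.μg) ^ N) ^ 2 * ‖z - zStar f g x y‖ ^ 2 := by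
  have h1 := norm_psiMean_sub_hyperGrad_le hp hr N x y z
  have h2 := norm_hyperGrad_sub_gradient_outer_le hp hr x y
  have h3 := norm_sub_le_norm_sub_add_norm_sub (psiMean p N f g x y z) (hyperGrad f g x y)
    (gradient (outer f g) x)
  have h0 : 0 ≤ (1 - p.β * p.μg) ^ N := pow_nonneg (by linarith [hp.β_mul_μg_le]) _
  have h4 : p.Lg' ≤ p.Lψ := le_max_right _ _
  have h5 : p.Lg' * ((1 - p.β * p.μg) ^ N * ‖z - zStar f g x y‖)
      ≤ p.Lψ * ((1 - p.β * p.μg) ^ N * ‖z - zStar f g x y‖) :=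
    mul_le_mul_of_nonneg_right h4 (by positivity)
  have h6 : ‖psiMean p N f g x y z - gradient (outer f g) x‖ ^ 2
      ≤ (p.Lψ * ((1 - p.β * p.μg) ^ N * ‖z - zStar f g x y‖) + p.Lψ * ‖y - yStar g x‖) ^ 2 := by
    have : ‖psiMean p N f g x y z - gradient (outer f g) x‖
      ≤ p.Lψ * ((1 - p.β * p.μg) ^ N * ‖z - zStar f g x y‖) + p.Lψ * ‖y - yStar g x‖ := by linarith
    gcongr
  nlinarith [sq_nonneg (p.Lψ * ((1 - p.β * p.μg) ^ N * ‖z - zStar f g x y‖)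
    - p.Lψ * ‖y - yStar g x‖)]

/-- The descent lemma between 0 and x, used in both directions. Quadratic growth makes ℒ integrable
at square-integrable points. -/
lemma abs_outer_le (x : X) : |outer f g x| ≤ |outer f g 0|
    + ‖gradient (outer f g) 0‖ * ‖x‖ + 3 / 2 * p.L * ‖x‖ ^ 2 := by
  have hG := hasGradientAt_outer_gradient hp hr
  have hl := norm_gradient_outer_sub_le hp hr
  have h1 := le_quadratic_of_lipschitz_gradient hG hl 0 x
  have h2 := le_quadratic_of_lipschitz_gradient hG hl x 0
  have h3 := hl x 0
  have hL := hp.L_pos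
  simp only [sub_zero, zero_sub, inner_neg_right, norm_neg] at h1 h2 h3
  have h4 := real_inner_le_norm (gradient (outer f g) 0) x
  have h5 := real_inner_le_norm (gradient (outer f g) x) x
  have h6 := norm_sub_norm_le (gradient (outer f g) x) (gradient (outer f g) 0)
  have h7 : ‖gradient (outer f g) x‖ * ‖x‖ ≤ (‖gradient (outer f g) 0‖ + p.L * ‖x‖) * ‖x‖ :=
    mul_le_mul_of_nonneg_right (by linarith) (norm_nonneg _)
  have h8 := le_abs_self (outer f g 0)
  have h9 := neg_abs_le (outer f g 0)
  have h10 := sq_nonneg ‖x‖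
  have h11 : 0 ≤ p.L * ‖x‖ ^ 2 := by positivity
  have h12 := abs_nonneg (outer f g 0)
  rw [abs_le]
  constructor
  · have h13 := abs_real_inner_le_norm (gradient (outer f g) x) x
    have h14 := neg_abs_le (inner ℝ (gradient (outer f g) x) x)
    nlinarith
  · nlinarith

end RegularityMeasurability

section SquareIntegrable

variable {Ω : Type*} [MeasurableSpace Ω] {μ : Measure Ω} [IsProbabilityMeasure μ]
  {F : Type*} [NormedAddCommGroup F]

lemma _root_.MeasureTheory.MemLp.integrable_norm_sq {V : Ω → F} (h : MemLp V 2 μ) :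
    Integrable (fun ω => ‖V ω‖ ^ 2) μ :=
  (memLp_two_iff_integrable_sq_norm h.aestronglyMeasurable).mp h

variable {X Y : Type*}
  [NormedAddCommGroup X] [InnerProductSpace ℝ X] [CompleteSpace X] [FiniteDimensional ℝ X]
  [MeasurableSpace X] [BorelSpace X]
  [NormedAddCommGroup Y] [InnerProductSpace ℝ Y] [CompleteSpace Y] [FiniteDimensional ℝ Y]
  [MeasurableSpace Y] [BorelSpace Y]
  {p : Params} {f g : X → Y → ℝ} (hp : p.Admissible) (hr : RegularProblem p f g)
  {x : Ω → X} {y z : Ω → Y}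

lemma memLp_two_of_lipschitz {G : Type*} [NormedAddCommGroup G] {φ : X → G} {c : ℝ}
    (hφ : Continuous φ) (hl : ∀ x x', ‖φ x - φ x'‖ ≤ c * ‖x - x'‖) (hx : MemLp x 2 μ) :
    MemLp (fun ω => φ (x ω)) 2 μ := by
  have h1 : MemLp (fun ω => φ (x ω) - φ 0) 2 μ := by
    refine MemLp.of_le_mul (c := c) hx ?_ (Filter.Eventually.of_forall fun ω => ?_)
    · exact (hφ.comp_aestronglyMeasurable hx.aestronglyMeasurable).sub aestronglyMeasurable_const
    · simpa using hl (x ω) 0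
  have h2 : MemLp (fun ω => (φ (x ω) - φ 0) + φ 0) 2 μ := h1.add (memLp_const (φ 0))
  simpa using h2

include hp hr

lemma memLp_yStar (hx : MemLp x 2 μ) : MemLp (fun ω => yStar g (x ω)) 2 μ :=
  memLp_two_of_lipschitz (continuous_yStar hp hr) (norm_yStar_sub_le hp hr) hx

lemma memLp_gradient_outer (hx : MemLp x 2 μ) :
    MemLp (fun ω => gradient (outer f g) (x ω)) 2 μ :=
  memLp_two_of_lipschitz (continuous_gradient_outer hp hr) (norm_gradient_outer_sub_le hp hr) hx

lemma memLp_zStar (hx : Measurable x) (hy : Measurable y) :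
    MemLp (fun ω => zStar f g (x ω) (y ω)) 2 μ :=
  MemLp.of_bound ((continuous_zStar hp hr).measurable.comp (hx.prodMk hy)).aestronglyMeasurable
    (p.B / p.μg) (Filter.Eventually.of_forall fun _ => norm_zStar_le hp hr _ _)

/-- Square integrability is read off the bias bound: the conditional mean differs from the
square-integrable ∇ℒ(x) by an error controlled by y - y*(x) and z - z*(x, y). -/
lemma memLp_psiMean (N : ℕ) (hx : Measurable x) (hy : Measurable y) (hz : Measurable z)
    (hx2 : MemLp x 2 μ) (hy2 : MemLp y 2 μ) (hz2 : MemLp z 2 μ) :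
    MemLp (fun ω => psiMean p N f g (x ω) (y ω) (z ω)) 2 μ := by
  have hm : Measurable fun ω => psiMean p N f g (x ω) (y ω) (z ω) :=
    (continuous_psiMean hp hr N).measurable.comp (hx.prodMk (hy.prodMk hz))
  have h1 : MemLp (fun ω => psiMean p N f g (x ω) (y ω) (z ω) - gradient (outer f g) (x ω)) 2 μ := by
    have hm2 : Measurable fun ω => psiMean p N f g (x ω) (y ω) (z ω) - gradient (outer f g) (x ω) :=
      hm.sub ((continuous_gradient_outer hp hr).measurable.comp hx)
    rw [memLp_two_iff_integrable_sq_norm hm2.aestronglyMeasurable]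
    refine (((hy2.sub (memLp_yStar hp hr hx2)).integrable_norm_sq.const_mul (2 * p.Lψ ^ 2)).add
      ((hz2.sub (memLp_zStar hp hr hx hy)).integrable_norm_sq.const_mul
        (2 * p.Lψ ^ 2 * ((1 - p.β * p.μg) ^ N) ^ 2))).mono'
      (hm2.norm.pow_const 2).aestronglyMeasurable (Filter.Eventually.of_forall fun ω => ?_)
    rw [Real.norm_of_nonneg (by positivity)]
    exact sq_norm_psiMean_sub_gradient_le hp hr N (x ω) (y ω) (z ω)
  have h2 : MemLp (fun ω => (psiMean p N f g (x ω) (y ω) (z ω) - gradient (outer f g) (x ω))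
      + gradient (outer f g) (x ω)) 2 μ := h1.add (memLp_gradient_outer hp hr hx2)
  simpa using h2

lemma integrable_outer (hx : MemLp x 2 μ) : Integrable (fun ω => outer f g (x ω)) μ := by
  have h1 : Integrable (fun ω => |outer f g 0| + ‖gradient (outer f g) 0‖ * ‖x ω‖
      + 3 / 2 * p.L * ‖x ω‖ ^ 2) μ :=
    ((integrable_const _).add ((hx.integrable one_le_two).norm.const_mul _)).add
      (hx.integrable_norm_sq.const_mul _)
  exact h1.mono' ((continuous_outer hp hr).comp_aestronglyMeasurable hx.aestronglyMeasurable)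
    (Filter.Eventually.of_forall fun ω => abs_outer_le hp hr (x ω))

end SquareIntegrable

end AmIGO

namespace AmIGO

/-! ### Noise floors of the solver and of the gradient estimate -/

namespace Params

variable {p : Params}

/-- The part of the error of the linear solver that is due to the noise. -/
noncomputable def zNoise (p : Params) : ℝ :=
  3 / 2 * (p.varf / p.μg ^ 2) + p.varyy / (p.μg * p.Lg) * (p.B / p.μg) ^ 2

/-- The variance of the gradient estimate, for an exact warm start of the linear solver. -/
noncomputable def psiNoise (p : Params) : ℝ :=
  (1 + p.Lg' / p.μg + 3 / 2 * (p.Lg' / p.μg) ^ 2) * p.varf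
    + p.Lg' ^ 2 * (p.varyy / (p.μg * p.Lg) * (p.B / p.μg) ^ 2)
    + p.varxy * (2 * (p.B / p.μg) ^ 2 + p.zNoise)

namespace Admissible

variable (hp : p.Admissible)
include hp

lemma one_sub_β_pow_mem (N : ℕ) : 0 ≤ (1 - p.β * p.μg) ^ N ∧ (1 - p.β * p.μg) ^ N ≤ 1 := by
  have h1 := hp.β_mul_μg_le
  have h2 := hp.β_mul_μg_pos
  exact ⟨pow_nonneg (by linarith) _, pow_le_one₀ (by linarith) (by linarith)⟩

lemma varyy_div_mem : 0 ≤ p.varyy / (p.μg * p.Lg) ∧ p.varyy / (p.μg * p.Lg) ≤ 1 := by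
  have h1 := mul_pos hp.μg_pos hp.Lg_pos
  exact ⟨div_nonneg hp.varyy_nonneg h1.le, (div_le_one h1).mpr hp.varyy_le⟩

lemma zNoise_nonneg : 0 ≤ p.zNoise := by
  have h1 := hp.varyy_div_mem.1
  have h2 := hp.varf_nonneg
  unfold zNoise
  positivity

lemma psiNoise_nonneg : 0 ≤ p.psiNoise := by
  have h1 := hp.varyy_div_mem.1
  have h2 := hp.varf_nonneg
  have h3 := hp.varxy_nonneg
  have h4 := hp.zNoise_nonneg
  have h5 := hp.Lg'_pos
  have h6 := hp.μg_pos
  unfold psiNoise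
  positivity

lemma σx2_nonneg : 0 ≤ p.σx2 := by
  have h2 := hp.varyy_nonneg
  have h3 := hp.varxy_nonneg
  unfold σx2
  positivity

lemma spreadBound_le (N : ℕ) (d : ℝ) :
    p.spreadBound N d ≤ p.varyy / (p.μg * p.Lg) * (p.B / p.μg) ^ 2 + p.varf / (2 * p.μg ^ 2)
      + 2 * (p.varyy / (p.μg * p.Lg)) * (1 - p.β * p.μg) ^ N * d := by
  have h1 : p.varyy / (p.μg * p.Lg) * (p.varf / (2 * p.μg ^ 2)) ≤ p.varf / (2 * p.μg ^ 2) :=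
    mul_le_of_le_one_left (div_nonneg hp.varf_nonneg (by positivity)) hp.varyy_div_mem.2
  unfold spreadBound
  linarith

/-- Separates the floor from the transient. The variance of the solver decays only like R = (1 -
βμ_g)^N, so R² is relaxed to R. -/
lemma zErr_le (N : ℕ) {d : ℝ} (hd : 0 ≤ d) :
    p.zErr N d ≤ p.zNoise + 3 * (1 - p.β * p.μg) ^ N * d := by
  have h1 := hp.spreadBound_le N d
  obtain ⟨h2, h3⟩ := hp.one_sub_β_pow_mem N
  obtain ⟨h4, h5⟩ := hp.varyy_div_mem
  have h6 : ((1 - p.β * p.μg) ^ N) ^ 2 * d ≤ (1 - p.β * p.μg) ^ N * d :=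
    mul_le_mul_of_nonneg_right (by nlinarith) hd
  have h7 : p.varyy / (p.μg * p.Lg) * ((1 - p.β * p.μg) ^ N * d) ≤ (1 - p.β * p.μg) ^ N * d :=
    mul_le_of_le_one_left (by positivity) h5
  have h8 : p.varf / (2 * p.μg ^ 2) = 1 / 2 * (p.varf / p.μg ^ 2) := by ring
  unfold zErr zNoise
  linarith

/-- The transient of the variance has the factor σ_x²: its first part is the noise of ∂_xy acting on
the error of the solver, its second part the Hessian noise transported by ∂_xy g, with μ_g L_g
relaxed to μ_g². -/
lemma psiVar_le (N : ℕ) {d : ℝ} (hd : 0 ≤ d) :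
    p.psiVar N d ≤ p.psiNoise + 2 * (1 - p.β * p.μg) ^ N * p.σx2 * d := by
  have h1 := hp.spreadBound_le N d
  obtain ⟨h2, h3⟩ := hp.one_sub_β_pow_mem N
  obtain ⟨h4, h5⟩ := hp.varyy_div_mem
  have hxy := hp.varxy_nonneg
  set R := (1 - p.β * p.μg) ^ N
  set τ := p.varyy / (p.μg * p.Lg) with hτ
  have h6 : R ^ 2 * d ≤ R * d := mul_le_mul_of_nonneg_right (by nlinarith) hd
  have h7 : τ * (R * d) ≤ R * d := mul_le_of_le_one_left (by positivity) h5
  have h8 : p.varf / (2 * p.μg ^ 2) = 1 / 2 * (p.varf / p.μg ^ 2) := by ring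
  have h9 : τ ≤ p.varyy / p.μg ^ 2 := by
    rw [hτ]
    have := hp.μg_le
    have := hp.μg_pos
    have := hp.varyy_nonneg
    gcongr
    nlinarith
  have h10 := mul_le_mul_of_nonneg_left h1 (sq_nonneg p.Lg')
  have h11 := mul_le_mul_of_nonneg_left h1 hxy
  have h12 := mul_le_mul_of_nonneg_left h6 hxy
  have h13 := mul_le_mul_of_nonneg_left h7 hxy
  have h14 : p.Lg' ^ 2 * (τ * (R * d)) ≤ p.Lg' ^ 2 * (p.varyy / p.μg ^ 2 * (R * d)) := by gcongr
  have h15 : p.Lg' ^ 2 * (p.varf / p.μg ^ 2) = (p.Lg' / p.μg) ^ 2 * p.varf := by ring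
  have h16 : 2 * p.Lg' ^ 2 / p.μg ^ 2 * p.varyy = 2 * (p.Lg' ^ 2 * (p.varyy / p.μg ^ 2)) := by ring
  have h17 : 0 ≤ p.Lg' ^ 2 * (p.varyy / p.μg ^ 2 * (R * d)) := by
    have := hp.varyy_nonneg
    positivity
  unfold psiVar psiNoise zNoise σx2
  rw [h16]
  rw [h8] at h10 h11
  linarith

end Admissible

end Params

/-! ### Bounds at random states, by conditioning on the past -/

section Iterates

/-- The outer iteration in which a sample is drawn. -/
def SampleIdx.outerIndex : SampleIdx → ℕ
  | .g k _ _ => k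
  | .gyy k _ _ => k
  | .f k _ => k
  | .gxy k _ => k

/-- The labels of everything that is drawn before the outer iteration `k`. -/
def pastLabels (k : ℕ) : Set (Option SampleIdx) := {o | ∀ i ∈ o, i.outerIndex < k}

/-- The labels of the samples of the inner descent at iteration `k`. -/
def descentLabels (k : ℕ) : Set (Option SampleIdx) := {o | ∃ t i, o = some (.g k t i)}

/-- The labels of the samples at iteration `k` that follow the inner descent. -/
def solverLabels (k : ℕ) : Set (Option SampleIdx) :=
  {o | (∃ t i, o = some (.gyy k t i)) ∨ (∃ i, o = some (.f k i)) ∨ ∃ i, o = some (.gxy k i)}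

lemma disjoint_pastLabels_descentLabels (k : ℕ) : Disjoint (pastLabels k) (descentLabels k) := by
  rw [Set.disjoint_left]
  rintro _ h ⟨t, i, rfl⟩
  exact lt_irrefl _ (h _ rfl)

lemma disjoint_union_solverLabels (k : ℕ) :
    Disjoint (pastLabels k ∪ descentLabels k) (solverLabels k) := by
  rw [Set.disjoint_left]
  rintro _ (h | ⟨t, i, rfl⟩) h'
  · rcases h' with ⟨t, i, rfl⟩ | ⟨i, rfl⟩ | ⟨i, rfl⟩ <;> exact lt_irrefl _ (h _ rfl)
  · rcases h' with ⟨t, i, h⟩ | ⟨i, h⟩ | ⟨i, h⟩ <;> simp at h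

lemma union_subset_pastLabels_succ (k : ℕ) :
    pastLabels k ∪ descentLabels k ⊆ pastLabels (k + 1) := by
  rintro _ (h | ⟨t, i, rfl⟩) j hj
  · exact (h j hj).trans k.lt_succ_self
  · cases hj
    exact k.lt_succ_self

lemma solverLabels_subset_pastLabels_succ (k : ℕ) : solverLabels k ⊆ pastLabels (k + 1) := by
  rintro _ (⟨t, i, rfl⟩ | ⟨i, rfl⟩ | ⟨i, rfl⟩) j hj <;> cases hj <;> exact k.lt_succ_self

variable {X Y Ξ Ω Q : Type*}
  [NormedAddCommGroup X] [InnerProductSpace ℝ X] [CompleteSpace X] [FiniteDimensional ℝ X]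
  [MeasurableSpace X] [BorelSpace X]
  [NormedAddCommGroup Y] [InnerProductSpace ℝ Y] [CompleteSpace Y] [FiniteDimensional ℝ Y]
  [MeasurableSpace Y] [BorelSpace Y]
  [MeasurableSpace Ξ] [MeasurableSpace Ω] [MeasurableSpace Q]
  {μ : Measure Ω} [IsProbabilityMeasure μ]
  {p : Params} {f g : X → Y → ℝ} {fhat ghat : X → Y → Ξ → ℝ} {P : Measure Ξ}
  [IsProbabilityMeasure P] {q₀ : Ω → Q} {ξ : SampleIdx → Ω → Ξ}

section Phases

variable (hp : p.Admissible) (hr : RegularProblem p f g)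
  (hm : StochasticModel f g fhat ghat P) (hn : GradientNoise p f g fhat ghat P)
  (hs : IsSampling μ P q₀ ξ) (k T : ℕ) {x : Ω → X} {y z : Ω → Y} {S : Set (Option SampleIdx)}

include hm in
lemma measurable_descent (hx : Measurable[observed q₀ ξ S] x) (hy : Measurable[observed q₀ ξ S] y)
    (hS : descentLabels k ⊆ S) :
    Measurable[observed q₀ ξ S] fun ω => innerY ghat p.α (x ω) (samplesG p ξ k ω) (y ω) T :=
  hm.measurable_innerY p.α hx hy T
    fun t _ i => measurable_sample_observed (hS ⟨t, i, rfl⟩)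

lemma measurable_samplesG : Measurable[observed q₀ ξ (descentLabels k)] (samplesG p ξ k) :=
  @measurable_pi_lambda _ _ _ (observed q₀ ξ (descentLabels k)) _ _ fun t =>
    measurable_batch_observed fun i => ⟨t, i, rfl⟩

include hp hr hm hn hs in
/-- The inner descent, from a random starting point. -/
lemma descent_error (hx : Measurable[observed q₀ ξ S] x) (hy : Measurable[observed q₀ ξ S] y)
    (hS : Disjoint S (descentLabels k)) (hx2 : MemLp x 2 μ) (hy2 : MemLp y 2 μ) :
    Integrable (fun ω => ‖innerY ghat p.α (x ω) (samplesG p ξ k ω) (y ω) T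
      - yStar g (x ω)‖ ^ 2) μ ∧
    ∫ ω, ‖innerY ghat p.α (x ω) (samplesG p ξ k ω) (y ω) T - yStar g (x ω)‖ ^ 2 ∂μ
      ≤ ((1 - p.α * p.μg) ^ T) ^ 2 * ∫ ω, ‖y ω - yStar g (x ω)‖ ^ 2 ∂μ
        + p.varg / (p.μg * p.Lg) := by
  have hU : Measurable[observed q₀ ξ S] fun ω => (x ω, y ω) := hx.prodMk hy
  have hV := measurable_samplesG (p := p) (q₀ := q₀) (ξ := ξ) k
  have hφ : Measurable fun q : (X × Y) × (ℕ → Fin p.ng → Ξ) =>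
      innerY ghat p.α q.1.1 q.2 q.1.2 T - yStar g q.1.1 :=
    (hm.measurable_innerY p.α (measurable_fst.comp measurable_fst)
      (measurable_snd.comp measurable_fst) T fun t _ i =>
        (measurable_pi_apply i).comp ((measurable_pi_apply t).comp measurable_snd)).sub
      ((continuous_yStar hp hr).measurable.comp (measurable_fst.comp measurable_fst))
  have hd : Integrable (fun ω => ‖y ω - yStar g (x ω)‖ ^ 2) μ :=
    (hy2.sub (memLp_yStar hp hr hx2)).integrable_norm_sq
  have key := integral_comp_indep_le (hs.measurable_of_observed hU) (hs.measurable_of_observed hV)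
    (hs.indepFun hS hU hV) (hφ.norm.pow_const 2) (fun _ => by positivity)
    (H := fun q => ((1 - p.α * p.μg) ^ T) ^ 2 * ‖q.2 - yStar g q.1‖ ^ 2
      + p.varg / (p.μg * p.Lg))
    (fun q => (integral_sq_norm_innerY_sub_le hp hr hm hn hs k T q.1 q.2).1)
    (fun q => (integral_sq_norm_innerY_sub_le hp hr hm hn hs k T q.1 q.2).2)
    ((hd.const_mul _).add (integrable_const _))
  refine ⟨key.1, key.2.trans (le_of_eq ?_)⟩
  rw [integral_add (hd.const_mul _) (integrable_const _), integral_const_mul, integral_const,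
    probReal_univ, one_smul]

variable (hn2 : HessianNoise p g ghat P) (N : ℕ)

/-- The samples used at iteration `k` after the inner descent. -/
abbrev solverSamples (p : Params) (ξ : SampleIdx → Ω → Ξ) (k : ℕ) (ω : Ω) :
    (Fin p.nf → Ξ) × (ℕ → Fin p.nyy → Ξ) × (Fin p.nxy → Ξ) :=
  (samplesF p ξ k ω, samplesYY p ξ k ω, samplesXY p ξ k ω)

lemma measurable_solverSamples :
    Measurable[observed q₀ ξ (solverLabels k)] (solverSamples p ξ k) := by
  refine Measurable.prodMk (measurable_batch_observed fun i => Or.inr (Or.inl ⟨i, rfl⟩))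
    (Measurable.prodMk ?_ (measurable_batch_observed fun i => Or.inr (Or.inr ⟨i, rfl⟩)))
  exact @measurable_pi_lambda _ _ _ (observed q₀ ξ (solverLabels k)) _ _ fun t =>
    measurable_batch_observed fun i => Or.inl ⟨t, i, rfl⟩

include hm in
lemma measurable_zStep {A : Type*} {_ : MeasurableSpace A} {x : A → X} {y z : A → Y}
    {D : A → (Fin p.nf → Ξ) × (ℕ → Fin p.nyy → Ξ) × (Fin p.nxy → Ξ)}
    (hx : Measurable x) (hy : Measurable y) (hz : Measurable z) (hD : Measurable D) :
    Measurable fun a => zStep p N fhat ghat (D a).1 (D a).2.1 (x a) (y a) (z a) :=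
  hm.measurable_innerZ p.β hx hy
    (hm.measurable_gradY_batch_f hx hy fun i => (measurable_pi_apply i).comp hD.fst) hz N
    fun t _ i => (measurable_pi_apply i).comp ((measurable_pi_apply t).comp hD.snd.fst)

include hm in
lemma measurable_psiHat {A : Type*} {_ : MeasurableSpace A} {x : A → X} {y z : A → Y}
    {D : A → (Fin p.nf → Ξ) × (ℕ → Fin p.nyy → Ξ) × (Fin p.nxy → Ξ)}
    (hx : Measurable x) (hy : Measurable y) (hz : Measurable z) (hD : Measurable D) :
    Measurable fun a => psiHat p N fhat ghat (D a).1 (D a).2.1 (D a).2.2 (x a) (y a) (z a) :=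
  (hm.measurable_gradX_batch hx hy fun i => (measurable_pi_apply i).comp hD.fst).add
    (hm.measurable_hessXY_batch_apply hx hy (measurable_zStep hm N hx hy hz hD)
      fun i => (measurable_pi_apply i).comp hD.snd.snd)

section Solver

variable (hx : Measurable[observed q₀ ξ S] x) (hy : Measurable[observed q₀ ξ S] y)
    (hz : Measurable[observed q₀ ξ S] z) (hS : Disjoint S (solverLabels k))
    (hd : Integrable (fun ω => ‖z ω - zStar f g (x ω) (y ω)‖ ^ 2) μ)
include hp hr hm hn hs hn2 hx hy hz hS hd

/-- The linear solver, from a random state. -/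
lemma solver_error :
    Integrable (fun ω => ‖zStep p N fhat ghat (samplesF p ξ k ω) (samplesYY p ξ k ω)
      (x ω) (y ω) (z ω) - zStar f g (x ω) (y ω)‖ ^ 2) μ ∧
    ∫ ω, ‖zStep p N fhat ghat (samplesF p ξ k ω) (samplesYY p ξ k ω)
      (x ω) (y ω) (z ω) - zStar f g (x ω) (y ω)‖ ^ 2 ∂μ
      ≤ p.zNoise + 3 * (1 - p.β * p.μg) ^ N
        * ∫ ω, ‖z ω - zStar f g (x ω) (y ω)‖ ^ 2 ∂μ := by
  have hU : Measurable[observed q₀ ξ S] fun ω => (x ω, y ω, z ω) := hx.prodMk (hy.prodMk hz)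
  have hV := measurable_solverSamples (p := p) (q₀ := q₀) (ξ := ξ) k
  have hφ : Measurable fun q : (X × Y × Y) ×
      ((Fin p.nf → Ξ) × (ℕ → Fin p.nyy → Ξ) × (Fin p.nxy → Ξ)) =>
      zStep p N fhat ghat q.2.1 q.2.2.1 q.1.1 q.1.2.1 q.1.2.2 - zStar f g q.1.1 q.1.2.1 := by
    have hq : Measurable fun q : (X × Y × Y) ×
        ((Fin p.nf → Ξ) × (ℕ → Fin p.nyy → Ξ) × (Fin p.nxy → Ξ)) => (q.1.1, q.1.2.1) :=
      measurable_fst.fst.prodMk measurable_fst.snd.fst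
    have hz := (continuous_zStar hp hr).measurable.comp hq
    exact (measurable_zStep hm N measurable_fst.fst measurable_fst.snd.fst
      measurable_fst.snd.snd measurable_snd).sub hz
  have key := integral_comp_indep_le (hs.measurable_of_observed hU) (hs.measurable_of_observed hV)
    (hs.indepFun hS hU hV) (hφ.norm.pow_const 2) (fun _ => by positivity)
    (H := fun q => p.zNoise + 3 * (1 - p.β * p.μg) ^ N * ‖q.2.2 - zStar f g q.1 q.2.1‖ ^ 2)
    (fun q => (zStep_error hp hr hm hn hn2 hs k N q.1 q.2.1 q.2.2).1)
    (fun q => (zStep_error hp hr hm hn hn2 hs k N q.1 q.2.1 q.2.2).2.trans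
      (hp.zErr_le N (by positivity)))
    ((integrable_const _).add (hd.const_mul _))
  refine ⟨key.1, key.2.trans (le_of_eq ?_)⟩
  rw [integral_add (integrable_const _) (hd.const_mul _), integral_const_mul, integral_const,
    probReal_univ, one_smul]

/-- The variance of the gradient estimate, at a random state. -/
lemma psiHat_variance :
    Integrable (fun ω => ‖psiHat p N fhat ghat (samplesF p ξ k ω) (samplesYY p ξ k ω)
      (samplesXY p ξ k ω) (x ω) (y ω) (z ω) - psiMean p N f g (x ω) (y ω) (z ω)‖ ^ 2) μ ∧
    ∫ ω, ‖psiHat p N fhat ghat (samplesF p ξ k ω) (samplesYY p ξ k ω)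
      (samplesXY p ξ k ω) (x ω) (y ω) (z ω) - psiMean p N f g (x ω) (y ω) (z ω)‖ ^ 2 ∂μ
      ≤ p.psiNoise + 2 * (1 - p.β * p.μg) ^ N * p.σx2
        * ∫ ω, ‖z ω - zStar f g (x ω) (y ω)‖ ^ 2 ∂μ := by
  have hU : Measurable[observed q₀ ξ S] fun ω => (x ω, y ω, z ω) := hx.prodMk (hy.prodMk hz)
  have hV := measurable_solverSamples (p := p) (q₀ := q₀) (ξ := ξ) k
  have hφ : Measurable fun q : (X × Y × Y) ×
      ((Fin p.nf → Ξ) × (ℕ → Fin p.nyy → Ξ) × (Fin p.nxy → Ξ)) =>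
      psiHat p N fhat ghat q.2.1 q.2.2.1 q.2.2.2 q.1.1 q.1.2.1 q.1.2.2
        - psiMean p N f g q.1.1 q.1.2.1 q.1.2.2 :=
    (measurable_psiHat hm N measurable_fst.fst measurable_fst.snd.fst measurable_fst.snd.snd
      measurable_snd).sub ((continuous_psiMean hp hr N).measurable.comp measurable_fst)
  have key := integral_comp_indep_le (hs.measurable_of_observed hU) (hs.measurable_of_observed hV)
    (hs.indepFun hS hU hV) (hφ.norm.pow_const 2) (fun _ => by positivity)
    (H := fun q => p.psiNoise
      + 2 * (1 - p.β * p.μg) ^ N * p.σx2 * ‖q.2.2 - zStar f g q.1 q.2.1‖ ^ 2)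
    (fun q => (isNoise_psiHat hp hr hm hn hn2 hs k N q.1 q.2.1 q.2.2).integrable_sq)
    (fun q => (isNoise_psiHat hp hr hm hn hn2 hs k N q.1 q.2.1 q.2.2).sq_le.trans
      (hp.psiVar_le N (by positivity)))
    ((integrable_const _).add (hd.const_mul _))
  refine ⟨key.1, key.2.trans (le_of_eq ?_)⟩
  rw [integral_add (integrable_const _) (hd.const_mul _), integral_const_mul, integral_const,
    probReal_univ, one_smul]

/-- The noise of the gradient estimate is orthogonal to functions of the state. -/
lemma integral_inner_psiHat_sub {w : X × Y × Y → X} (hw : Measurable w)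
    (hw2 : MemLp (fun ω => w (x ω, y ω, z ω)) 2 μ) :
    Integrable (fun ω => inner ℝ (w (x ω, y ω, z ω))
      (psiHat p N fhat ghat (samplesF p ξ k ω) (samplesYY p ξ k ω)
      (samplesXY p ξ k ω) (x ω) (y ω) (z ω) - psiMean p N f g (x ω) (y ω) (z ω))) μ ∧
    ∫ ω, inner ℝ (w (x ω, y ω, z ω))
      (psiHat p N fhat ghat (samplesF p ξ k ω) (samplesYY p ξ k ω)
      (samplesXY p ξ k ω) (x ω) (y ω) (z ω) - psiMean p N f g (x ω) (y ω) (z ω)) ∂μ = 0 := by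
  have hU : Measurable[observed q₀ ξ S] fun ω => (x ω, y ω, z ω) := hx.prodMk (hy.prodMk hz)
  have hV := measurable_solverSamples (p := p) (q₀ := q₀) (ξ := ξ) k
  have hU' := hs.measurable_of_observed hU
  have hV' := hs.measurable_of_observed hV
  have hφ : Measurable fun q : (X × Y × Y) ×
      ((Fin p.nf → Ξ) × (ℕ → Fin p.nyy → Ξ) × (Fin p.nxy → Ξ)) =>
      psiHat p N fhat ghat q.2.1 q.2.2.1 q.2.2.2 q.1.1 q.1.2.1 q.1.2.2
        - psiMean p N f g q.1.1 q.1.2.1 q.1.2.2 :=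
    (measurable_psiHat hm N measurable_fst.fst measurable_fst.snd.fst measurable_fst.snd.snd
      measurable_snd).sub ((continuous_psiMean hp hr N).measurable.comp measurable_fst)
  have hψ : Measurable fun q : (X × Y × Y) ×
      ((Fin p.nf → Ξ) × (ℕ → Fin p.nyy → Ξ) × (Fin p.nxy → Ξ)) => inner ℝ (w q.1)
      (psiHat p N fhat ghat q.2.1 q.2.2.1 q.2.2.2 q.1.1 q.1.2.1 q.1.2.2
        - psiMean p N f g q.1.1 q.1.2.1 q.1.2.2) := (hw.comp measurable_fst).inner hφ
  have h2 : MemLp (fun ω => psiHat p N fhat ghat (samplesF p ξ k ω) (samplesYY p ξ k ω)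
      (samplesXY p ξ k ω) (x ω) (y ω) (z ω) - psiMean p N f g (x ω) (y ω) (z ω)) 2 μ :=
    (memLp_two_iff_integrable_sq_norm (hφ.comp (hU'.prodMk hV')).aestronglyMeasurable).mpr
      (psiHat_variance hp hr hm hn hs k hn2 N hx hy hz hS hd).1
  have hint : Integrable (fun ω => inner ℝ (w (x ω, y ω, z ω))
      (psiHat p N fhat ghat (samplesF p ξ k ω) (samplesYY p ξ k ω)
      (samplesXY p ξ k ω) (x ω) (y ω) (z ω) - psiMean p N f g (x ω) (y ω) (z ω))) μ := by
    refine ((hw2.integrable_norm_sq.add h2.integrable_norm_sq).div_const 2).mono'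
      (hψ.comp (hU'.prodMk hV')).aestronglyMeasurable (Filter.Eventually.of_forall fun ω => ?_)
    rw [Real.norm_eq_abs]
    refine (abs_real_inner_le_norm _ _).trans ?_
    simp only [Pi.add_apply]
    nlinarith [two_mul_le_add_sq ‖w (x ω, y ω, z ω)‖
      ‖psiHat p N fhat ghat (samplesF p ξ k ω) (samplesYY p ξ k ω)
      (samplesXY p ξ k ω) (x ω) (y ω) (z ω) - psiMean p N f g (x ω) (y ω) (z ω)‖]
  refine ⟨hint, (integral_comp_indep_eq hU' hV' (hs.indepFun hS hU hV)
    hψ.stronglyMeasurable hint).trans ?_⟩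
  -- For a frozen state the inner integral is the inner product of a constant vector with the mean
  -- of a centred noise.
  refine integral_eq_zero_of_ae (Filter.Eventually.of_forall fun ω => ?_)
  have hν := isNoise_psiHat hp hr hm hn hn2 hs k N (x ω) (y ω) (z ω)
  dsimp only [Pi.zero_apply]
  exact (integral_inner hν.integrable _).trans (by rw [hν.mean, inner_zero_right])

end Solver

end Phases

end Iterates

end AmIGO

namespace AmIGO

/-! ### One inexact gradient step on ℒ -/

section OuterStep

variable {X Y Ξ Ω Q : Type*}
  [NormedAddCommGroup X] [InnerProductSpace ℝ X] [CompleteSpace X] [FiniteDimensional ℝ X]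
  [MeasurableSpace X] [BorelSpace X]
  [NormedAddCommGroup Y] [InnerProductSpace ℝ Y] [CompleteSpace Y] [FiniteDimensional ℝ Y]
  [MeasurableSpace Y] [BorelSpace Y]
  [MeasurableSpace Ξ] [MeasurableSpace Ω] [MeasurableSpace Q]
  {μ : Measure Ω} [IsProbabilityMeasure μ]
  {p : Params} {f g : X → Y → ℝ} {fhat ghat : X → Y → Ξ → ℝ} {P : Measure Ξ}
  [IsProbabilityMeasure P] {q₀ : Ω → Q} {ξ : SampleIdx → Ω → Ξ}
  (hp : p.Admissible) (hr : RegularProblem p f g)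

/-- Bound of the squared bias of the gradient estimate. -/
noncomputable def Params.biasBound (p : Params) (N : ℕ) (ey ez : ℝ) : ℝ :=
  2 * p.Lψ ^ 2 * ey + 2 * p.Lψ ^ 2 * ((1 - p.β * p.μg) ^ N) ^ 2 * ez

/-- Bound of the variance of the gradient estimate. -/
noncomputable def Params.varBound (p : Params) (N : ℕ) (ez : ℝ) : ℝ :=
  p.psiNoise + 2 * (1 - p.β * p.μg) ^ N * p.σx2 * ez

section Bias

variable {x : Ω → X} {y z : Ω → Y} (N : ℕ) (hx : Measurable x) (hy : Measurable y)
  (hz : Measurable z) (hx2 : MemLp x 2 μ) (hy2 : MemLp y 2 μ) (hz2 : MemLp z 2 μ)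
include hp hr hx hy hz hx2 hy2 hz2

lemma memLp_bias :
    MemLp (fun ω => psiMean p N f g (x ω) (y ω) (z ω) - gradient (outer f g) (x ω)) 2 μ :=
  (memLp_psiMean hp hr N hx hy hz hx2 hy2 hz2).sub (memLp_gradient_outer hp hr hx2)

lemma integral_sq_bias_le :
    ∫ ω, ‖psiMean p N f g (x ω) (y ω) (z ω) - gradient (outer f g) (x ω)‖ ^ 2 ∂μ
      ≤ p.biasBound N (∫ ω, ‖y ω - yStar g (x ω)‖ ^ 2 ∂μ)
        (∫ ω, ‖z ω - zStar f g (x ω) (y ω)‖ ^ 2 ∂μ) := by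
  have h1 := (hy2.sub (memLp_yStar hp hr hx2)).integrable_norm_sq
  have h2 := (hz2.sub (memLp_zStar hp hr hx hy)).integrable_norm_sq
  refine (integral_mono (memLp_bias hp hr N hx hy hz hx2 hy2 hz2).integrable_norm_sq
    ((h1.const_mul (2 * p.Lψ ^ 2)).add
      (h2.const_mul (2 * p.Lψ ^ 2 * ((1 - p.β * p.μg) ^ N) ^ 2)))
    fun ω => sq_norm_psiMean_sub_gradient_le hp hr N (x ω) (y ω) (z ω)).trans (le_of_eq ?_)
  refine (integral_add (h1.const_mul _) (h2.const_mul _)).trans ?_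
  rw [integral_const_mul, integral_const_mul]
  rfl

end Bias

section Pointwise

include hp hr

/-- The descent lemma with γ = 1/L. Completing the square, ‖ψ‖² - 2⟨∇ℒ, ψ⟩ = ‖ψ - ∇ℒ‖² - ‖∇ℒ‖², and
the noise ν is left paired with the bias only. -/
lemma outer_step_le (x ψ ν : X) : outer f g (x - p.γ • (ψ + ν)) ≤ outer f g x
    + p.γ / 2 * ‖ψ - gradient (outer f g) x‖ ^ 2 - p.γ / 2 * ‖gradient (outer f g) x‖ ^ 2
    + p.γ * inner ℝ (ψ - gradient (outer f g) x) ν + p.γ / 2 * ‖ν‖ ^ 2 := by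
  have h1 := le_quadratic_of_lipschitz_gradient (hasGradientAt_outer_gradient hp hr)
    (norm_gradient_outer_sub_le hp hr) x (x - p.γ • (ψ + ν))
  have h2 : x - p.γ • (ψ + ν) - x = -(p.γ • (ψ + ν)) := by abel
  rw [h2, inner_neg_right, norm_neg, norm_smul, mul_pow, inner_smul_right, Real.norm_eq_abs,
    sq_abs] at h1
  have h3 : p.L / 2 * (p.γ ^ 2 * ‖ψ + ν‖ ^ 2) = p.γ / 2 * ‖ψ + ν‖ ^ 2 := by
    have := hp.L_pos.ne'
    unfold Params.γ
    field_simp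
  rw [h3] at h1
  refine h1.trans (le_of_eq ?_)
  rw [norm_add_sq_real, norm_sub_sq_real, inner_add_right, inner_sub_left,
    real_inner_comm ψ (gradient (outer f g) x)]
  ring

variable {xs : X} (hmin : ∀ x, outer f g xs ≤ outer f g x)
include hmin

/-- An exact gradient step does not move away from the minimizer: γ²‖∇ℒ‖² ≤ 2γ(ℒ - ℒ*) by
smoothness, and ℒ - ℒ* ≤ ⟨∇ℒ, x - x*⟩ by convexity. -/
lemma norm_gradient_step_sub_le {m : ℝ} (hm : 0 ≤ m) (hsc : ∀ x x', outer f g x - outer f g x' ≤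
      inner ℝ (gradient (outer f g) x) (x - x') - m / 2 * ‖x - x'‖ ^ 2) (x : X) :
    ‖p.γ • gradient (outer f g) x - (x - xs)‖ ≤ ‖x - xs‖ := by
  have h1 := sq_norm_gradient_le hp.L_pos (hasGradientAt_outer_gradient hp hr)
    (norm_gradient_outer_sub_le hp hr) hmin x
  have h2 := hsc x xs
  have h3 : 0 ≤ m / 2 * ‖x - xs‖ ^ 2 := by positivity
  have h4 : p.γ ^ 2 * ‖gradient (outer f g) x‖ ^ 2
      ≤ p.γ ^ 2 * (2 * p.L * (outer f g x - outer f g xs)) := by gcongr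
  have h5 : p.γ ^ 2 * (2 * p.L * (outer f g x - outer f g xs))
      = 2 * p.γ * (outer f g x - outer f g xs) := by
    have := hp.L_pos.ne'
    unfold Params.γ
    field_simp
  have h6 := mul_le_mul_of_nonneg_left h2 hp.γ_pos.le
  have h7 := mul_nonneg hp.γ_pos.le h3
  rw [← sq_le_sq₀ (norm_nonneg _) (norm_nonneg _), norm_sub_sq_real, norm_smul, mul_pow,
    real_inner_smul_left, Real.norm_eq_abs, sq_abs]
  linarith

/-- Expand the squared distance and add δ = γη' times both the descent inequality and strong
convexity between x and x*. The terms in ‖∇ℒ‖² cancel because η'γ² = γδ. The bias is paired with a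
gradient step, which is nonexpansive around x*. -/
lemma outer_step_strongly_convex {m η η' : ℝ} (hm : 0 ≤ m) (hη : 0 < η) (hη' : 0 < η')
    (hstep : η' = η + p.γ * η' * (m - η))
    (hsc : ∀ x x', outer f g x - outer f g x' ≤
      inner ℝ (gradient (outer f g) x) (x - x') - m / 2 * ‖x - x'‖ ^ 2) (x ψ ν : X) :
    η' / 2 * ‖x - p.γ • (ψ + ν) - xs‖ ^ 2
        + p.γ * η' * (outer f g (x - p.γ • (ψ + ν)) - outer f g xs)
      ≤ (1 - p.γ * η' + p.γ * η' / 4) * (η / 2) * ‖x - xs‖ ^ 2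
        + (p.γ * (p.γ * η') + 2 * (p.γ * η') / η) * ‖ψ - gradient (outer f g) x‖ ^ 2
        + p.γ * (p.γ * η') * ‖ν‖ ^ 2
        + p.γ * η' * (2 * p.γ * inner ℝ (ψ - gradient (outer f g) x) ν
          + inner ℝ (p.γ • gradient (outer f g) x - (x - xs)) ν) := by
  set D := gradient (outer f g) x with hD
  set d := x - xs with hd
  have h1 := outer_step_le hp hr x ψ ν
  rw [← hD] at h1
  obtain ⟨e, rfl⟩ : ∃ e, ψ = D + e := ⟨ψ - D, by abel⟩
  simp only [add_sub_cancel_left] at h1 ⊢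
  have h2 := hsc x xs
  rw [← hD, ← hd] at h2
  have h3 : x - p.γ • (D + e + ν) - xs = d - p.γ • (D + e + ν) := by rw [hd]; abel
  rw [h3, norm_sub_sq_real, norm_smul, mul_pow, inner_smul_right, Real.norm_eq_abs, sq_abs]
  have hδ : 0 < p.γ * η' := mul_pos hp.γ_pos hη'
  -- Young's inequality with weights such that, after multiplication by δ, the distance term costs
  -- exactly a quarter of the contraction δ of η/2 ‖d‖².
  have h4 : inner ℝ e (p.γ • D - d) ≤ 2 / η * ‖e‖ ^ 2 + η / 8 * ‖d‖ ^ 2 := by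
    refine (real_inner_le_norm _ _).trans ((mul_le_mul_of_nonneg_left
      (norm_gradient_step_sub_le hp hr hmin hm hsc x) (norm_nonneg _)).trans ?_)
    rw [← hd]
    have : 2 / η * ‖e‖ ^ 2 + η / 8 * ‖d‖ ^ 2 - ‖e‖ * ‖d‖
        = 2 / η * (‖e‖ - η / 4 * ‖d‖) ^ 2 := by
      field_simp
      ring
    have h0 : 0 ≤ 2 / η * (‖e‖ - η / 4 * ‖d‖) ^ 2 := by positivity
    linarith
  have h5 := mul_le_mul_of_nonneg_left h4 hδ.le
  have h6 := mul_le_mul_of_nonneg_left h1 hδ.le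
  have h7 := mul_le_mul_of_nonneg_left h2 hδ.le
  -- The recursion of η is designed for this identity: strong convexity turns the coefficient η'
  -- into (1 - δ)η.
  have h8 : (η' / 2 - p.γ * η' * m / 2) * ‖d‖ ^ 2 = (1 - p.γ * η') * (η / 2) * ‖d‖ ^ 2 := by
    congr 1
    linear_combination hstep / 2
  have h9 : 2 * (p.γ * η') / η = p.γ * η' * (2 / η) := by ring
  rw [h9]
  have e2 : ‖D + e + ν‖ ^ 2 = ‖e‖ ^ 2 + 2 * inner ℝ e D + ‖D‖ ^ 2
      + 2 * inner ℝ e ν + 2 * inner ℝ D ν + ‖ν‖ ^ 2 := by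
    rw [norm_add_sq_real, norm_add_sq_real, inner_add_left, real_inner_comm D e]
    ring
  have e3 : inner ℝ d (D + e + ν) = inner ℝ e d + inner ℝ D d + inner ℝ d ν := by
    rw [inner_add_right, inner_add_right, real_inner_comm d D, real_inner_comm d e]
    ring
  rw [e2, e3, inner_sub_left (p.γ • D), real_inner_smul_left]
  rw [inner_sub_right e, real_inner_smul_right] at h5
  linarith

end Pointwise

end OuterStep

end AmIGO

namespace AmIGO

/-! ### Expected progress of an outer step -/

section ExpectedStep

variable {X Y Ω : Type*}
  [NormedAddCommGroup X] [InnerProductSpace ℝ X] [CompleteSpace X] [FiniteDimensional ℝ X]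
  [MeasurableSpace X] [BorelSpace X]
  [NormedAddCommGroup Y] [InnerProductSpace ℝ Y] [CompleteSpace Y] [FiniteDimensional ℝ Y]
  [MeasurableSpace Y] [BorelSpace Y]
  [MeasurableSpace Ω] {μ : Measure Ω} [IsProbabilityMeasure μ]
  {p : Params} {f g : X → Y → ℝ}

lemma integrable_inner_of_memLp {v w : Ω → X} (hv : MemLp v 2 μ) (hw : MemLp w 2 μ) :
    Integrable (fun ω => inner ℝ (v ω) (w ω)) μ := by
  refine ((hv.integrable_norm_sq.add hw.integrable_norm_sq).div_const 2).mono'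
    (hv.aestronglyMeasurable.inner hw.aestronglyMeasurable)
    (Filter.Eventually.of_forall fun ω => ?_)
  rw [Real.norm_eq_abs]
  refine (abs_real_inner_le_norm _ _).trans ?_
  simp only [Pi.add_apply]
  nlinarith [two_mul_le_add_sq ‖v ω‖ ‖w ω‖]

/-- A gradient step on `outer f g` with a biased and noisy gradient. -/
structure IsOuterStep (μ : Measure Ω) (p : Params) (f g : X → Y → ℝ) (x x' e ν : Ω → X)
    (B V : ℝ) : Prop where
  eq : ∀ ω, x' ω = x ω - p.γ • (gradient (outer f g) (x ω) + e ω + ν ω)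
  memLp_x : MemLp x 2 μ
  memLp_bias : MemLp e 2 μ
  memLp_noise : MemLp ν 2 μ
  orthogonal_bias : ∫ ω, inner ℝ (e ω) (ν ω) ∂μ = 0
  orthogonal_gradient : ∫ ω, inner ℝ (gradient (outer f g) (x ω)) (ν ω) ∂μ = 0
  orthogonal_sub : ∀ c, ∫ ω, inner ℝ (x ω - c) (ν ω) ∂μ = 0
  bias_le : ∫ ω, ‖e ω‖ ^ 2 ∂μ ≤ B
  noise_le : ∫ ω, ‖ν ω‖ ^ 2 ∂μ ≤ V

namespace IsOuterStep

variable {x x' e ν : Ω → X} {B V : ℝ} (hp : p.Admissible) (hr : RegularProblem p f g)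
  (h : IsOuterStep μ p f g x x' e ν B V)
include hp hr h

lemma memLp_next : MemLp x' 2 μ := by
  have h1 : x' = fun ω => x ω - p.γ • (gradient (outer f g) (x ω) + e ω + ν ω) := funext h.eq
  rw [h1]
  exact h.memLp_x.sub ((((memLp_gradient_outer hp hr h.memLp_x).add h.memLp_bias).add
    h.memLp_noise).const_smul p.γ)

/-- The noise is orthogonal to the gradient and to the bias, so its variance enters with coefficient
1. Gradient and bias may be correlated, and each takes a factor 2. -/
lemma integral_sq_norm_sub_le : ∫ ω, ‖x' ω - x ω‖ ^ 2 ∂μ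
    ≤ p.γ ^ 2 * (V + 2 * B + 2 * ∫ ω, ‖gradient (outer f g) (x ω)‖ ^ 2 ∂μ) := by
  have hG := memLp_gradient_outer hp hr h.memLp_x
  have i1 := hG.integrable_norm_sq
  have i2 := h.memLp_bias.integrable_norm_sq
  have i3 := h.memLp_noise.integrable_norm_sq
  have i4 := integrable_inner_of_memLp hG h.memLp_noise
  have i5 := integrable_inner_of_memLp h.memLp_bias h.memLp_noise
  have j1 : Integrable (fun ω => ‖ν ω‖ ^ 2 + 2 * ‖e ω‖ ^ 2) μ := i3.add (i2.const_mul 2)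
  have j2 : Integrable (fun ω => ‖ν ω‖ ^ 2 + 2 * ‖e ω‖ ^ 2
      + 2 * ‖gradient (outer f g) (x ω)‖ ^ 2) μ := j1.add (i1.const_mul 2)
  have j3 : Integrable (fun ω => ‖ν ω‖ ^ 2 + 2 * ‖e ω‖ ^ 2
      + 2 * ‖gradient (outer f g) (x ω)‖ ^ 2
      + 2 * inner ℝ (gradient (outer f g) (x ω)) (ν ω)) μ := j2.add (i4.const_mul 2)
  have j4 : Integrable (fun ω => ‖ν ω‖ ^ 2 + 2 * ‖e ω‖ ^ 2
      + 2 * ‖gradient (outer f g) (x ω)‖ ^ 2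
      + 2 * inner ℝ (gradient (outer f g) (x ω)) (ν ω) + 2 * inner ℝ (e ω) (ν ω)) μ :=
    j3.add (i5.const_mul 2)
  have key : ∫ ω, ‖x' ω - x ω‖ ^ 2 ∂μ ≤ ∫ ω, p.γ ^ 2 * (‖ν ω‖ ^ 2 + 2 * ‖e ω‖ ^ 2
      + 2 * ‖gradient (outer f g) (x ω)‖ ^ 2
      + 2 * inner ℝ (gradient (outer f g) (x ω)) (ν ω) + 2 * inner ℝ (e ω) (ν ω)) ∂μ := by
    refine integral_mono ((h.memLp_next hp hr).sub h.memLp_x).integrable_norm_sq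
      (j4.const_mul _) fun ω => ?_
    have e1 : x' ω - x ω = -(p.γ • (gradient (outer f g) (x ω) + e ω + ν ω)) := by
      rw [h.eq]
      abel
    dsimp only [Pi.sub_apply]
    rw [e1, norm_neg, norm_smul, mul_pow, Real.norm_eq_abs, sq_abs]
    refine mul_le_mul_of_nonneg_left ?_ (sq_nonneg _)
    rw [norm_add_sq_real, inner_add_left]
    have e2 := norm_add_sq_real (gradient (outer f g) (x ω)) (e ω)
    have e3 := norm_sub_sq_real (gradient (outer f g) (x ω)) (e ω)
    have e4 := sq_nonneg ‖gradient (outer f g) (x ω) - e ω‖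
    linarith
  refine key.trans ?_
  rw [integral_const_mul, integral_add j3 (i5.const_mul 2), integral_add j2 (i4.const_mul 2),
    integral_add j1 (i1.const_mul 2), integral_add i3 (i2.const_mul 2), integral_const_mul,
    integral_const_mul, integral_const_mul, integral_const_mul, h.orthogonal_bias,
    h.orthogonal_gradient]
  refine mul_le_mul_of_nonneg_left ?_ (sq_nonneg _)
  have := h.bias_le
  have := h.noise_le
  linarith

lemma integral_outer_le : ∫ ω, outer f g (x' ω) ∂μ ≤ ∫ ω, outer f g (x ω) ∂μ
    - p.γ / 2 * (∫ ω, ‖gradient (outer f g) (x ω)‖ ^ 2 ∂μ) + p.γ / 2 * B + p.γ / 2 * V := by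
  have hG := memLp_gradient_outer hp hr h.memLp_x
  have i0 := integrable_outer hp hr h.memLp_x
  have i1 := hG.integrable_norm_sq.const_mul (p.γ / 2)
  have i2 := h.memLp_bias.integrable_norm_sq.const_mul (p.γ / 2)
  have i3 := h.memLp_noise.integrable_norm_sq.const_mul (p.γ / 2)
  have i5 := (integrable_inner_of_memLp h.memLp_bias h.memLp_noise).const_mul p.γ
  have j1 := i0.add i2
  have j2 := j1.sub i1
  have j3 := j2.add i5
  have key := integral_mono (integrable_outer hp hr (h.memLp_next hp hr)) (j3.add i3) fun ω => by
    have := outer_step_le hp hr (x ω) (gradient (outer f g) (x ω) + e ω) (ν ω)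
    rw [← h.eq, add_sub_cancel_left] at this
    exact this
  refine key.trans ?_
  rw [integral_add' j3 i3, integral_add' j2 i5, integral_sub' j1 i1, integral_add' i0 i2,
    integral_const_mul, integral_const_mul, integral_const_mul, integral_const_mul,
    h.orthogonal_bias]
  have h1 := mul_le_mul_of_nonneg_left h.bias_le (half_pos hp.γ_pos).le
  have h2 := mul_le_mul_of_nonneg_left h.noise_le (half_pos hp.γ_pos).le
  linarith

lemma strongly_convex_le {xs : X} (hmin : ∀ x, outer f g xs ≤ outer f g x)
    {m η η' : ℝ} (hm : 0 ≤ m) (hη : 0 < η) (hη' : 0 < η')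
    (hstep : η' = η + p.γ * η' * (m - η))
    (hsc : ∀ x x', outer f g x - outer f g x' ≤
      inner ℝ (gradient (outer f g) x) (x - x') - m / 2 * ‖x - x'‖ ^ 2) :
    η' / 2 * (∫ ω, ‖x' ω - xs‖ ^ 2 ∂μ)
        + p.γ * η' * (∫ ω, outer f g (x' ω) ∂μ - outer f g xs)
      ≤ (1 - p.γ * η' + p.γ * η' / 4) * (η / 2) * (∫ ω, ‖x ω - xs‖ ^ 2 ∂μ)
        + (p.γ * (p.γ * η') + 2 * (p.γ * η') / η) * B + p.γ * (p.γ * η') * V := by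
  have hG := memLp_gradient_outer hp hr h.memLp_x
  have hx' := h.memLp_next hp hr
  have hc := memLp_const (μ := μ) (p := 2) xs
  have i0 := integrable_outer hp hr hx'
  have i1 := ((h.memLp_x.sub hc).integrable_norm_sq).const_mul
    ((1 - p.γ * η' + p.γ * η' / 4) * (η / 2))
  have i2 := h.memLp_bias.integrable_norm_sq.const_mul (p.γ * (p.γ * η') + 2 * (p.γ * η') / η)
  have i3 := h.memLp_noise.integrable_norm_sq.const_mul (p.γ * (p.γ * η'))
  have i4 := (integrable_inner_of_memLp h.memLp_bias h.memLp_noise).const_mul (2 * p.γ)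
  have i5 := (integrable_inner_of_memLp hG h.memLp_noise).const_mul p.γ
  have i6 := integrable_inner_of_memLp (h.memLp_x.sub hc) h.memLp_noise
  have i7 := i5.sub i6
  have i8 := (i4.add i7).const_mul (p.γ * η')
  have k1 := ((hx'.sub hc).integrable_norm_sq).const_mul (η' / 2)
  have k3 := i0.sub (integrable_const (outer f g xs))
  have k2 := k3.const_mul (p.γ * η')
  have key := integral_mono (k1.add k2) (((i1.add i2).add i3).add i8) fun ω => by
    have := outer_step_strongly_convex hp hr hmin hm hη hη' hstep hsc (x ω)
      (gradient (outer f g) (x ω) + e ω) (ν ω)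
    rw [← h.eq, add_sub_cancel_left, inner_sub_left (p.γ • gradient (outer f g) (x ω)),
      real_inner_smul_left] at this
    exact this
  rw [integral_add' k1 k2, integral_const_mul, integral_const_mul, integral_sub' i0
    (integrable_const _), integral_const, probReal_univ, one_smul,
    integral_add' ((i1.add i2).add i3) i8, integral_add' (i1.add i2) i3, integral_add' i1 i2,
    integral_const_mul, integral_const_mul, integral_const_mul, integral_const_mul,
    integral_add' i4 i7, integral_sub' i5 i6, integral_const_mul, integral_const_mul,
    h.orthogonal_bias, h.orthogonal_gradient] at key
  have h0 := h.orthogonal_sub xs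
  simp only [Pi.sub_apply] at key
  rw [h0] at key
  have hδ : 0 < p.γ * η' := mul_pos hp.γ_pos hη'
  have h1 := mul_le_mul_of_nonneg_left h.bias_le
    (show 0 ≤ p.γ * (p.γ * η') + 2 * (p.γ * η') / η by have := hp.γ_pos; positivity)
  have h2 := mul_le_mul_of_nonneg_left h.noise_le (mul_pos hp.γ_pos hδ).le
  linarith

end IsOuterStep

end ExpectedStep

end AmIGO

namespace AmIGO

/-! ### Recursions of the warm-start errors -/

section Recursions

variable {X Y Ξ Ω : Type*}
  [NormedAddCommGroup X] [InnerProductSpace ℝ X] [CompleteSpace X] [FiniteDimensional ℝ X]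
  [MeasurableSpace X] [BorelSpace X]
  [NormedAddCommGroup Y] [InnerProductSpace ℝ Y] [CompleteSpace Y] [FiniteDimensional ℝ Y]
  [MeasurableSpace Y] [BorelSpace Y]
  [MeasurableSpace Ξ] [MeasurableSpace Ω]
  {μ : Measure Ω} [IsProbabilityMeasure μ]
  {p : Params} {f g : X → Y → ℝ} {fhat ghat : X → Y → Ξ → ℝ} {P : Measure Ξ}
  [IsProbabilityMeasure P]

section State

variable {Q : Type*} [MeasurableSpace Q] {q₀ : Ω → Q} {ξ : SampleIdx → Ω → Ξ}
  (hp : p.Admissible) (hr : RegularProblem p f g)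
  (hm : StochasticModel f g fhat ghat P) (hn : GradientNoise p f g fhat ghat P)
  (hn2 : HessianNoise p g ghat P) (hs : IsSampling μ P q₀ ξ) (k N : ℕ)
  {x : Ω → X} {y z : Ω → Y} {S : Set (Option SampleIdx)}
include hp hr hm hn hn2 hs

/-- The solver and gradient batches are fresh with respect to the state, which provides the three
orthogonality relations. -/
lemma isOuterStep_psiHat (hx : Measurable[observed q₀ ξ S] x) (hy : Measurable[observed q₀ ξ S] y)
    (hz : Measurable[observed q₀ ξ S] z) (hS : Disjoint S (solverLabels k))
    (hx2 : MemLp x 2 μ) (hy2 : MemLp y 2 μ) (hz2 : MemLp z 2 μ) :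
    IsOuterStep μ p f g x (fun ω => x ω - p.γ • psiHat p N fhat ghat (samplesF p ξ k ω)
        (samplesYY p ξ k ω) (samplesXY p ξ k ω) (x ω) (y ω) (z ω))
      (fun ω => psiMean p N f g (x ω) (y ω) (z ω) - gradient (outer f g) (x ω))
      (fun ω => psiHat p N fhat ghat (samplesF p ξ k ω) (samplesYY p ξ k ω)
        (samplesXY p ξ k ω) (x ω) (y ω) (z ω) - psiMean p N f g (x ω) (y ω) (z ω))
      (p.biasBound N (∫ ω, ‖y ω - yStar g (x ω)‖ ^ 2 ∂μ)
        (∫ ω, ‖z ω - zStar f g (x ω) (y ω)‖ ^ 2 ∂μ))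
      (p.varBound N (∫ ω, ‖z ω - zStar f g (x ω) (y ω)‖ ^ 2 ∂μ)) := by
  have hx' := hs.measurable_of_observed hx
  have hy' := hs.measurable_of_observed hy
  have hz' := hs.measurable_of_observed hz
  have hd := (hz2.sub (memLp_zStar hp hr hx' hy')).integrable_norm_sq
  have hvar := psiHat_variance hp hr hm hn hs k hn2 N hx hy hz hS hd
  have hbias := memLp_bias hp hr N hx' hy' hz' hx2 hy2 hz2
  have hG := continuous_gradient_outer hp hr
  have hν : Measurable fun ω => psiHat p N fhat ghat (samplesF p ξ k ω) (samplesYY p ξ k ω)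
        (samplesXY p ξ k ω) (x ω) (y ω) (z ω) - psiMean p N f g (x ω) (y ω) (z ω) := by
    have h1 := (continuous_psiMean hp hr N).measurable.comp (hx'.prodMk (hy'.prodMk hz'))
    exact (measurable_psiHat hm N hx' hy' hz' (hs.measurable_of_observed
      (measurable_solverSamples (p := p) (q₀ := q₀) (ξ := ξ) k))).sub h1
  refine ⟨fun ω => ?_, hx2, hbias, ?_, ?_, ?_, fun c => ?_,
    integral_sq_bias_le hp hr N hx' hy' hz' hx2 hy2 hz2, hvar.2⟩
  · congr 2
    abel
  · exact (memLp_two_iff_integrable_sq_norm hν.aestronglyMeasurable).mpr hvar.1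
  · exact (integral_inner_psiHat_sub hp hr hm hn hs k hn2 N hx hy hz hS hd
      (w := fun q => psiMean p N f g q.1 q.2.1 q.2.2 - gradient (outer f g) q.1)
      ((continuous_psiMean hp hr N).sub (hG.comp continuous_fst)).measurable hbias).2
  · exact (integral_inner_psiHat_sub hp hr hm hn hs k hn2 N hx hy hz hS hd
      (w := fun q => gradient (outer f g) q.1)
      (hG.comp continuous_fst).measurable (memLp_gradient_outer hp hr hx2)).2
  · exact (integral_inner_psiHat_sub hp hr hm hn hs k hn2 N hx hy hz hS hd
      (w := fun q => q.1 - c) (measurable_fst.sub_const c) (hx2.sub (memLp_const c))).2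

end State

variable {q₀ : Ω → X × Y × Y} {ξ : SampleIdx → Ω → Ξ}
  (hp : p.Admissible) (hr : RegularProblem p f g)
  (hm : StochasticModel f g fhat ghat P) (hn : GradientNoise p f g fhat ghat P)
  (hn2 : HessianNoise p g ghat P) (hs : IsSampling μ P q₀ ξ) (hq2 : MemLp q₀ 2 μ) (T N : ℕ)

section MeasurableIterates

include hm

lemma measurable_run (k : ℕ) :
    Measurable[observed q₀ ξ (pastLabels k)] (xIter p T N fhat ghat q₀ ξ k) ∧
    Measurable[observed q₀ ξ (pastLabels k)] (yInit p T N fhat ghat q₀ ξ k) ∧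
    Measurable[observed q₀ ξ (pastLabels k)] (zInit p T N fhat ghat q₀ ξ k) := by
  induction k with
  | zero =>
    -- `none` belongs to `pastLabels 0` vacuously, so the starting point is part of every past.
    have h0 : Measurable[observed q₀ ξ (pastLabels 0)] q₀ :=
      measurable_start_observed fun i hi => by cases hi
    exact ⟨h0.fst, h0.snd.fst, h0.snd.snd⟩
  | succ k ih =>
    have hle : observed q₀ ξ (pastLabels k) ≤ observed q₀ ξ (pastLabels (k + 1)) :=
      observed_mono (Set.subset_union_left.trans (union_subset_pastLabels_succ k))
    have hx := ih.1.mono hle le_rfl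
    have hy := ih.2.1.mono hle le_rfl
    have hz := ih.2.2.mono hle le_rfl
    have hy' : Measurable[observed q₀ ξ (pastLabels (k + 1))] (yIter p T N fhat ghat q₀ ξ k) :=
      measurable_descent hm k T hx hy
        (Set.subset_union_right.trans (union_subset_pastLabels_succ k))
    have hD : Measurable[observed q₀ ξ (pastLabels (k + 1))] (solverSamples p ξ k) :=
      (measurable_solverSamples k).mono (observed_mono (solverLabels_subset_pastLabels_succ k))
        le_rfl
    have h1 := measurable_psiHat hm N hx hy' hz hD
    have h2 := measurable_zStep hm N hx hy' hz hD
    exact ⟨hx.sub (h1.const_smul p.γ), hy', h2⟩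

/-- The output y_k of the descent uses the batches of iteration k labelled `g`, but none of those
that follow. This is the state on which the rest of the iteration is conditioned. -/
lemma measurable_state (k : ℕ) :
    Measurable[observed q₀ ξ (pastLabels k ∪ descentLabels k)] (xIter p T N fhat ghat q₀ ξ k) ∧
    Measurable[observed q₀ ξ (pastLabels k ∪ descentLabels k)] (yIter p T N fhat ghat q₀ ξ k) ∧
    Measurable[observed q₀ ξ (pastLabels k ∪ descentLabels k)] (zInit p T N fhat ghat q₀ ξ k) := by
  have hle : observed q₀ ξ (pastLabels k) ≤ observed q₀ ξ (pastLabels k ∪ descentLabels k) :=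
    observed_mono Set.subset_union_left
  obtain ⟨hx, hy, hz⟩ := measurable_run (p := p) (q₀ := q₀) (ξ := ξ) hm T N k
  exact ⟨hx.mono hle le_rfl, measurable_descent hm k T (hx.mono hle le_rfl) (hy.mono hle le_rfl)
    Set.subset_union_right, hz.mono hle le_rfl⟩

end MeasurableIterates

section

include hp hr hm hn hs

lemma memLp_yIter_sub (k : ℕ) (hx : MemLp (xIter p T N fhat ghat q₀ ξ k) 2 μ)
    (hy : MemLp (yInit p T N fhat ghat q₀ ξ k) 2 μ) :
    MemLp (fun ω => yIter p T N fhat ghat q₀ ξ k ω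
      - yStar g (xIter p T N fhat ghat q₀ ξ k ω)) 2 μ := by
  obtain ⟨hx', hy', hz'⟩ := measurable_run (p := p) (q₀ := q₀) (ξ := ξ) hm T N k
  have hm2 := (measurable_state (p := p) (q₀ := q₀) (ξ := ξ) hm T N k).2.1
  have h1 : Measurable fun ω => yIter p T N fhat ghat q₀ ξ k ω
      - yStar g (xIter p T N fhat ghat q₀ ξ k ω) :=
    (hs.measurable_of_observed hm2).sub
      ((continuous_yStar hp hr).measurable.comp (hs.measurable_of_observed hx'))
  exact (memLp_two_iff_integrable_sq_norm h1.aestronglyMeasurable).mpr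
    (descent_error hp hr hm hn hs k T hx' hy' (disjoint_pastLabels_descentLabels k) hx hy).1

lemma memLp_yIter (k : ℕ) (hx : MemLp (xIter p T N fhat ghat q₀ ξ k) 2 μ)
    (hy : MemLp (yInit p T N fhat ghat q₀ ξ k) 2 μ) :
    MemLp (yIter p T N fhat ghat q₀ ξ k) 2 μ := by
  have h2 : MemLp (fun ω => (yIter p T N fhat ghat q₀ ξ k ω
      - yStar g (xIter p T N fhat ghat q₀ ξ k ω)) + yStar g (xIter p T N fhat ghat q₀ ξ k ω)) 2 μ :=
    (memLp_yIter_sub hp hr hm hn hs T N k hx hy).add (memLp_yStar hp hr hx)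
  simpa using h2

include hn2

lemma isOuterStep_of_memLp (k : ℕ) (hx : MemLp (xIter p T N fhat ghat q₀ ξ k) 2 μ)
    (hy : MemLp (yInit p T N fhat ghat q₀ ξ k) 2 μ)
    (hz : MemLp (zInit p T N fhat ghat q₀ ξ k) 2 μ) : ∃ e ν : Ω → X,
    IsOuterStep μ p f g (xIter p T N fhat ghat q₀ ξ k) (xIter p T N fhat ghat q₀ ξ (k + 1)) e ν
      (p.biasBound N (∫ ω, ‖yIter p T N fhat ghat q₀ ξ k ω
          - yStar g (xIter p T N fhat ghat q₀ ξ k ω)‖ ^ 2 ∂μ)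
        (Ez p T N fhat ghat q₀ ξ μ f g k))
      (p.varBound N (Ez p T N fhat ghat q₀ ξ μ f g k)) := by
  obtain ⟨hx', hy', hz'⟩ := measurable_state (p := p) (q₀ := q₀) (ξ := ξ) hm T N k
  exact ⟨_, _, isOuterStep_psiHat hp hr hm hn hn2 hs k N hx' hy' hz'
    (disjoint_union_solverLabels k) hx (memLp_yIter hp hr hm hn hs T N k hx hy) hz⟩

/-- `zInit` at k + 1 is the output z_k of iteration k; here it is compared with the target z*(x_k,
y_k) for which it was computed. -/
lemma memLp_zInit_succ_sub (k : ℕ) (hz : MemLp (zInit p T N fhat ghat q₀ ξ k) 2 μ) :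
    MemLp (fun ω => zInit p T N fhat ghat q₀ ξ (k + 1) ω
      - zStar f g (xIter p T N fhat ghat q₀ ξ k ω) (yIter p T N fhat ghat q₀ ξ k ω)) 2 μ ∧
    ∫ ω, ‖zInit p T N fhat ghat q₀ ξ (k + 1) ω
      - zStar f g (xIter p T N fhat ghat q₀ ξ k ω) (yIter p T N fhat ghat q₀ ξ k ω)‖ ^ 2 ∂μ
      ≤ p.zNoise + 3 * (1 - p.β * p.μg) ^ N * Ez p T N fhat ghat q₀ ξ μ f g k := by
  obtain ⟨hx', hy', hz'⟩ := measurable_state (p := p) (q₀ := q₀) (ξ := ξ) hm T N k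
  have hxm := hs.measurable_of_observed hx'
  have hym := hs.measurable_of_observed hy'
  have hzm := hs.measurable_of_observed
    (measurable_run (p := p) (q₀ := q₀) (ξ := ξ) hm T N (k + 1)).2.2
  have hd := (hz.sub (memLp_zStar (μ := μ) hp hr hxm hym)).integrable_norm_sq
  obtain ⟨h1, h2⟩ := solver_error hp hr hm hn hs k hn2 N hx' hy' hz'
    (disjoint_union_solverLabels k) hd
  have h3 : Measurable fun ω => zInit p T N fhat ghat q₀ ξ (k + 1) ω
      - zStar f g (xIter p T N fhat ghat q₀ ξ k ω) (yIter p T N fhat ghat q₀ ξ k ω) := by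
    have h4 := (continuous_zStar hp hr).measurable.comp (hxm.prodMk hym)
    exact hzm.sub h4
  exact ⟨(memLp_two_iff_integrable_sq_norm h3.aestronglyMeasurable).mpr h1, h2⟩

include hq2

/-- Each component is a square-integrable error plus its target; the target y* is Lipschitz in x,
and z* is bounded. -/
lemma memLp_run (k : ℕ) :
    MemLp (xIter p T N fhat ghat q₀ ξ k) 2 μ ∧ MemLp (yInit p T N fhat ghat q₀ ξ k) 2 μ ∧
    MemLp (zInit p T N fhat ghat q₀ ξ k) 2 μ := by
  induction k with
  | zero => exact ⟨hq2.fst, hq2.snd.fst, hq2.snd.snd⟩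
  | succ k ih =>
    obtain ⟨hx, hy, hz⟩ := ih
    obtain ⟨e, ν, h⟩ := isOuterStep_of_memLp hp hr hm hn hn2 hs T N k hx hy hz
    refine ⟨h.memLp_next hp hr, memLp_yIter hp hr hm hn hs T N k hx hy, ?_⟩
    obtain ⟨hx', hy', -⟩ := measurable_state (p := p) (q₀ := q₀) (ξ := ξ) hm T N k
    have h2 : MemLp (fun ω => (zInit p T N fhat ghat q₀ ξ (k + 1) ω
        - zStar f g (xIter p T N fhat ghat q₀ ξ k ω) (yIter p T N fhat ghat q₀ ξ k ω))
        + zStar f g (xIter p T N fhat ghat q₀ ξ k ω) (yIter p T N fhat ghat q₀ ξ k ω)) 2 μ :=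
      (memLp_zInit_succ_sub hp hr hm hn hn2 hs T N k hz).1.add
        (memLp_zStar hp hr (hs.measurable_of_observed hx') (hs.measurable_of_observed hy'))
    simpa using h2

lemma exists_isOuterStep (k : ℕ) : ∃ e ν : Ω → X,
    IsOuterStep μ p f g (xIter p T N fhat ghat q₀ ξ k) (xIter p T N fhat ghat q₀ ξ (k + 1)) e ν
      (p.biasBound N (∫ ω, ‖yIter p T N fhat ghat q₀ ξ k ω
          - yStar g (xIter p T N fhat ghat q₀ ξ k ω)‖ ^ 2 ∂μ)
        (Ez p T N fhat ghat q₀ ξ μ f g k))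
      (p.varBound N (Ez p T N fhat ghat q₀ ξ μ f g k)) := by
  obtain ⟨hx, hy, hz⟩ := memLp_run hp hr hm hn hn2 hs hq2 T N k
  exact isOuterStep_of_memLp hp hr hm hn hn2 hs T N k hx hy hz

lemma memLp_xHat (k : ℕ) : MemLp (xHat p T N fhat ghat q₀ ξ k) 2 μ := by
  induction k with
  | zero => exact (memLp_run hp hr hm hn hn2 hs hq2 T N 0).1
  | succ k ih =>
    exact (ih.const_smul (p.u * (1 - p.δ (k + 1)))).add
      ((memLp_run hp hr hm hn hn2 hs hq2 T N (k + 1)).1.const_smul (1 - p.u * (1 - p.δ (k + 1))))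

lemma finiteEnergy (k : ℕ) : FiniteEnergy p T N fhat ghat q₀ ξ μ f g k := by
  obtain ⟨hx, hy, hz⟩ := memLp_run hp hr hm hn hn2 hs hq2 T N k
  obtain ⟨hx', hy', -⟩ := measurable_state (p := p) (q₀ := q₀) (ξ := ξ) hm T N k
  exact ⟨(hx.sub (memLp_const _)).integrable_norm_sq, integrable_outer hp hr hx,
    integrable_outer hp hr (memLp_xHat hp hr hm hn hn2 hs hq2 T N k),
    (memLp_gradient_outer hp hr hx).integrable_norm_sq,
    (hy.sub (memLp_yStar hp hr hx)).integrable_norm_sq,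
    (hz.sub (memLp_zStar hp hr (hs.measurable_of_observed hx')
      (hs.measurable_of_observed hy'))).integrable_norm_sq⟩

lemma integral_sq_yIter_sub_le (k : ℕ) :
    ∫ ω, ‖yIter p T N fhat ghat q₀ ξ k ω - yStar g (xIter p T N fhat ghat q₀ ξ k ω)‖ ^ 2 ∂μ
      ≤ ((1 - p.α * p.μg) ^ T) ^ 2 * Ey p T N fhat ghat q₀ ξ μ g k
        + p.varg / (p.μg * p.Lg) := by
  obtain ⟨hx, hy, hz⟩ := memLp_run hp hr hm hn hn2 hs hq2 T N k
  obtain ⟨hx', hy', hz'⟩ := measurable_run (p := p) (q₀ := q₀) (ξ := ξ) hm T N k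
  exact (descent_error hp hr hm hn hs k T hx' hy' (disjoint_pastLabels_descentLabels k) hx hy).2

/-- The warm start y_k is close to y*(x_k), and the target moves by at most L_y times the
displacement of x. -/
lemma Ey_succ_le (k : ℕ) : Ey p T N fhat ghat q₀ ξ μ g (k + 1)
    ≤ 2 * (∫ ω, ‖yIter p T N fhat ghat q₀ ξ k ω
        - yStar g (xIter p T N fhat ghat q₀ ξ k ω)‖ ^ 2 ∂μ)
      + 2 * p.Ly ^ 2 * ∫ ω, ‖xIter p T N fhat ghat q₀ ξ (k + 1) ω
        - xIter p T N fhat ghat q₀ ξ k ω‖ ^ 2 ∂μ := by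
  obtain ⟨hx, hy, hz⟩ := memLp_run hp hr hm hn hn2 hs hq2 T N k
  obtain ⟨hx2, hy2, hz2⟩ := memLp_run hp hr hm hn hn2 hs hq2 T N (k + 1)
  have i1 := (memLp_yIter_sub hp hr hm hn hs T N k hx hy).integrable_norm_sq
  have i2 := (hx2.sub hx).integrable_norm_sq
  refine (integral_mono (hy2.sub (memLp_yStar hp hr hx2)).integrable_norm_sq
    ((i1.const_mul 2).add (i2.const_mul (2 * p.Ly ^ 2))) fun ω => ?_).trans (le_of_eq ?_)
  · have h1 := norm_yStar_sub_le hp hr (xIter p T N fhat ghat q₀ ξ (k + 1) ω)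
      (xIter p T N fhat ghat q₀ ξ k ω)
    have h2 := norm_sub_le_norm_sub_add_norm_sub (yIter p T N fhat ghat q₀ ξ k ω)
      (yStar g (xIter p T N fhat ghat q₀ ξ k ω))
      (yStar g (xIter p T N fhat ghat q₀ ξ (k + 1) ω))
    rw [norm_sub_rev (yStar g (xIter p T N fhat ghat q₀ ξ k ω))] at h2
    have h3 : ‖yIter p T N fhat ghat q₀ ξ k ω
        - yStar g (xIter p T N fhat ghat q₀ ξ (k + 1) ω)‖ ^ 2
        ≤ (‖yIter p T N fhat ghat q₀ ξ k ω - yStar g (xIter p T N fhat ghat q₀ ξ k ω)‖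
          + p.Ly * ‖xIter p T N fhat ghat q₀ ξ (k + 1) ω
            - xIter p T N fhat ghat q₀ ξ k ω‖) ^ 2 :=
      pow_le_pow_left₀ (norm_nonneg _) (h2.trans (by linarith)) 2
    refine h3.trans ?_
    simp only [Pi.add_apply, Pi.sub_apply]
    nlinarith [sq_nonneg (‖yIter p T N fhat ghat q₀ ξ k ω
        - yStar g (xIter p T N fhat ghat q₀ ξ k ω)‖
          - p.Ly * ‖xIter p T N fhat ghat q₀ ξ (k + 1) ω - xIter p T N fhat ghat q₀ ξ k ω‖)]
  · rw [integral_add' (i1.const_mul 2) (i2.const_mul _), integral_const_mul, integral_const_mul]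
    rfl

/-- The target z*(x, y) moves with x and with y. The move from y_k to y_{k+1} is split through
y*(x_k) and y*(x_{k+1}), which brings in the error of the next inner descent as well. -/
lemma Ez_succ_le (k : ℕ) : Ez p T N fhat ghat q₀ ξ μ f g (k + 1)
    ≤ 2 * (p.zNoise + 3 * (1 - p.β * p.μg) ^ N * Ez p T N fhat ghat q₀ ξ μ f g k)
      + 2 * p.Lz ^ 2 * ((1 + 3 * p.Ly ^ 2) * (∫ ω, ‖xIter p T N fhat ghat q₀ ξ (k + 1) ω
          - xIter p T N fhat ghat q₀ ξ k ω‖ ^ 2 ∂μ)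
        + 3 * (∫ ω, ‖yIter p T N fhat ghat q₀ ξ (k + 1) ω
          - yStar g (xIter p T N fhat ghat q₀ ξ (k + 1) ω)‖ ^ 2 ∂μ)
        + 3 * ∫ ω, ‖yIter p T N fhat ghat q₀ ξ k ω
          - yStar g (xIter p T N fhat ghat q₀ ξ k ω)‖ ^ 2 ∂μ) := by
  obtain ⟨hx, hy, hz⟩ := memLp_run hp hr hm hn hn2 hs hq2 T N k
  obtain ⟨hx2, hy2, hz2⟩ := memLp_run hp hr hm hn hn2 hs hq2 T N (k + 1)
  have i1 := (memLp_yIter_sub hp hr hm hn hs T N k hx hy).integrable_norm_sq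
  have i1' := (memLp_yIter_sub hp hr hm hn hs T N (k + 1) hx2 hy2).integrable_norm_sq
  have i2 := (hx2.sub hx).integrable_norm_sq
  obtain ⟨j1, j2⟩ := memLp_zInit_succ_sub hp hr hm hn hn2 hs T N k hz
  have j3 := j1.integrable_norm_sq
  have i3 := (((i2.const_mul (1 + 3 * p.Ly ^ 2)).add (i1'.const_mul 3)).add
    (i1.const_mul 3)).const_mul (2 * p.Lz ^ 2)
  refine (integral_mono (finiteEnergy hp hr hm hn hn2 hs hq2 T N (k + 1)).err_z
    ((j3.const_mul 2).add i3) fun ω => ?_).trans ?_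
  · simp only [Pi.add_apply, Pi.sub_apply]
    set x := xIter p T N fhat ghat q₀ ξ k ω
    set x' := xIter p T N fhat ghat q₀ ξ (k + 1) ω
    set y := yIter p T N fhat ghat q₀ ξ k ω
    set y' := yIter p T N fhat ghat q₀ ξ (k + 1) ω
    set z := zInit p T N fhat ghat q₀ ξ (k + 1) ω
    have h1 := norm_yStar_sub_le hp hr x' x
    have h2 := norm_zStar_sub_le hp hr x x' y y'
    have h3 : y - y' = (y - yStar g x) + (yStar g x - yStar g x') + (yStar g x' - y') := by abel
    have h4 : ‖y - y'‖ ≤ ‖y - yStar g x‖ + p.Ly * ‖x' - x‖ + ‖y' - yStar g x'‖ := by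
      rw [h3]
      refine (norm_add₃_le).trans ?_
      rw [norm_sub_rev (yStar g x), norm_sub_rev _ y']
      linarith
    have h5 : ‖y - y'‖ ^ 2
        ≤ 3 * (‖y - yStar g x‖ ^ 2 + p.Ly ^ 2 * ‖x' - x‖ ^ 2 + ‖y' - yStar g x'‖ ^ 2) := by
      refine (pow_le_pow_left₀ (norm_nonneg _) h4 2).trans ?_
      nlinarith [sq_nonneg (‖y - yStar g x‖ - p.Ly * ‖x' - x‖),
        sq_nonneg (‖y - yStar g x‖ - ‖y' - yStar g x'‖),
        sq_nonneg (‖y' - yStar g x'‖ - p.Ly * ‖x' - x‖)]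
    have h6 : ‖zStar f g x y - zStar f g x' y'‖ ^ 2
        ≤ p.Lz ^ 2 * (‖x' - x‖ ^ 2 + ‖y - y'‖ ^ 2) := by
      rw [norm_sub_rev x' x, ← pairNorm_sq, ← mul_pow]
      exact pow_le_pow_left₀ (norm_nonneg _) h2 2
    have h7 := mul_le_mul_of_nonneg_left h5 (sq_nonneg p.Lz)
    have h8 := norm_sub_le_norm_sub_add_norm_sub z (zStar f g x y) (zStar f g x' y')
    have h9 := pow_le_pow_left₀ (norm_nonneg _) h8 2
    nlinarith [sq_nonneg (‖z - zStar f g x y‖ - ‖zStar f g x y - zStar f g x' y'‖)]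
  · rw [integral_add' (j3.const_mul 2) i3, integral_const_mul, integral_const_mul,
      integral_add' ((i2.const_mul _).add (i1'.const_mul 3)) (i1.const_mul 3),
      integral_add' (i2.const_mul _) (i1'.const_mul 3), integral_const_mul, integral_const_mul,
      integral_const_mul]
    exact add_le_add_left (mul_le_mul_of_nonneg_left j2 zero_le_two) _

end

end Recursions

end AmIGO

/-! ### Bookkeeping of the weighted errors -/

namespace AmIGO

/-- The three terms are the contributions of Y through the next y-error, the next z-error and the
bias. The bracket is at most half of 6η₀ + 24Q; one of the four factors l reduces it to η₀/2, and l³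
≤ l. -/
lemma absorb_descent_error {η₀ l Q b : ℝ} (hη₀ : 0 < η₀) (hl : 0 ≤ l) (hl1 : l ≤ 1) (hQ : 0 ≤ Q)
    (hl2 : l * (6 * η₀ + 24 * Q) ≤ η₀) (hb : 32 * b ≤ 1) :
    (2 * l * η₀ + 18 * b * η₀ + 36 / 5 * Q) * l ^ 4 ≤ 1 / 2 * (η₀ * l) := by
  have h19 : 2 * l * η₀ ≤ 2 * η₀ := by nlinarith
  have h20 : 18 * b * η₀ ≤ 9 / 16 * η₀ := by nlinarith
  have h21 : (2 * l * η₀ + 18 * b * η₀ + 36 / 5 * Q) * l ^ 4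
      ≤ (3 * η₀ + 12 * Q) * l ^ 4 := by
    refine mul_le_mul_of_nonneg_right ?_ (by positivity)
    linarith
  have h22 : (3 * η₀ + 12 * Q) * l ^ 4 = 1 / 2 * (l * (6 * η₀ + 24 * Q)) * (l ^ 3) := by ring
  have h23 : 1 / 2 * (l * (6 * η₀ + 24 * Q)) * (l ^ 3) ≤ 1 / 2 * η₀ * l := by
    have h24 : l ^ 3 ≤ l := by
      have := mul_le_of_le_one_left hl (pow_le_one₀ hl hl1 (n := 2))
      calc l ^ 3 = l ^ 2 * l := by ring
        _ ≤ l := this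
    exact mul_le_mul (by linarith) h24 (by positivity) (by positivity)
  linarith

/-- The three terms are the contributions of Z through the next z-error, the bias and the variance.
Since ρ ≤ π⁴ and π ≤ 1/4, there are enough spare powers of π to absorb the constants Q and σ. -/
lemma absorb_solver_error {η₀ π ρ Q σ : ℝ} (hη₀ : 0 < η₀) (hπ : 0 ≤ π) (hρ : 0 ≤ ρ)
    (hρπ : ρ ≤ π ^ 4) (hQ : 0 ≤ Q) (hσ : 0 ≤ σ)
    (hπ2 : π * (4 * η₀ + 12 * (2 * Q + σ)) ≤ η₀) :
    6 * η₀ * π * ρ + 36 / 5 * Q * ρ ^ 2 + 5 * ρ * σ ≤ 1 / 2 * (η₀ * π) := by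
  have hπ4 : π ≤ 1 / 4 := by nlinarith [mul_nonneg hπ hQ, mul_nonneg hπ hσ]
  have hπ3 : π ^ 3 ≤ 1 / 64 := by
    calc π ^ 3 ≤ (1 / 4) ^ 3 := pow_le_pow_left₀ hπ hπ4 3
      _ = 1 / 64 := by norm_num
  have h27 : ρ ≤ 1 / 64 * π := by
    have : π ^ 4 = π ^ 3 * π := by ring
    have := mul_le_mul_of_nonneg_right hπ3 hπ
    linarith
  have h28 : ρ ≤ 1 := by linarith
  have h29 : 36 / 5 * Q * ρ ^ 2 ≤ 36 / 5 * Q * ρ := by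
    gcongr
    nlinarith
  have h30 : 6 * η₀ * π * ρ + 36 / 5 * Q * ρ ^ 2 + 5 * ρ * σ
      ≤ (6 * η₀ * π + 36 / 5 * Q + 5 * σ) * ρ := by linarith
  have h33 : 0 ≤ π * Q := by positivity
  have h34 : 0 ≤ π * σ := by positivity
  have h35 : π * (π * (4 * η₀ + 12 * (2 * Q + σ))) ≤ π * η₀ := by gcongr
  have h37 : ρ ≤ π ^ 2 * (1 / 16) := by
    have : π ^ 4 = π ^ 2 * π ^ 2 := by ring
    have : π ^ 2 ≤ 1 / 16 := by nlinarith
    nlinarith [sq_nonneg π]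
  have h38 : (36 / 5 * Q + 5 * σ) * ρ ≤ (36 / 5 * Q + 5 * σ) * (π ^ 2 * (1 / 16)) := by gcongr
  have h39 : 6 * η₀ * π * ρ ≤ 6 * η₀ * π * (1 / 64) := by
    gcongr
    linarith
  have h40 : 0 ≤ π ^ 2 * η₀ := by positivity
  have h41 : 0 ≤ π ^ 2 * Q := by positivity
  have h42 : 0 ≤ π ^ 2 * σ := by positivity
  nlinarith

/-- The recursions of the warm-start errors, weighted by `γ η₀ l` and `γ η₀ π`: half of the
weighted errors pays for the bias and the variance of the gradient estimate. -/
lemma weighted_errors_le {γ η₀ l π e ρ Q y2 z2 σ w n v cB cV q Y Z s s' D G Y' Z' Bb Vb : ℝ}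
    (hγ : 0 < γ) (hη₀ : 0 < η₀) (hl : 0 ≤ l) (hl1 : l ≤ 1) (hπ : 0 ≤ π) (hρ : 0 ≤ ρ)
    (hρπ : ρ ≤ π ^ 4) (hQ : 0 ≤ Q) (hy2 : 0 ≤ y2) (hz2 : 0 ≤ z2)
    (hσ : 0 ≤ σ) (hn : 0 ≤ n) (hY : 0 ≤ Y) (hZ : 0 ≤ Z) (hD0 : 0 ≤ D)
    (hcB : 0 ≤ cB) (hcB' : cB ≤ 7 / 2 * γ) (hcV' : cV ≤ 2 * γ)
    (hq : q = γ * η₀ * (3 * e * y2) * γ ^ 2) (hq0 : 0 ≤ q) (hqγ : q ≤ 3 / 64 * γ)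
    (hl2 : l * (6 * η₀ + 24 * Q) ≤ η₀) (hπ2 : π * (4 * η₀ + 12 * (2 * Q + σ)) ≤ η₀)
    (hle : l ≤ e) (hπe : 2 * π * z2 * (1 + 16 * y2) ≤ e * y2) (hπz : 32 * (π * z2) ≤ 1)
    (hln : l * η₀ ≤ 5 * Q) (hπn : 4 * (π * z2) * η₀ ≤ Q)
    (hs : s ≤ l ^ 4 * Y + n) (hs' : s' ≤ l ^ 4 * Y' + n)
    (hY' : Y' ≤ 2 * s + 2 * y2 * D)
    (hZ' : Z' ≤ 2 * (w + 3 * ρ * Z) + 2 * z2 * ((1 + 3 * y2) * D + 3 * s' + 3 * s))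
    (hD : D ≤ γ ^ 2 * (Vb + 2 * Bb + 2 * G))
    (hBb : Bb = 2 * Q * s + 2 * Q * ρ ^ 2 * Z) (hVb : Vb = v + 2 * ρ * σ * Z) :
    γ * η₀ * l * Y' + γ * η₀ * π * Z' + cB * Bb + cV * Vb
      ≤ 1 / 2 * (γ * η₀ * l * Y) + 1 / 2 * (γ * η₀ * π * Z) + 2 * q * G + (cV + q) * v
        + 2 * (γ * η₀ * π) * w + (16 * γ * Q + 2 * Q * (cB + 2 * q)) * n := by
  have hγη : 0 < γ * η₀ := mul_pos hγ hη₀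
  have hl4 : l ^ 4 ≤ 1 := pow_le_one₀ hl hl1
  -- the next descent error
  have h1' : s' ≤ l ^ 4 * (2 * s + 2 * y2 * D) + n :=
    hs'.trans (by gcongr)
  have hs0 : 0 ≤ 2 * (l ^ 4 * Y + n) + 2 * y2 * D := by positivity
  have h2 : s' ≤ 2 * (l ^ 4 * Y + n) + 2 * y2 * D + n := by
    have h3 : l ^ 4 * (2 * s + 2 * y2 * D) ≤ l ^ 4 * (2 * (l ^ 4 * Y + n) + 2 * y2 * D) := by
      gcongr
    have h4 := mul_le_of_le_one_left hs0 hl4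
    linarith
  have h5 : Y' ≤ 2 * (l ^ 4 * Y + n) + 2 * y2 * D := by linarith
  have h6 : Z' ≤ 2 * (w + 3 * ρ * Z)
      + 2 * z2 * ((1 + 9 * y2) * D + 9 * (l ^ 4 * Y + n) + 3 * n) := by
    refine hZ'.trans (add_le_add_right (mul_le_mul_of_nonneg_left ?_ (by positivity)) _)
    linarith
  have h7 := mul_le_mul_of_nonneg_left h5 (mul_nonneg hγη.le hl)
  have h8 := mul_le_mul_of_nonneg_left h6 (mul_nonneg hγη.le hπ)
  -- the displacement
  have h9 : (2 * l * y2 + 2 * π * z2 * (1 + 9 * y2)) * D ≤ 3 * e * y2 * D := by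
    refine mul_le_mul_of_nonneg_right ?_ hD0
    have h10 : l * y2 ≤ e * y2 := mul_le_mul_of_nonneg_right hle hy2
    have h11 : 0 ≤ π * z2 * y2 := by positivity
    nlinarith
  have he : 0 ≤ e := hl.trans hle
  -- The displacement sends variance, bias and gradient back into the estimate with the weight q, so
  -- that the coefficients become cV + q and cB + 2q.
  have h12 : γ * η₀ * (3 * e * y2) * D ≤ q * (Vb + 2 * Bb + 2 * G) := by
    rw [hq, mul_assoc (γ * η₀ * (3 * e * y2))]
    exact mul_le_mul_of_nonneg_left hD (by positivity)
  have h13 := mul_le_mul_of_nonneg_left h9 hγη.le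
  -- the bias
  have hBb' : Bb ≤ 2 * Q * (l ^ 4 * Y + n) + 2 * Q * ρ ^ 2 * Z := by
    rw [hBb]
    gcongr
  have h14 := mul_le_mul_of_nonneg_left hBb' (by positivity : 0 ≤ cB + 2 * q)
  -- 7/2 + 2 · 3/64 ≤ 18/5, the origin of the constant 36/5 in the two absorption lemmas.
  have hc : cB + 2 * q ≤ 18 / 5 * γ := by linarith
  have h15 : (cB + 2 * q) * (2 * Q * (l ^ 4 * Y)) ≤ 18 / 5 * γ * (2 * Q * (l ^ 4 * Y)) :=
    mul_le_mul_of_nonneg_right hc (by positivity)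
  have h16 : (cB + 2 * q) * (2 * Q * ρ ^ 2 * Z) ≤ 18 / 5 * γ * (2 * Q * ρ ^ 2 * Z) :=
    mul_le_mul_of_nonneg_right hc (by positivity)
  have h17 : (cV + q) * (2 * ρ * σ * Z) ≤ 5 / 2 * γ * (2 * ρ * σ * Z) :=
    mul_le_mul_of_nonneg_right (by linarith) (by positivity)
  have h18 := absorb_descent_error hη₀ hl hl1 hQ hl2 hπz
  have h25 := mul_le_mul_of_nonneg_left h18 (mul_nonneg hγ.le hY)
  have h26 := absorb_solver_error hη₀ hπ hρ hρπ hQ hσ hπ2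
  have h43 := mul_le_mul_of_nonneg_left h26 (mul_nonneg hγ.le hZ)
  -- the noise of the descent
  have h44 : (2 * (l * η₀) + 24 * (π * z2) * η₀) * n ≤ 16 * Q * n :=
    mul_le_mul_of_nonneg_right (by linarith) hn
  have h45 := mul_le_mul_of_nonneg_left h44 hγ.le
  subst hVb
  linarith

end AmIGO

/-! ### Consequences of the numbers of inner iterations -/

namespace AmIGO

lemma exp_neg_half_mul_le_one {A c : ℝ} (hA : 0 < A) (h : 2 * Real.log A ≤ c) :
    Real.exp (-c / 2) * A ≤ 1 := by
  have h1 : Real.exp (-c / 2) ≤ Real.exp (-Real.log A) := Real.exp_le_exp.mpr (by linarith)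
  rw [Real.exp_neg, Real.exp_log hA] at h1
  exact (mul_le_mul_of_nonneg_right h1 hA.le).trans (inv_mul_cancel₀ hA.ne').le

lemma exp_neg_half_le {A c : ℝ} (hA : 0 < A) (h : -2 * Real.log A ≤ c) :
    Real.exp (-c / 2) ≤ A := by
  have h1 : Real.exp (-c / 2) ≤ Real.exp (Real.log A) := Real.exp_le_exp.mpr (by linarith)
  rwa [Real.exp_log hA] at h1

/-- A geometric factor after a logarithmic number of steps. -/
lemma sqrt_one_sub_pow_le {t c : ℝ} {n : ℕ} (ht : t ≤ 1) (h : c ≤ t * n) :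
    √((1 - t) ^ n) ≤ Real.exp (-c / 2) := by
  have h1 : (1 - t) ^ n ≤ Real.exp (-t) ^ n :=
    pow_le_pow_left₀ (by linarith) (Real.one_sub_le_exp_neg t) n
  rw [← Real.exp_nat_mul] at h1
  rw [Real.sqrt_le_left (Real.exp_nonneg _), ← Real.exp_nat_mul]
  refine h1.trans (Real.exp_le_exp.mpr ?_)
  push_cast
  linarith

namespace Params

variable {p : Params}

/-- The weight of the squared displacement of the outer iterates in the energy estimates. -/
noncomputable def driftWeight (p : Params) : ℝ :=
  p.γ * p.η 0 * (3 * Real.exp (-p.C / 2) * p.Ly ^ 2) * p.γ ^ 2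

namespace Admissible

variable (hp : p.Admissible)
include hp

lemma ηmin_pos : 0 < p.ηmin := by
  unfold ηmin
  split_ifs with h
  · exact h
  · exact hp.L_pos

/-- The implicit recursion keeps η between μ and its previous value; the lower bound uses γμ ≤ 1. -/
lemma η_mem (k : ℕ) : p.ηmin ≤ p.η k ∧ p.η k ≤ p.L := by
  by_cases h : 0 < p.μ
  · simp only [ηmin, h, if_true]
    induction k with
    | zero => simpa [η, h] using ⟨hp.η₀_ge h, hp.η₀_le h⟩
    | succ k ih =>
      obtain ⟨h1, h2⟩ := ih
      have h3 : 0 ≤ p.γ * (p.η k - p.μ) := mul_nonneg hp.γ_pos.le (by linarith)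
      have h4 : p.γ * p.μ ≤ 1 := by
        unfold γ
        rw [one_div, inv_mul_le_iff₀ hp.L_pos]
        linarith
      simp only [η, h, if_true]
      constructor
      · rw [le_div_iff₀ (by linarith)]
        nlinarith
      · rw [div_le_iff₀ (by linarith)]
        nlinarith [hp.L_pos]
  · cases k <;> simp [ηmin, η, h]

lemma η_pos (k : ℕ) : 0 < p.η k := hp.ηmin_pos.trans_le (hp.η_mem k).1

lemma η_succ_le (k : ℕ) : p.η (k + 1) ≤ p.η k := by
  by_cases h : 0 < p.μ
  · have h1 := (hp.η_mem k).1
    have h2 := hp.η_pos k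
    simp only [ηmin, h, if_true] at h1
    have h3 : 0 ≤ p.γ * (p.η k - p.μ) := mul_nonneg hp.γ_pos.le (by linarith)
    simp only [η, h, if_true]
    exact div_le_self h2.le (by linarith)
  · cases k <;> simp [η, h]

lemma η_succ_eq (h : 0 < p.μ) (k : ℕ) :
    p.η (k + 1) = p.η k + p.γ * p.η (k + 1) * (p.μ - p.η k) := by
  have h1 := (hp.η_mem k).1
  simp only [ηmin, h, if_true] at h1
  have h3 : 0 ≤ p.γ * (p.η k - p.μ) := mul_nonneg hp.γ_pos.le (by linarith)
  simp only [η, h, if_true]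
  field_simp
  ring

lemma γ_mul_L : p.γ * p.L = 1 := by
  unfold γ
  exact one_div_mul_cancel hp.L_pos.ne'

lemma δ_mem (k : ℕ) : p.γ * p.ηmin ≤ p.δ k ∧ p.δ k ≤ 1 := by
  obtain ⟨h1, h2⟩ := hp.η_mem k
  refine ⟨mul_le_mul_of_nonneg_left h1 hp.γ_pos.le, ?_⟩
  rw [← hp.γ_mul_L]
  exact mul_le_mul_of_nonneg_left h2 hp.γ_pos.le

lemma κL_inv : p.κL⁻¹ = p.γ * p.ηmin := by
  unfold κL γ
  rw [inv_div]
  ring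

lemma ζ₀_pos : 0 < p.ζ₀ := by
  have h1 := hp.η_pos 0
  have h2 := hp.ηmin_pos
  have h3 := hp.L_pos
  unfold ζ₀
  split_ifs <;> positivity

/-- Entries of the maximum that defines `C` are logarithmic forms of smallness conditions on
exp(-C/2), which dominates the weight l. The third fact controls the drift of y*. -/
lemma exp_C_facts :
    Real.exp (-p.C / 2) ≤ 1 ∧
    Real.exp (-p.C / 2) * (6 + 24 * p.Lψ ^ 2 / p.η 0) ≤ 1 ∧
    Real.exp (-p.C / 2) * (32 * p.Ly ^ 2 / p.L ^ 2 * p.ζ₀) ≤ 1 ∧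
    Real.exp (-p.C / 2) ≤ 5 * p.Lψ ^ 2 / p.η 0 := by
  have hη := hp.η_pos 0
  have hψ := hp.Lψ_pos
  have hy := hp.Ly_pos
  have hL := hp.L_pos
  have hζ := hp.ζ₀_pos
  have hA : 0 < 4 * p.Ly ^ 2 / p.L ^ 2 * max (p.η 0) (8 * p.ζ₀) := by
    have : 0 < max (p.η 0) (8 * p.ζ₀) := hη.trans_le (le_max_left _ _)
    positivity
  have h1 : 1 + 2 * Real.log (6 + 24 * p.Lψ ^ 2 / p.η 0) ≤ p.C := le_max_left _ _
  have h2 : 2 * Real.log (1 + 4 * p.Ly ^ 2 / p.L ^ 2 * max (p.η 0) (8 * p.ζ₀)) ≤ p.C :=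
    (le_max_left _ _).trans (le_max_right _ _)
  have h3 : 0 ≤ p.C := (le_max_left _ _).trans ((le_max_right _ _).trans (le_max_right _ _))
  have h4 : -2 * Real.log (5 * p.Lψ ^ 2 / p.η 0) ≤ p.C :=
    (le_max_left _ _).trans ((le_max_right _ _).trans ((le_max_right _ _).trans (le_max_right _ _)))
  refine ⟨Real.exp_le_one_iff.mpr (by linarith), exp_neg_half_mul_le_one (by positivity)
    (by linarith), ?_, exp_neg_half_le (by positivity) h4⟩
  refine le_trans (mul_le_mul_of_nonneg_left ?_ (Real.exp_nonneg _))
    (exp_neg_half_mul_le_one (by positivity) h2)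
  have h5 : 4 * p.Ly ^ 2 / p.L ^ 2 * (8 * p.ζ₀)
      ≤ 4 * p.Ly ^ 2 / p.L ^ 2 * max (p.η 0) (8 * p.ζ₀) := by
    gcongr
    exact le_max_right _ _
  have h6 : 32 * p.Ly ^ 2 / p.L ^ 2 * p.ζ₀ = 4 * p.Ly ^ 2 / p.L ^ 2 * (8 * p.ζ₀) := by ring
  linarith

lemma exp_C'_facts :
    Real.exp (-p.C' / 2) * (4 + 12 * (2 * p.Lψ ^ 2 + p.σx2) / p.η 0) ≤ 1 ∧
    Real.exp (-p.C' / 2) * (2 * p.Lz ^ 2 / p.Ly ^ 2 * (1 + 16 * p.Ly ^ 2)) ≤ 1 ∧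
    Real.exp (-p.C' / 2) ≤ p.Lψ ^ 2 / (4 * p.Lz ^ 2 * p.η 0) ∧
    Real.exp (-p.C' / 2) ≤ p.γ * (p.varxy + p.Lg' ^ 2) * (p.ηmin / p.η 0) := by
  have hη := hp.η_pos 0
  have hψ := hp.Lψ_pos
  have hy := hp.Ly_pos
  have hz := hp.Lz_pos
  have hσ := hp.σx2_nonneg
  have h1 : 1 + 2 * Real.log (4 + 12 * (2 * p.Lψ ^ 2 + p.σx2) / p.η 0) ≤ p.C' := le_max_left _ _
  have h2 : 2 * Real.log (1 + 2 * p.Lz ^ 2 / p.Ly ^ 2 * (1 + 16 * p.Ly ^ 2)) ≤ p.C' :=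
    (le_max_left _ _).trans (le_max_right _ _)
  have h4 : -2 * Real.log (p.Lψ ^ 2 / (4 * p.Lz ^ 2 * p.η 0)) ≤ p.C' :=
    (le_max_left _ _).trans ((le_max_right _ _).trans ((le_max_right _ _).trans (le_max_right _ _)))
  have h5 : -2 * Real.log (p.γ * (p.varxy + p.Lg' ^ 2) * (p.ηmin / p.η 0)) ≤ p.C' :=
    (le_max_right _ _).trans ((le_max_right _ _).trans ((le_max_right _ _).trans (le_max_right _ _)))
  have hA : 0 < p.γ * (p.varxy + p.Lg' ^ 2) * (p.ηmin / p.η 0) := by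
    have := hp.γ_pos
    have := hp.varxy_nonneg
    have := hp.Lg'_pos
    have := hp.ηmin_pos
    positivity
  refine ⟨exp_neg_half_mul_le_one (by positivity) (by linarith), ?_,
    exp_neg_half_le (by positivity) h4, exp_neg_half_le hA h5⟩
  refine le_trans (mul_le_mul_of_nonneg_left ?_ (Real.exp_nonneg _))
    (exp_neg_half_mul_le_one (by positivity) h2)
  linarith

lemma sqrt_descent_le {T : ℕ} (hT : p.Tmin ≤ T) :
    √((1 - p.α * p.μg) ^ T) ≤ Real.exp (-p.C / 2) := by
  have h1 : 0 < p.α * p.μg := by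
    rw [hp.α_mul_μg]
    exact div_pos hp.μg_pos hp.Lg_pos
  refine sqrt_one_sub_pow_le ?_ ?_
  · rw [hp.α_mul_μg]
    exact hp.μg_div_Lg_le
  · have h2 := Nat.lt_floor_add_one (p.C / (p.α * p.μg))
    have h3 : ((⌊p.C / (p.α * p.μg)⌋₊ + 1 : ℕ) : ℝ) ≤ T := Nat.cast_le.mpr hT
    push_cast at h3
    rw [div_lt_iff₀ h1] at h2
    nlinarith

/-- The rate under the root is βμ_g/2, hence the factor 2 in `Nmin`. -/
lemma sqrt_solver_le {N : ℕ} (hN : p.Nmin ≤ N) :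
    √((1 - p.β * p.μg / 2) ^ N) ≤ Real.exp (-p.C / 2) * Real.exp (-p.C' / 2) := by
  have h1 := hp.β_mul_μg_pos
  rw [← Real.exp_add, show -p.C / 2 + -p.C' / 2 = -(p.C + p.C') / 2 by ring]
  refine sqrt_one_sub_pow_le (by linarith [hp.β_mul_μg_le]) ?_
  have h2 := Nat.lt_floor_add_one (2 * (p.C + p.C') / (p.β * p.μg))
  have h3 : ((⌊2 * (p.C + p.C') / (p.β * p.μg)⌋₊ + 1 : ℕ) : ℝ) ≤ N := Nat.cast_le.mpr hN
  push_cast at h3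
  rw [div_lt_iff₀ h1] at h2
  nlinarith

/-- 1 - t ≤ (1 - t/2)². Half the rate in the weight b leaves a fourth power of its root, the same
margin as for the descent. -/
lemma pow_solver_le (N : ℕ) :
    (1 - p.β * p.μg) ^ N ≤ √((1 - p.β * p.μg / 2) ^ N) ^ 4 := by
  have h1 := hp.β_mul_μg_le
  have h2 : 0 ≤ (1 - p.β * p.μg / 2) ^ N := pow_nonneg (by linarith) _
  rw [show √((1 - p.β * p.μg / 2) ^ N) ^ 4 = (√((1 - p.β * p.μg / 2) ^ N) ^ 2) ^ 2 by ring,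
    Real.sq_sqrt h2, ← pow_mul, mul_comm N 2, pow_mul]
  exact pow_le_pow_left₀ (by linarith) (by nlinarith [sq_nonneg (p.β * p.μg)]) N

lemma pow_descent_eq (T : ℕ) :
    ((1 - p.α * p.μg) ^ T) ^ 2 = √((1 - p.α * p.μg) ^ T) ^ 4 := by
  have h2 : 0 ≤ (1 - p.α * p.μg) ^ T := pow_nonneg (by
    rw [hp.α_mul_μg]
    linarith [hp.μg_div_Lg_le]) _
  rw [show √((1 - p.α * p.μg) ^ T) ^ 4 = (√((1 - p.α * p.μg) ^ T) ^ 2) ^ 2 by ring,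
    Real.sq_sqrt h2]

lemma driftWeight_nonneg : 0 ≤ p.driftWeight := by
  have := hp.γ_pos
  have := hp.η_pos 0
  unfold driftWeight
  positivity

/-- With u = 1 no decrease of ‖∇ℒ‖² is kept, and the drift has to be paid by the contraction of η‖x
- x*‖² through ‖∇ℒ‖² ≤ L²‖x - x*‖². The weight must then be of order γ(γμ)², which explains the
larger value of ζ₀. -/
lemma driftWeight_le_of_strongly_convex (h : 0 < p.μ ∧ p.u = 1) :
    p.driftWeight ≤ 3 / 64 * (p.γ * (p.γ * p.ηmin) ^ 2) := by
  have h1 := hp.exp_C_facts.2.2.1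
  have hm := hp.ηmin_pos
  have hL := hp.L_pos
  simp only [ζ₀, h, if_true, and_self] at h1
  have h2 : Real.exp (-p.C / 2) * p.Ly ^ 2 * p.η 0 ≤ p.ηmin ^ 2 / 64 := by
    have h3 : Real.exp (-p.C / 2) * (32 * p.Ly ^ 2 / p.L ^ 2 * (2 * p.L ^ 2 * p.η 0 / p.ηmin ^ 2))
        = 64 * (Real.exp (-p.C / 2) * p.Ly ^ 2 * p.η 0) / p.ηmin ^ 2 := by
      field_simp
      ring
    rw [h3, div_le_one (by positivity)] at h1
    linarith
  have h4 : p.driftWeight = 3 * p.γ ^ 3 * (Real.exp (-p.C / 2) * p.Ly ^ 2 * p.η 0) := by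
    unfold driftWeight
    ring
  rw [h4]
  have h5 : 0 ≤ 3 * p.γ ^ 3 := by have := hp.γ_pos; positivity
  refine (mul_le_mul_of_nonneg_left h2 h5).trans (le_of_eq ?_)
  ring

/-- Here the descent inequality supplies a term -γ/2 ‖∇ℒ‖², so a weight that is a small multiple of
γ is sufficient. -/
lemma driftWeight_le_of_not (h : ¬ (0 < p.μ ∧ p.u = 1)) :
    p.driftWeight ≤ 3 / 64 * (p.γ * p.δ 0) := by
  have h1 := hp.exp_C_facts.2.2.1
  have hL := hp.L_pos
  simp only [ζ₀, h, if_false] at h1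
  have h2 : Real.exp (-p.C / 2) * p.Ly ^ 2 * p.γ ≤ 1 / 64 := by
    have h3 : Real.exp (-p.C / 2) * (32 * p.Ly ^ 2 / p.L ^ 2 * (2 * p.L))
        = 64 * (Real.exp (-p.C / 2) * p.Ly ^ 2 * p.γ) := by
      unfold γ
      field_simp
      ring
    linarith
  have h4 : p.driftWeight = 3 * (p.γ * p.δ 0) * (Real.exp (-p.C / 2) * p.Ly ^ 2 * p.γ) := by
    unfold driftWeight δ
    ring
  rw [h4]
  have h5 : 0 ≤ 3 * (p.γ * p.δ 0) := by
    have := hp.γ_pos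
    have := hp.η_pos 0
    unfold δ
    positivity
  linarith [mul_le_mul_of_nonneg_left h2 h5]

lemma driftWeight_le : p.driftWeight ≤ 3 / 64 * p.γ := by
  have hγ := hp.γ_pos
  by_cases h : 0 < p.μ ∧ p.u = 1
  · refine (hp.driftWeight_le_of_strongly_convex h).trans ?_
    have h1 : p.γ * p.ηmin ≤ 1 := (hp.δ_mem 0).1.trans (hp.δ_mem 0).2
    have h2 : 0 ≤ p.γ * p.ηmin := (mul_pos hγ hp.ηmin_pos).le
    have h3 : (p.γ * p.ηmin) ^ 2 ≤ 1 := pow_le_one₀ h2 h1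
    nlinarith
  · refine (hp.driftWeight_le_of_not h).trans ?_
    have := (hp.δ_mem 0).2
    nlinarith

lemma psiNoise_add_le : p.psiNoise + (p.varxy + p.Lg' ^ 2) * p.zNoise ≤ p.wx2 := by
  have h1 := hp.varf_nonneg
  have h2 := hp.varxy_nonneg
  have h3 := hp.varyy_div_mem.1
  have hμ := hp.μg_pos
  have hL := hp.Lg_pos
  have e1 : 2 * (p.varxy + p.Lg' ^ 2) * p.B ^ 2 / (p.Lg * p.μg ^ 3) * p.varyy
      = 2 * (p.varxy + p.Lg' ^ 2) * (p.varyy / (p.μg * p.Lg) * (p.B / p.μg) ^ 2) := by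
    field_simp
  have e2 : 2 * p.B ^ 2 / p.μg ^ 2 * p.varxy = p.varxy * (2 * (p.B / p.μg) ^ 2) := by ring
  have e3 : (1 + 2 * p.Lg' / p.μg + 6 * (p.varxy + p.Lg' ^ 2) / p.μg ^ 2) * p.varf
      = p.varf + 2 * (p.Lg' / p.μg * p.varf) + 6 * (p.varxy * (p.varf / p.μg ^ 2))
        + 6 * ((p.Lg' / p.μg) ^ 2 * p.varf) := by ring
  have e4 : p.Lg' ^ 2 * (p.varf / p.μg ^ 2) = (p.Lg' / p.μg) ^ 2 * p.varf := by ring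
  have h4 : 0 ≤ p.varxy * (p.varf / p.μg ^ 2) := by positivity
  have h5 : 0 ≤ (p.Lg' / p.μg) ^ 2 * p.varf := by positivity
  have h6 : 0 ≤ p.Lg' / p.μg * p.varf := by have := hp.Lg'_pos; positivity
  unfold wx2 psiNoise zNoise
  rw [e1, e2, e3]
  linarith

lemma zNoise_mul_le : 2 * ((p.varxy + p.Lg' ^ 2) * p.zNoise) ≤ p.wx2 := by
  have h1 := hp.varf_nonneg
  have h2 := hp.varxy_nonneg
  have h3 := hp.varyy_div_mem.1
  have hμ := hp.μg_pos
  have hL := hp.Lg_pos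
  have hg := hp.Lg'_pos
  have e1 : 2 * (p.varxy + p.Lg' ^ 2) * p.B ^ 2 / (p.Lg * p.μg ^ 3) * p.varyy
      = 2 * (p.varxy + p.Lg' ^ 2) * (p.varyy / (p.μg * p.Lg) * (p.B / p.μg) ^ 2) := by
    field_simp
  have e2 : (1 + 2 * p.Lg' / p.μg + 6 * (p.varxy + p.Lg' ^ 2) / p.μg ^ 2) * p.varf
      = (1 + 2 * p.Lg' / p.μg) * p.varf + 6 * ((p.varxy + p.Lg' ^ 2) * (p.varf / p.μg ^ 2)) := by
    ring
  have h4 : 0 ≤ (1 + 2 * p.Lg' / p.μg) * p.varf := by positivity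
  have h5 : 0 ≤ (p.varxy + p.Lg' ^ 2) * (p.varf / p.μg ^ 2) := by positivity
  have h6 : 0 ≤ 2 * p.B ^ 2 / p.μg ^ 2 * p.varxy := by positivity
  unfold wx2 zNoise
  rw [e1, e2]
  linarith

/-- The floor of the solver enters the energy with weight b. The last entry of `C'` makes b so small
that this costs no more than the noise of the gradient estimate. -/
lemma b_mul_zNoise_le {N : ℕ} (hN : p.Nmin ≤ N) :
    2 * p.b N * p.zNoise ≤ p.γ * (p.γ * p.ηmin) * (2 * ((p.varxy + p.Lg' ^ 2) * p.zNoise)) := by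
  have h1 := hp.sqrt_solver_le hN
  have h2 := hp.exp_C'_facts.2.2.2
  have h3 := hp.exp_C_facts.1
  have hη := hp.η_pos 0
  have hγ := hp.γ_pos
  have h4 : √((1 - p.β * p.μg / 2) ^ N) ≤ p.γ * (p.varxy + p.Lg' ^ 2) * (p.ηmin / p.η 0) :=
    h1.trans ((mul_le_of_le_one_left (Real.exp_nonneg _) h3).trans h2)
  have h5 : p.b N ≤ p.γ * p.η 0 * (p.γ * (p.varxy + p.Lg' ^ 2) * (p.ηmin / p.η 0)) :=
    mul_le_mul_of_nonneg_left h4 (mul_pos hγ hη).le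
  have h6 : p.γ * p.η 0 * (p.γ * (p.varxy + p.Lg' ^ 2) * (p.ηmin / p.η 0))
      = p.γ * (p.γ * p.ηmin) * (p.varxy + p.Lg' ^ 2) := by
    field_simp
  rw [h6] at h5
  linarith [mul_le_mul_of_nonneg_right h5 hp.zNoise_nonneg]

/-- Half of the weighted warm-start errors pays for the bias and the variance. -/
lemma energy_errors_le {T N : ℕ} (hT : p.Tmin ≤ T) (hN : p.Nmin ≤ N)
    {cB cV Y Z s s' D G Y' Z' : ℝ} (hY : 0 ≤ Y) (hZ : 0 ≤ Z) (hD0 : 0 ≤ D)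
    (hcB : 0 ≤ cB) (hcB' : cB ≤ 7 / 2 * p.γ) (hcV' : cV ≤ 2 * p.γ)
    (hs : s ≤ ((1 - p.α * p.μg) ^ T) ^ 2 * Y + p.varg / (p.μg * p.Lg))
    (hs' : s' ≤ ((1 - p.α * p.μg) ^ T) ^ 2 * Y' + p.varg / (p.μg * p.Lg))
    (hY' : Y' ≤ 2 * s + 2 * p.Ly ^ 2 * D)
    (hZ' : Z' ≤ 2 * (p.zNoise + 3 * (1 - p.β * p.μg) ^ N * Z)
      + 2 * p.Lz ^ 2 * ((1 + 3 * p.Ly ^ 2) * D + 3 * s' + 3 * s))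
    (hD : D ≤ p.γ ^ 2 * (p.varBound N Z + 2 * p.biasBound N s Z + 2 * G)) :
    p.a T * Y' + p.b N * Z' + cB * p.biasBound N s Z + cV * p.varBound N Z
      ≤ 1 / 2 * (p.a T * Y) + 1 / 2 * (p.b N * Z) + 2 * p.driftWeight * G
        + (cV + p.driftWeight) * p.psiNoise + 2 * p.b N * p.zNoise
        + (16 * p.γ * p.Lψ ^ 2 + 2 * p.Lψ ^ 2 * (cB + 2 * p.driftWeight))
          * (p.varg / (p.μg * p.Lg)) := by
  obtain ⟨e1, e2, -, e4⟩ := hp.exp_C_facts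
  obtain ⟨d1, d2, d3, -⟩ := hp.exp_C'_facts
  have hl := hp.sqrt_descent_le hT
  have hπ := hp.sqrt_solver_le hN
  have hη := hp.η_pos 0
  have hy := hp.Ly_pos
  have hz := hp.Lz_pos
  have hl0 := Real.sqrt_nonneg ((1 - p.α * p.μg) ^ T)
  have hπ0 := Real.sqrt_nonneg ((1 - p.β * p.μg / 2) ^ N)
  have hρ := hp.pow_solver_le N
  rw [hp.pow_descent_eq] at hs hs'
  set l := √((1 - p.α * p.μg) ^ T) with hldef
  set π := √((1 - p.β * p.μg / 2) ^ N) with hπdef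
  set e := Real.exp (-p.C / 2) with hedef
  have he0 : 0 < e := Real.exp_pos _
  set e' := Real.exp (-p.C' / 2) with hedef'
  have he0' : 0 < e' := Real.exp_pos _
  have hπ' : π ≤ e' := hπ.trans (mul_le_of_le_one_left he0'.le e1)
  have ha : p.a T = p.γ * p.η 0 * l := rfl
  have hb : p.b N = p.γ * p.η 0 * π := rfl
  rw [ha, hb]
  -- The facts f1 to f6 are the smallness conditions of `weighted_errors_le`, derived from
  -- `exp_C_facts` and `exp_C'_facts`.
  have f1 : l * (6 * p.η 0 + 24 * p.Lψ ^ 2) ≤ p.η 0 := by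
    have h1 : 6 * p.η 0 + 24 * p.Lψ ^ 2 = p.η 0 * (6 + 24 * p.Lψ ^ 2 / p.η 0) := by
      field_simp
    have h2 : l * (6 + 24 * p.Lψ ^ 2 / p.η 0) ≤ 1 :=
      (mul_le_mul_of_nonneg_right hl (by positivity)).trans e2
    rw [h1]
    nlinarith
  have f2 : π * (4 * p.η 0 + 12 * (2 * p.Lψ ^ 2 + p.σx2)) ≤ p.η 0 := by
    have h0 := hp.σx2_nonneg
    have h1 : 4 * p.η 0 + 12 * (2 * p.Lψ ^ 2 + p.σx2)
        = p.η 0 * (4 + 12 * (2 * p.Lψ ^ 2 + p.σx2) / p.η 0) := by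
      field_simp
    have h2 : π * (4 + 12 * (2 * p.Lψ ^ 2 + p.σx2) / p.η 0) ≤ 1 :=
      (mul_le_mul_of_nonneg_right hπ' (by positivity)).trans d1
    rw [h1]
    nlinarith
  have d2' : e' * (2 * p.Lz ^ 2 * (1 + 16 * p.Ly ^ 2)) ≤ p.Ly ^ 2 := by
    have h1 : e' * (2 * p.Lz ^ 2 / p.Ly ^ 2 * (1 + 16 * p.Ly ^ 2))
        = e' * (2 * p.Lz ^ 2 * (1 + 16 * p.Ly ^ 2)) / p.Ly ^ 2 := by ring
    rw [h1, div_le_one (by positivity)] at d2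
    exact d2
  -- This needs both factors of π ≤ e e': e' compensates L_z and L_y, and e matches the weight of
  -- the drift of y*. It is the reason for C + C' in `Nmin`.
  have f3 : 2 * π * p.Lz ^ 2 * (1 + 16 * p.Ly ^ 2) ≤ e * p.Ly ^ 2 := by
    calc 2 * π * p.Lz ^ 2 * (1 + 16 * p.Ly ^ 2)
        = π * (2 * p.Lz ^ 2 * (1 + 16 * p.Ly ^ 2)) := by ring
      _ ≤ e * e' * (2 * p.Lz ^ 2 * (1 + 16 * p.Ly ^ 2)) := by gcongr
      _ = e * (e' * (2 * p.Lz ^ 2 * (1 + 16 * p.Ly ^ 2))) := by ring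
      _ ≤ e * p.Ly ^ 2 := by gcongr
  have f4 : 32 * (π * p.Lz ^ 2) ≤ 1 := by
    have h1 : 32 * (e' * p.Lz ^ 2) * p.Ly ^ 2 ≤ 1 * p.Ly ^ 2 := by
      have : 0 ≤ e' * p.Lz ^ 2 := by positivity
      linarith
    have h2 := le_of_mul_le_mul_right h1 (by positivity)
    have h3 : π * p.Lz ^ 2 ≤ e' * p.Lz ^ 2 := by gcongr
    linarith
  have f5 : l * p.η 0 ≤ 5 * p.Lψ ^ 2 := by
    rw [← le_div_iff₀ hη]
    exact hl.trans e4
  have f6 : 4 * (π * p.Lz ^ 2) * p.η 0 ≤ p.Lψ ^ 2 := by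
    have h1 := hπ'.trans d3
    rw [le_div_iff₀ (by positivity)] at h1
    linarith
  have hR := (hp.one_sub_β_pow_mem N).1
  have hn : 0 ≤ p.varg / (p.μg * p.Lg) :=
    div_nonneg hp.varg_nonneg (mul_pos hp.μg_pos hp.Lg_pos).le
  exact weighted_errors_le hp.γ_pos hη hl0 (hl.trans e1) hπ0 hR hρ (sq_nonneg p.Lψ)
    (sq_nonneg _) (sq_nonneg _) hp.σx2_nonneg hn hY hZ hD0 hcB hcB' hcV' rfl
    hp.driftWeight_nonneg hp.driftWeight_le f1 f2 hl f3 f4 f5 f6 hs hs' hY' hZ' hD rfl rfl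

end Admissible

end Params

end AmIGO

namespace AmIGO

/-! ### The energy inequality, and the non-convex case -/

section Convergence

variable {X Y Ξ Ω : Type*}
  [NormedAddCommGroup X] [InnerProductSpace ℝ X] [CompleteSpace X] [FiniteDimensional ℝ X]
  [MeasurableSpace X] [BorelSpace X]
  [NormedAddCommGroup Y] [InnerProductSpace ℝ Y] [CompleteSpace Y] [FiniteDimensional ℝ Y]
  [MeasurableSpace Y] [BorelSpace Y]
  [MeasurableSpace Ξ] [MeasurableSpace Ω]
  {μ : Measure Ω} [IsProbabilityMeasure μ]
  {p : Params} {f g : X → Y → ℝ} {fhat ghat : X → Y → Ξ → ℝ} {P : Measure Ξ}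
  [IsProbabilityMeasure P] {q₀ : Ω → X × Y × Y} {ξ : SampleIdx → Ω → Ξ}
  (hp : p.Admissible) (hr : RegularProblem p f g)
  (hm : StochasticModel f g fhat ghat P) (hn : GradientNoise p f g fhat ghat P)
  (hn2 : HessianNoise p g ghat P) (hs : IsSampling μ P q₀ ξ) (hq2 : MemLp q₀ 2 μ) {T N : ℕ}
  (hT : p.Tmin ≤ T) (hN : p.Nmin ≤ N)

lemma Ey_nonneg (k : ℕ) : 0 ≤ Ey p T N fhat ghat q₀ ξ μ g k :=
  integral_nonneg fun _ => by positivity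

lemma Ez_nonneg (k : ℕ) : 0 ≤ Ez p T N fhat ghat q₀ ξ μ f g k :=
  integral_nonneg fun _ => by positivity

lemma gap_nonneg (hb : BddBelow (Set.range (outer f g))) (V : Ω → X) : 0 ≤ gap μ f g V :=
  integral_nonneg fun ω => sub_nonneg.mpr (ciInf_le hb (V ω))

lemma gap_eq {V : Ω → X} (hV : Integrable (fun ω => outer f g (V ω)) μ) :
    gap μ f g V = ∫ ω, outer f g (V ω) ∂μ - outerStar f g := by
  unfold gap
  rw [integral_sub hV (integrable_const _), integral_const, probReal_univ, one_smul]

section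

include hp

lemma a_nonneg : 0 ≤ p.a T :=
  mul_nonneg (mul_pos hp.γ_pos (hp.η_pos 0)).le (Real.sqrt_nonneg _)

lemma b_nonneg : 0 ≤ p.b N :=
  mul_nonneg (mul_pos hp.γ_pos (hp.η_pos 0)).le (Real.sqrt_nonneg _)

include hT in
lemma a_le_one : p.a T ≤ 1 :=
  mul_le_one₀ (hp.δ_mem 0).2 (Real.sqrt_nonneg _)
    ((hp.sqrt_descent_le hT).trans hp.exp_C_facts.1)

lemma b_le_one : p.b N ≤ 1 := by
  refine mul_le_one₀ (hp.δ_mem 0).2 (Real.sqrt_nonneg _) (Real.sqrt_le_one.mpr ?_)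
  have h1 := hp.β_mul_μg_le
  have h2 := hp.β_mul_μg_pos
  exact pow_le_one₀ (by linarith) (by linarith)

include hr hm hn hn2 hs hq2 hT hN

/-- One outer iteration, up to the choice of an inequality for the outer objective. -/
lemma exists_isOuterStep_and_errors_le (k : ℕ) : ∃ (e ν : Ω → X) (B V : ℝ),
    IsOuterStep μ p f g (xIter p T N fhat ghat q₀ ξ k) (xIter p T N fhat ghat q₀ ξ (k + 1)) e ν
      B V ∧ 0 ≤ B ∧ 0 ≤ V ∧
    ∀ cB cV : ℝ, 0 ≤ cB → cB ≤ 7 / 2 * p.γ → cV ≤ 2 * p.γ →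
      p.a T * Ey p T N fhat ghat q₀ ξ μ g (k + 1) + p.b N * Ez p T N fhat ghat q₀ ξ μ f g (k + 1)
        + cB * B + cV * V
      ≤ 1 / 2 * (p.a T * Ey p T N fhat ghat q₀ ξ μ g k)
        + 1 / 2 * (p.b N * Ez p T N fhat ghat q₀ ξ μ f g k)
        + 2 * p.driftWeight
          * (∫ ω, ‖gradient (outer f g) (xIter p T N fhat ghat q₀ ξ k ω)‖ ^ 2 ∂μ)
        + (cV + p.driftWeight) * p.psiNoise + 2 * p.b N * p.zNoise
        + (16 * p.γ * p.Lψ ^ 2 + 2 * p.Lψ ^ 2 * (cB + 2 * p.driftWeight))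
          * (p.varg / (p.μg * p.Lg)) := by
  obtain ⟨e, ν, h⟩ := exists_isOuterStep hp hr hm hn hn2 hs hq2 T N k
  refine ⟨e, ν, _, _, h, (integral_nonneg fun _ => by positivity).trans h.bias_le,
    (integral_nonneg fun _ => by positivity).trans h.noise_le, fun cB cV hcB hcB' hcV => ?_⟩
  exact hp.energy_errors_le hT hN (Ey_nonneg k) (Ez_nonneg k)
    (integral_nonneg fun _ => by positivity) hcB hcB' hcV
    (integral_sq_yIter_sub_le hp hr hm hn hn2 hs hq2 T N k)
    (integral_sq_yIter_sub_le hp hr hm hn hn2 hs hq2 T N (k + 1))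
    (Ey_succ_le hp hr hm hn hn2 hs hq2 T N k) (Ez_succ_le hp hr hm hn hn2 hs hq2 T N k)
    (h.integral_sq_norm_sub_le hp hr)

end

section NonConvex

variable (hneg : p.μ < 0) (hb : BddBelow (Set.range (outer f g)))
include hp hneg

lemma Ex_of_neg (k : ℕ) : Ex p T N fhat ghat q₀ ξ μ f g k = p.γ / 2
    * ∫ ω, ‖gradient (outer f g) (xIter p T N fhat ghat q₀ ξ k ω)‖ ^ 2 ∂μ := by
  have h1 : p.η k = p.L := by cases k <;> simp [Params.η, hneg.not_gt]
  have hL := hp.L_pos.ne'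
  unfold Ex
  rw [if_neg hneg.not_gt, Params.δ, h1]
  congr 1
  unfold Params.γ
  field_simp

/-- Noise budget: since the drift weight is below γ/2, the gradient noise and the solver floor cost
at most 3/2 γ `wx2`, and the descent floor at most 30γ times L_ψ² σ_g²/(μ_g L_g). Twice these
constants appear in 𝒲². -/
lemma noise_le_of_neg (hN : p.Nmin ≤ N) :
    (p.γ / 2 + p.driftWeight) * p.psiNoise + 2 * p.b N * p.zNoise
        + (16 * p.γ * p.Lψ ^ 2 + 2 * p.Lψ ^ 2 * (p.γ / 2 + 2 * p.driftWeight))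
          * (p.varg / (p.μg * p.Lg)) ≤ p.γ / 2 * p.W2 := by
  have hγ := hp.γ_pos
  have h1 := hp.driftWeight_le
  have h2 := hp.psiNoise_add_le
  have h3 := hp.zNoise_mul_le
  have h4 := hp.b_mul_zNoise_le hN
  have hm : p.ηmin = p.L := by simp [Params.ηmin, hneg.not_gt]
  have hκ : p.κL = 1 := by rw [Params.κL, hm, div_self hp.L_pos.ne']
  rw [hm, hp.γ_mul_L, mul_one] at h4
  have hn : 0 ≤ p.varg / (p.μg * p.Lg) :=
    div_nonneg hp.varg_nonneg (mul_pos hp.μg_pos hp.Lg_pos).le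
  have e1 : p.W2 = 3 * p.wx2 + 60 * (p.Lψ ^ 2 * (p.varg / (p.μg * p.Lg))) := by
    unfold Params.W2
    rw [if_neg hneg.not_gt, hκ]
    ring
  rw [e1]
  have hψ := hp.psiNoise_nonneg
  have h5 : (p.γ / 2 + p.driftWeight) * p.psiNoise ≤ p.γ / 2 * (2 * p.psiNoise) := by
    nlinarith
  have h6 : 0 ≤ p.Lψ ^ 2 * (p.varg / (p.μg * p.Lg)) := by positivity
  have h7 : (16 * p.γ * p.Lψ ^ 2 + 2 * p.Lψ ^ 2 * (p.γ / 2 + 2 * p.driftWeight))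
      * (p.varg / (p.μg * p.Lg)) = (16 * p.γ + 2 * (p.γ / 2 + 2 * p.driftWeight))
        * (p.Lψ ^ 2 * (p.varg / (p.μg * p.Lg))) := by ring
  have h8 : (16 * p.γ + 2 * (p.γ / 2 + 2 * p.driftWeight))
        * (p.Lψ ^ 2 * (p.varg / (p.μg * p.Lg)))
      ≤ 30 * p.γ * (p.Lψ ^ 2 * (p.varg / (p.μg * p.Lg))) :=
    mul_le_mul_of_nonneg_right (by linarith) h6
  have h9 : p.γ * (p.psiNoise + (p.varxy + p.Lg' ^ 2) * p.zNoise) ≤ p.γ * p.wx2 := by gcongr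
  have h10 : p.γ * (2 * ((p.varxy + p.Lg' ^ 2) * p.zNoise)) ≤ p.γ * p.wx2 := by gcongr
  rw [h7]
  linarith

include hr hm hn hn2 hs hq2 hT hN

/-- The gap decreases by γ/2 E‖∇ℒ‖² = E_k^x. The drift takes at most 3/32 γ E‖∇ℒ‖² of it, and half
of each weighted error is left over, so half of the total energy is released. -/
lemma energy_step_of_neg (k : ℕ) :
    gap μ f g (xIter p T N fhat ghat q₀ ξ (k + 1))
        + p.a T * Ey p T N fhat ghat q₀ ξ μ g (k + 1)
        + p.b N * Ez p T N fhat ghat q₀ ξ μ f g (k + 1)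
      ≤ gap μ f g (xIter p T N fhat ghat q₀ ξ k)
        + p.a T * Ey p T N fhat ghat q₀ ξ μ g k + p.b N * Ez p T N fhat ghat q₀ ξ μ f g k
        - 1 / 2 * Etot p T N fhat ghat q₀ ξ μ f g k + p.γ / 2 * p.W2 := by
  obtain ⟨e, ν, B, V, h, hB, hV, hE⟩ :=
    exists_isOuterStep_and_errors_le hp hr hm hn hn2 hs hq2 hT hN k
  have hγ := hp.γ_pos
  -- γ/2 is the coefficient of both bias and variance in `integral_outer_le`.
  have h1 := hE (p.γ / 2) (p.γ / 2) (by positivity) (by linarith) (by linarith)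
  have h2 := h.integral_outer_le hp hr
  have h3 := noise_le_of_neg hp hneg hN
  have h4 := hp.driftWeight_le
  rw [gap_eq (integrable_outer hp hr (h.memLp_next hp hr)),
    gap_eq (integrable_outer hp hr h.memLp_x)]
  unfold Etot
  rw [Ex_of_neg hp hneg]
  have h5 : 0 ≤ ∫ ω, ‖gradient (outer f g) (xIter p T N fhat ghat q₀ ξ k ω)‖ ^ 2 ∂μ :=
    integral_nonneg fun _ => by positivity
  have h6 := mul_le_mul_of_nonneg_right h4 h5
  have h7 := mul_nonneg hγ.le h5
  linarith

include hb

/-- Convergence of the averaged energies in the non-convex case. -/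
theorem nonconvex_bound {k : ℕ} (hk : 1 ≤ k) :
    (1 / (k : ℝ)) * ∑ t ∈ Finset.Icc 1 k, Etot p T N fhat ghat q₀ ξ μ f g t
      ≤ 2 / (k : ℝ) * (gap μ f g (xIter p T N fhat ghat q₀ ξ 0)
          + Ey p T N fhat ghat q₀ ξ μ g 0 + Ez p T N fhat ghat q₀ ξ μ f g 0)
        + 2 * p.W2 / p.L := by
  have hstep := energy_step_of_neg hp hr hm hn hn2 hs hq2 hT hN hneg
  set Φ : ℕ → ℝ := fun k => gap μ f g (xIter p T N fhat ghat q₀ ξ k)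
        + p.a T * Ey p T N fhat ghat q₀ ξ μ g k + p.b N * Ez p T N fhat ghat q₀ ξ μ f g k with hΦ
  have hsum : ∀ k : ℕ, 1 / 2 * ∑ t ∈ Finset.Icc 1 k, Etot p T N fhat ghat q₀ ξ μ f g t
      ≤ Φ 1 - Φ (k + 1) + k * (p.γ / 2 * p.W2) := by
    intro k
    induction k with
    | zero => simp
    | succ k ih =>
      rw [Finset.sum_Icc_succ_top (by omega)]
      have := hstep (k + 1)
      push_cast
      simp only [hΦ] at ih ⊢
      linarith
  have hγ := hp.γ_pos
  have ha := a_nonneg hp (T := T)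
  have hb' := b_nonneg hp (N := N)
  have hE : ∀ k, 0 ≤ Etot p T N fhat ghat q₀ ξ μ f g k := by
    intro k
    unfold Etot
    rw [Ex_of_neg hp hneg]
    have h1 : 0 ≤ ∫ ω, ‖gradient (outer f g) (xIter p T N fhat ghat q₀ ξ k ω)‖ ^ 2 ∂μ :=
      integral_nonneg fun _ => by positivity
    have h2 : 0 ≤ Ey p T N fhat ghat q₀ ξ μ g k := Ey_nonneg k
    have h3 : 0 ≤ Ez p T N fhat ghat q₀ ξ μ f g k := Ez_nonneg k
    positivity
  have hΦ0 : ∀ k, 0 ≤ Φ k := fun k =>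
    add_nonneg (add_nonneg (gap_nonneg hb _) (mul_nonneg ha (Ey_nonneg k)))
      (mul_nonneg hb' (Ez_nonneg k))
  have h1 := hsum k
  have h2 : Φ 1 ≤ Φ 0 - 1 / 2 * Etot p T N fhat ghat q₀ ξ μ f g 0 + p.γ / 2 * p.W2 := hstep 0
  have h3 := hE 0
  have h4 := hΦ0 (k + 1)
  have h5 : Φ 0 ≤ gap μ f g (xIter p T N fhat ghat q₀ ξ 0)
          + Ey p T N fhat ghat q₀ ξ μ g 0 + Ez p T N fhat ghat q₀ ξ μ f g 0 := by
    have h6 := mul_le_mul_of_nonneg_right (a_le_one hp hT)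
      (Ey_nonneg (p := p) (T := T) (N := N) (fhat := fhat) (ghat := ghat) (q₀ := q₀) (ξ := ξ)
        (μ := μ) (g := g) 0)
    have h7 := mul_le_mul_of_nonneg_right (b_le_one hp (N := N))
      (Ez_nonneg (p := p) (T := T) (N := N) (fhat := fhat) (ghat := ghat) (q₀ := q₀) (ξ := ξ)
        (μ := μ) (f := f) (g := g) 0)
    simp only [hΦ]
    linarith
  have hk' : (1 : ℝ) ≤ k := Nat.one_le_cast.mpr hk
  have hk0 : (0 : ℝ) < k := by linarith
  have hW : 0 ≤ p.γ / 2 * p.W2 := by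
    refine le_trans ?_ (noise_le_of_neg hp hneg hN)
    have := hp.driftWeight_nonneg
    have := hp.psiNoise_nonneg
    have := hp.zNoise_nonneg
    have := div_nonneg hp.varg_nonneg (mul_pos hp.μg_pos hp.Lg_pos).le
    positivity
  -- Step 0 links Φ 1 to the initial data and adds one more noise term; k + 1 ≤ 2k gives the factor
  -- 4k.
  have h8 : ∑ t ∈ Finset.Icc 1 k, Etot p T N fhat ghat q₀ ξ μ f g t
      ≤ 2 * (gap μ f g (xIter p T N fhat ghat q₀ ξ 0)
          + Ey p T N fhat ghat q₀ ξ μ g 0 + Ez p T N fhat ghat q₀ ξ μ f g 0)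
        + 4 * k * (p.γ / 2 * p.W2) := by
    nlinarith
  have h9 : 2 * p.W2 / p.L = 1 / (k : ℝ) * (4 * k * (p.γ / 2 * p.W2)) := by
    have := hp.L_pos.ne'
    unfold Params.γ
    field_simp
    ring
  rw [h9, div_eq_mul_one_div 2 (k : ℝ), mul_comm 2 (1 / (k : ℝ)), mul_assoc, ← mul_add]
  exact mul_le_mul_of_nonneg_left h8 (by positivity)

end NonConvex

end Convergence

end AmIGO

namespace AmIGO

/-! ### The strongly convex case -/

section StronglyConvex

variable {X Y Ξ Ω : Type*}
  [NormedAddCommGroup X] [InnerProductSpace ℝ X] [CompleteSpace X] [FiniteDimensional ℝ X]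
  [MeasurableSpace X] [BorelSpace X]
  [NormedAddCommGroup Y] [InnerProductSpace ℝ Y] [CompleteSpace Y] [FiniteDimensional ℝ Y]
  [MeasurableSpace Y] [BorelSpace Y]
  [MeasurableSpace Ξ] [MeasurableSpace Ω]
  {μ : Measure Ω} [IsProbabilityMeasure μ]
  {p : Params} {f g : X → Y → ℝ} {fhat ghat : X → Y → Ξ → ℝ} {P : Measure Ξ}
  [IsProbabilityMeasure P] {q₀ : Ω → X × Y × Y} {ξ : SampleIdx → Ω → Ξ}
  (hp : p.Admissible) (hr : RegularProblem p f g)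

section Objective

include hp hr

lemma outer_xStar_le {m : ℝ} (hm : 0 < m) (hsc : ∀ x x', outer f g x - outer f g x' ≤
      inner ℝ (gradient (outer f g) x) (x - x') - m / 2 * ‖x - x'‖ ^ 2) (x : X) :
    outer f g (xStar f g) ≤ outer f g x := by
  have h1 : ∃ y, ∀ y', outer f g y ≤ outer f g y' := by
    refine exists_forall_le_of_quadratic_lower_bound (continuous_outer hp hr) hm
      (c := outer f g 0) (G := gradient (outer f g) 0) (x := 0) fun y => ?_
    have h2 := hsc 0 y
    simp only [zero_sub, sub_zero, inner_neg_right, norm_neg] at h2 ⊢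
    linarith
  exact Classical.epsilon_spec h1 x

variable {xs : X} (hmin : ∀ x, outer f g xs ≤ outer f g x)
include hmin

lemma outerStar_eq : outerStar f g = outer f g xs :=
  le_antisymm (ciInf_le ⟨_, Set.forall_mem_range.mpr hmin⟩ xs) (le_ciInf hmin)

lemma gradient_outer_eq_zero : gradient (outer f g) xs = 0 := by
  have h := sq_norm_gradient_le hp.L_pos (hasGradientAt_outer_gradient hp hr)
    (norm_gradient_outer_sub_le hp hr) hmin xs
  rw [sub_self, mul_zero] at h
  exact norm_eq_zero.mp (pow_eq_zero_iff two_ne_zero |>.mp (le_antisymm h (by positivity)))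

lemma integral_sq_gradient_le {x : Ω → X} (hx : MemLp x 2 μ) :
    ∫ ω, ‖gradient (outer f g) (x ω)‖ ^ 2 ∂μ ≤ p.L ^ 2 * ∫ ω, ‖x ω - xs‖ ^ 2 ∂μ := by
  rw [← integral_const_mul]
  refine integral_mono (memLp_gradient_outer hp hr hx).integrable_norm_sq
    ((hx.sub (memLp_const xs)).integrable_norm_sq.const_mul _) fun ω => ?_
  have h := norm_gradient_outer_sub_le hp hr (x ω) xs
  rw [gradient_outer_eq_zero hp hr hmin, sub_zero] at h
  dsimp only [Pi.sub_apply]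
  rw [← mul_pow]
  gcongr

end Objective

/-- The first-order inequalities at the combined point towards v and w, with weights 1 - δ and δ,
have cancelling linear terms. -/
lemma gap_convex_combination_le (hp : p.Admissible) (hr : RegularProblem p f g) {m δ : ℝ}
    (hm : 0 ≤ m) (hsc : ∀ x x', outer f g x - outer f g x' ≤
      inner ℝ (gradient (outer f g) x) (x - x') - m / 2 * ‖x - x'‖ ^ 2)
    (hδ0 : 0 ≤ δ) (hδ1 : δ ≤ 1) {v w : Ω → X} (hv : MemLp v 2 μ) (hw : MemLp w 2 μ) :
    gap μ f g (fun ω => (1 - δ) • v ω + δ • w ω) ≤ (1 - δ) * gap μ f g v + δ * gap μ f g w := by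
  have hvw : MemLp (fun ω => (1 - δ) • v ω + δ • w ω) 2 μ :=
    (hv.const_smul (1 - δ)).add (hw.const_smul δ)
  have i1 := integrable_outer hp hr hv
  have i2 := integrable_outer hp hr hw
  rw [gap_eq (integrable_outer hp hr hvw), gap_eq i1, gap_eq i2]
  have h := integral_mono (integrable_outer hp hr hvw) ((i1.const_mul (1 - δ)).add (i2.const_mul δ))
    fun ω => by
      have h1 := hsc ((1 - δ) • v ω + δ • w ω) (v ω)
      have h2 := hsc ((1 - δ) • v ω + δ • w ω) (w ω)
      have e1 : (1 - δ) • v ω + δ • w ω - v ω = δ • (w ω - v ω) := by module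
      have e2 : (1 - δ) • v ω + δ • w ω - w ω = -((1 - δ) • (w ω - v ω)) := by module
      have n1 : 0 ≤ m / 2 * ‖(1 - δ) • v ω + δ • w ω - v ω‖ ^ 2 := by positivity
      have n2 : 0 ≤ m / 2 * ‖(1 - δ) • v ω + δ • w ω - w ω‖ ^ 2 := by positivity
      rw [e1, inner_smul_right] at h1
      rw [e2, inner_neg_right, inner_smul_right] at h2
      rw [e1] at n1
      rw [e2] at n2
      dsimp only [Pi.add_apply]
      have h3 := mul_le_mul_of_nonneg_left (h1.trans (sub_le_self _ n1)) (sub_nonneg.mpr hδ1)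
      have h4 := mul_le_mul_of_nonneg_left (h2.trans (sub_le_self _ n2)) hδ0
      linarith
  rw [integral_add' (i1.const_mul _) (i2.const_mul _), integral_const_mul, integral_const_mul] at h
  linarith

variable (hm : StochasticModel f g fhat ghat P) (hn : GradientNoise p f g fhat ghat P)
  (hn2 : HessianNoise p g ghat P) (hs : IsSampling μ P q₀ ξ) (hq2 : MemLp q₀ 2 μ) {T N : ℕ}
  (hT : p.Tmin ≤ T) (hN : p.Nmin ≤ N) (hpos : 0 < p.μ)

lemma Ex_of_pos (hp : p.Admissible) (hpos : 0 < p.μ) (k : ℕ) :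
    Ex p T N fhat ghat q₀ ξ μ f g k = p.η k / 2
      * (∫ ω, ‖xIter p T N fhat ghat q₀ ξ k ω - xStar f g‖ ^ 2 ∂μ)
      + (1 - p.u) * gap μ f g (xIter p T N fhat ghat q₀ ξ k) := by
  have hγ := hp.γ_pos.ne'
  unfold Ex
  rw [if_pos hpos, Params.δ]
  congr 2
  field_simp

lemma noise_eq_zero_of_deterministic {p : Params} (hdet : p.Deterministic) :
    p.psiNoise = 0 ∧ p.zNoise = 0 ∧ p.varg = 0 ∧ p.W2 = 0 := by
  obtain ⟨h1, h2, h3, h4⟩ := hdet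
  simp [Params.psiNoise, Params.zNoise, Params.W2, Params.wx2, Params.varg, Params.varf,
    Params.varxy, Params.varyy, h1, h2, h3, h4]

section Noise

include hp hpos

lemma one_le_κL_mul_δ (k : ℕ) : 1 ≤ p.κL * p.δ k := by
  have h1 := (hp.δ_mem k).1
  rw [← hp.κL_inv] at h1
  have h2 : 0 < p.κL := div_pos hp.L_pos hp.ηmin_pos
  rwa [inv_le_iff_one_le_mul₀' h2] at h1

/-- Gradient noise and solver floor enter with the factor γδ, but the descent floor enters with γ
only. Since κ_ℒ δ ≥ 1, a factor κ_ℒ makes up for the missing δ, which is why it multiplies σ_g² in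
𝒲². -/
lemma noise_le_of_pos (hu : p.u = 1) (hN : p.Nmin ≤ N) (k : ℕ) {c : ℝ} (hc : c ≤ 7 / 2 * p.γ) :
    (p.γ * p.δ k + p.driftWeight) * p.psiNoise + 2 * p.b N * p.zNoise
        + (16 * p.γ * p.Lψ ^ 2 + 2 * p.Lψ ^ 2 * (c + 2 * p.driftWeight))
          * (p.varg / (p.μg * p.Lg)) ≤ p.γ * p.δ k * p.W2 := by
  have hγ := hp.γ_pos
  have h1 := hp.driftWeight_le
  have h2 := hp.psiNoise_add_le
  have h3 := hp.zNoise_mul_le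
  have h4 := hp.b_mul_zNoise_le hN
  have hκ := one_le_κL_mul_δ hp hpos k
  obtain ⟨hδ, hδ1⟩ := hp.δ_mem k
  have hδ0 : 0 < p.γ * p.ηmin := mul_pos hγ hp.ηmin_pos
  have hn : 0 ≤ p.varg / (p.μg * p.Lg) :=
    div_nonneg hp.varg_nonneg (mul_pos hp.μg_pos hp.Lg_pos).le
  have e1 : p.γ * p.δ k * p.W2 = 3 * (p.γ * p.δ k * p.wx2)
      + 60 * (p.γ * (p.Lψ ^ 2 * (p.varg / (p.μg * p.Lg)))) * (p.κL * p.δ k) := by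
    unfold Params.W2
    rw [if_pos hpos, hu]
    ring
  rw [e1]
  have hψ := hp.psiNoise_nonneg
  have hz : 0 ≤ (p.varxy + p.Lg' ^ 2) * p.zNoise := by
    have := hp.varxy_nonneg
    have := hp.zNoise_nonneg
    positivity
  have h5 : p.driftWeight ≤ p.γ * p.δ k := by
    refine (hp.driftWeight_le_of_strongly_convex ⟨hpos, hu⟩).trans ?_
    have : (p.γ * p.ηmin) ^ 2 ≤ p.δ k := by
      rw [sq]
      exact (mul_le_of_le_one_right hδ0.le (hδ.trans hδ1)).trans hδ
    nlinarith [hδ0.trans_le hδ]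
  have h5' : (p.γ * p.δ k + p.driftWeight) * p.psiNoise
      ≤ (p.γ * p.δ k + p.γ * p.δ k) * p.psiNoise := by gcongr
  have h6 : 0 ≤ p.γ * (p.Lψ ^ 2 * (p.varg / (p.μg * p.Lg))) := by positivity
  have h7 : (16 * p.γ * p.Lψ ^ 2 + 2 * p.Lψ ^ 2 * (c + 2 * p.driftWeight))
      * (p.varg / (p.μg * p.Lg)) = (16 * p.γ + 2 * (c + 2 * p.driftWeight))
        * (p.Lψ ^ 2 * (p.varg / (p.μg * p.Lg))) := by ring
  have h8 : (16 * p.γ + 2 * (c + 2 * p.driftWeight))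
        * (p.Lψ ^ 2 * (p.varg / (p.μg * p.Lg)))
      ≤ 60 * p.γ * (p.Lψ ^ 2 * (p.varg / (p.μg * p.Lg))) :=
    mul_le_mul_of_nonneg_right (by linarith) (by positivity)
  have h8' := le_mul_of_one_le_right (mul_nonneg (by norm_num : (0 : ℝ) ≤ 60) h6) hκ
  have hγδ : 0 ≤ p.γ * p.δ k := (mul_pos hγ (hδ0.trans_le hδ)).le
  have h9 := mul_le_mul_of_nonneg_left h2 hγδ
  have h10 := mul_le_mul_of_nonneg_left h3 hγδ
  have h11 : p.γ * (p.γ * p.ηmin) * (2 * ((p.varxy + p.Lg' ^ 2) * p.zNoise))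
      ≤ p.γ * p.δ k * (2 * ((p.varxy + p.Lg' ^ 2) * p.zNoise)) := by gcongr
  have h12 := mul_nonneg hγδ hψ
  have h13 := mul_nonneg hγδ hz
  rw [h7]
  linarith

end Noise

variable (hsc : ∀ x x', outer f g x - outer f g x' ≤
      inner ℝ (gradient (outer f g) x) (x - x') - p.μ / 2 * ‖x - x'‖ ^ 2)
include hp hr hm hn hn2 hs hq2 hT hN hpos hsc

/-- For u = 1 the averaging of the iterates produces δ times the gap at x_{k+1}, exactly what the
outer step bounds. For u = 0 the average is x_{k+1} itself, and the missing multiple of its gap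
comes from the descent inequality. -/
lemma energy_step_of_pos (k : ℕ) :
    gap μ f g (xHat p T N fhat ghat q₀ ξ (k + 1)) + Etot p T N fhat ghat q₀ ξ μ f g (k + 1)
      ≤ (1 - p.δ (k + 1) / 2) *
          (gap μ f g (xHat p T N fhat ghat q₀ ξ k) + Etot p T N fhat ghat q₀ ξ μ f g k)
        + p.γ * p.δ (k + 1) * p.W2 := by
  obtain ⟨e, ν, B, V, h, hB, hV, hE⟩ :=
    exists_isOuterStep_and_errors_le hp hr hm hn hn2 hs hq2 hT hN k
  have hγ := hp.γ_pos
  have hmin := outer_xStar_le hp hr hpos hsc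
  have hη := hp.η_pos k
  have hη' := hp.η_pos (k + 1)
  have hηη := hp.η_succ_le k
  have hb : BddBelow (Set.range (outer f g)) := ⟨_, Set.forall_mem_range.mpr hmin⟩
  have h1 := h.strongly_convex_le hp hr hmin hpos.le hη hη' (hp.η_succ_eq hpos k) hsc
  have h2 := h.integral_outer_le hp hr
  have h3 := integral_sq_gradient_le hp hr hmin h.memLp_x
  have h4 := hp.driftWeight_nonneg
  have hs1 : outerStar f g = outer f g (xStar f g) := outerStar_eq hp hr hmin
  have hG' := gap_eq (integrable_outer hp hr (h.memLp_next hp hr))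
  have hG := gap_eq (integrable_outer hp hr h.memLp_x)
  rw [hs1] at hG' hG
  obtain ⟨hδ, hδ1⟩ := hp.δ_mem (k + 1)
  have hδ0 : 0 < p.δ (k + 1) := mul_pos hγ hη'
  have e1 : p.γ * p.η (k + 1) = p.δ (k + 1) := rfl
  have e2 : 2 * p.δ (k + 1) / p.η k ≤ 2 * p.γ := by
    rw [div_le_iff₀ hη, Params.δ]
    nlinarith
  have e3 : 0 ≤ 2 * p.δ (k + 1) / p.η k := by positivity
  rw [e1, ← hG'] at h1
  unfold Etot
  rw [Ex_of_pos hp hpos, Ex_of_pos hp hpos]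
  have hXnn : 0 ≤ ∫ ω, ‖xIter p T N fhat ghat q₀ ξ k ω - xStar f g‖ ^ 2 ∂μ :=
    integral_nonneg fun _ => by positivity
  have hYnn : 0 ≤ p.a T * Ey p T N fhat ghat q₀ ξ μ g k := mul_nonneg (a_nonneg hp) (Ey_nonneg k)
  have hZnn : 0 ≤ p.b N * Ez p T N fhat ghat q₀ ξ μ f g k :=
    mul_nonneg (b_nonneg hp) (Ez_nonneg k)
  have hY1 := mul_le_mul_of_nonneg_right hδ1 hYnn
  have hZ1 := mul_le_mul_of_nonneg_right hδ1 hZnn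
  set G := gap μ f g (xIter p T N fhat ghat q₀ ξ k) with hGdef
  set G' := gap μ f g (xIter p T N fhat ghat q₀ ξ (k + 1)) with hGdef'
  set D := ∫ ω, ‖xIter p T N fhat ghat q₀ ξ k ω - xStar f g‖ ^ 2 ∂μ with hD
  set D' := ∫ ω, ‖xIter p T N fhat ghat q₀ ξ (k + 1) ω - xStar f g‖ ^ 2 ∂μ with hD'
  set Γ := ∫ ω, ‖gradient (outer f g) (xIter p T N fhat ghat q₀ ξ k ω)‖ ^ 2 ∂μ with hΓ
  set δ := p.δ (k + 1) with hδdef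
  have hΓ0 : 0 ≤ Γ := integral_nonneg fun _ => by positivity
  have hX0 : 0 ≤ p.η k / 2 * D := by positivity
  have hγδ : p.γ * δ ≤ p.γ := mul_le_of_le_one_right hγ.le hδ1
  rcases hp.u_eq with hu | ⟨hu, hdet⟩
  · have h5 := hE (p.γ * δ + 2 * δ / p.η k) (p.γ * δ) (by positivity) (by linarith) (by linarith)
    have h6 := noise_le_of_pos hp hpos hu hN (k + 1)
      (c := p.γ * δ + 2 * δ / p.η k) (by linarith)
    have hhat : gap μ f g (xHat p T N fhat ghat q₀ ξ (k + 1))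
        ≤ (1 - δ) * gap μ f g (xHat p T N fhat ghat q₀ ξ k) + δ * G' := by
      have h7 := gap_convex_combination_le hp hr hpos.le hsc hδ0.le hδ1
        (memLp_xHat hp hr hm hn hn2 hs hq2 T N k) (h.memLp_next hp hr)
      have h8 : xHat p T N fhat ghat q₀ ξ (k + 1) = fun ω => (1 - δ) • xHat p T N fhat ghat q₀ ξ k ω
          + δ • xIter p T N fhat ghat q₀ ξ (k + 1) ω := by
        ext1 ω
        simp only [xHat, hu, one_mul, sub_sub_cancel, hδdef]
      rw [h8]
      exact h7
    have hhat0 := gap_nonneg (μ := μ) hb (xHat p T N fhat ghat q₀ ξ k)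
    have hhat1 := mul_nonneg hδ0.le hhat0
    -- The drift costs 3/16 of δ. With the quarter lost to the bias, the distance factor is 1 - δ +
    -- 7δ/16, at most 1 - δ/2.
    have h9 : 2 * p.driftWeight * Γ ≤ 3 / 16 * δ * (p.η k / 2 * D) := by
      have h10 := hp.driftWeight_le_of_strongly_convex ⟨hpos, hu⟩
      have h11 : (p.γ * p.ηmin) ^ 2 ≤ δ ^ 2 :=
        pow_le_pow_left₀ (mul_pos hγ hp.ηmin_pos).le hδ 2
      have h12 : p.driftWeight ≤ 3 / 64 * (p.γ * δ ^ 2) :=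
        h10.trans (by gcongr)
      have h13 : 2 * p.driftWeight * Γ ≤ 2 * (3 / 64 * (p.γ * δ ^ 2)) * (p.L ^ 2 * D) := by
        gcongr
      have h14 : 2 * (3 / 64 * (p.γ * δ ^ 2)) * (p.L ^ 2 * D)
          = 3 / 32 * δ * (p.η (k + 1) * D) * (p.γ * p.L) ^ 2 := by
        rw [hδdef, Params.δ]
        ring
      rw [h14, hp.γ_mul_L] at h13
      have h15 : p.η (k + 1) * D ≤ p.η k * D := by gcongr
      have h16 := mul_le_mul_of_nonneg_left h15 (by positivity : 0 ≤ 3 / 32 * δ)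
      linarith
    have h17 := mul_nonneg hδ0.le hX0
    rw [hu, sub_self, zero_mul, zero_mul]
    linarith
  · obtain ⟨z1, z2, z3, z4⟩ := noise_eq_zero_of_deterministic hdet
    -- The energy contains the gap twice. Together with δ times the gap from the strongly convex
    -- step, 2 - δ times the descent inequality makes 2, and (2 - δ)G = (1 - δ/2) · 2G is the
    -- desired contraction. The coefficients of bias and variance grow accordingly.
    have hc : (2 - δ) * (p.γ / 2) = p.γ - p.γ * δ / 2 := by ring
    have h5 := hE (p.γ * δ + 2 * δ / p.η k + (2 - δ) * (p.γ / 2)) (p.γ * δ + (2 - δ) * (p.γ / 2))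
      (by nlinarith) (by rw [hc]; linarith) (by rw [hc]; linarith)
    rw [z1, z2, z3, zero_div, mul_zero, mul_zero, mul_zero, add_zero, add_zero, add_zero] at h5
    have hhat : ∀ k, xHat p T N fhat ghat q₀ ξ k = xIter p T N fhat ghat q₀ ξ k := by
      intro k
      cases k with
      | zero => rfl
      | succ k =>
        ext1 ω
        simp [xHat, hu]
    rw [hhat, hhat, ← hGdef, ← hGdef', hu, z4]
    have h6 := mul_le_mul_of_nonneg_left h2 (by linarith : 0 ≤ 2 - δ)
    have h7 : 2 * p.driftWeight * Γ ≤ p.γ / 2 * Γ := by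
      have := hp.driftWeight_le
      gcongr
      linarith
    have h8 : p.γ / 2 * Γ ≤ (2 - δ) * (p.γ / 2 * Γ) :=
      le_mul_of_one_le_left (by positivity) (by linarith)
    have h9 : (2 - δ) * G' ≤ (2 - δ) * (G - p.γ / 2 * Γ + p.γ / 2 * B + p.γ / 2 * V) := by
      rw [hG', hG]
      linarith
    have h10 := mul_nonneg hδ0.le hX0
    linarith

/-- Convergence in the strongly convex case. -/
theorem strongly_convex_bound (k : ℕ) :
    gap μ f g (xHat p T N fhat ghat q₀ ξ k) + Etot p T N fhat ghat q₀ ξ μ f g k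
      ≤ (1 - (2 * p.κL)⁻¹) ^ k * (Etot p T N fhat ghat q₀ ξ μ f g 0
          + gap μ f g (xIter p T N fhat ghat q₀ ξ 0)) + 2 * p.W2 / p.L := by
  have hmin := outer_xStar_le hp hr hpos hsc
  have hb : BddBelow (Set.range (outer f g)) := ⟨_, Set.forall_mem_range.mpr hmin⟩
  have hu : 0 ≤ 1 - p.u := by rcases hp.u_eq with hu | ⟨hu, -⟩ <;> simp [hu]
  have h0 : 0 ≤ Etot p T N fhat ghat q₀ ξ μ f g 0
      + gap μ f g (xIter p T N fhat ghat q₀ ξ 0) := by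
    have h1 : 0 ≤ ∫ ω, ‖xIter p T N fhat ghat q₀ ξ 0 ω - xStar f g‖ ^ 2 ∂μ :=
      integral_nonneg fun _ => by positivity
    have h2 := mul_nonneg (a_nonneg hp (T := T)) (Ey_nonneg (p := p) (T := T) (N := N)
      (fhat := fhat) (ghat := ghat) (q₀ := q₀) (ξ := ξ) (μ := μ) (g := g) 0)
    have h3 := mul_nonneg (b_nonneg hp (N := N)) (Ez_nonneg (p := p) (T := T) (N := N)
      (fhat := fhat) (ghat := ghat) (q₀ := q₀) (ξ := ξ) (μ := μ) (f := f) (g := g) 0)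
    have h4 := gap_nonneg (μ := μ) hb (xIter p T N fhat ghat q₀ ξ 0)
    have h5 := hp.η_pos 0
    unfold Etot
    rw [Ex_of_pos hp hpos]
    positivity
  have hγW : 2 * p.W2 / p.L = 2 * (p.γ * p.W2) := by
    unfold Params.γ
    ring
  have hκ : (2 * p.κL)⁻¹ = p.γ * p.ηmin / 2 := by
    rw [mul_inv, hp.κL_inv]
    ring
  rw [hγW, hκ]
  have hδ0 : 0 ≤ p.γ * p.ηmin := (mul_pos hp.γ_pos hp.ηmin_pos).le
  have hδ1 : p.γ * p.ηmin ≤ 1 := (hp.δ_mem 0).1.trans (hp.δ_mem 0).2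
  have hW : 0 ≤ p.γ * p.W2 := by
    have h1 := hp.varf_nonneg
    have h2 := hp.varxy_nonneg
    have h3 := hp.varyy_nonneg
    have h4 := hp.varg_nonneg
    have h5 := hp.μg_pos
    have h6 := hp.Lg_pos
    have h7 := hp.Lg'_pos
    have h8 := hp.γ_pos
    have h9 : 0 < p.κL := div_pos hp.L_pos hp.ηmin_pos
    unfold Params.W2 Params.wx2
    split_ifs
    positivity
  induction k with
  | zero =>
    rw [pow_zero, one_mul]
    have : xHat p T N fhat ghat q₀ ξ 0 = xIter p T N fhat ghat q₀ ξ 0 := rfl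
    rw [this]
    linarith
  | succ k ih =>
    obtain ⟨h1, h2⟩ := hp.δ_mem (k + 1)
    refine (energy_step_of_pos hp hr hm hn hn2 hs hq2 hT hN hpos hsc k).trans ?_
    -- The accumulated noise 2γ𝒲² is a fixed point of the recursion for every δ: (1 - δ/2) 2γ𝒲² +
    -- γδ𝒲² = 2γ𝒲². Only the first part uses δ ≥ 1/κ_ℒ.
    have h3 := mul_le_mul_of_nonneg_left ih (by linarith : 0 ≤ 1 - p.δ (k + 1) / 2)
    set E₀ := Etot p T N fhat ghat q₀ ξ μ f g 0 + gap μ f g (xIter p T N fhat ghat q₀ ξ 0)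
    have h4 : 0 ≤ (1 - p.γ * p.ηmin / 2) ^ k * E₀ :=
      mul_nonneg (pow_nonneg (by linarith) _) h0
    have h5 : (1 - p.δ (k + 1) / 2) * ((1 - p.γ * p.ηmin / 2) ^ k * E₀)
        ≤ (1 - p.γ * p.ηmin / 2) * ((1 - p.γ * p.ηmin / 2) ^ k * E₀) :=
      mul_le_mul_of_nonneg_right (by linarith) h4
    rw [pow_succ']
    linarith

end StronglyConvex

end AmIGO

namespace AmIGO

/-! ### Order of magnitude of the effective variance -/

namespace Params

lemma Admissible.wx2_nonneg {p : Params} (hp : p.Admissible) : 0 ≤ p.wx2 := by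
  have h1 := hp.varf_nonneg
  have h2 := hp.varxy_nonneg
  have h3 := hp.varyy_nonneg
  have h5 := hp.μg_pos
  have h6 := hp.Lg_pos
  have h7 := hp.Lg'_pos
  unfold wx2
  positivity

/-- u = 0 is admitted only without noise, so the first coefficient is 3 as soon as there is some. -/
lemma Admissible.W2_eq {p : Params} (hp : p.Admissible) (h : ¬ p.Deterministic) :
    p.W2 = 3 * p.wx2 + 60 * p.κL * p.Lψ ^ 2 / (p.μg * p.Lg) * p.varg := by
  have hu : p.u = 1 := by
    rcases hp.u_eq with hu | ⟨-, hd⟩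
    · exact hu
    · exact absurd hd h
  unfold W2
  rw [hu]
  simp

lemma Admissible.κL_pos {p : Params} (hp : p.Admissible) : 0 < p.κL :=
  div_pos hp.L_pos hp.ηmin_pos

lemma Admissible.one_le_κL {p : Params} (hp : p.Admissible) : 1 ≤ p.κL :=
  (one_le_div hp.ηmin_pos).mpr ((hp.η_mem 0).1.trans (hp.η_mem 0).2)

lemma Admissible.one_le_κg {p : Params} (hp : p.Admissible) : 1 ≤ p.κg :=
  (one_le_div hp.μg_pos).mpr hp.μg_le

/-- The effective variance is positive as soon as there is some noise. -/
lemma Admissible.W2_pos {p : Params} (hp : p.Admissible) (h : ¬ p.Deterministic) : 0 < p.W2 := by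
  rw [hp.W2_eq h]
  have h1 := hp.varf_nonneg
  have h2 := hp.varxy_nonneg
  have h3 := hp.varyy_nonneg
  have h4 := hp.varg_nonneg
  have h5 := hp.μg_pos
  have h6 := hp.Lg_pos
  have h7 := hp.Lg'_pos
  have h8 := hp.B_pos
  have h9 := hp.κL_pos
  have h10 := hp.Lψ_pos
  have h11 := hp.wx2_nonneg
  have hvar : ∀ {s : ℝ} {n : ℕ}, s ≠ 0 → 1 ≤ n → 0 < s ^ 2 / n := fun hs hn =>
    div_pos (by positivity) (Nat.cast_pos.mpr hn)
  by_cases hg : p.σg = 0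
  · have hw : 0 < p.wx2 := by
      unfold wx2
      by_cases hf : p.σf = 0
      · by_cases hxy : p.σxy = 0
        · have hyy : p.σyy ≠ 0 := fun hyy => h ⟨hf, hg, hxy, hyy⟩
          have : 0 < p.varyy := hvar hyy hp.nyy_pos
          positivity
        · have : 0 < p.varxy := hvar hxy hp.nxy_pos
          positivity
      · have : 0 < p.varf := hvar hf hp.nf_pos
        positivity
    positivity
  · have : 0 < p.varg := hvar hg hp.ng_pos
    positivity

/-- The admissible parameters with given constants. -/
def withConstants (Lg Lf B Lg' Mg σxy : ℝ) : Set Params :=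
  {p | p.Admissible ∧ p.Lg = Lg ∧ p.Lf = Lf ∧ p.B = B ∧ p.Lg' = Lg' ∧ p.Mg = Mg ∧ p.σxy = σxy}

section Variance

variable {Lg Lf B Lg' Mg σxy : ℝ} {p : Params}

lemma varxy_le (hp : p.Admissible) : p.varxy ≤ p.σxy ^ 2 :=
  div_le_self (sq_nonneg _) (Nat.one_le_cast.mpr hp.nxy_pos)

lemma inv_μg_eq (hp : p.Admissible) : p.μg⁻¹ = p.κg * p.Lg⁻¹ := by
  have := hp.Lg_pos.ne'
  unfold κg
  field_simp

/-- L_ψ grows like κ_g², through L_z. Its square and the factor 1/(μ_g L_g) give the power κ_g⁵ in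
front of σ_g². -/
lemma Lψ_le (hp : p.Admissible) : p.Lψ ≤ p.κg ^ 2 * (p.Lf + p.Mg * p.B * p.Lg⁻¹
    + p.Lg' * (p.Mg * p.B * p.Lg⁻¹ ^ 2 + p.Lf * p.Lg⁻¹) + p.Lg') := by
  have h0 := hp.one_le_κg
  have h1 : p.κg ≤ p.κg ^ 2 := le_self_pow₀ h0 two_ne_zero
  have h2 : 1 ≤ p.κg ^ 2 := one_le_pow₀ h0
  have hL := inv_pos.mpr hp.Lg_pos
  have hf := hp.Lf_pos
  have hB := mul_pos hp.Mg_pos hp.B_pos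
  have hg := hp.Lg'_pos
  have e1 : p.Lf + p.Mg * p.B / p.μg + p.Lg' * p.Lz = p.Lf + p.Mg * p.B * p.Lg⁻¹ * p.κg
      + p.Lg' * (p.Mg * p.B * p.Lg⁻¹ ^ 2 * p.κg ^ 2 + p.Lf * p.Lg⁻¹ * p.κg) := by
    unfold Lz
    rw [div_eq_mul_inv, div_eq_mul_inv, div_eq_mul_inv, ← inv_pow, inv_μg_eq hp]
    ring
  have f1 : p.Lf ≤ p.Lf * p.κg ^ 2 := le_mul_of_one_le_right hf.le h2
  have f2 : p.Mg * p.B * p.Lg⁻¹ * p.κg ≤ p.Mg * p.B * p.Lg⁻¹ * p.κg ^ 2 := by gcongr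
  have f3 : p.Lg' * (p.Lf * p.Lg⁻¹) * p.κg ≤ p.Lg' * (p.Lf * p.Lg⁻¹) * p.κg ^ 2 := by gcongr
  have f4 : p.Lg' ≤ p.Lg' * p.κg ^ 2 := le_mul_of_one_le_right hg.le h2
  have f5 : 0 ≤ p.Lg' * p.κg ^ 2 := by positivity
  have f6 : 0 ≤ p.κg ^ 2 * (p.Lf + p.Mg * p.B * p.Lg⁻¹
    + p.Lg' * (p.Mg * p.B * p.Lg⁻¹ ^ 2 + p.Lf * p.Lg⁻¹)) := by positivity
  refine max_le ?_ ?_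
  · rw [e1]
    linarith
  · linarith

lemma exists_W2_le (Lg Lf B Lg' Mg σxy : ℝ) : ∃ c : ℝ, 0 ≤ c ∧
    ∀ p ∈ withConstants Lg Lf B Lg' Mg σxy,
      p.W2 ≤ c * (p.κL * p.κg ^ 5 * p.varg + p.κg ^ 3 * p.varyy + p.κg ^ 2 * p.varxy
        + p.κg ^ 2 * p.varf) := by
  set cψ := Lf + Mg * B * Lg⁻¹ + Lg' * (Mg * B * Lg⁻¹ ^ 2 + Lf * Lg⁻¹) + Lg' with hcψ
  -- The constants are fixed before any admissible parameter is known, hence the absolute value: the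
  -- signs of L_g' and L_g are not available yet.
  set c1 := 3 * (1 + 2 * |Lg' * Lg⁻¹| + 6 * (σxy ^ 2 + Lg' ^ 2) * Lg⁻¹ ^ 2) with hc1
  set c2 := 6 * (σxy ^ 2 + Lg' ^ 2) * B ^ 2 * Lg⁻¹ ^ 4 with hc2
  set c3 := 6 * B ^ 2 * Lg⁻¹ ^ 2 with hc3
  set c4 := 60 * cψ ^ 2 * Lg⁻¹ ^ 2 with hc4
  have n1 : 0 ≤ c1 := by positivity
  have n2 : 0 ≤ c2 := by positivity
  have n3 : 0 ≤ c3 := by positivity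
  have n4 : 0 ≤ c4 := by positivity
  refine ⟨c1 + c2 + c3 + c4, by positivity, ?_⟩
  rintro p ⟨hp, rfl, rfl, rfl, rfl, rfl, rfl⟩
  have h1 := hp.varf_nonneg
  have h2 := hp.varxy_nonneg
  have h3 := hp.varyy_nonneg
  have h4 := hp.varg_nonneg
  have hκ := hp.one_le_κg
  have hκ0 : 0 < p.κg := by linarith
  have hκL := hp.κL_pos
  have hLi := inv_pos.mpr hp.Lg_pos
  have hg := hp.Lg'_pos
  have hB := hp.B_pos
  have hRHS : 0 ≤ p.κL * p.κg ^ 5 * p.varg + p.κg ^ 3 * p.varyy + p.κg ^ 2 * p.varxy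
        + p.κg ^ 2 * p.varf := by positivity
  by_cases hd : p.Deterministic
  · rw [(noise_eq_zero_of_deterministic hd).2.2.2]
    positivity
  have hxy := varxy_le hp
  have e1 : p.W2 = 3 * (1 + 2 * (p.Lg' * p.Lg⁻¹) * p.κg
        + 6 * (p.varxy + p.Lg' ^ 2) * p.Lg⁻¹ ^ 2 * p.κg ^ 2) * p.varf
      + 6 * (p.varxy + p.Lg' ^ 2) * p.B ^ 2 * p.Lg⁻¹ ^ 4 * (p.κg ^ 3 * p.varyy)
      + c3 * (p.κg ^ 2 * p.varxy)
      + 60 * p.Lψ ^ 2 * p.Lg⁻¹ ^ 2 * (p.κL * p.κg * p.varg) := by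
    rw [hp.W2_eq hd]
    unfold wx2
    simp only [div_eq_mul_inv, mul_inv, ← inv_pow, inv_μg_eq hp, hc3]
    ring
  have h5 := Lψ_le hp
  have hψ := hp.Lψ_pos
  have g1 : 3 * (1 + 2 * (p.Lg' * p.Lg⁻¹) * p.κg
        + 6 * (p.varxy + p.Lg' ^ 2) * p.Lg⁻¹ ^ 2 * p.κg ^ 2) ≤ c1 * p.κg ^ 2 := by
    have f1 : 1 ≤ p.κg ^ 2 := one_le_pow₀ hκ
    have f2 : p.κg ≤ p.κg ^ 2 := le_self_pow₀ hκ two_ne_zero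
    have f3 : p.Lg' * p.Lg⁻¹ * p.κg ≤ |p.Lg' * p.Lg⁻¹| * p.κg ^ 2 :=
      mul_le_mul (le_abs_self _) f2 hκ0.le (abs_nonneg _)
    have f4 : 6 * (p.varxy + p.Lg' ^ 2) * p.Lg⁻¹ ^ 2 * p.κg ^ 2
        ≤ 6 * (p.σxy ^ 2 + p.Lg' ^ 2) * p.Lg⁻¹ ^ 2 * p.κg ^ 2 := by gcongr
    rw [hc1]
    linarith
  have g2 : 6 * (p.varxy + p.Lg' ^ 2) * p.B ^ 2 * p.Lg⁻¹ ^ 4 ≤ c2 := by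
    rw [hc2]
    gcongr
  have g4 : 60 * p.Lψ ^ 2 * p.Lg⁻¹ ^ 2 ≤ c4 * p.κg ^ 4 := by
    have : p.Lψ ^ 2 ≤ (p.κg ^ 2 * cψ) ^ 2 := pow_le_pow_left₀ hψ.le h5 2
    calc 60 * p.Lψ ^ 2 * p.Lg⁻¹ ^ 2 ≤ 60 * (p.κg ^ 2 * cψ) ^ 2 * p.Lg⁻¹ ^ 2 := by gcongr
      _ = c4 * p.κg ^ 4 := by rw [hc4]; ring
  have k1 := mul_le_mul_of_nonneg_right g1 h1
  have k2 := mul_le_mul_of_nonneg_right g2 (by positivity : 0 ≤ p.κg ^ 3 * p.varyy)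
  have k4 := mul_le_mul_of_nonneg_right g4 (by positivity : 0 ≤ p.κL * p.κg * p.varg)
  have m1 : 0 ≤ p.κg ^ 2 * p.varf := by positivity
  have m2 : 0 ≤ p.κg ^ 3 * p.varyy := by positivity
  have m3 : 0 ≤ p.κg ^ 2 * p.varxy := by positivity
  have m4 : 0 ≤ p.κL * p.κg ^ 5 * p.varg := by positivity
  have l1 : c1 * (p.κg ^ 2 * p.varf) ≤ (c1 + c2 + c3 + c4) * (p.κg ^ 2 * p.varf) := by
    gcongr
    linarith
  have l2 : c2 * (p.κg ^ 3 * p.varyy) ≤ (c1 + c2 + c3 + c4) * (p.κg ^ 3 * p.varyy) := by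
    gcongr
    linarith
  have l3 : c3 * (p.κg ^ 2 * p.varxy) ≤ (c1 + c2 + c3 + c4) * (p.κg ^ 2 * p.varxy) := by
    gcongr
    linarith
  have l4 : c4 * (p.κL * p.κg ^ 5 * p.varg)
      ≤ (c1 + c2 + c3 + c4) * (p.κL * p.κg ^ 5 * p.varg) := by
    gcongr
    linarith
  rw [e1]
  linarith

end Variance

/-! ### Numbers of inner iterations -/

/-- A nonnegative quantity that is at most polynomial in the condition numbers. -/
def PolyBounded (S : Set Params) (F : Params → ℝ) : Prop :=
  ∃ (c : ℝ) (m : ℕ), 0 < c ∧ ∀ p ∈ S, 0 ≤ F p ∧ F p ≤ c * (p.κg * p.κL) ^ m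

/-- A quantity that is at most logarithmic in the condition numbers. -/
def LogBounded (S : Set Params) (F : Params → ℝ) : Prop :=
  ∃ c : ℝ, 0 ≤ c ∧ ∀ p ∈ S, F p ≤ c * (1 + Real.log p.κg + Real.log p.κL)

lemma Admissible.one_le_κg_mul_κL {p : Params} (hp : p.Admissible) : 1 ≤ p.κg * p.κL :=
  one_le_mul_of_one_le_of_one_le hp.one_le_κg hp.one_le_κL

lemma Admissible.one_le_log_factor {p : Params} (hp : p.Admissible) :
    1 ≤ 1 + Real.log p.κg + Real.log p.κL := by
  have := Real.log_nonneg hp.one_le_κg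
  have := Real.log_nonneg hp.one_le_κL
  linarith

section Closure

variable {S : Set Params} {F G : Params → ℝ}

lemma PolyBounded.mono (hF : PolyBounded S F) (h : ∀ p ∈ S, 0 ≤ G p ∧ G p ≤ F p) :
    PolyBounded S G := by
  obtain ⟨c, m, hc, hF⟩ := hF
  exact ⟨c, m, hc, fun p hp => ⟨(h p hp).1, (h p hp).2.trans (hF p hp).2⟩⟩

variable (hS : ∀ p ∈ S, p.Admissible)
include hS

lemma PolyBounded.const {A : ℝ} (h : ∀ p ∈ S, 0 ≤ F p ∧ F p ≤ A) : PolyBounded S F :=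
  ⟨|A| + 1, 0, by positivity, fun p hp => ⟨(h p hp).1, by
    rw [pow_zero, mul_one]
    linarith [(h p hp).2, le_abs_self A]⟩⟩

lemma polyBounded_κg : PolyBounded S κg :=
  ⟨1, 1, one_pos, fun p hp => ⟨by linarith [(hS p hp).one_le_κg], by
    rw [one_mul, pow_one]
    exact le_mul_of_one_le_right (by linarith [(hS p hp).one_le_κg]) (hS p hp).one_le_κL⟩⟩

lemma polyBounded_κL : PolyBounded S κL :=
  ⟨1, 1, one_pos, fun p hp => ⟨by linarith [(hS p hp).one_le_κL], by
    rw [one_mul, pow_one]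
    exact le_mul_of_one_le_left (by linarith [(hS p hp).one_le_κL]) (hS p hp).one_le_κg⟩⟩

lemma PolyBounded.add (hF : PolyBounded S F) (hG : PolyBounded S G) :
    PolyBounded S fun p => F p + G p := by
  obtain ⟨c, m, hc, hF⟩ := hF
  obtain ⟨d, n, hd, hG⟩ := hG
  refine ⟨c + d, m + n, by positivity, fun p hp => ⟨add_nonneg (hF p hp).1 (hG p hp).1, ?_⟩⟩
  have h1 := (hS p hp).one_le_κg_mul_κL
  have h2 := mul_le_mul_of_nonneg_left (pow_le_pow_right₀ h1 (Nat.le_add_right m n)) hc.le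
  have h3 := mul_le_mul_of_nonneg_left (pow_le_pow_right₀ h1 (Nat.le_add_left n m)) hd.le
  rw [add_mul]
  linarith [(hF p hp).2, (hG p hp).2]

omit hS in
lemma PolyBounded.mul (hF : PolyBounded S F) (hG : PolyBounded S G) :
    PolyBounded S fun p => F p * G p := by
  obtain ⟨c, m, hc, hF⟩ := hF
  obtain ⟨d, n, hd, hG⟩ := hG
  refine ⟨c * d, m + n, by positivity, fun p hp => ⟨mul_nonneg (hF p hp).1 (hG p hp).1, ?_⟩⟩
  rw [pow_add, mul_mul_mul_comm]
  exact mul_le_mul (hF p hp).2 (hG p hp).2 (hG p hp).1 ((hF p hp).1.trans (hF p hp).2)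

/-- The degree of the polynomial bound becomes a factor of the logarithm, so it need not be tracked.
-/
lemma PolyBounded.log (hF : PolyBounded S F) (h0 : ∀ p ∈ S, 0 < F p) :
    LogBounded S fun p => Real.log (F p) := by
  obtain ⟨c, m, hc, hF⟩ := hF
  refine ⟨|Real.log c| + m, by positivity, fun p hp => ?_⟩
  have h1 := (hS p hp).one_le_κg
  have h2 := (hS p hp).one_le_κL
  have h3 := Real.log_le_log (h0 p hp) (hF p hp).2
  rw [Real.log_mul hc.ne' (by positivity), Real.log_pow, Real.log_mul (by positivity)
    (by positivity)] at h3
  have h4 := Real.log_nonneg h1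
  have h5 := Real.log_nonneg h2
  have h6 := le_abs_self (Real.log c)
  have h7 : |Real.log c| ≤ |Real.log c| * (1 + Real.log p.κg + Real.log p.κL) :=
    le_mul_of_one_le_right (abs_nonneg _) (by linarith)
  have h8 : (0 : ℝ) ≤ m := Nat.cast_nonneg m
  linarith

lemma LogBounded.const (A : ℝ) : LogBounded S fun _ => A :=
  ⟨|A|, abs_nonneg A, fun p hp => (le_abs_self A).trans
    (le_mul_of_one_le_right (abs_nonneg A) (hS p hp).one_le_log_factor)⟩

omit hS in
lemma LogBounded.add (hF : LogBounded S F) (hG : LogBounded S G) :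
    LogBounded S fun p => F p + G p := by
  obtain ⟨c, hc, hF⟩ := hF
  obtain ⟨d, hd, hG⟩ := hG
  exact ⟨c + d, by positivity, fun p hp => by linarith [hF p hp, hG p hp]⟩

omit hS in
lemma LogBounded.const_mul (hF : LogBounded S F) {A : ℝ} (hA : 0 ≤ A) :
    LogBounded S fun p => A * F p := by
  obtain ⟨c, hc, hF⟩ := hF
  refine ⟨A * c, by positivity, fun p hp => ?_⟩
  rw [mul_assoc]
  exact mul_le_mul_of_nonneg_left (hF p hp) hA

lemma LogBounded.max (hF : LogBounded S F) (hG : LogBounded S G) :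
    LogBounded S fun p => max (F p) (G p) := by
  obtain ⟨c, hc, hF⟩ := hF
  obtain ⟨d, hd, hG⟩ := hG
  refine ⟨c + d, by positivity, fun p hp => ?_⟩
  have h1 := (hS p hp).one_le_log_factor
  have h2 := mul_nonneg hc (zero_le_one.trans h1)
  have h3 := mul_nonneg hd (zero_le_one.trans h1)
  exact max_le (by linarith [hF p hp]) (by linarith [hG p hp])

/-- The entries -2 log F grow when F is small, so it is 1/F that has to be polynomially bounded. -/
lemma PolyBounded.neg_log_inv (hF : PolyBounded S fun p => (F p)⁻¹) (h0 : ∀ p ∈ S, 0 < F p) :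
    LogBounded S fun p => -2 * Real.log (F p) := by
  have h := (hF.log hS fun p hp => inv_pos.mpr (h0 p hp)).const_mul zero_le_two
  simp only [Real.log_inv, mul_neg] at h
  simpa only [neg_mul] using h

end Closure

end Params

end AmIGO

namespace AmIGO

namespace Params

/-! ### Polynomial bounds of the constants, and the numbers of inner iterations -/

section Orders

variable {Lg Lf B Lg' Mg σxy : ℝ}

local notation "𝒮" => withConstants Lg Lf B Lg' Mg σxy

lemma admissible_of_mem : ∀ p ∈ 𝒮, p.Admissible := fun _ h => h.1

lemma polyBounded_const (A : ℝ) (hA : 0 ≤ A) : PolyBounded 𝒮 fun _ => A :=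
  PolyBounded.const admissible_of_mem fun _ _ => ⟨hA, le_rfl⟩

lemma polyBounded_inv_μg : PolyBounded 𝒮 fun p => p.μg⁻¹ :=
  ((polyBounded_κg admissible_of_mem).mul (PolyBounded.const (F := fun p => p.Lg⁻¹)
    admissible_of_mem (A := Lg⁻¹) fun p h => ⟨(inv_pos.mpr h.1.Lg_pos).le, by rw [h.2.1]⟩)).mono
      fun p h => ⟨(inv_pos.mpr h.1.μg_pos).le, (inv_μg_eq h.1).le⟩

lemma polyBounded_μg : PolyBounded 𝒮 fun p => p.μg :=
  PolyBounded.const admissible_of_mem (A := Lg) fun p h =>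
    ⟨h.1.μg_pos.le, by rw [← h.2.1]; exact h.1.μg_le⟩

lemma polyBounded_Lg : PolyBounded 𝒮 fun p => p.Lg :=
  PolyBounded.const admissible_of_mem (A := Lg) fun _ h => ⟨h.1.Lg_pos.le, h.2.1.le⟩

lemma polyBounded_Lf : PolyBounded 𝒮 fun p => p.Lf :=
  PolyBounded.const admissible_of_mem (A := Lf) fun _ h => ⟨h.1.Lf_pos.le, h.2.2.1.le⟩

lemma polyBounded_MgB : PolyBounded 𝒮 fun p => p.Mg * p.B :=
  PolyBounded.const admissible_of_mem (A := Mg * B) fun p h =>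
    ⟨(mul_pos h.1.Mg_pos h.1.B_pos).le, by rw [h.2.2.2.1, h.2.2.2.2.2.1]⟩

lemma polyBounded_Lg' : PolyBounded 𝒮 fun p => p.Lg' :=
  PolyBounded.const admissible_of_mem (A := Lg') fun _ h => ⟨h.1.Lg'_pos.le, h.2.2.2.2.1.le⟩

lemma polyBounded_inv_Lg' : PolyBounded 𝒮 fun p => p.Lg'⁻¹ :=
  PolyBounded.const admissible_of_mem (A := Lg'⁻¹) fun p h =>
    ⟨(inv_pos.mpr h.1.Lg'_pos).le, by rw [h.2.2.2.2.1]⟩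

lemma PolyBounded.of_eq {S : Set Params} {F G : Params → ℝ} (hF : PolyBounded S F)
    (h : ∀ p, G p = F p) : PolyBounded S G := by
  rwa [show G = F from funext h]

lemma PolyBounded.sq {S : Set Params} {F : Params → ℝ} (hF : PolyBounded S F) :
    PolyBounded S fun p => F p ^ 2 :=
  (hF.mul hF).of_eq fun _ => pow_two _

lemma polyBounded_Ly : PolyBounded 𝒮 Ly :=
  (polyBounded_Lg'.mul polyBounded_inv_μg).of_eq fun p => by
    unfold Ly
    ring

lemma polyBounded_Lz : PolyBounded 𝒮 Lz :=
  ((polyBounded_MgB.mul polyBounded_inv_μg.sq).add admissible_of_mem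
    (polyBounded_Lf.mul polyBounded_inv_μg)).of_eq fun p => by
    unfold Lz
    ring

lemma polyBounded_Lψ : PolyBounded 𝒮 Lψ := by
  have hS := admissible_of_mem (Lg := Lg) (Lf := Lf) (B := B) (Lg' := Lg') (Mg := Mg) (σxy := σxy)
  refine (((polyBounded_Lf.add hS (polyBounded_MgB.mul polyBounded_inv_μg)).add hS
    (polyBounded_Lg'.mul polyBounded_Lz)).add hS polyBounded_Lg').mono fun p h =>
      ⟨h.1.Lψ_pos.le, max_le ?_ ?_⟩
  · rw [div_eq_mul_inv]
    linarith [h.1.Lg'_pos]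
  · have := h.1.Lf_pos
    have := mul_pos (mul_pos h.1.Mg_pos h.1.B_pos) (inv_pos.mpr h.1.μg_pos)
    have := mul_pos h.1.Lg'_pos h.1.Lz_pos
    linarith

lemma polyBounded_inv_Lψ : PolyBounded 𝒮 fun p => (p.Lψ)⁻¹ :=
  polyBounded_inv_Lg'.mono fun _ h => ⟨(inv_pos.mpr h.1.Lψ_pos).le,
    inv_anti₀ h.1.Lg'_pos (le_max_right _ _)⟩

lemma polyBounded_L : PolyBounded 𝒮 L := by
  have hS := admissible_of_mem (Lg := Lg) (Lf := Lf) (B := B) (Lg' := Lg') (Mg := Mg) (σxy := σxy)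
  exact ((((polyBounded_Lf.add hS ((polyBounded_Lg'.mul polyBounded_MgB).mul
    polyBounded_inv_μg.sq)).add hS (((polyBounded_Lg'.mul polyBounded_Lf).add hS
      polyBounded_MgB).mul polyBounded_inv_μg))).mul ((polyBounded_const 1 zero_le_one).add hS
        (polyBounded_Lg'.mul polyBounded_inv_μg))).of_eq fun p => by
    unfold L
    ring

/-- Bounds L from below by a constant that does not depend on μ_g. -/
lemma Lf_le_L {p : Params} (hp : p.Admissible) : p.Lf ≤ p.L := by
  have h1 := hp.μg_pos
  have h2 := hp.Lg'_pos
  have h3 := hp.Mg_pos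
  have h4 := hp.B_pos
  have h5 := hp.Lf_pos
  have h6 : p.Lf ≤ p.Lf + p.Lg' * p.Mg * p.B / p.μg ^ 2
      + (p.Lg' * p.Lf + p.Mg * p.B) / p.μg := by
    have : 0 ≤ p.Lg' * p.Mg * p.B / p.μg ^ 2 := by positivity
    have : 0 ≤ (p.Lg' * p.Lf + p.Mg * p.B) / p.μg := by positivity
    linarith
  refine h6.trans (le_mul_of_one_le_right (h5.le.trans h6) ?_)
  have : 0 ≤ p.Lg' / p.μg := by positivity
  linarith

lemma polyBounded_inv_L : PolyBounded 𝒮 fun p => (p.L)⁻¹ :=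
  PolyBounded.const admissible_of_mem (A := Lf⁻¹) fun p h =>
    ⟨(inv_pos.mpr h.1.L_pos).le, by
      rw [← h.2.2.1]
      exact inv_anti₀ h.1.Lf_pos (Lf_le_L h.1)⟩

lemma polyBounded_η : PolyBounded 𝒮 fun p => p.η 0 :=
  polyBounded_L.mono fun _ h => ⟨(h.1.η_pos 0).le, (h.1.η_mem 0).2⟩

/-- 1/ηmin = κ_ℒ/L; this is how κ_ℒ enters the numbers of inner iterations. -/
lemma polyBounded_inv_ηmin : PolyBounded 𝒮 fun p => (p.ηmin)⁻¹ :=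
  ((polyBounded_κL admissible_of_mem).mul polyBounded_inv_L).mono fun p h =>
    ⟨(inv_pos.mpr h.1.ηmin_pos).le, by
      have := h.1.L_pos.ne'
      unfold κL
      apply le_of_eq
      field_simp⟩

lemma polyBounded_inv_η : PolyBounded 𝒮 fun p => (p.η 0)⁻¹ :=
  polyBounded_inv_ηmin.mono fun _ h =>
    ⟨(inv_pos.mpr (h.1.η_pos 0)).le, inv_anti₀ h.1.ηmin_pos (h.1.η_mem 0).1⟩

/-- The Hessian noise level is not among the fixed constants; the batch condition σ_yy² ≤ μ_g L_g
replaces it. -/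
lemma polyBounded_σx2 : PolyBounded 𝒮 σx2 := by
  have hS := admissible_of_mem (Lg := Lg) (Lf := Lf) (B := B) (Lg' := Lg') (Mg := Mg) (σxy := σxy)
  refine ((polyBounded_const (2 * σxy ^ 2) (by positivity)).add hS
    (((polyBounded_const 2 zero_le_two).mul polyBounded_Lg'.sq).mul (polyBounded_inv_μg.sq.mul
      (polyBounded_μg.mul polyBounded_Lg)))).mono fun p h => ⟨h.1.σx2_nonneg, ?_⟩
  have h1 := varxy_le h.1
  rw [h.2.2.2.2.2.2] at h1
  have h2 : 2 * p.Lg' ^ 2 / p.μg ^ 2 * p.varyy ≤ 2 * p.Lg' ^ 2 / p.μg ^ 2 * (p.μg * p.Lg) :=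
    mul_le_mul_of_nonneg_left h.1.varyy_le (by positivity)
  have h3 : 2 * p.Lg' ^ 2 * (p.μg⁻¹ ^ 2 * (p.μg * p.Lg))
      = 2 * p.Lg' ^ 2 / p.μg ^ 2 * (p.μg * p.Lg) := by
    rw [div_eq_mul_inv, inv_pow]
    ring
  unfold σx2
  linarith

lemma polyBounded_ζ₀ : PolyBounded 𝒮 ζ₀ := by
  have hS := admissible_of_mem (Lg := Lg) (Lf := Lf) (B := B) (Lg' := Lg') (Mg := Mg) (σxy := σxy)
  refine ((((polyBounded_const 2 zero_le_two).mul polyBounded_L.sq).mul (polyBounded_η.mul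
    polyBounded_inv_ηmin.sq)).add hS ((polyBounded_const 2 zero_le_two).mul polyBounded_L)).mono
      fun p h => ⟨h.1.ζ₀_pos.le, ?_⟩
  have h1 := h.1.L_pos
  have h2 := h.1.η_pos 0
  have h3 := h.1.ηmin_pos
  have h4 : 0 ≤ 2 * p.L ^ 2 * (p.η 0 * p.ηmin⁻¹ ^ 2) := by positivity
  unfold ζ₀
  split_ifs
  · have h5 : 2 * p.L ^ 2 * p.η 0 / p.ηmin ^ 2 = 2 * p.L ^ 2 * (p.η 0 * p.ηmin⁻¹ ^ 2) := by
      rw [div_eq_mul_inv, inv_pow]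
      ring
    linarith
  · linarith

lemma logBounded_C : LogBounded 𝒮 C := by
  have hS := admissible_of_mem (Lg := Lg) (Lf := Lf) (B := B) (Lg' := Lg') (Mg := Mg) (σxy := σxy)
  have p1 : PolyBounded 𝒮 fun p => 6 + 24 * p.Lψ ^ 2 / p.η 0 :=
    ((polyBounded_const 6 (by norm_num)).add hS (((polyBounded_const 24 (by norm_num)).mul
      polyBounded_Lψ.sq).mul polyBounded_inv_η)).of_eq fun p => by rw [div_eq_mul_inv]
  have p2 : PolyBounded 𝒮 fun p => 1 + 4 * p.Ly ^ 2 / p.L ^ 2 * max (p.η 0) (8 * p.ζ₀) := by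
    have h8 : PolyBounded 𝒮 fun p => max (p.η 0) (8 * p.ζ₀) :=
      (polyBounded_η.add hS ((polyBounded_const 8 (by norm_num)).mul polyBounded_ζ₀)).mono
        fun p h => by
          have h1 := h.1.η_pos 0
          have h2 := h.1.ζ₀_pos
          exact ⟨h1.le.trans (le_max_left _ _), max_le (by linarith) (by linarith)⟩
    exact ((polyBounded_const 1 zero_le_one).add hS ((((polyBounded_const 4 (by norm_num)).mul
      polyBounded_Ly.sq).mul polyBounded_inv_L.sq).mul h8)).of_eq fun p => by
        rw [div_eq_mul_inv, inv_pow]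
  have p4 : PolyBounded 𝒮 fun p => (5 * p.Lψ ^ 2 / p.η 0)⁻¹ :=
    (((polyBounded_const 5⁻¹ (by norm_num)).mul polyBounded_inv_Lψ.sq).mul polyBounded_η).of_eq
      fun p => by rw [inv_div, div_eq_mul_inv, mul_inv, inv_pow]; ring
  have p5 : PolyBounded 𝒮 fun p => (p.L / (4 * p.Ly ^ 2))⁻¹ :=
    (((polyBounded_const 4 (by norm_num)).mul polyBounded_Ly.sq).mul polyBounded_inv_L).of_eq
      fun p => by rw [inv_div, div_eq_mul_inv]
  refine LogBounded.max hS ((LogBounded.const hS 1).add ((p1.log hS ?_).const_mul zero_le_two))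
    (LogBounded.max hS ((p2.log hS ?_).const_mul zero_le_two) (LogBounded.max hS
      (LogBounded.const hS 0) (LogBounded.max hS (p4.neg_log_inv hS ?_) (p5.neg_log_inv hS ?_))))
  all_goals
    intro p h
    have h1 := h.1.η_pos 0
    have h2 := h.1.Lψ_pos
    have h3 := h.1.Ly_pos
    have h4 := h.1.L_pos
    have h5 : 0 < max (p.η 0) (8 * p.ζ₀) := h1.trans_le (le_max_left _ _)
    positivity

lemma logBounded_C' : LogBounded 𝒮 C' := by
  have hS := admissible_of_mem (Lg := Lg) (Lf := Lf) (B := B) (Lg' := Lg') (Mg := Mg) (σxy := σxy)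
  have hLy : PolyBounded 𝒮 fun p => (p.Ly)⁻¹ :=
    (polyBounded_μg.mul polyBounded_inv_Lg').of_eq fun p => by
      unfold Ly
      rw [inv_div, div_eq_mul_inv]
  have p1 : PolyBounded 𝒮 fun p => 4 + 12 * (2 * p.Lψ ^ 2 + p.σx2) / p.η 0 :=
    ((polyBounded_const 4 (by norm_num)).add hS (((polyBounded_const 12 (by norm_num)).mul
      (((polyBounded_const 2 zero_le_two).mul polyBounded_Lψ.sq).add hS polyBounded_σx2)).mul
        polyBounded_inv_η)).of_eq fun p => by rw [div_eq_mul_inv]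
  have p2 : PolyBounded 𝒮 fun p => 1 + 2 * p.Lz ^ 2 / p.Ly ^ 2 * (1 + 16 * p.Ly ^ 2) :=
    ((polyBounded_const 1 zero_le_one).add hS ((((polyBounded_const 2 zero_le_two).mul
      polyBounded_Lz.sq).mul hLy.sq).mul ((polyBounded_const 1 zero_le_one).add hS
        ((polyBounded_const 16 (by norm_num)).mul polyBounded_Ly.sq)))).of_eq fun p => by
          rw [div_eq_mul_inv, inv_pow]
  have p4 : PolyBounded 𝒮 fun p => (p.Lψ ^ 2 / (4 * p.Lz ^ 2 * p.η 0))⁻¹ :=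
    ((((polyBounded_const 4 (by norm_num)).mul polyBounded_Lz.sq).mul polyBounded_η).mul
      polyBounded_inv_Lψ.sq).of_eq fun p => by rw [inv_div, div_eq_mul_inv, inv_pow]
  have p5 : PolyBounded 𝒮 fun p => (p.γ * (p.varxy + p.Lg' ^ 2) * (p.ηmin / p.η 0))⁻¹ := by
    have hv : PolyBounded 𝒮 fun p => (p.varxy + p.Lg' ^ 2)⁻¹ :=
      polyBounded_inv_Lg'.sq.mono fun p h => by
        have h1 := h.1.varxy_nonneg
        have h2 := h.1.Lg'_pos
        refine ⟨by positivity, ?_⟩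
        rw [inv_pow]
        exact inv_anti₀ (by positivity) (by linarith)
    exact ((polyBounded_L.mul hv).mul (polyBounded_η.mul polyBounded_inv_ηmin)).of_eq fun p => by
      unfold γ
      rw [mul_inv, mul_inv, inv_div, inv_div, div_one, div_eq_mul_inv]
  refine LogBounded.max hS ((LogBounded.const hS 1).add ((p1.log hS ?_).const_mul zero_le_two))
    (LogBounded.max hS ((p2.log hS ?_).const_mul zero_le_two) (LogBounded.max hS
      (LogBounded.const hS 0) (LogBounded.max hS (p4.neg_log_inv hS ?_) (p5.neg_log_inv hS ?_))))
  all_goals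
    intro p h
    have h1 := h.1.η_pos 0
    have h2 := h.1.Lψ_pos
    have h3 := h.1.Ly_pos
    have h4 := h.1.Lz_pos
    have h5 := h.1.ηmin_pos
    have h6 := h.1.γ_pos
    have h7 := h.1.varxy_nonneg
    have h8 := h.1.Lg'_pos
    have h9 := h.1.σx2_nonneg
    positivity

lemma C_nonneg (p : Params) : 0 ≤ p.C :=
  (le_max_left _ _).trans ((le_max_right _ _).trans (le_max_right _ _))

lemma C'_nonneg (p : Params) : 0 ≤ p.C' :=
  (le_max_left _ _).trans ((le_max_right _ _).trans (le_max_right _ _))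

lemma exists_Tmin_Nmin_le (Lg Lf B Lg' Mg σxy : ℝ) : ∃ c : ℝ, 0 ≤ c ∧
    ∀ p ∈ withConstants Lg Lf B Lg' Mg σxy,
      (p.Tmin : ℝ) ≤ c * p.κg * (1 + Real.log p.κg + Real.log p.κL) ∧
      (p.Nmin : ℝ) ≤ c * p.κg * (1 + Real.log p.κg + Real.log p.κL) := by
  obtain ⟨c, hc, hC⟩ := logBounded_C (Lg := Lg) (Lf := Lf) (B := B) (Lg' := Lg') (Mg := Mg)
    (σxy := σxy)
  obtain ⟨d, hd, hC'⟩ := logBounded_C' (Lg := Lg) (Lf := Lf) (B := B) (Lg' := Lg') (Mg := Mg)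
    (σxy := σxy)
  refine ⟨4 * (c + d) + 1, by positivity, fun p h => ?_⟩
  have hκ := h.1.one_le_κg
  have hℓ := h.1.one_le_log_factor
  have h1 := hC p h
  have h2 := hC' p h
  have h3 := C_nonneg p
  have h4 := C'_nonneg p
  have hL := h.1.Lg_pos.ne'
  have hμ := h.1.μg_pos.ne'
  set ℓ := 1 + Real.log p.κg + Real.log p.κL with hℓdef
  -- Absorbs the + 1 after the integer part, hence the + 1 in the constant.
  have h5 : 1 ≤ p.κg * ℓ := one_le_mul_of_one_le_of_one_le hκ hℓ
  have h6 := mul_le_mul_of_nonneg_right h1 (by linarith : 0 ≤ p.κg)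
  have h7 := mul_le_mul_of_nonneg_right h2 (by linarith : 0 ≤ p.κg)
  have h8 : 0 ≤ c * (p.κg * ℓ) := by positivity
  have h9 : 0 ≤ d * (p.κg * ℓ) := by positivity
  have e1 : p.C / (p.α * p.μg) = p.C * p.κg := by
    unfold α κg
    field_simp
  have e2 : 2 * (p.C + p.C') / (p.β * p.μg) = 4 * (p.C + p.C') * p.κg := by
    unfold β κg
    field_simp
    ring
  have f1 : 0 ≤ p.C * p.κg := by positivity
  have f2 : 0 ≤ 4 * (p.C + p.C') * p.κg := by positivity
  unfold Tmin Nmin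
  rw [e1, e2]
  push_cast
  constructor
  · have := Nat.floor_le f1
    linarith
  · have := Nat.floor_le f2
    linarith

end Orders

end Params

end AmIGO

theorem theorem1 :
    (∀ {dx dy : ℕ} {Ω Ξ : Type*} [MeasurableSpace Ω] [MeasurableSpace Ξ]
      (Pr : Measure Ω) [IsProbabilityMeasure Pr] (P : Measure Ξ) [IsProbabilityMeasure P]
      (f g : EuclideanSpace ℝ (Fin dx) → EuclideanSpace ℝ (Fin dy) → ℝ)
      (fhat ghat : EuclideanSpace ℝ (Fin dx) → EuclideanSpace ℝ (Fin dy) → Ξ → ℝ)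
      (p : AmIGO.Params) (T N : ℕ)
      (q₀ : Ω → EuclideanSpace ℝ (Fin dx) × EuclideanSpace ℝ (Fin dy) ×
        EuclideanSpace ℝ (Fin dy))
      (ξ : AmIGO.SampleIdx → Ω → Ξ),
      p.Admissible →
      AmIGO.RegularProblem p f g →
      AmIGO.StochasticModel f g fhat ghat P →
      AmIGO.GradientNoise p f g fhat ghat P →
      AmIGO.HessianNoise p g ghat P →
      p.Tmin ≤ T → p.Nmin ≤ N →
      -- i.i.d. samples with law `P`, independent of the square-integrable starting point
      (∀ i, Measurable (ξ i)) → (∀ i, Pr.map (ξ i) = P) → iIndepFun ξ Pr →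
      Measurable q₀ → MemLp q₀ 2 Pr → IndepFun q₀ (fun ω i => ξ i ω) Pr →
      (∀ k, AmIGO.FiniteEnergy p T N fhat ghat q₀ ξ Pr f g k) ∧
      -- strongly convex case
      (0 < p.μ →
        (∀ x x', AmIGO.outer f g x - AmIGO.outer f g x' ≤
          inner ℝ (gradient (AmIGO.outer f g) x) (x - x') - p.μ / 2 * ‖x - x'‖ ^ 2) →
        ∀ k : ℕ,
          AmIGO.gap Pr f g (AmIGO.xHat p T N fhat ghat q₀ ξ k)
              + AmIGO.Etot p T N fhat ghat q₀ ξ Pr f g k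
            ≤ (1 - (2 * p.κL)⁻¹) ^ k *
                (AmIGO.Etot p T N fhat ghat q₀ ξ Pr f g 0
                  + AmIGO.gap Pr f g (AmIGO.xIter p T N fhat ghat q₀ ξ 0))
              + 2 * p.W2 / p.L) ∧
      -- non-convex case
      (p.μ < 0 → BddBelow (Set.range (AmIGO.outer f g)) →
        ∀ k : ℕ, 1 ≤ k →
          (1 / (k : ℝ)) * ∑ t ∈ Finset.Icc 1 k, AmIGO.Etot p T N fhat ghat q₀ ξ Pr f g t
            ≤ 2 / (k : ℝ) *
                (AmIGO.gap Pr f g (AmIGO.xIter p T N fhat ghat q₀ ξ 0)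
                  + AmIGO.Ey p T N fhat ghat q₀ ξ Pr g 0
                  + AmIGO.Ez p T N fhat ghat q₀ ξ Pr f g 0)
              + 2 * p.W2 / p.L)) ∧
    -- the effective variance vanishes exactly in the deterministic setting
    (∀ p : AmIGO.Params, p.Admissible →
      (p.Deterministic → p.W2 = 0) ∧ (¬ p.Deterministic → 0 < p.W2)) ∧
    -- orders of magnitude of the effective variance and of the numbers of inner iterations
    (∀ Lg Lf B Lg' Mg σxy : ℝ, ∃ c : ℝ, ∀ p : AmIGO.Params, p.Admissible →
      p.Lg = Lg → p.Lf = Lf → p.B = B → p.Lg' = Lg' → p.Mg = Mg → p.σxy = σxy →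
      p.W2 ≤ c * (p.κL * p.κg ^ 5 * (p.σg ^ 2 / p.ng) + p.κg ^ 3 * (p.σyy ^ 2 / p.nyy)
        + p.κg ^ 2 * (p.σxy ^ 2 / p.nxy) + p.κg ^ 2 * (p.σf ^ 2 / p.nf)) ∧
      (p.Tmin : ℝ) ≤ c * p.κg * (1 + Real.log p.κg + Real.log p.κL) ∧
      (p.Nmin : ℝ) ≤ c * p.κg * (1 + Real.log p.κg + Real.log p.κL)) := by
  refine ⟨?_, fun p hp => ⟨fun h => (AmIGO.noise_eq_zero_of_deterministic h).2.2.2, hp.W2_pos⟩, ?_⟩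
  · intro dx dy Ω Ξ _ _ Pr _ P _ f g fhat ghat p T N q₀ ξ hp hr hm hn hn2 hT hN hmeas hlaw hind hq hq2
      hqξ
    have hs : AmIGO.IsSampling Pr P q₀ ξ := ⟨hmeas, hlaw, hind, hq, hqξ⟩
    exact ⟨AmIGO.finiteEnergy hp hr hm hn hn2 hs hq2 T N,
      fun hpos hsc => AmIGO.strongly_convex_bound hp hr hm hn hn2 hs hq2 hT hN hpos hsc,
      fun hneg hb k hk => AmIGO.nonconvex_bound hp hr hm hn hn2 hs hq2 hT hN hneg hb hk⟩
  · intro Lg Lf B Lg' Mg σxy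
    obtain ⟨c, hc, h1⟩ := AmIGO.Params.exists_W2_le Lg Lf B Lg' Mg σxy
    obtain ⟨d, hd, h2⟩ := AmIGO.Params.exists_Tmin_Nmin_le Lg Lf B Lg' Mg σxy
    refine ⟨c + d, fun p hp e1 e2 e3 e4 e5 e6 => ?_⟩
    have hmem : p ∈ AmIGO.Params.withConstants Lg Lf B Lg' Mg σxy := ⟨hp, e1, e2, e3, e4, e5, e6⟩
    have hκ := hp.one_le_κg
    have hκL := hp.one_le_κL
    have hℓ := hp.one_le_log_factor
    have h3 : 0 ≤ p.κg * (1 + Real.log p.κg + Real.log p.κL) := by positivity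
    have h4 := mul_nonneg hc h3
    obtain ⟨h5, h6⟩ := h2 p hmem
    refine ⟨(h1 p hmem).trans ?_, by linarith, by linarith⟩
    have hf := hp.varf_nonneg
    have hg := hp.varg_nonneg
    have hxy := hp.varxy_nonneg
    have hyy := hp.varyy_nonneg
    exact mul_le_mul_of_nonneg_right (le_add_of_nonneg_right hd) (by positivity)
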